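/- Let $M$ be a smooth (finite-dimensional, Hausdorff, $\sigma$-compact, without boundary) manifold with a Poisson bivector field $\Pi$; write $\Pi^\sharp:T_M^*\to T_M$, $\beta(\Pi^\sharp\alpha)=\Pi(\alpha,\beta)$. Let $\mathfrak g=\Omega_M\otimes_{C^\infty_M}(T_M[-1]\oplus T_M^*)$. A curved $\ell_\infty$ structure on $\mathfrak g\otimes\Omega(\Delta^n)$ over the dg algebra $\Omega_M\otimes\Omega(\Delta^n)$ (polynomial forms on the simplex) means a continuous degree-one derivation $Q$ with $Q^2=0$ of the completed symmetric algebra $$C^*(\mathfrak g\otimes\Omega(\Delta^n))=\Omega_M\otimes\Omega(\Delta^n)\otimes\prod_s \mathrm{Sym}^s(T_M^*)\otimes\Lambda(T_M)$$ ($T_M^*$ in degree $0$, $T_M$ in degree $1$) extending the de Rham differential of $\Omega_M\otimes\Omega(\Delta^n)$; for $n=0$ its cohomology is the Chevalley–Eilenberg cohomology of $\mathfrak g$. Then there is a contractible family of curved $\ell_\infty$ structures on $\mathfrak g$: a contractible simplicial set $K$ (every sphere $\partial\Delta^n\to K$ extends to $\Delta^n$), and for each $n$-simplex of $K$ a curved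 $\ell_\infty$ structure on $\mathfrak g\otimes\Omega(\Delta^n)$ over $\Omega_M\otimes\Omega(\Delta^n)$, compatibly with all simplicial operators, whose vertices are in bijection with the torsion-free connections $\nabla$ on $T_M$, such that for the structure $Q_\nabla$ at the vertex $\nabla$: 1. $\ell_0$ and $\ell_1$ are given by the identity of $T_M$, the connection and $\Pi^\sharp$. On the generators $y_\alpha$ ($\alpha\in\Omega^1(M)$) dual to $T_M[-1]$ and $z_X$ ($X$ a vector field) dual to $T_M^*$, and modulo terms of weight at least $2$ in the generators, $Q_\nabla y_\alpha\equiv-\alpha+y_{\nabla\alpha}-z_{\Pi^\sharp\alpha}$ and $Q_\nabla z_X\equiv z_{\nabla X}$. 2. $C^*(\mathfrak g)$ computes the Poisson cohomology of $M$: there is a homomorphism of dg algebras $j:(\Gamma(\Lambda^\bullet T_M),[\Pi,-])\to (C^*(\mathfrak g),Q_\nabla)$ that induces isomorphisms on cohomology in all degrees, and whose composite with the projection to the component of $\mathrm{Sym}$-degree $0$ is the inclusion of $\Gamma(\Lambda^\bullet T_M)$. 3. If $\Pi$ is symplectic (i.e. $\Pi^\sharp$ is an isomorphism), then the cohomology algebra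 of $(C^*(\mathfrak g),Q_\nabla)$ is isomorphic, as a graded algebra, to the de Rham cohomology algebra $H^*(M,\mathbb R)$. -/

import Mathlib

open CategoryTheory Simplicial Opposite
open scoped TensorProduct

universe u w

noncomputable section

namespace FormalPoisson
/-- A Lie algebroid bracket on an `A`-module `L`, in algebraic form: an anchor `L → Der A` and a
skew-symmetric real bilinear bracket satisfying the Leibniz rule. (The Jacobi identity is not needed
to write down the differential; it holds in the two instances used below.) -/
structure AnchoredBracket (A L : Type*) [CommRing A] [Algebra ℝ A] [AddCommGroup L] [Module A L]
    [Module ℝ L] where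
  anchor : L →ₗ[A] Derivation ℝ A A
  bracket : L →ₗ[ℝ] L →ₗ[ℝ] L
  bracket_self : ∀ x, bracket x x = 0
  bracket_smul : ∀ x (f : A) y, bracket x (f • y) = f • bracket x y + anchor x f • y

namespace AnchoredBracket
variable {A L : Type*} [CommRing A] [Algebra ℝ A] [AddCommGroup L] [Module A L]
    [Module ℝ L] (S : AnchoredBracket A L) {k : ℕ}

theorem bracket_swap (x y : L) : S.bracket x y = - S.bracket y x := by
  have h := S.bracket_self (x + y)
  simp only [map_add, LinearMap.add_apply, S.bracket_self, zero_add, add_zero] at h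
  exact eq_neg_of_add_eq_zero_right h

theorem smul_bracket (x : L) (f : A) (y : L) :
    S.bracket (f • x) y = f • S.bracket x y - S.anchor y f • x := by
  rw [S.bracket_swap, S.bracket_smul, S.bracket_swap y x]
  module

variable [IsScalarTower ℝ A L]

/-- Auxiliary: `(x, ω) ↦ ρ(x) ∘ ω - ½ ∑ⱼ ω(…, [x, yⱼ], …)`. -/
def halfLie (ω : L [⋀^Fin k]→ₗ[A] A) (x : L) : L [⋀^Fin k]→ₗ[ℝ] A :=
  let m : MultilinearMap ℝ (fun _ : Fin k => L) A := ω.toMultilinearMap.restrictScalars ℝ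
  { (LinearMap.compMultilinearMap (S.anchor x : A →ₗ[ℝ] A) m
      - (1 / 2 : ℝ) • ∑ j, m.compLinearMap (fun l => if l = j then S.bracket x else LinearMap.id))
    with
    map_eq_zero_of_eq' := by
      intro v i j hv hij
      have key : ∑ l, ω (Function.update v l (S.bracket x (v l))) = 0 := by
        rw [Finset.sum_eq_add i j hij]
        · have : Function.update v j (S.bracket x (v j))
              = Function.update v i (S.bracket x (v i)) ∘ Equiv.swap i j := by
            funext l
            rcases eq_or_ne l i with rfl | hi
            · simp [hij, hij.symm, hv]
            rcases eq_or_ne l j with rfl | hj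
            · simp [hv]
            · simp [Equiv.swap_apply_of_ne_of_ne hi hj, hi, hj]
          rw [this, ω.map_swap _ hij]; simp
        · intro c _ hc
          exact ω.map_eq_zero_of_eq _ (by simp [hc.1.symm, hc.2.symm, hv]) hij
        · simp
        · simp
      have key' : ∀ l, (fun c => (if c = l then S.bracket x else LinearMap.id : L →ₗ[ℝ] L) (v c))
          = Function.update v l (S.bracket x (v l)) := by
        intro l; funext c
        rcases eq_or_ne c l with rfl | h <;> simp [*]
      simp [m, key', key, ω.map_eq_zero_of_eq v hv hij] }

theorem halfLie_apply (ω : L [⋀^Fin k]→ₗ[A] A) (x : L) (v : Fin k → L) :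
    S.halfLie ω x v = S.anchor x (ω v)
      - (1 / 2 : ℝ) • ∑ j, ω (Function.update v j (S.bracket x (v j))) := by
  have key' : ∀ l, (fun c => (if c = l then S.bracket x else LinearMap.id : L →ₗ[ℝ] L) (v c))
      = Function.update v l (S.bracket x (v l)) := by
    intro l; funext c
    rcases eq_or_ne c l with rfl | h <;> simp [*]
  change S.anchor x (ω v) - ((1 / 2 : ℝ) • ∑ j, _ : MultilinearMap ℝ (fun _ : Fin k => L) A) v = _
  simp [key']

/-- Auxiliary: the Lie algebroid differential as a real multilinear map. -/
def dReal (ω : L [⋀^Fin k]→ₗ[A] A) : L [⋀^Fin (k + 1)]→ₗ[ℝ] A :=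
  AlternatingMap.alternatizeUncurryFin
    { toFun := S.halfLie ω
      map_add' := fun x y => by
        ext v
        simp [halfLie_apply, Finset.sum_add_distrib]
        ring
      map_smul' := fun c x => by
        ext v
        have h : ∀ j (y : L), ω (Function.update v j (c • y)) = c • ω (Function.update v j y) := by
          intro j y
          rw [← algebraMap_smul A c y, ω.map_update_smul, algebraMap_smul]
        have h2 : S.anchor (c • x) = c • S.anchor x := by
          rw [← algebraMap_smul A c x, map_smul, algebraMap_smul]
        simp only [halfLie_apply, map_smul, LinearMap.smul_apply, h, h2, Derivation.smul_apply,
          AlternatingMap.smul_apply, RingHom.id_apply, ← Finset.smul_sum, smul_sub]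
        rw [smul_comm c] }

theorem dReal_apply (ω : L [⋀^Fin k]→ₗ[A] A) (v : Fin (k + 1) → L) :
    S.dReal ω v = ∑ i : Fin (k + 1), (-1 : ℤ) ^ (i : ℕ) • (S.anchor (v i) (ω (i.removeNth v))
      - (1 / 2 : ℝ) • ∑ j, ω (Function.update (i.removeNth v) j
          (S.bracket (v i) (i.removeNth v j)))) := by
  simp [dReal, AlternatingMap.alternatizeUncurryFin_apply, halfLie_apply]

theorem dReal_cons_smul (ω : L [⋀^Fin k]→ₗ[A] A) (f : A) (x : L) (w : Fin k → L) :
    S.dReal ω (Fin.cons (f • x) w) = f • S.dReal ω (Fin.cons x w) := by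
  rcases k with _ | k
  · simp [dReal_apply]
  have hrem : ∀ (i : Fin (k + 1)) (y : L), (i.succ).removeNth (Fin.cons y w : Fin (k + 2) → L)
      = Fin.cons y (i.removeNth w) := by
    intro i y
    funext l
    refine Fin.cases ?_ (fun l => ?_) l <;> simp [Fin.removeNth]
  have hcons : ∀ (g : A) (y : L) (u : Fin k → L), ω (Fin.cons (g • y) u)
      = g • ω (Fin.cons y u) := fun g y u => by
    simpa using ω.map_update_smul (Fin.cons y u) 0 g y
  have hcadd : ∀ (y z : L) (u : Fin k → L), ω (Fin.cons (y + z) u)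
      = ω (Fin.cons y u) + ω (Fin.cons z u) := fun y z u => by
    simpa using ω.map_update_add (Fin.cons y u) 0 y z
  have hup : ∀ (u : Fin k → L) (y z : L) (l : Fin k),
      Function.update (Fin.cons y u : Fin (k + 1) → L) l.succ z
        = Fin.cons y (Function.update u l z) := fun u y z l => by
    rw [Fin.cons_update]
  have hmove : ∀ (j : Fin (k + 1)) (y : L), ω (Function.update w j y)
      = (-1 : ℤ) ^ (j : ℕ) • ω (Fin.cons y (j.removeNth w)) := by
    intro j y
    have := ω.map_insertNth j y (j.removeNth w)
    rw [← Fin.insertNth_removeNth]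
    exact this
  have hsub : ∀ (j : Fin (k + 1)) (y z : L), ω (Function.update w j (y - z))
      = ω (Function.update w j y) - ω (Function.update w j z) := fun j y z =>
    ω.map_update_sub w j y z
  have h0 : ∑ j, ω (Function.update w j (S.bracket (f • x) (w j)))
      = f • ∑ j, ω (Function.update w j (S.bracket x (w j)))
        - ∑ j : Fin (k + 1), S.anchor (w j) f • (-1 : ℤ) ^ (j : ℕ) •
            ω (Fin.cons x (j.removeNth w)) := by
    simp only [S.smul_bracket, hsub, ω.map_update_smul, Finset.sum_sub_distrib, Finset.smul_sum]
    simp only [hmove _ x]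
  have hi : ∀ i : Fin (k + 1), ∑ j, ω (Function.update (Fin.cons (f • x) (i.removeNth w) :
        Fin (k + 1) → L) j (S.bracket (w i) ((Fin.cons (f • x) (i.removeNth w) :
        Fin (k + 1) → L) j)))
      = f • ∑ j, ω (Function.update (Fin.cons x (i.removeNth w) :
        Fin (k + 1) → L) j (S.bracket (w i) ((Fin.cons x (i.removeNth w) : Fin (k + 1) → L) j)))
        + S.anchor (w i) f • ω (Fin.cons x (i.removeNth w)) := by
    intro i
    simp only [Fin.sum_univ_succ (n := k), Fin.cons_zero, Fin.cons_succ, Fin.update_cons_zero, hup,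
      hcons, S.bracket_smul, hcadd, Finset.smul_sum, smul_add]
    ring
  have half : ∀ t : A, (1 / 2 : ℝ) • t = algebraMap ℝ A (1 / 2) * t := fun t =>
    Algebra.smul_def _ _
  have hc : 1 - 2 * algebraMap ℝ A (1 / 2) = 0 := by
    rw [← map_ofNat (algebraMap ℝ A) 2, ← map_mul]; norm_num
  rw [dReal_apply, dReal_apply, Fin.sum_univ_succ, Fin.sum_univ_succ (n := k + 1),
    smul_add, Finset.smul_sum (r := f)]
  simp only [Fin.cons_zero, Fin.cons_succ, hrem, Fin.removeNth_zero, Fin.tail_cons, hi, hcons]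
  rw [h0, map_smul, Derivation.smul_apply]
  have hd : ∀ i : Fin (k + 1), S.anchor (w i) (f • ω (Fin.cons x (i.removeNth w)))
      = f • S.anchor (w i) (ω (Fin.cons x (i.removeNth w)))
        + S.anchor (w i) f • ω (Fin.cons x (i.removeNth w)) := by
    intro i
    rw [smul_eq_mul, Derivation.leibniz]
    simp only [smul_eq_mul]; ring
  have ht : ∀ i : Fin (k + 1), (-1 : ℤ) ^ (i.succ : ℕ) •
      (S.anchor (w i) (f • ω (Fin.cons x (i.removeNth w)))
        - (1 / 2 : ℝ) • (f • ∑ j, ω (Function.update (Fin.cons x (i.removeNth w) :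
          Fin (k + 1) → L) j (S.bracket (w i) ((Fin.cons x (i.removeNth w) : Fin (k + 1) → L) j)))
          + S.anchor (w i) f • ω (Fin.cons x (i.removeNth w))))
      = f • (-1 : ℤ) ^ (i.succ : ℕ) • (S.anchor (w i) (ω (Fin.cons x (i.removeNth w)))
        - (1 / 2 : ℝ) • ∑ j, ω (Function.update (Fin.cons x (i.removeNth w) :
          Fin (k + 1) → L) j (S.bracket (w i) ((Fin.cons x (i.removeNth w) : Fin (k + 1) → L) j))))
        - (1 / 2 : ℝ) • (S.anchor (w i) f • (-1 : ℤ) ^ (i : ℕ) •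
            ω (Fin.cons x (i.removeNth w))) := by
    intro i
    rw [hd, Fin.val_succ, pow_succ]
    set y := S.anchor (w i) f • ω (Fin.cons x (i.removeNth w)) with hy
    have hy' : S.anchor (w i) f • (-1 : ℤ) ^ (i : ℕ) • ω (Fin.cons x (i.removeNth w))
        = (-1 : ℤ) ^ (i : ℕ) • y := by rw [hy, smul_comm]
    rw [hy']
    generalize (∑ j, ω (Function.update (Fin.cons x (i.removeNth w) :
          Fin (k + 1) → L) j (S.bracket (w i) ((Fin.cons x (i.removeNth w) :
          Fin (k + 1) → L) j)))) = z
    clear_value y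
    rw [half, half, half]
    rcases neg_one_pow_eq_or ℤ (i : ℕ) with h | h <;> rw [h] <;>
      simp only [smul_eq_mul, neg_smul, one_smul, mul_neg, mul_one, neg_neg]
    · linear_combination (-y) * hc
    · linear_combination y * hc
  simp only [ht, Finset.sum_sub_distrib, ← Finset.smul_sum]
  simp only [Fin.val_zero, pow_zero, one_smul]
  rw [half, half, half (∑ j, ω (Function.update w j (S.bracket x (w j))))]
  simp only [smul_eq_mul]
  ring

/-- The Lie algebroid (Koszul) differential
`dω(x₀,…,xₖ) = ∑ᵢ (-1)ⁱ ρ(xᵢ) ω(…,x̂ᵢ,…) + ∑_{i<j} (-1)^{i+j} ω([xᵢ,xⱼ],…,x̂ᵢ,…,x̂ⱼ,…)`.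
In `d_apply` the bracket `[xᵢ,xⱼ]` stands in the slot of `xⱼ`, and each pair occurs twice, whence the
factor `1/2`. -/
def d (ω : L [⋀^Fin k]→ₗ[A] A) : L [⋀^Fin (k + 1)]→ₗ[A] A :=
  { S.dReal ω with
    map_update_smul' := by
      intro inst v i f x
      obtain rfl : inst = instDecidableEqFin _ := Subsingleton.elim _ _
      change S.dReal ω _ = f • S.dReal ω _
      have h0 : ∀ (u : Fin (k + 1) → L) (y : L),
          Function.update u 0 y = Fin.cons y (Fin.tail u) := fun u y => by
        conv_lhs => rw [← Fin.cons_self_tail u, Fin.update_cons_zero]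
      rcases eq_or_ne i 0 with rfl | hi
      · rw [h0, h0, dReal_cons_smul]
      · have hs : ∀ y, Function.update v i y
            = Function.update (v ∘ Equiv.swap i 0) 0 y ∘ Equiv.swap i 0 := by
          intro y
          funext l
          rcases eq_or_ne l i with rfl | h1
          · simp
          rcases eq_or_ne l 0 with rfl | h2
          · simp [hi, hi.symm]
          · simp [Equiv.swap_apply_of_ne_of_ne h1 h2, h1, h2]
        rw [hs, hs, (S.dReal ω).map_swap _ hi, (S.dReal ω).map_swap _ hi, h0, h0,
          dReal_cons_smul, smul_neg] }

theorem d_apply (ω : L [⋀^Fin k]→ₗ[A] A) (v : Fin (k + 1) → L) :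
    S.d ω v = ∑ i : Fin (k + 1), (-1 : ℤ) ^ (i : ℕ) • (S.anchor (v i) (ω (i.removeNth v))
      - (1 / 2 : ℝ) • ∑ j, ω (Function.update (i.removeNth v) j
          (S.bracket (v i) (i.removeNth v j)))) :=
  S.dReal_apply ω v

variable (k) in
/-- The Lie algebroid differential as a linear map. -/
def differential : (L [⋀^Fin k]→ₗ[A] A) →ₗ[ℝ] (L [⋀^Fin (k + 1)]→ₗ[A] A) where
  toFun := S.d
  map_add' ω η := by
    ext v
    simp only [d_apply, AlternatingMap.add_apply, map_add, ← Finset.sum_add_distrib]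
    refine Finset.sum_congr rfl fun i _ => ?_
    rw [Finset.sum_add_distrib]
    module
  map_smul' c ω := by
    ext v
    simp only [d_apply, AlternatingMap.smul_apply, Derivation.map_smul, RingHom.id_apply,
      Finset.smul_sum]
    refine Finset.sum_congr rfl fun i _ => ?_
    rw [← Finset.smul_sum, ← Finset.smul_sum, ← Finset.smul_sum, smul_comm (1/2 : ℝ) c, ← smul_sub,
      smul_comm c]

end AnchoredBracket

section
variable (A : Type*) [CommRing A] [Algebra ℝ A]
/-- Vector fields: derivations of the algebra `A` of smooth functions. -/
abbrev VectorFields := Derivation ℝ A A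
/-- One-forms: the dual of the module of vector fields. -/
abbrev OneForms := Module.Dual A (VectorFields A)
/-- Differential `k`-forms: `A`-multilinear alternating functions of `k` vector fields. -/
abbrev Forms (k : ℕ) := VectorFields A [⋀^Fin k]→ₗ[A] A
/-- Polyvector fields of degree `k`: `A`-multilinear alternating functions of `k` one-forms. -/
abbrev Polyvectors (k : ℕ) := OneForms A [⋀^Fin k]→ₗ[A] A

/-- Vector fields with their commutator. -/
def tangentBracket : AnchoredBracket A (VectorFields A) where
  anchor := LinearMap.id
  bracket := LinearMap.mk₂ ℝ (fun X Y => ⁅X, Y⁆) (by simp) (by simp) (by simp) (by simp)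
  bracket_self X := by simp
  bracket_smul X f Y := by simp
end

variable {A : Type*} [CommRing A] [Algebra ℝ A]

/-- The exterior derivative `f ↦ df` on functions. -/
def grad : Derivation ℝ A (OneForms A) :=
  Derivation.mk'
    { toFun := fun f =>
        { toFun := fun X => X f
          map_add' := fun X Y => by simp
          map_smul' := fun g X => by simp }
      map_add' := fun f g => by ext X; simp
      map_smul' := fun c f => by ext X; simp }
    (fun f g => by ext X; simp)

/-- The Lie derivative of one-forms along a vector field. -/
def lieForm (X : VectorFields A) : OneForms A →ₗ[ℝ] OneForms A where
  toFun α :=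
    { toFun := fun Y => X (α Y) - α ⁅X, Y⁆
      map_add' := fun Y Z => by simp; ring
      map_smul' := fun f Y => by
        simp [mul_comm]; ring }
  map_add' α β := by ext Y; simp; ring
  map_smul' c α := by ext Y; simp [smul_sub]


section Cohomology

variable {X Y : ℕ → Type*} [∀ k, AddCommGroup (X k)] [∀ k, Module ℝ (X k)]
  [∀ k, AddCommGroup (Y k)] [∀ k, Module ℝ (Y k)]

/-- The coboundaries of degree `k` of a graded space with an operator `d` of degree `1`. -/
def boundaries (d : ∀ k, X k →ₗ[ℝ] X (k + 1)) (k : ℕ) : Submodule ℝ (X k) :=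
  match k with
  | 0 => ⊥
  | k + 1 => LinearMap.range (d k)

/-- Cohomology: cocycles modulo coboundaries. -/
def Cohomology (X : ℕ → Type*) [∀ k, AddCommGroup (X k)] [∀ k, Module ℝ (X k)]
    (d : ∀ k, X k →ₗ[ℝ] X (k + 1)) (k : ℕ) : Type _ :=
  LinearMap.ker (d k) ⧸ (boundaries d k).submoduleOf (LinearMap.ker (d k))

instance (d : ∀ k, X k →ₗ[ℝ] X (k + 1)) (k : ℕ) : AddCommGroup (Cohomology X d k) :=
  inferInstanceAs
    (AddCommGroup (LinearMap.ker (d k) ⧸ (boundaries d k).submoduleOf (LinearMap.ker (d k))))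

instance (d : ∀ k, X k →ₗ[ℝ] X (k + 1)) (k : ℕ) : Module ℝ (Cohomology X d k) :=
  inferInstanceAs
    (Module ℝ (LinearMap.ker (d k) ⧸ (boundaries d k).submoduleOf (LinearMap.ker (d k))))

/-- The class of a cocycle. -/
def Cohomology.mk (d : ∀ k, X k →ₗ[ℝ] X (k + 1)) {k : ℕ} (x : X k) (hx : d k x = 0) :
    Cohomology X d k :=
  Submodule.Quotient.mk (p := (boundaries d k).submoduleOf (LinearMap.ker (d k))) ⟨x, hx⟩

/-- The map induced on cohomology by a map of complexes. -/
def Cohomology.map {d : ∀ k, X k →ₗ[ℝ] X (k + 1)} {d' : ∀ k, Y k →ₗ[ℝ] Y (k + 1)}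
    (f : ∀ k, X k →ₗ[ℝ] Y k) (hf : ∀ k x, d' k (f k x) = f (k + 1) (d k x)) (k : ℕ) :
    Cohomology X d k →ₗ[ℝ] Cohomology Y d' k :=
  Submodule.mapQ ((boundaries d k).submoduleOf (LinearMap.ker (d k)))
    ((boundaries d' k).submoduleOf (LinearMap.ker (d' k)))
    ((f k).restrict (p := LinearMap.ker (d k)) (q := LinearMap.ker (d' k)) (fun x hx => by
      rw [LinearMap.mem_ker] at hx ⊢
      rw [hf, hx, map_zero]))
    (by
      rintro ⟨x, hx⟩ hb
      rw [Submodule.mem_comap]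
      change f k x ∈ boundaries d' k
      change x ∈ boundaries d k at hb
      rcases k with _ | k
      · obtain rfl : x = 0 := hb
        simp
      · obtain ⟨y, rfl⟩ := hb
        exact ⟨f k y, hf k y⟩)

end Cohomology

variable (A) in
/-- The de Rham differential. -/
def deRham (k : ℕ) : Forms A k →ₗ[ℝ] Forms A (k + 1) :=
  (tangentBracket A).differential k

/-- A Poisson structure: a bivector field, given by its contraction `sharp : T^* → T`
(`Π(α, β) = β (sharp α)`, skew-symmetric), such that the bracket `{f, g} = Π(df, dg)` on functions
satisfies the Jacobi identity. -/
structure PoissonStructure (A : Type*) [CommRing A] [Algebra ℝ A] where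
  sharp : OneForms A →ₗ[A] VectorFields A
  skew : ∀ α : OneForms A, α (sharp α) = 0
  jacobi : ∀ f g h : A,
    sharp (grad f) (sharp (grad g) h) + sharp (grad g) (sharp (grad h) f)
      + sharp (grad h) (sharp (grad f) g) = 0

namespace PoissonStructure

variable (P : PoissonStructure A)

theorem skew_apply (α β : OneForms A) : α (P.sharp β) = - β (P.sharp α) := by
  have h := P.skew (α + β)
  simp only [map_add, LinearMap.add_apply, P.skew, zero_add, add_zero] at h
  exact eq_neg_of_add_eq_zero_right h

/-- The Koszul bracket of one-forms,
`[α, β] = L_{sharp α} β - L_{sharp β} α - d Π(α, β)`. -/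
def cotangentBracket : AnchoredBracket A (OneForms A) where
  anchor := P.sharp
  bracket := LinearMap.mk₂ ℝ
    (fun α β => lieForm (P.sharp α) β - lieForm (P.sharp β) α - grad (β (P.sharp α)))
    (fun α α' β => by ext Y; simp [lieForm, grad]; ring)
    (fun c α β => by
      ext Y
      simp [lieForm, grad, LinearMap.map_smul_of_tower]
      module)
    (fun α β β' => by ext Y; simp [lieForm, grad]; ring)
    (fun c α β => by
      ext Y
      simp [lieForm, grad, LinearMap.map_smul_of_tower]
      module)
  bracket_self α := by ext Y; simp [lieForm, grad, P.skew]
  bracket_smul α f β := by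
    ext Y
    have h := P.skew_apply α β
    have hl : ⁅f • P.sharp β, Y⁆ = f • ⁅P.sharp β, Y⁆ - Y f • P.sharp β := by
      ext g
      simp [Derivation.commutator_apply]
      ring
    simp [lieForm, grad, hl, h]
    ring

/-- The Poisson (Lichnerowicz) differential `[Π, -]` on polyvector fields, written as the Lie algebroid
differential of the cotangent Lie algebroid of the Poisson structure. -/
def differential (k : ℕ) : Polyvectors A k →ₗ[ℝ] Polyvectors A (k + 1) :=
  P.cotangentBracket.differential k

end PoissonStructure

/-- The exterior product of alternating maps with values in a commutative algebra, as a linear map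
(sum over shuffles, no factorials). -/
def wedgeHom {L B : Type*} [AddCommGroup L] [Module A L] [CommRing B] [Algebra A B]
    {k l m : ℕ} (h : k + l = m) :
    (L [⋀^Fin k]→ₗ[A] B) ⊗[A] (L [⋀^Fin l]→ₗ[A] B) →ₗ[A] (L [⋀^Fin m]→ₗ[A] B) :=
  (AlternatingMap.domDomCongrₗ A (finSumFinEquiv.trans (finCongr h))).toLinearMap ∘ₗ
    LinearMap.compAlternatingMapₗ A (LinearMap.mul' A B) ∘ₗ AlternatingMap.domCoprod'

/-- The exterior product of alternating maps with values in a commutative algebra. -/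
def wedge {L B : Type*} [AddCommGroup L] [Module A L] [CommRing B] [Algebra A B]
    {k l m : ℕ} (h : k + l = m) (a : L [⋀^Fin k]→ₗ[A] B) (b : L [⋀^Fin l]→ₗ[A] B) :
    L [⋀^Fin m]→ₗ[A] B :=
  wedgeHom h (a ⊗ₜ[A] b)

/-- Homogeneous polynomial maps of degree `s` between modules. On a projective module of finite rank
(and over `ℝ`) these are the elements of `Symˢ(V^*) ⊗ W`. -/
def homogeneousMaps (A V W : Type*) [CommRing A] [AddCommGroup V] [Module A V] [AddCommGroup W]
    [Module A W] (s : ℕ) : Submodule A (V → W) where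
  carrier := {f | ∃ m : MultilinearMap A (fun _ : Fin s => V) W, ∀ v, f v = m (fun _ => v)}
  add_mem' := by
    rintro f g ⟨m, hm⟩ ⟨m', hm'⟩
    exact ⟨m + m', fun v => by simp [hm, hm']⟩
  zero_mem' := ⟨0, fun v => rfl⟩
  smul_mem' := by
    rintro c f ⟨m, hm⟩
    exact ⟨c • m, fun v => by simp [hm]⟩

/-- Polynomial functions on the `n`-simplex with coefficients in `A`; the variables are the barycentric
coordinates `t₁, …, tₙ`, and `t₀ = 1 - t₁ - … - tₙ`. -/
abbrev PolyFun (A : Type*) [CommRing A] (n : ℕ) := MvPolynomial (Fin n) A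

/-- The odd arguments of a cochain: a vector field `Y` (form direction on `M`), a one-form `β` (from
the summand `T^*` of `𝔤`), and `τ`, a vector field along the simplex in the coordinates `t₁, …, tₙ`. -/
abbrev OddArgs (A : Type*) [CommRing A] [Algebra ℝ A] (n : ℕ) :=
  VectorFields A × OneForms A × (Fin n → A)

/-- The space `(Λ(T^*) ⊗ Λ(T) ⊗ Λ(dt₁, …, dtₙ))ᵏ ⊗ A[t₁, …, tₙ]` in total degree `k`. -/
abbrev Coeff (A : Type*) [CommRing A] [Algebra ℝ A] (n k : ℕ) :=
  OddArgs A n [⋀^Fin k]→ₗ[A] PolyFun A n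

/-- Sequences of homogeneous polynomial maps `T → Coeff`, one for each degree `s`. -/
def cochainSubmodule (A : Type*) [CommRing A] [Algebra ℝ A] (n k : ℕ) :
    Submodule ℝ (ℕ → VectorFields A → Coeff A n k) where
  carrier := {a | ∀ s, a s ∈ homogeneousMaps A (VectorFields A) (Coeff A n k) s}
  add_mem' ha hb s := add_mem (ha s) (hb s)
  zero_mem' s := zero_mem _
  smul_mem' c a ha s := by
    have : (c • a) s = algebraMap ℝ A c • a s := by
      ext v
      simp
    rw [this]
    exact Submodule.smul_mem _ _ (ha s)

/-- The Chevalley–Eilenberg cochains of degree `k` of `𝔤 ⊗ Ω(Δⁿ)` over the base `Ω_M ⊗ Ω(Δⁿ)`,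
where `𝔤 = Ω_M ⊗ (T[-1] ⊕ T^*)`. By definition they are the base-multilinear, graded symmetric maps
from `𝔤[1] ⊗ Ω(Δⁿ)` to the base, that is, the completed symmetric algebra
`Ω_M ⊗ Ω(Δⁿ) ⊗ ∏ₛ Symˢ(T^*) ⊗ Λ(T)`. Elements of `T` enter `𝔤[1] = Ω_M ⊗ (T ⊕ T^*[1])` in degree zero,
so a cochain depends on them polynomially, whereas it is alternating in the elements of `T^*` and in
the arguments of the differential forms on `M` and on `Δⁿ`. For `n = 0` this is `C^*(𝔤)`. -/
def Cochain (A : Type*) [CommRing A] [Algebra ℝ A] (n k : ℕ) : Type _ := cochainSubmodule A n k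

instance (n k : ℕ) : AddCommGroup (Cochain A n k) :=
  inferInstanceAs (AddCommGroup (cochainSubmodule A n k))

instance (n k : ℕ) : Module ℝ (Cochain A n k) :=
  inferInstanceAs (Module ℝ (cochainSubmodule A n k))

namespace Cochain

variable {n k l m : ℕ}

/-- The component of degree `s` of a cochain, a homogeneous polynomial map of degree `s`. -/
def coeff (a : Cochain A n k) : ℕ → VectorFields A → Coeff A n k :=
  Subtype.val (p := (· ∈ cochainSubmodule A n k)) a

theorem coeff_mem (a : Cochain A n k) (s : ℕ) :
    a.coeff s ∈ homogeneousMaps A (VectorFields A) (Coeff A n k) s :=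
  Subtype.property (p := (· ∈ cochainSubmodule A n k)) a s

/-- The cochain with given homogeneous components. -/
def ofCoeff (f : ℕ → VectorFields A → Coeff A n k)
    (hf : ∀ s, f s ∈ homogeneousMaps A (VectorFields A) (Coeff A n k) s) : Cochain A n k :=
  Subtype.mk (p := (· ∈ cochainSubmodule A n k)) f hf

/-- The product of cochains: exterior product of values, Cauchy product of power series. -/
def mul (h : k + l = m) (a : Cochain A n k) (b : Cochain A n l) : Cochain A n m :=
  ofCoeff (fun s v => ∑ p ∈ Finset.HasAntidiagonal.antidiagonal s,
      wedge h (a.coeff p.1 v) (b.coeff p.2 v)) fun s => by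
    have : (fun v => ∑ p ∈ Finset.HasAntidiagonal.antidiagonal s,
          wedge h (a.coeff p.1 v) (b.coeff p.2 v))
        = ∑ p ∈ Finset.HasAntidiagonal.antidiagonal s, fun v =>
          wedge h (a.coeff p.1 v) (b.coeff p.2 v) := by
      funext v; simp
    change (fun v => _) ∈ _
    rw [this]
    refine Submodule.sum_mem _ fun p hp => ?_
    obtain ⟨i, j⟩ := p
    obtain rfl : i + j = s := by simpa using hp
    obtain ⟨f, hf⟩ := a.coeff_mem i
    obtain ⟨g, hg⟩ := b.coeff_mem j
    refine ⟨((wedgeHom h).compMultilinearMap (f.domCoprod g)).domDomCongr finSumFinEquiv,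
      fun v => ?_⟩
    simp [wedge, hf, hg, MultilinearMap.domCoprod_apply]

/-- A cochain that does not depend on the even variable. -/
def const (b : Coeff A n k) : Cochain A n k :=
  ofCoeff (fun s _ => if s = 0 then b else 0) fun s => by
    rcases s with _ | s
    · exact ⟨MultilinearMap.constOfIsEmpty A _ b, fun v => by simp⟩
    · exact ⟨0, fun v => by simp⟩

/-- A function on the simplex, as a cochain of degree zero. -/
def scalar (f : PolyFun A n) : Cochain A n 0 :=
  const (AlternatingMap.constOfIsEmpty A _ (Fin 0) f)

/-- A differential form on `M`, as a cochain. -/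
def ofForm (n : ℕ) {k : ℕ} (ω : Forms A k) : Cochain A n k :=
  const ((Algebra.linearMap A (PolyFun A n)).compAlternatingMap
    (ω.compLinearMap (LinearMap.fst A (VectorFields A) (OneForms A × (Fin n → A)))))

/-- A linear function of the odd arguments, as a coefficient of degree one. -/
def oneCoeff (f : OddArgs A n →ₗ[A] A) : Coeff A n 1 :=
  AlternatingMap.ofSubsingleton A (OddArgs A n) (PolyFun A n) (0 : Fin 1)
    (Algebra.linearMap A (PolyFun A n) ∘ₗ f)

/-- The one-form `dtᵢ` on the simplex, as a cochain. -/
def dSimplex (i : Fin n) : Cochain A n 1 :=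
  const (oneCoeff (LinearMap.proj i ∘ₗ LinearMap.snd A _ _ ∘ₗ LinearMap.snd A _ _))

/-- The generator of `C^*(𝔤)` dual to the summand `T[-1]` given by a one-form `α`: the linear function
`v ↦ α(v)` of the even variable. -/
def linear (n : ℕ) (α : OneForms A) : Cochain A n 0 :=
  ofCoeff (fun s v => if s = 1 then
      AlternatingMap.constOfIsEmpty A _ (Fin 0) (algebraMap A (PolyFun A n) (α v)) else 0)
    fun s => by
      by_cases hs : s = 1
      · subst hs
        refine ⟨MultilinearMap.ofSubsingleton A _ _ (0 : Fin 1)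
          ((AlternatingMap.constLinearEquivOfIsEmpty).toLinearMap ∘ₗ
            Algebra.linearMap A (PolyFun A n) ∘ₗ α), fun v => ?_⟩
        simp
      · simp only [hs, if_false]
        exact zero_mem _

/-- The generator of `C^*(𝔤)` dual to the summand `T^*` given by a vector field `X`: the function
`β ↦ β(X)` of the odd variable. -/
def odd (n : ℕ) (X : VectorFields A) : Cochain A n 1 :=
  const (oneCoeff (Module.Dual.eval A _ X ∘ₗ LinearMap.fst A _ _ ∘ₗ LinearMap.snd A _ _))

end Cochain

section Simplices

variable {n m : ℕ}

/-- The barycentric coordinates `t₀, …, tₘ` of the simplex. -/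
def barycentric (n : ℕ) : Fin (n + 1) → PolyFun A n :=
  Fin.cons (1 - ∑ i, MvPolynomial.X i) MvPolynomial.X

/-- The barycentric components of a vector tangent to the simplex. -/
def barycentricVec (n : ℕ) (τ : Fin n → A) : Fin (n + 1) → A :=
  Fin.cons (- ∑ i, τ i) τ

/-- Pull-back of functions along the affine map of simplices given by `φ` on vertices:
`tⱼ ↦ ∑_{φ i = j} tᵢ`. -/
def pullFun (φ : Fin (m + 1) → Fin (n + 1)) : PolyFun A n →ₐ[A] PolyFun A m :=
  MvPolynomial.aeval fun j => ∑ i, if φ i = j.succ then barycentric m i else 0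

/-- The derivative of the affine map of simplices given by `φ` on vertices. -/
def pushVec (φ : Fin (m + 1) → Fin (n + 1)) : (Fin m → A) →ₗ[A] (Fin n → A) where
  toFun τ j := ∑ i, if φ i = j.succ then barycentricVec m τ i else 0
  map_add' τ τ' := by
    funext j
    simp only [Pi.add_apply, ← Finset.sum_add_distrib]
    refine Finset.sum_congr rfl fun i _ => ?_
    split_ifs
    · refine Fin.cases ?_ (fun i => ?_) i
      · simp [barycentricVec, Finset.sum_add_distrib]; ring
      · simp [barycentricVec]
    · simp
  map_smul' c τ := by
    funext j
    simp only [Pi.smul_apply, Finset.smul_sum, RingHom.id_apply]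
    refine Finset.sum_congr rfl fun i _ => ?_
    split_ifs
    · refine Fin.cases ?_ (fun i => ?_) i
      · simp [barycentricVec, Finset.mul_sum]
      · simp [barycentricVec]
    · simp

/-- Pull-back of coefficients along the affine map of simplices given by `φ` on vertices. -/
def pullCoeff (φ : Fin (m + 1) → Fin (n + 1)) {k : ℕ} : Coeff A n k →ₗ[A] Coeff A m k where
  toFun b := (pullFun φ).toLinearMap.compAlternatingMap
    (b.compLinearMap (LinearMap.prodMap LinearMap.id (LinearMap.prodMap LinearMap.id (pushVec φ))))
  map_add' b c := by ext; simp
  map_smul' r b := by ext; simp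

/-- Pull-back of cochains along the affine map of simplices given by `φ` on vertices. -/
def Cochain.pull (φ : Fin (m + 1) → Fin (n + 1)) {k : ℕ} (a : Cochain A n k) : Cochain A m k :=
  ofCoeff (fun s v => pullCoeff (A := A) φ (a.coeff s v)) fun s => by
    obtain ⟨f, hf⟩ := a.coeff_mem s
    exact ⟨(pullCoeff (A := A) φ).compMultilinearMap f, fun v => by simp [hf]⟩

end Simplices

/-- A curved `L∞` algebra structure on `𝔤 ⊗ Ω(Δⁿ)`, `𝔤 = Ω_M ⊗ (T[-1] ⊕ T^*)`, over the dg algebra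
`Ω_M ⊗ Ω(Δⁿ)`, given as usual by its Chevalley–Eilenberg differential: a continuous derivation `Q` of
degree one and square zero of the completed symmetric algebra of `𝔤[1]^∨`, which extends the de Rham
differential of the base. The operations `lᵣ` are dual to the components of `Q` that send generators to
polynomials of weight `r` in the generators. For degree reasons `l₀` lies in `Ω¹ ⊗ T ⊕ Ω² ⊗ T^*`
(when `n = 0`), so the curvature is in the nilpotent ideal of forms of positive degree.
For `n = 0` these are the structures on `𝔤` itself; for larger `n` they are families of structures
(homotopies and higher homotopies) parametrised by the simplex. -/
structure CurvedLInfty (A : Type*) [CommRing A] [Algebra ℝ A] (n : ℕ) where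
  Q : ∀ k, Cochain A n k →ₗ[ℝ] Cochain A n (k + 1)
  Q_Q : ∀ k (a : Cochain A n k), Q (k + 1) (Q k a) = 0
  leibniz : ∀ (k l m : ℕ) (h : k + l = m) (a : Cochain A n k) (b : Cochain A n l),
    Q m (Cochain.mul h a b) = Cochain.mul (by omega) (Q k a) b
      + (-1 : ℝ) ^ k • Cochain.mul (by omega) a (Q l b)
  Q_form : ∀ k (ω : Forms A k),
    Q k (Cochain.ofForm n ω) = Cochain.ofForm n (deRham A k ω)
  Q_coord : ∀ i : Fin n, Q 0 (Cochain.scalar (MvPolynomial.X i)) = Cochain.dSimplex i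
  continuous : ∀ k s (a : Cochain A n k), (∀ i ≤ s, a.coeff i = 0) → ∀ i < s, (Q k a).coeff i = 0

/-- Contractibility of a simplicial set (as a Kan complex): every sphere in it can be filled. The case
`n = 0` says that it is non-empty. -/
def FillsSpheres (K : SSet.{w}) : Prop :=
  ∀ (n : ℕ) (b : (SSet.boundary n).toSSet ⟶ K), ∃ c : Δ[n] ⟶ K, (SSet.boundary n).ι ≫ c = b

/-- A contractible family of curved `L∞` structures: a contractible simplicial set `K`, for each
`n`-simplex of `K` a curved `L∞` structure over `Ω_M ⊗ Ω(Δⁿ)`, compatible with all faces and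
degeneracies. -/
structure ContractibleFamily (A : Type u) [CommRing A] [Algebra ℝ A] where
  K : SSet.{w}
  contractible : FillsSpheres K
  member : ∀ n : ℕ, K.obj (op ⦋n⦌) → CurvedLInfty A n
  natural : ∀ (m n : ℕ) (φ : ⦋m⦌ ⟶ ⦋n⦌) (x : K.obj (op ⦋n⦌)) (k : ℕ) (a : Cochain A n k),
    (member m (K.map φ.op x)).Q k (Cochain.pull φ.toOrderHom a)
      = Cochain.pull φ.toOrderHom ((member n x).Q k a)


/-- Torsion-free connections on the tangent bundle. -/
structure IsTorsionFreeConnection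
    (nabla : VectorFields A →ₗ[A] VectorFields A →ₗ[ℝ] VectorFields A) : Prop where
  leibniz : ∀ (X : VectorFields A) (f : A) (Y : VectorFields A),
    nabla X (f • Y) = f • nabla X Y + X f • Y
  torsion_free : ∀ X Y : VectorFields A, nabla X Y - nabla Y X = ⁅X, Y⁆

variable (A) in
/-- The set of torsion-free connections on the tangent bundle. -/
abbrev TorsionFreeConnection :=
  {nabla : VectorFields A →ₗ[A] VectorFields A →ₗ[ℝ] VectorFields A //
    IsTorsionFreeConnection nabla}

/-- The operations `l₀` and `l₁` of `D`, read off from `Q` on generators: `l₀` is (up to sign) the identity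
in `Ω¹ ⊗ T`, and `l₁` consists of the connection `∇` on `T`, its dual on `T^*`, and the
contraction `T^* → T` with the Poisson bivector. Concretely, for the generators `y_α` and `z_X`:
`Q y_α = -α + ∇α + Π(-, α) + (weight ≥ 2)` and `Q z_X = ∇X + (weight ≥ 2)`. -/
structure HasLowBrackets (P : PoissonStructure A)
    (nabla : VectorFields A →ₗ[A] VectorFields A →ₗ[ℝ] VectorFields A)
    (D : CurvedLInfty A 0) : Prop where
  l0_tangent : ∀ (α : OneForms A) (v Y : VectorFields A) (β : OneForms A),
    (D.Q 0 (Cochain.linear 0 α)).coeff 0 v ![(Y, β, 0)]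
      = algebraMap A (PolyFun A 0) (- α Y + α (P.sharp β))
  l1_tangent : ∀ (α : OneForms A) (v Y : VectorFields A),
    (D.Q 0 (Cochain.linear 0 α)).coeff 1 v ![(Y, 0, 0)]
      = algebraMap A (PolyFun A 0) (Y (α v) - α (nabla Y v))
  l0_cotangent : ∀ X v Y Z : VectorFields A,
    (D.Q 1 (Cochain.odd 0 X)).coeff 0 v ![(Y, 0, 0), (Z, 0, 0)] = 0
  l1_cotangent : ∀ (X v Y : VectorFields A) (β : OneForms A),
    (D.Q 1 (Cochain.odd 0 X)).coeff 0 v ![(Y, 0, 0), (0, β, 0)]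
      = algebraMap A (PolyFun A 0) (β (nabla Y X))
  l1_mixed : ∀ X v Y Z : VectorFields A,
    (D.Q 1 (Cochain.odd 0 X)).coeff 1 v ![(Y, 0, 0), (Z, 0, 0)] = 0

/-- A map of dg algebras from polyvector fields with the Poisson differential to `C^*(𝔤)` whose zeroth
jet is the identity: the coefficient of degree zero in the even variable of `j U` is `U`. -/
structure TaylorMap (P : PoissonStructure A) (D : CurvedLInfty A 0) where
  j : ∀ k, Polyvectors A k →ₗ[ℝ] Cochain A 0 k
  map_one : j 0 (AlternatingMap.constOfIsEmpty A _ (Fin 0) 1) = Cochain.scalar 1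
  map_wedge : ∀ (k l m : ℕ) (h : k + l = m) (U : Polyvectors A k) (V : Polyvectors A l),
    j m (wedge h U V) = Cochain.mul h (j k U) (j l V)
  comm : ∀ k (U : Polyvectors A k), D.Q k (j k U) = j (k + 1) (P.differential k U)
  zeroth_jet : ∀ k (U : Polyvectors A k) (v : VectorFields A) (Y : Fin k → VectorFields A)
    (β : Fin k → OneForms A),
    (j k U).coeff 0 v (fun i => (Y i, β i, 0)) = algebraMap A (PolyFun A 0) (U β)

/-- De Rham cohomology. -/
abbrev DeRhamCohomology (A : Type*) [CommRing A] [Algebra ℝ A] (k : ℕ) : Type _ :=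
  Cohomology (fun k => Forms A k) (deRham A) k

/-- Poisson cohomology. -/
abbrev PoissonCohomology (P : PoissonStructure A) (k : ℕ) : Type _ :=
  Cohomology (fun k => Polyvectors A k) P.differential k

/-- The cohomology of the Chevalley–Eilenberg complex `C^*(𝔤)`. -/
abbrev CECohomology (D : CurvedLInfty A 0) (k : ℕ) : Type _ :=
  Cohomology (fun k => Cochain A 0 k) D.Q k

/-- The class of a closed form. -/
def deRhamClass {k : ℕ} (ω : Forms A k) (hω : deRham A k ω = 0) : DeRhamCohomology A k :=
  Cohomology.mk (X := fun k => Forms A k) (deRham A) ω hω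

/-- The class of a Chevalley–Eilenberg cocycle. -/
def CurvedLInfty.classOf (D : CurvedLInfty A 0) {k : ℕ} (a : Cochain A 0 k) (ha : D.Q k a = 0) :
    CECohomology D k :=
  Cohomology.mk (X := fun k => Cochain A 0 k) D.Q a ha

/-- The map on cohomology. -/
def TaylorMap.onCohomology {P : PoissonStructure A} {D : CurvedLInfty A 0} (T : TaylorMap P D)
    (k : ℕ) : PoissonCohomology P k →ₗ[ℝ] CECohomology D k :=
  Cohomology.map (X := fun k => Polyvectors A k) (Y := fun k => Cochain A 0 k) T.j T.comm k

/-- `C^*(𝔤)` computes Poisson cohomology: there is a quasi-isomorphism of dg algebras from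
polyvector fields to `C^*(𝔤)` (which on zeroth jets is the identity). -/
def ComputesPoissonCohomology (P : PoissonStructure A) (D : CurvedLInfty A 0) : Prop :=
  ∃ T : TaylorMap P D, ∀ k, Function.Bijective (T.onCohomology k)

/-- The cohomology algebra of `C^*(𝔤)` is isomorphic to the de Rham cohomology algebra: there are linear
isomorphisms in all degrees which respect products. -/
def HasDeRhamCohomologyAlgebra (D : CurvedLInfty A 0) : Prop :=
  ∃ Φ : ∀ k, CECohomology D k ≃ₗ[ℝ] DeRhamCohomology A k,
    ∀ (k l m : ℕ) (h : k + l = m) (a : Cochain A 0 k) (b : Cochain A 0 l)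
      (ω : Forms A k) (η : Forms A l)
      (ha : D.Q k a = 0) (hb : D.Q l b = 0) (hω : deRham A k ω = 0) (hη : deRham A l η = 0),
      Φ k (D.classOf a ha) = deRhamClass ω hω →
      Φ l (D.classOf b hb) = deRhamClass η hη →
      ∃ (hab : D.Q m (Cochain.mul h a b) = 0) (hωη : deRham A m (wedge h ω η) = 0),
        Φ m (D.classOf (Cochain.mul h a b) hab) = deRhamClass (wedge h ω η) hωη

section
open scoped Manifold ContDiff
/-- The algebra of smooth real functions on a manifold. -/
abbrev SmoothFunctions (E : Type*) [NormedAddCommGroup E] [NormedSpace ℝ E] (M : Type*)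
    [TopologicalSpace M] [ChartedSpace E M] : Type _ :=
  C^∞⟮𝓘(ℝ, E), M; 𝓘(ℝ, ℝ), ℝ⟯
end

end FormalPoisson

end

/-! The structure is forced by Taylor expansion. A connection has a spray S = ∑ yᵢ ∇_{Xᵢ}, and the
expansion j(U) of a polyvector field U along geodesics is the unique solution of the radial equation
E c = S c (E the Euler operator of the even variable) whose component of degree zero is U. Both E
and S are derivations, so j is multiplicative (`flow_mul`). Its leading terms are j(f) = f + y_{df}
+ … and j(X) = z_X + …, hence the expansions of functions and vector fields, together with the forms
on M and on the simplex, generate the cochains topologically. Q is to be the derivation that extends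
the de Rham differential and satisfies Q j = j [Π, -].

All this needs only a finite `Frame`: functions fᵢ and fields Xᵢ with Y = ∑ Y(fᵢ) Xᵢ. Existence
(`exists_structure`): the exterior covariant derivative is already right on forms, and correction
terms wᵢ ∂/∂Xᵢ and ζᵢ ι(dfᵢ) are found order by order, because the lowest-order error is a
derivation in the function, respectively linear in the vector field, and so is known from its values
on the frame. Uniqueness (`RelDer.eq_zero`): a derivation of bounded order that kills the generators
is zero. Applied to Q² this gives Q² = 0; applied to the commutator of Q with a simplicial pull-back
it gives naturality (`CurvedLInfty.pull_comm`). So every tuple of connections, combined with the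
barycentric coordinates, carries a structure over a simplex, and the choices are compatible
automatically. K is the simplicial set of all tuples; it is contractible because a torsion-free
connection exists. The operations l₀ and l₁ come from solving the leading-term formulas for y and z.

For the cohomology write Q = R - κ with the Koszul differential κ = ∑ dfᵢ ∂/∂Xᵢ. If y and the forms
on M have weight one and z has weight two, then κ preserves the weight and R raises it
(`WeightGe.remainder`). The homotopy ∑ yᵢ ι(Xᵢ) contracts κ away from the part with neither y nor
forms on M, which consists of the symbols of Taylor expansions. A cochain whose differential lies in
the image of j is therefore moved into that image weight by weight, modulo coboundaries
(`exists_weight_step`, `exists_eq_taylor_add`). If Π is symplectic, pull-back along the anchor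
identifies forms with polyvector fields compatibly with products and differentials.

On a manifold a frame arises from finitely many functions with spanning differentials
(`exists_immersive`): generic projections bound their number on each compact set, and three families
of disjoint shells cover M. Their gradients for the Gram form ∑ dfᵢ ⊗ dfᵢ are the Xᵢ, and by
Hadamard's lemma a derivation at a point sees only the differential of a function
(`derivation_apply_eq_zero`). -/

noncomputable section

namespace FormalPoisson

set_option linter.unusedSectionVars false

/-! ### The exterior product of alternating maps, handled through contractions. -/

section Wedge

variable {A L B : Type*} [CommRing A] [AddCommGroup L] [Module A L] [CommRing B] [Algebra A B]
  {k l m : ℕ}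

/-- Contraction of an alternating map with a vector in the first argument. -/
def ins (x : L) : (L [⋀^Fin (k + 1)]→ₗ[A] B) →ₗ[A] (L [⋀^Fin k]→ₗ[A] B) where
  toFun ω := ω.curryLeft x
  map_add' _ _ := rfl
  map_smul' _ _ := rfl

theorem ins_apply (x : L) (ω : L [⋀^Fin (k + 1)]→ₗ[A] B) (v : Fin k → L) :
    ins x ω v = ω (Fin.cons x v) := rfl

theorem ins_ext {ω η : L [⋀^Fin (k + 1)]→ₗ[A] B} (h : ∀ x : L, ins x ω = ins x η) : ω = η := by
  ext v
  rw [← Fin.cons_self_tail v]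
  exact congrArg (fun ξ : L [⋀^Fin k]→ₗ[A] B => ξ (Fin.tail v)) (h (v 0))

theorem ins_add_left (x y : L) (ω : L [⋀^Fin (k + 1)]→ₗ[A] B) :
    ins (x + y) ω = ins x ω + ins y ω := by
  change ω.curryLeft (x + y) = _
  rw [map_add]; rfl

theorem ins_smul_left (c : A) (x : L) (ω : L [⋀^Fin (k + 1)]→ₗ[A] B) :
    ins (c • x) ω = c • ins x ω := by
  change ω.curryLeft (c • x) = _
  rw [map_smul]; rfl

theorem ins_ins_swap (x y : L) (ω : L [⋀^Fin (k + 2)]→ₗ[A] B) :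
    ins x (ins y ω) = - ins y (ins x ω) := by
  ext v
  simp only [ins_apply, AlternatingMap.neg_apply]
  rw [← ω.map_swap _ (show (0 : Fin (k + 2)) ≠ 1 by simp)]
  congr 1
  funext i
  refine Fin.cases ?_ (fun i => Fin.cases ?_ (fun i => ?_) i) i
  · simp
  · simp
  · rw [Function.comp_apply, Equiv.swap_apply_of_ne_of_ne] <;> simp [Fin.ext_iff]

/-- The first `k` slots of `m = k + l`. -/
def leftSlot (h : k + l = m) (i : Fin k) : Fin m := Fin.cast h (Fin.castAdd l i)

/-- The last `l` slots of `m = k + l`. -/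
def rightSlot (h : k + l = m) (i : Fin l) : Fin m := Fin.cast h (Fin.natAdd k i)

/-- Antisymmetrising a product over all permutations meets every shuffle `k! l!` times. The sum over
all permutations avoids the quotient in the definition by shuffles; over `ℝ` the factor is removed
by `real_factorial_cancel`. -/
theorem factorial_smul_wedge (h : k + l = m) (a : L [⋀^Fin k]→ₗ[A] B) (b : L [⋀^Fin l]→ₗ[A] B)
    (v : Fin m → L) :
    (k.factorial * l.factorial) • wedge h a b v
      = ∑ σ : Equiv.Perm (Fin m), Equiv.Perm.sign σ •
          (a (fun i => v (σ (leftSlot h i))) * b (fun i => v (σ (rightSlot h i)))) := by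
  let e : Fin k ⊕ Fin l ≃ Fin m := finSumFinEquiv.trans (finCongr h)
  have h1 : wedge h a b v = LinearMap.mul' A B (AlternatingMap.domCoprod a b (fun i => v (e i))) :=
    rfl
  have h2 := congrArg (fun ξ => LinearMap.mul' A B (ξ (fun i => v (e i))))
    (MultilinearMap.domCoprod_alternization_eq a b)
  simp only [Fintype.card_fin] at h2
  rw [h1, ← map_nsmul]
  refine h2.symm.trans ?_
  rw [MultilinearMap.alternatization_apply, map_sum]
  refine Fintype.sum_equiv e.permCongr _ _ fun σ => ?_
  rw [Equiv.Perm.sign_permCongr]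
  have h3 : ∀ (c : ℤˣ) (t : B ⊗[A] B), LinearMap.mul' A B (c • t) = c • LinearMap.mul' A B t := by
    intro c t
    rcases Int.units_eq_one_or c with rfl | rfl <;> simp
  have hl : ∀ i, e.symm (leftSlot h i) = Sum.inl i := fun i => by
    rw [Equiv.symm_apply_eq]; rfl
  have hr : ∀ i, e.symm (rightSlot h i) = Sum.inr i := fun i => by
    rw [Equiv.symm_apply_eq]; rfl
  rw [h3, MultilinearMap.domDomCongr_apply, MultilinearMap.domCoprod_apply, LinearMap.mul'_apply]
  simp [Equiv.permCongr_apply, hl, hr]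

/-- A permutation is given by the slot `i` that it sends to `0` and a permutation of the other
slots; the cycle that brings `i` to the front has sign `(-1)^i`. -/
theorem sum_perm_succ {N L' : Type*} [AddCommGroup N] (Φ : (Fin (m + 1) → L') → N) (x : L')
    (u : Fin m → L') :
    ∑ σ : Equiv.Perm (Fin (m + 1)), Equiv.Perm.sign σ •
        Φ (fun i => (Fin.cons x u : Fin (m + 1) → L') (σ i))
      = ∑ i : Fin (m + 1), ∑ ρ : Equiv.Perm (Fin m), ((-1 : ℤˣ) ^ (i : ℕ) * Equiv.Perm.sign ρ) •
          Φ (i.insertNth x (fun j => u (ρ j))) := by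
  let g : Fin (m + 1) × Equiv.Perm (Fin m) → Equiv.Perm (Fin (m + 1)) := fun p =>
    Equiv.Perm.decomposeFin.symm (0, p.2) * Fin.cycleRange p.1
  have hg0 : ∀ p, g p p.1 = 0 := fun p => by simp [g]
  have hgs : ∀ p j, g p (p.1.succAbove j) = (p.2 j).succ := fun p j => by
    simp [g, Fin.cycleRange_succAbove]
  have hinj : Function.Injective g := by
    intro p q hpq
    have h1 : p.1 = q.1 := by
      apply (g q).injective
      rw [hg0, ← hpq, hg0]
    refine Prod.ext h1 (Equiv.ext fun j => ?_)
    have := hgs p j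
    rw [hpq, h1, hgs] at this
    exact (Fin.succ_injective _ this).symm
  have hbij : Function.Bijective g := by
    rw [Fintype.bijective_iff_injective_and_card]
    refine ⟨hinj, ?_⟩
    simp [Fintype.card_perm, Nat.factorial_succ]
  rw [← Fintype.sum_prod_type']
  refine (Fintype.sum_bijective g hbij _ _ fun p => ?_).symm
  have hs : Equiv.Perm.sign (g p) = (-1 : ℤˣ) ^ (p.1 : ℕ) * Equiv.Perm.sign p.2 := by
    simp [g, Equiv.Perm.decomposeFin.symm_sign, mul_comm]
  rw [hs]
  congr 2
  funext i
  refine Fin.succAboveCases p.1 ?_ (fun j => ?_) i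
  · rw [hg0]; simp
  · rw [hgs]; simp

variable [Algebra ℝ B]

theorem real_factorial_cancel {c d : ℕ} {x y : B}
    (h : (c.factorial * d.factorial) • x = (c.factorial * d.factorial) • y) : x = y := by
  have hc : ((c.factorial * d.factorial : ℕ) : ℝ) ≠ 0 := by positivity
  rw [← Nat.cast_smul_eq_nsmul ℝ, ← Nat.cast_smul_eq_nsmul ℝ] at h
  exact smul_right_injective _ hc h

/-- The vector `x` lands either in a slot of `a` or, after passing `k + 1` slots, in a slot of `b`.
With `ins_ext` this antiderivation rule turns identities of exterior products into inductions on the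
degree. Contraction needs positive degree, so factors of degree zero are treated apart. -/
theorem ins_wedge (h : k + 1 + (l + 1) = m + 1) (h₁ : k + (l + 1) = m)
    (h₂ : k + 1 + l = m) (a : L [⋀^Fin (k + 1)]→ₗ[A] B) (b : L [⋀^Fin (l + 1)]→ₗ[A] B) (x : L) :
    ins x (wedge h a b) = wedge h₁ (ins x a) b + (-1 : ℤ) ^ (k + 1) • wedge h₂ a (ins x b) := by
  ext u
  refine real_factorial_cancel (c := k + 1) (d := l + 1) ?_
  rw [ins_apply, factorial_smul_wedge]
  rw [sum_perm_succ (Φ := fun v => a (fun i => v (leftSlot h i)) * b (fun i => v (rightSlot h i)))]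
  let e : Fin (k + 1) ⊕ Fin (l + 1) ≃ Fin (m + 1) := finSumFinEquiv.trans (finCongr h)
  have hLL : ∀ (i : Fin (k + 1)) (w : Fin m → L),
      (fun j => (Fin.insertNth (leftSlot h i) x w : Fin (m + 1) → L) (leftSlot h j))
        = Fin.insertNth i x (fun j => w (leftSlot h₁ j)) := by
    intro i w
    funext j
    refine Fin.succAboveCases i ?_ (fun j => ?_) j
    · simp
    · have : leftSlot h (i.succAbove j) = (leftSlot h i).succAbove (leftSlot h₁ j) := by
        simp only [leftSlot, Fin.succAbove, Fin.ext_iff, Fin.lt_def]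
        simp
        split_ifs <;> simp
      rw [this]; simp
  have hLR : ∀ (i : Fin (k + 1)) (w : Fin m → L),
      (fun j => (Fin.insertNth (leftSlot h i) x w : Fin (m + 1) → L) (rightSlot h j))
        = fun j => w (rightSlot h₁ j) := by
    intro i w
    funext j
    have : rightSlot h j = (leftSlot h i).succAbove (rightSlot h₁ j) := by
      simp only [leftSlot, rightSlot, Fin.succAbove, Fin.ext_iff, Fin.lt_def]
      simp
      split_ifs <;> simp <;> omega
    rw [this]; simp
  have hRL : ∀ (i : Fin (l + 1)) (w : Fin m → L),
      (fun j => (Fin.insertNth (rightSlot h i) x w : Fin (m + 1) → L) (leftSlot h j))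
        = fun j => w (leftSlot h₂ j) := by
    intro i w
    funext j
    have : leftSlot h j = (rightSlot h i).succAbove (leftSlot h₂ j) := by
      simp only [leftSlot, rightSlot, Fin.succAbove, Fin.ext_iff, Fin.lt_def]
      simp
      split_ifs <;> simp <;> omega
    rw [this]; simp
  have hRR : ∀ (i : Fin (l + 1)) (w : Fin m → L),
      (fun j => (Fin.insertNth (rightSlot h i) x w : Fin (m + 1) → L) (rightSlot h j))
        = Fin.insertNth i x (fun j => w (rightSlot h₂ j)) := by
    intro i w
    funext j
    refine Fin.succAboveCases i ?_ (fun j => ?_) j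
    · simp
    · have : rightSlot h (i.succAbove j) = (rightSlot h i).succAbove (rightSlot h₂ j) := by
        simp only [rightSlot, Fin.succAbove, Fin.ext_iff, Fin.lt_def]
        simp
        split_ifs <;> simp; omega
      rw [this]; simp
  have hl : ∀ i, e (Sum.inl i) = leftSlot h i := fun i => rfl
  have hr : ∀ i, e (Sum.inr i) = rightSlot h i := fun i => rfl
  have hlv : ∀ i : Fin (k + 1), (leftSlot h i : ℕ) = i := fun i => rfl
  have hrv : ∀ i : Fin (l + 1), (rightSlot h i : ℕ) = k + 1 + i := fun i => rfl
  rw [← e.sum_comp, Fintype.sum_sum_type]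
  simp only [hl, hr, hLL, hLR, hRL, hRR, hlv, hrv, AlternatingMap.map_insertNth]
  have hsgn : ∀ (i : ℕ) (c : ℤˣ) (y z : B),
      ((-1 : ℤˣ) ^ i * c) • (((-1 : ℤ) ^ i • y) * z) = c • (y * z) := by
    intro i c y z
    rcases neg_one_pow_eq_or ℤ i with h | h <;> rcases neg_one_pow_eq_or ℤˣ i with h' | h' <;>
      rw [h, h'] <;> simp
    all_goals exfalso; rcases Nat.even_or_odd i with e | e <;> simp [e] at h h'
  have hsgn' : ∀ (i : ℕ) (c : ℤˣ) (y z : B),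
      ((-1 : ℤˣ) ^ (k + 1 + i) * c) • (y * ((-1 : ℤ) ^ i • z)) = (-1 : ℤ) ^ (k + 1) • c • (y * z) := by
    intro i c y z
    rw [mul_comm y, pow_add, mul_assoc, mul_smul, hsgn, mul_comm z, Units.smul_def]
    simp
  simp only [hsgn, hsgn', ← Finset.smul_sum]
  -- All slots of one factor contribute equally; their number completes the factorials `k! (l + 1)!`
  -- and `(k + 1)! l!` to `(k + 1)! (l + 1)!`.
  rw [Finset.sum_const, Finset.sum_const]
  have e1 := factorial_smul_wedge h₁ (ins x a) b u
  have e2 := factorial_smul_wedge h₂ a (ins x b) u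
  have e1' : ∑ σ : Equiv.Perm (Fin m), Equiv.Perm.sign σ •
      (a (Matrix.vecCons x fun j => u (σ (leftSlot h₁ j))) * b fun j => u (σ (rightSlot h₁ j))) =
      (k.factorial * (l + 1).factorial) • wedge h₁ (ins x a) b u := e1.symm
  have e2' : ∑ σ : Equiv.Perm (Fin m), Equiv.Perm.sign σ •
      ((a fun j => u (σ (leftSlot h₂ j))) * b (Matrix.vecCons x fun j => u (σ (rightSlot h₂ j)))) =
      ((k + 1).factorial * l.factorial) • wedge h₂ a (ins x b) u := e2.symm
  rw [e1', e2']
  simp only [Finset.card_univ, Fintype.card_fin, AlternatingMap.add_apply, smul_add,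
    AlternatingMap.smul_apply, smul_smul, Nat.factorial_succ]
  congr 1
  · congr 1; ring
  · rw [show (l + 1) * ((k + 1) * k.factorial * l.factorial)
      = (k + 1) * k.factorial * ((l + 1) * l.factorial) by ring]
    exact smul_comm _ _ _

theorem wedge_zero_left (h : 0 + l = l) (a : L [⋀^Fin 0]→ₗ[A] B) (b : L [⋀^Fin l]→ₗ[A] B) :
    wedge h a b = a ![] • b := by
  ext v
  refine real_factorial_cancel (c := 0) (d := l) ?_
  rw [factorial_smul_wedge]
  have h1 : ∀ i, rightSlot h i = i := fun i => by ext; simp [rightSlot]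
  have h2 : ∀ σ : Equiv.Perm (Fin l), Equiv.Perm.sign σ •
      ((a fun i => v (σ (leftSlot h i))) * b fun i => v (σ (rightSlot h i))) = a ![] * b v := by
    intro σ
    simp only [h1]
    have := b.map_perm v σ
    rw [show (fun i => v (σ i)) = v ∘ σ from rfl, this,
      show (fun i => v (σ (leftSlot h i))) = ![] from Subsingleton.elim _ _, mul_smul_comm, smul_smul,
      Int.units_mul_self, one_smul]
  simp only [h2, Finset.sum_const, Finset.card_univ, Fintype.card_perm, Fintype.card_fin]
  simp

theorem wedge_zero_right (h : k + 0 = k) (a : L [⋀^Fin k]→ₗ[A] B) (b : L [⋀^Fin 0]→ₗ[A] B) :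
    wedge h a b = b ![] • a := by
  ext v
  refine real_factorial_cancel (c := k) (d := 0) ?_
  rw [factorial_smul_wedge]
  have h1 : ∀ i, leftSlot h i = i := fun i => by ext; simp [leftSlot]
  have h2 : ∀ σ : Equiv.Perm (Fin k), Equiv.Perm.sign σ •
      ((a fun i => v (σ (leftSlot h i))) * b fun i => v (σ (rightSlot h i))) = b ![] * a v := by
    intro σ
    simp only [h1]
    have := a.map_perm v σ
    rw [show (fun i => v (σ i)) = v ∘ σ from rfl, this,
      show (fun i => v (σ (rightSlot h i))) = ![] from Subsingleton.elim _ _, smul_mul_assoc,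
      smul_smul, Int.units_mul_self, one_smul, mul_comm]
  simp only [h2, Finset.sum_const, Finset.card_univ, Fintype.card_perm, Fintype.card_fin]
  simp

theorem wedge_add_left (h : k + l = m) (a a' : L [⋀^Fin k]→ₗ[A] B) (b : L [⋀^Fin l]→ₗ[A] B) :
    wedge h (a + a') b = wedge h a b + wedge h a' b := by
  simp [wedge, TensorProduct.add_tmul]

theorem wedge_add_right (h : k + l = m) (a : L [⋀^Fin k]→ₗ[A] B) (b b' : L [⋀^Fin l]→ₗ[A] B) :
    wedge h a (b + b') = wedge h a b + wedge h a b' := by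
  simp [wedge, TensorProduct.tmul_add]

/-- The exterior product as a biadditive map. -/
def wedgeAdd (h : k + l = m) :
    (L [⋀^Fin k]→ₗ[A] B) →+ (L [⋀^Fin l]→ₗ[A] B) →+ (L [⋀^Fin m]→ₗ[A] B) :=
  AddMonoidHom.mk' (fun a => AddMonoidHom.mk' (wedge h a) (wedge_add_right h a))
    fun a a' => by ext b : 1; exact wedge_add_left h a a' b

theorem wedge_zsmul_left (h : k + l = m) (c : ℤ) (a : L [⋀^Fin k]→ₗ[A] B)
    (b : L [⋀^Fin l]→ₗ[A] B) : wedge h (c • a) b = c • wedge h a b :=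
  congrArg (fun f => f b) (map_zsmul (wedgeAdd h) c a)

theorem wedge_zsmul_right (h : k + l = m) (c : ℤ) (a : L [⋀^Fin k]→ₗ[A] B)
    (b : L [⋀^Fin l]→ₗ[A] B) : wedge h a (c • b) = c • wedge h a b :=
  map_zsmul (wedgeAdd h a) c b

theorem wedge_zero (h : k + l = m) (a : L [⋀^Fin k]→ₗ[A] B) :
    wedge h a (0 : L [⋀^Fin l]→ₗ[A] B) = 0 := map_zero (wedgeAdd h a)

theorem zero_wedge (h : k + l = m) (b : L [⋀^Fin l]→ₗ[A] B) :
    wedge h (0 : L [⋀^Fin k]→ₗ[A] B) b = 0 := congrArg (fun f => f b) (map_zero (wedgeAdd h))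

theorem wedge_sum_left {ι : Type*} (s : Finset ι) (h : k + l = m) (a : ι → L [⋀^Fin k]→ₗ[A] B)
    (b : L [⋀^Fin l]→ₗ[A] B) : wedge h (∑ i ∈ s, a i) b = ∑ i ∈ s, wedge h (a i) b := by
  refine (congrArg (fun f => f b) (map_sum (wedgeAdd h) a s)).trans ?_
  rw [AddMonoidHom.finsetSum_apply]; rfl

theorem wedge_sum_right {ι : Type*} (s : Finset ι) (h : k + l = m) (a : L [⋀^Fin k]→ₗ[A] B)
    (b : ι → L [⋀^Fin l]→ₗ[A] B) : wedge h a (∑ i ∈ s, b i) = ∑ i ∈ s, wedge h a (b i) :=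
  map_sum (wedgeAdd h a) b s

theorem wedge_smul_left (h : k + l = m) (c : B) (a : L [⋀^Fin k]→ₗ[A] B)
    (b : L [⋀^Fin l]→ₗ[A] B) : wedge h (c • a) b = c • wedge h a b := by
  ext v
  refine real_factorial_cancel (c := k) (d := l) ?_
  rw [factorial_smul_wedge, AlternatingMap.smul_apply, smul_comm, factorial_smul_wedge,
    Finset.smul_sum]
  refine Finset.sum_congr rfl fun σ _ => ?_
  rw [AlternatingMap.smul_apply, smul_mul_assoc, smul_comm]

theorem wedge_smul_right (h : k + l = m) (c : B) (a : L [⋀^Fin k]→ₗ[A] B)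
    (b : L [⋀^Fin l]→ₗ[A] B) : wedge h a (c • b) = c • wedge h a b := by
  ext v
  refine real_factorial_cancel (c := k) (d := l) ?_
  rw [factorial_smul_wedge, AlternatingMap.smul_apply, smul_comm, factorial_smul_wedge,
    Finset.smul_sum]
  refine Finset.sum_congr rfl fun σ _ => ?_
  rw [AlternatingMap.smul_apply, mul_smul_comm, smul_comm]

theorem wedge_smul_left' (h : k + l = m) (c : A) (a : L [⋀^Fin k]→ₗ[A] B)
    (b : L [⋀^Fin l]→ₗ[A] B) : wedge h (c • a) b = c • wedge h a b := by
  rw [wedge, ← TensorProduct.smul_tmul', map_smul]; rfl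

theorem wedge_smul_right' (h : k + l = m) (c : A) (a : L [⋀^Fin k]→ₗ[A] B)
    (b : L [⋀^Fin l]→ₗ[A] B) : wedge h a (c • b) = c • wedge h a b := by
  simp [wedge]

theorem wedge_compLinearMap {L' : Type*} [AddCommGroup L'] [Module A L'] (h : k + l = m)
    (a : L [⋀^Fin k]→ₗ[A] B) (b : L [⋀^Fin l]→ₗ[A] B) (g : L' →ₗ[A] L) :
    wedge h (a.compLinearMap g) (b.compLinearMap g) = (wedge h a b).compLinearMap g := by
  ext v
  refine real_factorial_cancel (c := k) (d := l) ?_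
  rw [factorial_smul_wedge]
  exact (factorial_smul_wedge h a b (fun i => g (v i))).symm

theorem wedge_compAlternatingMap {B' : Type*} [CommRing B'] [Algebra A B'] [Algebra ℝ B']
    (h : k + l = m) (a : L [⋀^Fin k]→ₗ[A] B) (b : L [⋀^Fin l]→ₗ[A] B) (g : B →ₐ[A] B') :
    wedge h (g.toLinearMap.compAlternatingMap a) (g.toLinearMap.compAlternatingMap b)
      = g.toLinearMap.compAlternatingMap (wedge h a b) := by
  ext v
  refine real_factorial_cancel (c := k) (d := l) ?_
  rw [factorial_smul_wedge, LinearMap.compAlternatingMap_apply, ← map_nsmul, factorial_smul_wedge,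
    map_sum]
  refine Finset.sum_congr rfl fun σ _ => ?_
  rcases Int.units_eq_one_or (Equiv.Perm.sign σ) with h | h <;> rw [h] <;> simp

/-- Contraction with `x` reduces both sides to triple products of smaller total degree. Degrees are
variables tied by equations, so that no casts between types of forms appear. -/
theorem wedge_assoc {p q r : ℕ} (h₁ : k + l = p) (h₂ : p + m = r) (h₃ : l + m = q) (h₄ : k + q = r)
    (a : L [⋀^Fin k]→ₗ[A] B) (b : L [⋀^Fin l]→ₗ[A] B) (c : L [⋀^Fin m]→ₗ[A] B) :
    wedge h₂ (wedge h₁ a b) c = wedge h₄ a (wedge h₃ b c) := by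
  induction r generalizing k l m p q with
  | zero =>
    obtain rfl : k = 0 := by omega
    obtain rfl : l = 0 := by omega
    obtain rfl : m = 0 := by omega
    obtain rfl : p = 0 := by omega
    obtain rfl : q = 0 := by omega
    simp only [wedge_zero_left, AlternatingMap.smul_apply]
    rw [smul_eq_mul, mul_smul]
  | succ r ih =>
    rcases k with _ | k
    · obtain rfl : l = p := by omega
      obtain rfl : q = r + 1 := by omega
      simp only [wedge_zero_left, wedge_smul_left]
    rcases l with _ | l
    · obtain rfl : k + 1 = p := by omega
      obtain rfl : m = q := by omega
      simp only [wedge_zero_left, wedge_zero_right, wedge_smul_left, wedge_smul_right]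
    rcases m with _ | m
    · obtain rfl : p = r + 1 := by omega
      obtain rfl : l + 1 = q := by omega
      simp only [wedge_zero_right, wedge_smul_right]
    obtain ⟨p, rfl⟩ : ∃ p', p = p' + 1 := ⟨k + l + 1, by omega⟩
    obtain ⟨q, rfl⟩ : ∃ q', q = q' + 1 := ⟨l + m + 1, by omega⟩
    refine ins_ext fun x => ?_
    rw [ins_wedge h₂ (by omega) (by omega), ins_wedge h₄ (by omega) (by omega),
      ins_wedge h₁ (by omega) (by omega), ins_wedge h₃ (by omega) (by omega)]
    simp only [wedge_add_left, wedge_add_right, wedge_zsmul_left, wedge_zsmul_right]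
    rw [ih _ _ h₃ (by omega), ih _ _ (show l + (m + 1) = q by omega) (by omega),
      ih _ _ (show (l + 1) + m = q by omega) (by omega), smul_add, smul_smul, add_assoc]
    congr 3
    rw [← h₁, ← pow_add]

theorem wedge_comm (h : k + l = m) (h' : l + k = m) (a : L [⋀^Fin k]→ₗ[A] B)
    (b : L [⋀^Fin l]→ₗ[A] B) : wedge h a b = (-1 : ℤ) ^ (k * l) • wedge h' b a := by
  induction m generalizing k l with
  | zero =>
    obtain rfl : k = 0 := by omega
    obtain rfl : l = 0 := by omega
    simp only [wedge_zero_left]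
    ext v
    simp [mul_comm, Subsingleton.elim v ![]]
  | succ m ih =>
    rcases k with _ | k
    · obtain rfl : l = m + 1 := by omega
      rw [wedge_zero_left, wedge_zero_right]; simp
    rcases l with _ | l
    · obtain rfl : k = m := by omega
      simp only [wedge_zero_left, wedge_zero_right]; simp
    refine ins_ext fun x => ?_
    rw [map_zsmul, ins_wedge h (by omega) (by omega), ins_wedge h' (by omega) (by omega),
      ih (show k + (l + 1) = m by omega) (by omega), ih (show k + 1 + l = m by omega) (by omega),
      smul_add, smul_smul, smul_smul, add_comm]
    have e1 : (-1 : ℤ) ^ (k + 1) * (-1) ^ ((k + 1) * l) = (-1) ^ ((k + 1) * (l + 1)) := by ring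
    have e2 : (-1 : ℤ) ^ ((k + 1) * (l + 1)) * (-1) ^ (l + 1) = (-1) ^ (k * (l + 1)) := by
      rw [← pow_add, show (k + 1) * (l + 1) + (l + 1) = k * (l + 1) + 2 * (l + 1) by ring, pow_add]
      simp
    rw [e1, e2]

end Wedge

end FormalPoisson

end

/-! ### Covariant derivatives of alternating maps, and derivatives of homogeneous polynomial maps.
-/

noncomputable section

namespace FormalPoisson

set_option linter.unusedSectionVars false

section CovariantDerivatives

variable {A : Type*} [CommRing A] [Algebra ℝ A]

/-- An additive operator on a module obeying the Leibniz rule over a derivation `X` of the ring: a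
covariant derivative in the direction `X`. -/
structure CovDer (X : Derivation ℝ A A) (V : Type*) [AddCommGroup V] [Module A V] where
  op : V →+ V
  op_smul : ∀ (g : A) (v : V), op (g • v) = g • op v + X g • v

variable {X : Derivation ℝ A A} {V N L : Type*} [AddCommGroup V] [Module A V] [AddCommGroup N]
  [Module A N] [AddCommGroup L] [Module A L] {k l m s : ℕ}

namespace CovDer

/-- The covariant derivative of multilinear maps. -/
def multi (D : CovDer X V) (E : CovDer X N) (f : MultilinearMap A (fun _ : Fin s => V) N) :
    MultilinearMap A (fun _ : Fin s => V) N where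
  toFun v := E.op (f v) - ∑ j, f (Function.update v j (D.op (v j)))
  map_update_add' := by
    intro inst v i x y
    obtain rfl : inst = instDecidableEqFin _ := Subsingleton.elim _ _
    have h : ∀ z : V, ∑ j, f (Function.update (Function.update v i z) j
          (D.op (Function.update v i z j)))
        = f (Function.update v i (D.op z)) + ∑ j ∈ Finset.univ.erase i,
            f (Function.update (Function.update v j (D.op (v j))) i z) := by
      intro z
      rw [← Finset.add_sum_erase _ _ (Finset.mem_univ i)]
      congr 1
      · simp
      · refine Finset.sum_congr rfl fun j hj => ?_
        have hj := Finset.ne_of_mem_erase hj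
        rw [Function.update_of_ne hj, Function.update_comm hj]
    rw [h, h, h]
    simp only [f.map_update_add, map_add, Finset.sum_add_distrib]
    abel
  map_update_smul' := by
    intro inst v i g x
    obtain rfl : inst = instDecidableEqFin _ := Subsingleton.elim _ _
    have h : ∀ z : V, ∑ j, f (Function.update (Function.update v i z) j
          (D.op (Function.update v i z j)))
        = f (Function.update v i (D.op z)) + ∑ j ∈ Finset.univ.erase i,
            f (Function.update (Function.update v j (D.op (v j))) i z) := by
      intro z
      rw [← Finset.add_sum_erase _ _ (Finset.mem_univ i)]
      congr 1
      · simp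
      · refine Finset.sum_congr rfl fun j hj => ?_
        have hj := Finset.ne_of_mem_erase hj
        rw [Function.update_of_ne hj, Function.update_comm hj]
    rw [h, h]
    simp only [f.map_update_smul, D.op_smul, f.map_update_add, E.op_smul, ← Finset.smul_sum, smul_sub,
      smul_add]
    abel

/-- The covariant derivative of alternating maps. -/
def alt (D : CovDer X V) (E : CovDer X N) : CovDer X (V [⋀^Fin k]→ₗ[A] N) where
  op := AddMonoidHom.mk' (fun ω =>
    { D.multi E ω.toMultilinearMap with
      map_eq_zero_of_eq' := by
        intro v i j hv hij
        change E.op (ω v) - ∑ l, ω (Function.update v l (D.op (v l))) = 0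
        have key : ∑ l, ω (Function.update v l (D.op (v l))) = 0 := by
          rw [Finset.sum_eq_add i j hij]
          · have : Function.update v j (D.op (v j))
                = Function.update v i (D.op (v i)) ∘ Equiv.swap i j := by
              funext l
              rcases eq_or_ne l i with rfl | hi
              · simp [hij, hij.symm, hv]
              rcases eq_or_ne l j with rfl | hj
              · simp [hv]
              · simp [Equiv.swap_apply_of_ne_of_ne hi hj, hi, hj]
            rw [this, ω.map_swap _ hij]; simp
          · intro c _ hc
            exact ω.map_eq_zero_of_eq _ (by simp [hc.1.symm, hc.2.symm, hv]) hij
          · simp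
          · simp
        rw [key, ω.map_eq_zero_of_eq v hv hij]; simp }) (by
    intro ω η
    ext v
    change E.op ((ω + η) v) - ∑ l, (ω + η) (Function.update v l (D.op (v l)))
      = (E.op (ω v) - ∑ l, ω (Function.update v l (D.op (v l))))
        + (E.op (η v) - ∑ l, η (Function.update v l (D.op (v l))))
    simp only [AlternatingMap.add_apply, map_add, Finset.sum_add_distrib]
    abel)
  op_smul g ω := by
    ext v
    change E.op ((g • ω) v) - ∑ l, (g • ω) (Function.update v l (D.op (v l)))
      = g • (E.op (ω v) - ∑ l, ω (Function.update v l (D.op (v l)))) + X g • ω v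
    simp only [AlternatingMap.smul_apply, E.op_smul, ← Finset.smul_sum, smul_sub]
    abel

theorem alt_apply (D : CovDer X V) (E : CovDer X N) (ω : V [⋀^Fin k]→ₗ[A] N) (v : Fin k → V) :
    (D.alt E).op ω v = E.op (ω v) - ∑ l, ω (Function.update v l (D.op (v l))) := rfl

theorem alt_zero_apply (D : CovDer X V) (E : CovDer X N) (ω : V [⋀^Fin 0]→ₗ[A] N) (v : Fin 0 → V) :
    (D.alt E).op ω v = E.op (ω v) := by
  simp [alt_apply]

end CovDer

variable {B : Type*} [CommRing B] [Algebra A B] [Algebra ℝ B]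

theorem CovDer.ins_alt (D : CovDer X V) (E : CovDer X B) (ω : V [⋀^Fin (k + 1)]→ₗ[A] B) (x : V) :
    ins x ((D.alt E).op ω) = (D.alt E).op (ins x ω) - ins (D.op x) ω := by
  ext v
  simp only [ins_apply, CovDer.alt_apply, AlternatingMap.sub_apply, Fin.sum_univ_succ,
    Fin.update_cons_zero, Fin.cons_zero, Fin.cons_succ, ← Fin.cons_update]
  abel

/-- Contraction commutes with the covariant derivative up to contraction with the derivative of the
vector (`CovDer.ins_alt`), so the Leibniz rule follows by induction on the degree. -/
theorem CovDer.alt_wedge (D : CovDer X V) (E : CovDer X B)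
    (hE : ∀ b c : B, E.op (b * c) = E.op b * c + b * E.op c) (h : k + l = m)
    (a : V [⋀^Fin k]→ₗ[A] B) (b : V [⋀^Fin l]→ₗ[A] B) :
    (D.alt E).op (wedge h a b) = wedge h ((D.alt E).op a) b + wedge h a ((D.alt E).op b) := by
  have hs : ∀ {r : ℕ} (c : B) (η : V [⋀^Fin r]→ₗ[A] B),
      (D.alt E).op (c • η) = E.op c • η + c • (D.alt E).op η := by
    intro r c η
    ext v
    simp only [CovDer.alt_apply, AlternatingMap.smul_apply, AlternatingMap.add_apply, smul_eq_mul,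
      hE, ← Finset.mul_sum]
    ring
  induction m generalizing k l with
  | zero =>
    obtain rfl : k = 0 := by omega
    obtain rfl : l = 0 := by omega
    simp only [wedge_zero_left, hs, CovDer.alt_zero_apply]
  | succ m ih =>
    rcases k with _ | k
    · obtain rfl : l = m + 1 := by omega
      simp only [wedge_zero_left, hs, CovDer.alt_zero_apply]
    rcases l with _ | l
    · obtain rfl : k = m := by omega
      rw [wedge_zero_right, wedge_zero_right, wedge_zero_right, hs, CovDer.alt_zero_apply,
        add_comm (E.op (b ![]) • a)]
    refine ins_ext fun x => ?_
    have h₁ : k + (l + 1) = m := by omega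
    have h₂ : k + 1 + l = m := by omega
    rw [CovDer.ins_alt, map_add, ins_wedge h h₁ h₂, ins_wedge h h₁ h₂, ins_wedge h h₁ h₂,
      ins_wedge h h₁ h₂, map_add, map_zsmul, ih, ih, CovDer.ins_alt, CovDer.ins_alt]
    simp only [sub_eq_add_neg, wedge_add_left, wedge_add_right, ← neg_one_zsmul (ins _ _),
      wedge_zsmul_left, wedge_zsmul_right]
    module

end CovariantDerivatives

section PolynomialMaps

variable {A V W : Type*} [CommRing A] [Algebra ℝ A] [AddCommGroup V] [Module A V] [AddCommGroup W]
  [Module A W] [Module ℝ W] [IsScalarTower ℝ A W] {s : ℕ}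

/-- The value of `m` at the diagonal point `v + c w` is a polynomial in the real number `c`, and the
sum is its linear coefficient. Real functionals reduce the claim to polynomials over `ℝ`. -/
theorem sum_update_eq_zero_of_diagonal (m : MultilinearMap A (fun _ : Fin s => V) W)
    (hm : ∀ v, m (fun _ => v) = 0) (v w : V) :
    ∑ i, m (Function.update (fun _ => v) i w) = 0 := by
  classical
  refine (Module.forall_dual_apply_eq_zero_iff ℝ _).1 fun φ => ?_
  let p : Polynomial ℝ := ∑ S : Finset (Fin s),
    Polynomial.C (φ (m (S.piecewise (fun _ => w) (fun _ => v)))) * Polynomial.X ^ S.card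
  have hp : p = 0 := by
    refine Polynomial.funext fun c => ?_
    have h1 := m.map_add_univ (fun _ => algebraMap ℝ A c • w) (fun _ => v)
    have h2 : ∀ S : Finset (Fin s),
        m (S.piecewise (fun _ => algebraMap ℝ A c • w) (fun _ => v))
          = c ^ S.card • m (S.piecewise (fun _ => w) (fun _ => v)) := by
      intro S
      have h3 := m.map_piecewise_smul (fun _ => algebraMap ℝ A c)
        (S.piecewise (fun _ => w) (fun _ => v)) S
      rw [Finset.prod_const, ← map_pow, algebraMap_smul] at h3
      rw [← h3]
      congr 1
      funext i
      by_cases hi : i ∈ S <;> simp [hi]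
    simp only [h2] at h1
    have h4 := congrArg φ h1
    have h5 : m ((fun _ => algebraMap ℝ A c • w) + fun _ => v) = 0 := hm _
    rw [h5, map_zero, map_sum] at h4
    simp only [p, Polynomial.eval_finsetSum, Polynomial.eval_mul, Polynomial.eval_C,
      Polynomial.eval_pow, Polynomial.eval_X, Polynomial.eval_zero]
    rw [h4]
    refine Finset.sum_congr rfl fun S _ => ?_
    rw [map_smul, smul_eq_mul, mul_comm]
  have h6 := congrArg (fun q => Polynomial.coeff q 1) hp
  simp only [p, Polynomial.finsetSum_coeff, Polynomial.coeff_C_mul, Polynomial.coeff_X_pow,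
    Polynomial.coeff_zero, mul_ite, mul_one, mul_zero] at h6
  rw [← Finset.sum_filter] at h6
  have h7 : (Finset.univ.filter fun S : Finset (Fin s) => 1 = S.card)
      = Finset.univ.map ⟨fun i => ({i} : Finset (Fin s)), Finset.singleton_injective⟩ := by
    ext S
    simp [eq_comm, Finset.card_eq_one]
  rw [h7, Finset.sum_map] at h6
  rw [map_sum, ← h6]
  refine Finset.sum_congr rfl fun i _ => ?_
  congr 2
  simp [Finset.piecewise_singleton]

open Classical in
/-- The derivative of a homogeneous polynomial map at `v` in the direction `w`. -/
def dirDeriv (A : Type*) {V W : Type*} [CommRing A] [AddCommGroup V] [Module A V] [AddCommGroup W]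
    [Module A W] (s : ℕ) (f : V → W) (v w : V) : W :=
  if h : f ∈ homogeneousMaps A V W s then
    ∑ i, (Classical.choose h : MultilinearMap A (fun _ : Fin s => V) W)
      (Function.update (fun _ => v) i w)
  else 0

/-- Two multilinear maps with the same diagonal differ by one that vanishes on the diagonal, so the
representative chosen in the definition does not matter. -/
theorem dirDeriv_eq {f : V → W} (m : MultilinearMap A (fun _ : Fin s => V) W)
    (hf : ∀ v, f v = m (fun _ => v)) (v w : V) :
    dirDeriv A s f v w = ∑ i, m (Function.update (fun _ => v) i w) := by
  have h : f ∈ homogeneousMaps A V W s := ⟨m, hf⟩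
  rw [dirDeriv, dif_pos h, ← sub_eq_zero, ← Finset.sum_sub_distrib]
  refine sum_update_eq_zero_of_diagonal (Classical.choose h - m) (fun v => ?_) v w
  rw [sub_apply, ← hf v, ← Classical.choose_spec h v, sub_self]

variable {f g : V → W}

theorem dirDeriv_add (hf : f ∈ homogeneousMaps A V W s) (hg : g ∈ homogeneousMaps A V W s)
    (v w : V) : dirDeriv A s (fun v => f v + g v) v w = dirDeriv A s f v w + dirDeriv A s g v w := by
  obtain ⟨m, hm⟩ := hf
  obtain ⟨m', hm'⟩ := hg
  rw [dirDeriv_eq m hm, dirDeriv_eq m' hm', dirDeriv_eq (m + m') (fun v => by simp [hm, hm'])]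
  simp [Finset.sum_add_distrib]

theorem dirDeriv_comp {W' : Type*} [AddCommGroup W'] [Module A W'] [Module ℝ W']
    [IsScalarTower ℝ A W'] (hf : f ∈ homogeneousMaps A V W s) (φ : W →ₗ[A] W') (v w : V) :
    dirDeriv A s (fun v => φ (f v)) v w = φ (dirDeriv A s f v w) := by
  obtain ⟨m, hm⟩ := hf
  rw [dirDeriv_eq m hm, dirDeriv_eq (φ.compMultilinearMap m) (fun v => by simp [hm])]
  simp

theorem dirDeriv_zero (v w : V) : dirDeriv A s (fun _ => (0 : W)) v w = 0 := by
  rw [dirDeriv_eq (0 : MultilinearMap A (fun _ : Fin s => V) W) (fun v => by simp)]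
  simp

theorem dirDeriv_add_right (hf : f ∈ homogeneousMaps A V W s) (v w w' : V) :
    dirDeriv A s f v (w + w') = dirDeriv A s f v w + dirDeriv A s f v w' := by
  obtain ⟨m, hm⟩ := hf
  simp [dirDeriv_eq m hm, Finset.sum_add_distrib]

theorem dirDeriv_smul_right (hf : f ∈ homogeneousMaps A V W s) (v w : V) (c : A) :
    dirDeriv A s f v (c • w) = c • dirDeriv A s f v w := by
  obtain ⟨m, hm⟩ := hf
  simp [dirDeriv_eq m hm, Finset.smul_sum]

theorem dirDeriv_self (hf : f ∈ homogeneousMaps A V W s) (v : V) :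
    dirDeriv A s f v v = (s : ℝ) • f v := by
  obtain ⟨m, hm⟩ := hf
  rw [dirDeriv_eq m hm, Nat.cast_smul_eq_nsmul]
  simp [hm]

theorem dirDeriv_of_zero (v w : V) (f : V → W) (hf : f ∈ homogeneousMaps A V W 0) :
    dirDeriv A 0 f v w = 0 := by
  obtain ⟨m, hm⟩ := hf
  simp [dirDeriv_eq m hm]

theorem dirDeriv_mem (hf : f ∈ homogeneousMaps A V W (s + 1)) (w : V) :
    (fun v => dirDeriv A (s + 1) f v w) ∈ homogeneousMaps A V W s := by
  obtain ⟨m, hm⟩ := hf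
  refine ⟨∑ i, m.curryMid i w, fun v => ?_⟩
  change dirDeriv A (s + 1) f v w = _
  rw [dirDeriv_eq m hm, sum_apply]
  refine Finset.sum_congr rfl fun i _ => ?_
  rw [MultilinearMap.curryMid_apply_apply]
  congr 1
  funext j
  refine Fin.succAboveCases i ?_ (fun j => ?_) j <;> simp

theorem covDer_mem {X : Derivation ℝ A A} (D : CovDer X V) (E : CovDer X W)
    (hf : f ∈ homogeneousMaps A V W s) :
    (fun v => E.op (f v) - dirDeriv A s f v (D.op v)) ∈ homogeneousMaps A V W s := by
  obtain ⟨m, hm⟩ := hf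
  refine ⟨D.multi E m, fun v => ?_⟩
  change E.op (f v) - dirDeriv A s f v (D.op v) = _
  rw [dirDeriv_eq m hm, hm]; rfl

theorem dirDeriv_tmul {W' W'' : Type*} [AddCommGroup W'] [Module A W'] [Module ℝ W']
    [IsScalarTower ℝ A W'] [AddCommGroup W''] [Module A W''] [Module ℝ W''] [IsScalarTower ℝ A W'']
    {t : ℕ} {g : V → W'} (hf : f ∈ homogeneousMaps A V W s) (hg : g ∈ homogeneousMaps A V W' t)
    (φ : W ⊗[A] W' →ₗ[A] W'') (v w : V) :
    dirDeriv A (s + t) (fun v => φ (f v ⊗ₜ[A] g v)) v w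
      = φ (dirDeriv A s f v w ⊗ₜ[A] g v) + φ (f v ⊗ₜ[A] dirDeriv A t g v w) := by
  obtain ⟨m, hm⟩ := hf
  obtain ⟨m', hm'⟩ := hg
  rw [dirDeriv_eq m hm, dirDeriv_eq m' hm', dirDeriv_eq
    ((φ.compMultilinearMap (m.domCoprod m')).domDomCongr finSumFinEquiv)
    (fun v => by simp [hm, hm', MultilinearMap.domCoprod_apply]), ← finSumFinEquiv.sum_comp,
    Fintype.sum_sum_type, TensorProduct.sum_tmul, TensorProduct.tmul_sum, map_sum, map_sum]
  have h : ∀ i j : Fin s ⊕ Fin t, (Function.update (fun _ => v) (finSumFinEquiv i) w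
      : Fin (s + t) → V) (finSumFinEquiv j) = Function.update (fun _ => v) i w j := by
    intro i j
    rcases eq_or_ne j i with rfl | h
    · simp
    · rw [Function.update_of_ne h, Function.update_of_ne (by simpa using h)]
  congr 1
  · refine Finset.sum_congr rfl fun i _ => ?_
    rw [MultilinearMap.domDomCongr_apply, LinearMap.compMultilinearMap_apply,
      MultilinearMap.domCoprod_apply, hm']
    simp only [h]
    congr 2
    · congr 1
      funext j
      rcases eq_or_ne j i with rfl | h
      · simp
      · rw [Function.update_of_ne h, Function.update_of_ne (by simpa using h)]
  · refine Finset.sum_congr rfl fun i _ => ?_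
    rw [MultilinearMap.domDomCongr_apply, LinearMap.compMultilinearMap_apply,
      MultilinearMap.domCoprod_apply, hm]
    simp only [h]
    congr 2
    · congr 1
      funext j
      rcases eq_or_ne j i with rfl | h
      · simp
      · rw [Function.update_of_ne h, Function.update_of_ne (by simpa using h)]

end PolynomialMaps

end FormalPoisson

end

/-! ### The graded algebra of cochains, its order filtration, and its elementary derivations. -/

noncomputable section

namespace FormalPoisson

set_option linter.unusedSectionVars false

section WedgeZero

variable {A L B : Type*} [CommRing A] [AddCommGroup L] [Module A L] [CommRing B] [Algebra A B]
  [Algebra ℝ B] {k l m : ℕ}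

theorem ins_wedge_zero_left (h : 0 + (l + 1) = m + 1) (h' : 0 + l = m) (a : L [⋀^Fin 0]→ₗ[A] B)
    (b : L [⋀^Fin (l + 1)]→ₗ[A] B) (x : L) : ins x (wedge h a b) = wedge h' a (ins x b) := by
  obtain rfl : l = m := by omega
  rw [wedge_zero_left, wedge_zero_left]; rfl

theorem ins_wedge_zero_right (h : k + 1 + 0 = m + 1) (h' : k + 0 = m)
    (a : L [⋀^Fin (k + 1)]→ₗ[A] B) (b : L [⋀^Fin 0]→ₗ[A] B) (x : L) :
    ins x (wedge h a b) = wedge h' (ins x a) b := by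
  obtain rfl : k = m := by omega
  rw [wedge_zero_right, wedge_zero_right]; rfl

end WedgeZero

theorem neg_one_pow_smul_eq {M : Type*} [AddCommGroup M] [Module ℝ M] (k : ℕ) (x : M) :
    (-1 : ℤ) ^ k • x = (-1 : ℝ) ^ k • x := by
  rcases Nat.even_or_odd k with h | h <;> simp [h]

variable {A : Type*} [CommRing A] [Algebra ℝ A]

namespace Cochain

variable {n k l m : ℕ}

theorem ext_coeff {a b : Cochain A n k} (h : ∀ s v, a.coeff s v = b.coeff s v) : a = b :=
  Subtype.ext (funext fun s => funext fun v => h s v)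

@[simp] theorem coeff_ofCoeff (f : ℕ → VectorFields A → Coeff A n k)
    (hf : ∀ s, f s ∈ homogeneousMaps A (VectorFields A) (Coeff A n k) s) :
    (ofCoeff f hf).coeff = f := rfl

@[simp] theorem coeff_add (a b : Cochain A n k) (s : ℕ) (v : VectorFields A) :
    (a + b).coeff s v = a.coeff s v + b.coeff s v := rfl

@[simp] theorem coeff_sub (a b : Cochain A n k) (s : ℕ) (v : VectorFields A) :
    (a - b).coeff s v = a.coeff s v - b.coeff s v := rfl

@[simp] theorem coeff_neg (a : Cochain A n k) (s : ℕ) (v : VectorFields A) :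
    (-a).coeff s v = - a.coeff s v := rfl

@[simp] theorem coeff_zero (s : ℕ) (v : VectorFields A) : (0 : Cochain A n k).coeff s v = 0 := rfl

@[simp] theorem coeff_smul (c : ℝ) (a : Cochain A n k) (s : ℕ) (v : VectorFields A) :
    (c • a).coeff s v = c • a.coeff s v := rfl

/-- Coefficients as linear maps. -/
def coeffHom (A : Type*) [CommRing A] [Algebra ℝ A] (n k s : ℕ) (v : VectorFields A) :
    Cochain A n k →ₗ[ℝ] Coeff A n k where
  toFun a := a.coeff s v
  map_add' _ _ := rfl
  map_smul' _ _ := rfl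

@[simp] theorem coeff_sum {ι : Type*} (S : Finset ι) (a : ι → Cochain A n k) (s : ℕ)
    (v : VectorFields A) : (∑ i ∈ S, a i).coeff s v = ∑ i ∈ S, (a i).coeff s v :=
  map_sum (coeffHom A n k s v) a S

theorem coeff_mul (h : k + l = m) (a : Cochain A n k) (b : Cochain A n l) (s : ℕ)
    (v : VectorFields A) : (mul h a b).coeff s v
      = ∑ p ∈ Finset.HasAntidiagonal.antidiagonal s, wedge h (a.coeff p.1 v) (b.coeff p.2 v) := rfl

instance : IsScalarTower ℝ A (Coeff A n k) :=
  ⟨fun c g x => by ext v; simp⟩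

theorem real_smul_coeff (c : ℝ) (x : Coeff A n k) : c • x = algebraMap ℝ A c • x := by
  ext v; simp

theorem mul_add (h : k + l = m) (a : Cochain A n k) (b b' : Cochain A n l) :
    mul h a (b + b') = mul h a b + mul h a b' :=
  ext_coeff fun s v => by simp [coeff_mul, wedge_add_right, Finset.sum_add_distrib]

theorem add_mul (h : k + l = m) (a a' : Cochain A n k) (b : Cochain A n l) :
    mul h (a + a') b = mul h a b + mul h a' b :=
  ext_coeff fun s v => by simp [coeff_mul, wedge_add_left, Finset.sum_add_distrib]

theorem mul_smul (h : k + l = m) (c : ℝ) (a : Cochain A n k) (b : Cochain A n l) :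
    mul h a (c • b) = c • mul h a b :=
  ext_coeff fun s v => by
    simp only [coeff_mul, coeff_smul, Finset.smul_sum]
    exact Finset.sum_congr rfl fun p _ => by
      rw [real_smul_coeff, wedge_smul_right', ← real_smul_coeff]

theorem smul_mul (h : k + l = m) (c : ℝ) (a : Cochain A n k) (b : Cochain A n l) :
    mul h (c • a) b = c • mul h a b :=
  ext_coeff fun s v => by
    simp only [coeff_mul, coeff_smul, Finset.smul_sum]
    exact Finset.sum_congr rfl fun p _ => by
      rw [real_smul_coeff, wedge_smul_left', ← real_smul_coeff]

/-- The product of cochains as a bilinear map. -/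
def mulHom (h : k + l = m) : Cochain A n k →ₗ[ℝ] Cochain A n l →ₗ[ℝ] Cochain A n m :=
  LinearMap.mk₂ ℝ (mul h) (add_mul h) (smul_mul h) (mul_add h) (mul_smul h)

theorem mul_zero (h : k + l = m) (a : Cochain A n k) : mul h a (0 : Cochain A n l) = 0 :=
  map_zero (mulHom h a)

theorem zero_mul (h : k + l = m) (b : Cochain A n l) : mul h (0 : Cochain A n k) b = 0 :=
  congrArg (fun f => f b) (map_zero (mulHom h))

theorem mul_neg (h : k + l = m) (a : Cochain A n k) (b : Cochain A n l) :
    mul h a (-b) = - mul h a b := map_neg (mulHom h a) b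

theorem neg_mul (h : k + l = m) (a : Cochain A n k) (b : Cochain A n l) :
    mul h (-a) b = - mul h a b := congrArg (fun f => f b) (map_neg (mulHom h) a)

theorem mul_sub (h : k + l = m) (a : Cochain A n k) (b b' : Cochain A n l) :
    mul h a (b - b') = mul h a b - mul h a b' := map_sub (mulHom h a) b b'

theorem sub_mul (h : k + l = m) (a a' : Cochain A n k) (b : Cochain A n l) :
    mul h (a - a') b = mul h a b - mul h a' b := congrArg (fun f => f b) (map_sub (mulHom h) a a')

theorem mul_sum {ι : Type*} (S : Finset ι) (h : k + l = m) (a : Cochain A n k)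
    (b : ι → Cochain A n l) : mul h a (∑ i ∈ S, b i) = ∑ i ∈ S, mul h a (b i) :=
  map_sum (mulHom h a) b S

theorem sum_mul {ι : Type*} (S : Finset ι) (h : k + l = m) (a : ι → Cochain A n k)
    (b : Cochain A n l) : mul h (∑ i ∈ S, a i) b = ∑ i ∈ S, mul h (a i) b := by
  refine (congrArg (fun f => f b) (map_sum (mulHom h) a S)).trans ?_
  rw [LinearMap.sum_apply]; rfl

theorem mul_assoc {p q r : ℕ} (h₁ : k + l = p) (h₂ : p + m = r) (h₃ : l + m = q) (h₄ : k + q = r)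
    (a : Cochain A n k) (b : Cochain A n l) (c : Cochain A n m) :
    mul h₂ (mul h₁ a b) c = mul h₄ a (mul h₃ b c) := by
  refine ext_coeff fun s v => ?_
  simp only [coeff_mul, wedge_sum_left, wedge_sum_right, Finset.sum_sigma']
  refine Finset.sum_nbij' (fun x => ⟨(x.2.1, x.2.2 + x.1.2), (x.2.2, x.1.2)⟩)
    (fun x => ⟨(x.1.1 + x.2.1, x.2.2), (x.1.1, x.2.1)⟩) ?_ ?_ ?_ ?_ ?_
  · rintro ⟨⟨i, j⟩, ⟨u, v⟩⟩ hx
    simp only [Finset.mem_sigma, Finset.HasAntidiagonal.mem_antidiagonal] at hx ⊢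
    exact ⟨by omega, trivial⟩
  · rintro ⟨⟨i, j⟩, ⟨u, v⟩⟩ hx
    simp only [Finset.mem_sigma, Finset.HasAntidiagonal.mem_antidiagonal] at hx ⊢
    exact ⟨by omega, trivial⟩
  · rintro ⟨⟨i, j⟩, ⟨u, v⟩⟩ hx
    simp only [Finset.mem_sigma, Finset.HasAntidiagonal.mem_antidiagonal] at hx
    obtain ⟨h, rfl⟩ := hx
    rfl
  · rintro ⟨⟨i, j⟩, ⟨u, v⟩⟩ hx
    simp only [Finset.mem_sigma, Finset.HasAntidiagonal.mem_antidiagonal] at hx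
    obtain ⟨h, rfl⟩ := hx
    rfl
  · rintro ⟨⟨i, j⟩, ⟨u, v⟩⟩ hx
    exact wedge_assoc h₁ h₂ h₃ h₄ _ _ _

theorem mul_comm (h : k + l = m) (h' : l + k = m) (a : Cochain A n k) (b : Cochain A n l) :
    mul h a b = (-1 : ℝ) ^ (k * l) • mul h' b a := by
  refine ext_coeff fun s v => ?_
  rw [coeff_smul, coeff_mul, coeff_mul, ← Finset.Nat.sum_antidiagonal_swap, Finset.smul_sum]
  refine Finset.sum_congr rfl fun p _ => ?_
  rw [wedge_comm h h', neg_one_pow_smul_eq]; rfl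

theorem mul_left_comm {p q r : ℕ} (h₁ : l + m = p) (h₂ : k + p = r) (h₃ : k + m = q)
    (h₄ : l + q = r) (a : Cochain A n k) (b : Cochain A n l) (c : Cochain A n m) :
    mul h₂ a (mul h₁ b c) = (-1 : ℝ) ^ (k * l) • mul h₄ b (mul h₃ a c) := by
  rw [← mul_assoc (show k + l = k + l from rfl) (by omega) h₁ h₂,
    mul_comm rfl (show l + k = k + l by omega), smul_mul,
    mul_assoc (show l + k = k + l by omega) (by omega) h₃ h₄]

/-- Cochains whose components of degree less than `r` vanish. -/
def OrderGe (r : ℕ) (a : Cochain A n k) : Prop := ∀ i < r, a.coeff i = 0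

theorem orderGe_zero (a : Cochain A n k) : a.OrderGe 0 := fun _ h => absurd h (by omega)

theorem OrderGe.coeff_eq {r : ℕ} {a : Cochain A n k} (h : a.OrderGe r) {i : ℕ} (hi : i < r)
    (v : VectorFields A) : a.coeff i v = 0 := by rw [h i hi]; rfl

theorem orderGe_iff {r : ℕ} {a : Cochain A n k} :
    a.OrderGe r ↔ ∀ i < r, ∀ v, a.coeff i v = 0 :=
  ⟨fun h _ hi v => h.coeff_eq hi v, fun h _ hi => funext fun v => h _ hi v⟩

theorem OrderGe.mono {r r' : ℕ} {a : Cochain A n k} (h : a.OrderGe r) (hr : r' ≤ r) :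
    a.OrderGe r' := fun _ hi => h _ (by omega)

theorem OrderGe.add {r : ℕ} {a b : Cochain A n k} (ha : a.OrderGe r) (hb : b.OrderGe r) :
    (a + b).OrderGe r :=
  orderGe_iff.2 fun i hi v => by simp [ha.coeff_eq hi, hb.coeff_eq hi]

theorem OrderGe.neg {r : ℕ} {a : Cochain A n k} (ha : a.OrderGe r) : (-a).OrderGe r :=
  orderGe_iff.2 fun i hi v => by simp [ha.coeff_eq hi]

theorem OrderGe.sub {r : ℕ} {a b : Cochain A n k} (ha : a.OrderGe r) (hb : b.OrderGe r) :
    (a - b).OrderGe r :=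
  orderGe_iff.2 fun i hi v => by simp [ha.coeff_eq hi, hb.coeff_eq hi]

theorem OrderGe.smul {r : ℕ} {a : Cochain A n k} (c : ℝ) (ha : a.OrderGe r) : (c • a).OrderGe r :=
  orderGe_iff.2 fun i hi v => by simp [ha.coeff_eq hi]

theorem OrderGe.zero (r : ℕ) : (0 : Cochain A n k).OrderGe r :=
  orderGe_iff.2 fun i hi v => by simp

theorem OrderGe.sum {ι : Type*} {r : ℕ} (S : Finset ι) {a : ι → Cochain A n k}
    (h : ∀ j ∈ S, (a j).OrderGe r) : (∑ i ∈ S, a i).OrderGe r :=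
  orderGe_iff.2 fun i hi v => by
    rw [coeff_sum]; exact Finset.sum_eq_zero fun j hj => (h j hj).coeff_eq hi v

theorem OrderGe.mul {r r' : ℕ} (h : k + l = m) {a : Cochain A n k} {b : Cochain A n l}
    (ha : a.OrderGe r) (hb : b.OrderGe r') : (mul h a b).OrderGe (r + r') :=
  orderGe_iff.2 fun i hi v => by
    rw [coeff_mul]
    refine Finset.sum_eq_zero fun p hp => ?_
    rw [Finset.HasAntidiagonal.mem_antidiagonal] at hp
    by_cases h1 : p.1 < r
    · rw [ha.coeff_eq h1, zero_wedge]
    · rw [hb.coeff_eq (by omega), wedge_zero]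

/-- The filtration is separated; its completeness is `exists_limit`. These two facts carry all
arguments by successive orders below. -/
theorem eq_zero_of_orderGe {a : Cochain A n k} (h : ∀ r, a.OrderGe r) : a = 0 :=
  ext_coeff fun s v => (h (s + 1)).coeff_eq (by omega) v

/-- The component of a cochain of a given degree. -/
def comp (s : ℕ) : Cochain A n k →ₗ[ℝ] Cochain A n k where
  toFun a := ofCoeff (fun i => if i = s then a.coeff i else 0) fun i => by
    by_cases h : i = s
    · rw [if_pos h]; exact a.coeff_mem i
    · rw [if_neg h]; exact zero_mem _
  map_add' a b := ext_coeff fun i v => by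
    simp only [coeff_ofCoeff, coeff_add]; split_ifs <;> simp
  map_smul' c a := ext_coeff fun i v => by
    simp only [coeff_ofCoeff, coeff_smul, RingHom.id_apply]; split_ifs <;> simp

theorem coeff_comp (s i : ℕ) (a : Cochain A n k) (v : VectorFields A) :
    (comp s a).coeff i v = if i = s then a.coeff i v else 0 := by
  change (if i = s then a.coeff i else 0) v = _
  split_ifs <;> rfl

/-- The derivative in the even variable in the direction of a vector field. -/
def vder (X : VectorFields A) : Cochain A n k →ₗ[ℝ] Cochain A n k where
  toFun a := ofCoeff (fun s v => dirDeriv A (s + 1) (a.coeff (s + 1)) v X) fun s =>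
    dirDeriv_mem (a.coeff_mem (s + 1)) X
  map_add' a b := ext_coeff fun s v => dirDeriv_add (a.coeff_mem _) (b.coeff_mem _) v X
  map_smul' c a := ext_coeff fun s v => by
    -- Multiplication by a real number is viewed as an `A`-linear map of the values, so that
    -- `dirDeriv_comp` applies.
    change dirDeriv A (s + 1) (fun v => (c • LinearMap.id (R := A) (M := Coeff A n k))
      (a.coeff (s + 1) v)) v X = _
    rw [dirDeriv_comp (a.coeff_mem _)]
    rfl

theorem coeff_vder (X : VectorFields A) (a : Cochain A n k) (s : ℕ) (v : VectorFields A) :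
    (vder X a).coeff s v = dirDeriv A (s + 1) (a.coeff (s + 1)) v X := rfl

/-- Contraction of the odd variables. -/
def contr (w : OddArgs A n) : Cochain A n (k + 1) →ₗ[ℝ] Cochain A n k where
  toFun a := ofCoeff (fun s v => ins w (a.coeff s v)) fun s => by
    obtain ⟨m, hm⟩ := a.coeff_mem s
    exact ⟨(ins (B := PolyFun A n) w).compMultilinearMap m, fun v => by
      change ins w (a.coeff s v) = _
      rw [hm]; rfl⟩
  map_add' a b := ext_coeff fun s v => map_add (ins w) _ _
  map_smul' c a := ext_coeff fun s v => rfl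

theorem coeff_contr (w : OddArgs A n) (a : Cochain A n (k + 1)) (s : ℕ) (v : VectorFields A) :
    (contr w a).coeff s v = ins w (a.coeff s v) := rfl

/-- The covariant derivative of cochains. -/
def cov {X : Derivation ℝ A A} (D : CovDer X (VectorFields A)) (D' : CovDer X (OddArgs A n))
    (E : CovDer X (PolyFun A n)) : Cochain A n k →ₗ[ℝ] Cochain A n k where
  toFun a := ofCoeff (fun s v => (D'.alt E).op (a.coeff s v)
    - dirDeriv A s (a.coeff s) v (D.op v)) fun s => covDer_mem D (D'.alt E) (a.coeff_mem s)
  map_add' a b := ext_coeff fun s v => by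
    change (D'.alt E).op (a.coeff s v + b.coeff s v)
      - dirDeriv A s (fun v => a.coeff s v + b.coeff s v) v (D.op v) = _
    rw [dirDeriv_add (a.coeff_mem _) (b.coeff_mem _), map_add]
    change _ = ((D'.alt E).op (a.coeff s v) - dirDeriv A s (a.coeff s) v (D.op v))
      + ((D'.alt E).op (b.coeff s v) - dirDeriv A s (b.coeff s) v (D.op v))
    abel
  map_smul' c a := ext_coeff fun s v => by
    change (D'.alt E).op (c • a.coeff s v)
      - dirDeriv A s (fun v => (c • LinearMap.id (R := A) (M := Coeff A n k)) (a.coeff s v)) v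
        (D.op v) = c • ((D'.alt E).op (a.coeff s v) - dirDeriv A s (a.coeff s) v (D.op v))
    rw [dirDeriv_comp (a.coeff_mem _), real_smul_coeff, CovDer.op_smul, X.map_algebraMap, zero_smul,
      add_zero, ← real_smul_coeff, smul_sub]
    rfl

theorem coeff_cov {X : Derivation ℝ A A} (D : CovDer X (VectorFields A))
    (D' : CovDer X (OddArgs A n)) (E : CovDer X (PolyFun A n)) (a : Cochain A n k) (s : ℕ)
    (v : VectorFields A) : (cov D D' E a).coeff s v = (D'.alt E).op (a.coeff s v)
      - dirDeriv A s (a.coeff s) v (D.op v) := rfl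

theorem dirDeriv_mul_coeff (h : k + l = m) (a : Cochain A n k) (b : Cochain A n l) (s : ℕ)
    (v w : VectorFields A) :
    dirDeriv A s ((mul h a b).coeff s) v w = ∑ p ∈ Finset.HasAntidiagonal.antidiagonal s,
      (wedge h (dirDeriv A p.1 (a.coeff p.1) v w) (b.coeff p.2 v)
        + wedge h (a.coeff p.1 v) (dirDeriv A p.2 (b.coeff p.2) v w)) := by
  have key : ∀ p ∈ Finset.HasAntidiagonal.antidiagonal s,
      (fun v => wedge h (a.coeff p.1 v) (b.coeff p.2 v))
        ∈ homogeneousMaps A (VectorFields A) (Coeff A n m) s ∧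
      dirDeriv A s (fun v => wedge h (a.coeff p.1 v) (b.coeff p.2 v)) v w
        = wedge h (dirDeriv A p.1 (a.coeff p.1) v w) (b.coeff p.2 v)
        + wedge h (a.coeff p.1 v) (dirDeriv A p.2 (b.coeff p.2) v w) := by
    rintro ⟨i, j⟩ hp
    obtain rfl : i + j = s := by simpa using hp
    refine ⟨?_, dirDeriv_tmul (a.coeff_mem i) (b.coeff_mem j) (wedgeHom h) v w⟩
    obtain ⟨f, hf⟩ := a.coeff_mem i
    obtain ⟨g, hg⟩ := b.coeff_mem j
    refine ⟨((wedgeHom h).compMultilinearMap (f.domCoprod g)).domDomCongr finSumFinEquiv,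
      fun v => ?_⟩
    simp [wedge, hf, hg, MultilinearMap.domCoprod_apply]
  -- Homogeneity travels with the induction because `dirDeriv` is additive only on homogeneous maps.
  have hsum : ∀ S ⊆ Finset.HasAntidiagonal.antidiagonal s,
      (fun v => ∑ p ∈ S, wedge h (a.coeff p.1 v) (b.coeff p.2 v))
        ∈ homogeneousMaps A (VectorFields A) (Coeff A n m) s ∧
      dirDeriv A s (fun v => ∑ p ∈ S, wedge h (a.coeff p.1 v) (b.coeff p.2 v)) v w
        = ∑ p ∈ S, (wedge h (dirDeriv A p.1 (a.coeff p.1) v w) (b.coeff p.2 v)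
        + wedge h (a.coeff p.1 v) (dirDeriv A p.2 (b.coeff p.2) v w)) := by
    classical
    intro S
    induction S using Finset.induction_on with
    | empty =>
      intro _
      simp only [Finset.sum_empty]
      exact ⟨zero_mem _, dirDeriv_zero v w⟩
    | insert p S hp ih =>
      intro hS
      obtain ⟨h1, h2⟩ := ih fun x hx => hS (Finset.mem_insert_of_mem hx)
      obtain ⟨h3, h4⟩ := key p (hS (Finset.mem_insert_self _ _))
      simp only [Finset.sum_insert hp]
      exact ⟨add_mem h3 h1, by rw [dirDeriv_add h3 h1, h2, h4]⟩
  exact (hsum _ subset_rfl).2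

theorem vder_mul (X : VectorFields A) (h : k + l = m) (a : Cochain A n k) (b : Cochain A n l) :
    vder X (mul h a b) = mul h (vder X a) b + mul h a (vder X b) := by
  refine ext_coeff fun s v => ?_
  -- Differentiation lowers the degree by one: in the antidiagonal of `s + 1` the end term whose
  -- differentiated factor has degree zero drops out, and the remaining terms form the antidiagonal
  -- of `s`.
  rw [coeff_vder, dirDeriv_mul_coeff, Finset.sum_add_distrib, Finset.Nat.antidiagonal_succ,
    Finset.sum_cons, Finset.sum_map, ← Finset.Nat.antidiagonal_succ, Finset.Nat.antidiagonal_succ',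
    Finset.sum_cons, Finset.sum_map]
  rw [dirDeriv_of_zero _ _ _ (a.coeff_mem 0), dirDeriv_of_zero _ _ _ (b.coeff_mem 0), zero_wedge,
    wedge_zero, zero_add, zero_add, coeff_add, coeff_mul, coeff_mul]
  rfl

theorem cov_mul {X : Derivation ℝ A A} (D : CovDer X (VectorFields A)) (D' : CovDer X (OddArgs A n))
    (E : CovDer X (PolyFun A n)) (hE : ∀ b c, E.op (b * c) = E.op b * c + b * E.op c)
    (h : k + l = m) (a : Cochain A n k) (b : Cochain A n l) :
    cov D D' E (mul h a b) = mul h (cov D D' E a) b + mul h a (cov D D' E b) := by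
  refine ext_coeff fun s v => ?_
  rw [coeff_cov, dirDeriv_mul_coeff, coeff_add, coeff_mul, coeff_mul, coeff_mul, map_sum,
    ← Finset.sum_sub_distrib, ← Finset.sum_add_distrib]
  refine Finset.sum_congr rfl fun p _ => ?_
  rw [CovDer.alt_wedge D' E hE, coeff_cov, coeff_cov]
  simp only [sub_eq_add_neg, wedge_add_left, wedge_add_right,
    ← neg_one_zsmul (dirDeriv _ _ _ _ _), wedge_zsmul_left, wedge_zsmul_right]
  module

theorem contr_mul (w : OddArgs A n) (h : k + 1 + (l + 1) = m + 1) (h₁ : k + (l + 1) = m)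
    (h₂ : k + 1 + l = m) (a : Cochain A n (k + 1)) (b : Cochain A n (l + 1)) :
    contr w (mul h a b) = mul h₁ (contr w a) b + (-1 : ℝ) ^ (k + 1) • mul h₂ a (contr w b) := by
  refine ext_coeff fun s v => ?_
  rw [coeff_contr, coeff_add, coeff_smul, coeff_mul, coeff_mul, coeff_mul, map_sum, Finset.smul_sum,
    ← Finset.sum_add_distrib]
  refine Finset.sum_congr rfl fun p _ => ?_
  rw [ins_wedge h h₁ h₂, neg_one_pow_smul_eq]
  rfl

theorem contr_mul_zero_left (w : OddArgs A n) (h : 0 + (l + 1) = m + 1) (h' : 0 + l = m)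
    (a : Cochain A n 0) (b : Cochain A n (l + 1)) :
    contr w (mul h a b) = mul h' a (contr w b) := by
  refine ext_coeff fun s v => ?_
  rw [coeff_contr, coeff_mul, coeff_mul, map_sum]
  exact Finset.sum_congr rfl fun p _ => ins_wedge_zero_left h h' _ _ w

theorem contr_mul_zero_right (w : OddArgs A n) (h : k + 1 + 0 = m + 1) (h' : k + 0 = m)
    (a : Cochain A n (k + 1)) (b : Cochain A n 0) :
    contr w (mul h a b) = mul h' (contr w a) b := by
  refine ext_coeff fun s v => ?_
  rw [coeff_contr, coeff_mul, coeff_mul, map_sum]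
  exact Finset.sum_congr rfl fun p _ => ins_wedge_zero_right h h' _ _ w

theorem ext_contr {a b : Cochain A n (k + 1)} (h : ∀ w, contr w a = contr w b) : a = b :=
  ext_coeff fun s v => ins_ext fun w => congrArg (fun c : Cochain A n k => c.coeff s v) (h w)

end Cochain

end FormalPoisson

end

/-! ### Frames, Euler identities, and derivations of the algebra of cochains. -/

noncomputable section

namespace FormalPoisson

set_option linter.unusedSectionVars false

variable {A : Type*} [CommRing A] [Algebra ℝ A]

/-- A finite family of functions and vector fields with `Y = ∑ᵢ Y(fᵢ) Xᵢ` for every vector field `Y`. -/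
structure Frame (A : Type*) [CommRing A] [Algebra ℝ A] where
  N : ℕ
  f : Fin N → A
  X : Fin N → VectorFields A
  sum_eq : ∀ Y : VectorFields A, Y = ∑ i, Y (f i) • X i

@[simp] theorem grad_apply (g : A) (Y : VectorFields A) : grad g Y = Y g := rfl

namespace Frame

variable (F : Frame A)

theorem sum_apply (Y : VectorFields A) (g : A) : Y g = ∑ i, Y (F.f i) * F.X i g := by
  conv_lhs => rw [F.sum_eq Y]
  rw [← Derivation.coeFnAddMonoidHom_apply, map_sum, Finset.sum_apply]
  rfl

theorem oneForm_eq (α : OneForms A) : α = ∑ i, α (F.X i) • grad (F.f i) := by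
  ext Y
  conv_lhs => rw [F.sum_eq Y]
  simp [mul_comm]

/-- The index set of the frame of the odd arguments. -/
abbrev Idx (F : Frame A) (n : ℕ) := Fin F.N ⊕ Fin F.N ⊕ Fin n

/-- The frame of the odd arguments. -/
def oddVec (n : ℕ) : F.Idx n → OddArgs A n :=
  Sum.elim (fun i => (F.X i, 0, 0))
    (Sum.elim (fun i => (0, grad (F.f i), 0)) (fun j => (0, 0, Pi.single j 1)))

/-- The coframe of the odd arguments. -/
def oddForm (n : ℕ) : F.Idx n → OddArgs A n →ₗ[A] A :=
  Sum.elim (fun i => grad (F.f i) ∘ₗ LinearMap.fst A _ _)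
    (Sum.elim
      (fun i => Module.Dual.eval A _ (F.X i) ∘ₗ LinearMap.fst A _ _ ∘ₗ LinearMap.snd A _ _)
      (fun j => LinearMap.proj j ∘ₗ LinearMap.snd A _ _ ∘ₗ LinearMap.snd A _ _))

theorem odd_sum_eq (n : ℕ) (w : OddArgs A n) : w = ∑ J, F.oddForm n J w • F.oddVec n J := by
  obtain ⟨Y, β, τ⟩ := w
  rw [Fintype.sum_sum_type, Fintype.sum_sum_type]
  simp only [oddForm, oddVec, Sum.elim_inl, Sum.elim_inr, LinearMap.comp_apply, LinearMap.fst_apply, LinearMap.snd_apply,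
    LinearMap.proj_apply, Prod.smul_mk, smul_zero, grad_apply, Module.Dual.eval_apply]
  refine Prod.ext ?_ (Prod.ext ?_ ?_)
  · simp only [Prod.fst_add, Prod.fst_sum, Finset.sum_const_zero, add_zero]
    exact F.sum_eq Y
  · simp only [Prod.snd_add, Prod.fst_add, Prod.snd_sum, Prod.fst_sum, Finset.sum_const_zero,
      add_zero, zero_add]
    exact F.oneForm_eq β
  · simp only [Prod.snd_add, Prod.snd_sum, Finset.sum_const_zero, zero_add]
    funext j
    simp [Finset.sum_apply, Pi.single_apply]

end Frame

namespace Cochain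

variable {n k l m : ℕ}

/-- A linear function of the odd arguments as a cochain. -/
def oneForm (φ : OddArgs A n →ₗ[A] A) : Cochain A n 1 := const (oneCoeff φ)

theorem coeff_const (b : Coeff A n k) (s : ℕ) (v : VectorFields A) :
    (const b).coeff s v = if s = 0 then b else 0 := rfl

theorem coeff_scalar_mul (h : 0 + k = k) (b : PolyFun A n) (a : Cochain A n k) (s : ℕ)
    (v : VectorFields A) : (mul h (scalar b) a).coeff s v = b • a.coeff s v := by
  rw [coeff_mul, Finset.sum_eq_single (0, s)]
  · rw [wedge_zero_left]; rfl
  · rintro ⟨i, j⟩ hij hne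
    have : i ≠ 0 := by
      rintro rfl
      simp [Finset.HasAntidiagonal.mem_antidiagonal] at hij
      exact hne (by rw [hij])
    rw [scalar, coeff_const, if_neg this, zero_wedge]
  · simp [Finset.HasAntidiagonal.mem_antidiagonal]

theorem coeff_mul_scalar (h : k + 0 = k) (b : PolyFun A n) (a : Cochain A n k) (s : ℕ)
    (v : VectorFields A) : (mul h a (scalar b)).coeff s v = b • a.coeff s v := by
  rw [mul_comm h (show 0 + k = k by omega)]
  simp [coeff_scalar_mul]

theorem coeff_const_mul (h : k + l = m) (b : Coeff A n k) (a : Cochain A n l) (s : ℕ)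
    (v : VectorFields A) : (mul h (const b) a).coeff s v = wedge h b (a.coeff s v) := by
  rw [coeff_mul, Finset.sum_eq_single (0, s)]
  · rfl
  · rintro ⟨i, j⟩ hij hne
    have : i ≠ 0 := by
      rintro rfl
      simp [Finset.HasAntidiagonal.mem_antidiagonal] at hij
      exact hne (by rw [hij])
    rw [coeff_const, if_neg this, zero_wedge]
  · simp [Finset.HasAntidiagonal.mem_antidiagonal]

theorem coeff_linear (α : OneForms A) (s : ℕ) (v : VectorFields A) :
    (linear n α).coeff s v = if s = 1 then
      AlternatingMap.constOfIsEmpty A _ (Fin 0) (algebraMap A (PolyFun A n) (α v)) else 0 := rfl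

theorem coeff_linear_mul_zero (h : 0 + k = k) (α : OneForms A) (a : Cochain A n k)
    (v : VectorFields A) : (mul h (linear n α) a).coeff 0 v = 0 := by
  rw [coeff_mul]
  simp [coeff_linear, zero_wedge]

theorem coeff_linear_mul_succ (h : 0 + k = k) (α : OneForms A) (a : Cochain A n k) (s : ℕ)
    (v : VectorFields A) : (mul h (linear n α) a).coeff (s + 1) v = α v • a.coeff s v := by
  rw [coeff_mul, Finset.sum_eq_single (1, s)]
  · rw [wedge_zero_left]
    ext w
    simp [coeff_linear, Algebra.smul_def]
  · rintro ⟨i, j⟩ hij hne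
    have : i ≠ 1 := by
      rintro rfl
      simp only [Finset.HasAntidiagonal.mem_antidiagonal] at hij
      exact hne (by rw [show j = s by omega])
    rw [coeff_linear, if_neg this, zero_wedge]
  · intro h
    exact absurd (Finset.HasAntidiagonal.mem_antidiagonal.2 (by omega)) h

/-- The Euler operator of the even variable. -/
def euler : Cochain A n k →ₗ[ℝ] Cochain A n k where
  toFun a := ofCoeff (fun s v => (s : ℝ) • a.coeff s v) fun s => by
    have : (fun v => (s : ℝ) • a.coeff s v) = algebraMap ℝ A s • a.coeff s := by
      funext v; exact real_smul_coeff _ _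
    rw [this]
    exact Submodule.smul_mem _ _ (a.coeff_mem s)
  map_add' a b := ext_coeff fun s v => smul_add _ _ _
  map_smul' c a := ext_coeff fun s v => smul_comm (s : ℝ) c (a.coeff s v)

theorem coeff_euler (a : Cochain A n k) (s : ℕ) (v : VectorFields A) :
    (euler a).coeff s v = (s : ℝ) • a.coeff s v := rfl

theorem euler_mul (h : k + l = m) (a : Cochain A n k) (b : Cochain A n l) :
    euler (mul h a b) = mul h (euler a) b + mul h a (euler b) := by
  refine ext_coeff fun s v => ?_
  rw [coeff_euler, coeff_add, coeff_mul, coeff_mul, coeff_mul, Finset.smul_sum,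
    ← Finset.sum_add_distrib]
  refine Finset.sum_congr rfl fun p hp => ?_
  rw [Finset.HasAntidiagonal.mem_antidiagonal] at hp
  rw [coeff_euler, coeff_euler, real_smul_coeff, real_smul_coeff, real_smul_coeff, wedge_smul_left',
    wedge_smul_right', ← add_smul, ← map_add, ← hp]
  simp

/-- Expanding `v` in the frame makes the left side the derivative in the direction of `v` itself,
which multiplies the part of degree `s` by `s`. Thus every homogeneous cochain of positive degree is
a combination of linear generators times cochains of lower degree. -/
theorem sum_linear_mul_vder (F : Frame A) (h : 0 + k = k) (a : Cochain A n k) :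
    ∑ i, mul h (linear n (grad (F.f i))) (vder (F.X i) a) = euler a := by
  refine ext_coeff fun s v => ?_
  rw [coeff_sum, coeff_euler]
  rcases s with _ | s
  · simp [coeff_linear_mul_zero]
  · simp only [coeff_linear_mul_succ, coeff_vder]
    rw [← dirDeriv_self (a.coeff_mem (s + 1)) v]
    have hs : ∀ S : Finset (Fin F.N), ∑ i ∈ S, grad (F.f i) v •
        dirDeriv A (s + 1) (a.coeff (s + 1)) v (F.X i)
        = dirDeriv A (s + 1) (a.coeff (s + 1)) v (∑ i ∈ S, v (F.f i) • F.X i) := by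
      classical
      intro S
      induction S using Finset.induction_on with
      | empty =>
        have := dirDeriv_smul_right (a.coeff_mem (s + 1)) v 0 (0 : A)
        simpa using this.symm
      | insert i S hi ih =>
        rw [Finset.sum_insert hi, Finset.sum_insert hi, dirDeriv_add_right (a.coeff_mem _), ih,
          dirDeriv_smul_right (a.coeff_mem _), grad_apply]
    rw [hs, ← F.sum_eq v]

theorem contr_oneForm (w : OddArgs A n) (φ : OddArgs A n →ₗ[A] A) :
    contr w (oneForm φ) = scalar (algebraMap A _ (φ w)) := by
  refine ext_coeff fun s v => ?_
  rw [coeff_contr, oneForm, scalar, coeff_const, coeff_const]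
  split_ifs
  · ext u
    rw [ins_apply]
    simp [oneCoeff]
  · simp

theorem contr_contr (w w' : OddArgs A n) (a : Cochain A n (k + 2)) :
    contr w (contr w' a) = - contr w' (contr w a) :=
  ext_coeff fun s v => ins_ins_swap w w' (a.coeff s v)

theorem sum_smul_contr (F : Frame A) (w : OddArgs A n) (h : 0 + k = k) (a : Cochain A n (k + 1)) :
    ∑ J, mul h (scalar (algebraMap A _ (F.oddForm n J w))) (contr (F.oddVec n J) a) = contr w a := by
  refine ext_coeff fun s v => ?_
  rw [coeff_sum, coeff_contr]
  simp only [coeff_scalar_mul, coeff_contr]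
  conv_rhs => rw [F.odd_sum_eq n w]
  have hs : ins (∑ J, F.oddForm n J w • F.oddVec n J) (a.coeff s v)
      = ∑ J, ins (F.oddForm n J w • F.oddVec n J) (a.coeff s v) := by
    change (a.coeff s v).curryLeft _ = ∑ J, (a.coeff s v).curryLeft _
    rw [map_sum]
  rw [hs]
  refine Finset.sum_congr rfl fun J _ => ?_
  rw [ins_smul_left]
  ext u
  simp [Algebra.smul_def]

/-- The odd counterpart of `sum_linear_mul_vder`: contracting with `w` reproduces the identity one
degree lower plus the expansion of `w` in the frame. Division by `k + 1` shows that the coframe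
generates the odd part. -/
theorem sum_oneForm_mul_contr (F : Frame A) (h : 1 + k = k + 1) (a : Cochain A n (k + 1)) :
    ∑ J, mul h (oneForm (F.oddForm n J)) (contr (F.oddVec n J) a) = ((k : ℝ) + 1) • a := by
  induction k with
  | zero =>
    refine ext_contr fun w => ?_
    rw [map_sum, map_smul, ← sum_smul_contr F w rfl a]
    simp only [contr_mul_zero_right w (show 0 + 1 + 0 = 0 + 1 from rfl) rfl, contr_oneForm]
    simp
  | succ k ih =>
    refine ext_contr fun w => ?_
    rw [map_sum, map_smul]
    have h1 : ∀ J, contr w (mul h (oneForm (F.oddForm n J)) (contr (F.oddVec n J) a))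
        = mul (by omega) (scalar (algebraMap A _ (F.oddForm n J w))) (contr (F.oddVec n J) a)
          + mul (by omega) (oneForm (F.oddForm n J)) (contr (F.oddVec n J) (contr w a)) := by
      intro J
      rw [contr_mul w (show 0 + 1 + (k + 1) = (k + 1) + 1 by omega) (by omega) (by omega),
        contr_oneForm, contr_contr, mul_neg]
      simp
    simp only [h1]
    rw [Finset.sum_add_distrib, sum_smul_contr F w, ih]
    push_cast
    module

theorem contr_vder (w : OddArgs A n) (X : VectorFields A) (a : Cochain A n (k + 1)) :
    contr w (vder X a) = vder X (contr w a) :=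
  ext_coeff fun s v =>
    (dirDeriv_comp (a.coeff_mem (s + 1)) (ins (B := PolyFun A n) w) v X).symm

theorem contr_cov {X : Derivation ℝ A A} (D : CovDer X (VectorFields A))
    (D' : CovDer X (OddArgs A n)) (E : CovDer X (PolyFun A n)) (w : OddArgs A n)
    (a : Cochain A n (k + 1)) :
    contr w (cov D D' E a) = cov D D' E (contr w a) - contr (D'.op w) a := by
  refine ext_coeff fun s v => ?_
  have h := dirDeriv_comp (a.coeff_mem s) (ins (B := PolyFun A n) w) v (D.op v)
  change ins w ((D'.alt E).op (a.coeff s v) - dirDeriv A s (a.coeff s) v (D.op v))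
    = (D'.alt E).op (ins w (a.coeff s v)) - dirDeriv A s (fun v => ins w (a.coeff s v)) v (D.op v)
      - ins (D'.op w) (a.coeff s v)
  rw [h, map_sub, CovDer.ins_alt]
  abel

theorem vder_const (X : VectorFields A) (b : Coeff A n k) : vder X (const b) = 0 :=
  ext_coeff fun _ v => dirDeriv_zero v X

theorem vder_linear (X : VectorFields A) (α : OneForms A) :
    vder X (linear n α) = scalar (algebraMap A _ (α X)) := by
  refine ext_coeff fun s v => ?_
  rw [coeff_vder, scalar, coeff_const]
  rcases s with _ | s
  · rw [dirDeriv_eq (MultilinearMap.ofSubsingleton A _ _ (0 : Fin 1)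
      ((AlternatingMap.constLinearEquivOfIsEmpty).toLinearMap ∘ₗ
        Algebra.linearMap A (PolyFun A n) ∘ₗ α)) (fun v => by simp [coeff_linear])]
    simp
  · have : (linear n α).coeff (s + 1 + 1) = fun _ => 0 := by
      funext v; rw [coeff_linear, if_neg (by omega)]
    rw [this, dirDeriv_zero, if_neg (by omega)]

end Cochain

open Cochain

/-- Derivations of degree zero of the algebra of cochains. -/
structure EvenDer (A : Type*) [CommRing A] [Algebra ℝ A] (n : ℕ) where
  op : ∀ k, Cochain A n k →ₗ[ℝ] Cochain A n k
  leibniz : ∀ {k l m : ℕ} (h : k + l = m) (a : Cochain A n k) (b : Cochain A n l),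
    op m (Cochain.mul h a b) = Cochain.mul h (op k a) b + Cochain.mul h a (op l b)

/-- Derivations of degree one of the algebra of cochains. -/
structure OddDer (A : Type*) [CommRing A] [Algebra ℝ A] (n : ℕ) where
  op : ∀ k, Cochain A n k →ₗ[ℝ] Cochain A n (k + 1)
  leibniz : ∀ {k l m : ℕ} (h : k + l = m) (a : Cochain A n k) (b : Cochain A n l),
    op m (Cochain.mul h a b) = Cochain.mul (by omega) (op k a) b
      + (-1 : ℝ) ^ k • Cochain.mul (by omega) a (op l b)

variable {n : ℕ} {ι : Type*} [Fintype ι]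

/-- Linear combinations of even derivations with even coefficients. -/
def EvenDer.comb (c : ι → Cochain A n 0) (δ : ι → EvenDer A n) : EvenDer A n where
  op k := ∑ i, mulHom (Nat.zero_add k) (c i) ∘ₗ (δ i).op k
  leibniz {k l m} h a b := by
    simp only [LinearMap.sum_apply, LinearMap.comp_apply]
    rw [sum_mul, mul_sum, ← Finset.sum_add_distrib]
    refine Finset.sum_congr rfl fun i _ => ?_
    change mul _ (c i) _ = mul h (mul _ (c i) _) b + mul h a (mul _ (c i) _)
    rw [(δ i).leibniz, Cochain.mul_add, Cochain.mul_assoc (Nat.zero_add k) h h (Nat.zero_add m),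
      Cochain.mul_left_comm (Nat.zero_add l) h h (Nat.zero_add m) a (c i) ((δ i).op l b)]
    simp

/-- Linear combinations of even derivations with odd coefficients. -/
def OddDer.comb (c : ι → Cochain A n 1) (δ : ι → EvenDer A n) : OddDer A n where
  op k := ∑ i, mulHom (Nat.add_comm 1 k) (c i) ∘ₗ (δ i).op k
  leibniz {k l m} h a b := by
    simp only [LinearMap.sum_apply, LinearMap.comp_apply]
    rw [sum_mul, mul_sum, Finset.smul_sum, ← Finset.sum_add_distrib]
    refine Finset.sum_congr rfl fun i _ => ?_
    change mul _ (c i) _ = mul _ (mul _ (c i) _) b + (-1 : ℝ) ^ k • mul _ a (mul _ (c i) _)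
    rw [(δ i).leibniz, Cochain.mul_add,
      Cochain.mul_assoc (Nat.add_comm 1 k) (show k + 1 + l = m + 1 by omega) h (Nat.add_comm 1 m),
      Cochain.mul_left_comm (Nat.add_comm 1 l) (by omega) h (Nat.add_comm 1 m) a (c i)
        ((δ i).op l b)]
    simp [smul_smul, ← mul_pow]

/-- Linear combinations of contractions with coefficients of degree two. -/
def OddDer.contrComb (ζ : ι → Cochain A n 2) (w : ι → OddArgs A n) : OddDer A n where
  op k := match k with
    | 0 => 0
    | k + 1 => ∑ i, mulHom (show 2 + k = k + 1 + 1 by omega) (ζ i) ∘ₗ contr (w i)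
  leibniz {k l m} h a b := by
    rcases k with _ | k <;> rcases l with _ | l
    · obtain rfl : m = 0 := by omega
      simp [Cochain.mul_zero, Cochain.zero_mul]
    · obtain rfl : m = l + 1 := by omega
      simp only [LinearMap.sum_apply, LinearMap.comp_apply, LinearMap.zero_apply, Cochain.zero_mul,
        zero_add]
      rw [mul_sum, Finset.smul_sum]
      refine Finset.sum_congr rfl fun i _ => ?_
      change mul _ (ζ i) _ = (-1 : ℝ) ^ 0 • mul _ a (mul _ (ζ i) _)
      rw [contr_mul_zero_left (w i) h (Nat.zero_add l),
        Cochain.mul_left_comm (Nat.zero_add l) (by omega) (show 2 + l = l + 1 + 1 by omega) (by omega)]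
    · obtain rfl : m = k + 1 := by omega
      simp only [LinearMap.sum_apply, LinearMap.comp_apply, LinearMap.zero_apply, Cochain.mul_zero,
        add_zero, smul_zero]
      rw [sum_mul]
      refine Finset.sum_congr rfl fun i _ => ?_
      change mul _ (ζ i) _ = mul _ (mul _ (ζ i) _) b
      rw [contr_mul_zero_right (w i) h rfl,
        Cochain.mul_assoc (show 2 + k = k + 1 + 1 by omega) (by omega) (Nat.add_zero k) (by omega)]
    · obtain ⟨m, rfl⟩ : ∃ m', m = m' + 1 := ⟨k + l + 1, by omega⟩
      simp only [LinearMap.sum_apply, LinearMap.comp_apply]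
      rw [sum_mul, mul_sum, Finset.smul_sum, ← Finset.sum_add_distrib]
      refine Finset.sum_congr rfl fun i _ => ?_
      change mul _ (ζ i) _ = mul _ (mul _ (ζ i) _) b + (-1 : ℝ) ^ (k + 1) • mul _ a (mul _ (ζ i) _)
      rw [contr_mul (w i) h (by omega) (by omega), Cochain.mul_add, Cochain.mul_smul,
        Cochain.mul_assoc (show 2 + k = k + 1 + 1 by omega) (show k + 1 + 1 + (l + 1) = m + 1 + 1 by omega)
          (show k + (l + 1) = m by omega) (by omega),
        Cochain.mul_left_comm (show 2 + l = l + 1 + 1 by omega)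
          (show k + 1 + (l + 1 + 1) = m + 1 + 1 by omega) (show k + 1 + l = m by omega) (by omega)
          a (ζ i) (contr (w i) b)]
      have hsq : ((-1 : ℝ) ^ (k + 1)) ^ 2 = 1 := by rw [← pow_mul, pow_mul']; simp
      simp [pow_mul, hsq]

/-- The sum of odd derivations. -/
def OddDer.add (P Q : OddDer A n) : OddDer A n where
  op k := P.op k + Q.op k
  leibniz h a b := by
    simp only [LinearMap.add_apply, P.leibniz h, Q.leibniz h, Cochain.mul_add, Cochain.add_mul,
      smul_add]
    abel

end FormalPoisson

end

/-! ### Connections acting on cochains, forms as cochains, and generation of forms by a coframe. -/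

noncomputable section

namespace FormalPoisson

set_option linter.unusedSectionVars false

variable {A : Type*} [CommRing A] [Algebra ℝ A] {n m k l : ℕ}

/-- The action of a derivation of `A` on the coefficients of polynomials. -/
def coeffDer (n : ℕ) (X : Derivation ℝ A A) : CovDer X (PolyFun A n) where
  op := AddMonoidHom.mk' (fun p => ∑ s ∈ p.support, MvPolynomial.monomial s (X (p.coeff s))) (by
    classical
    intro p q
    ext s
    simp only [MvPolynomial.coeff_sum, MvPolynomial.coeff_add, MvPolynomial.coeff_monomial,
      Finset.sum_ite_eq', MvPolynomial.mem_support_iff]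
    split_ifs <;> simp_all [← map_add])
  op_smul g p := by
    classical
    ext s
    simp only [AddMonoidHom.mk'_apply, MvPolynomial.coeff_sum, MvPolynomial.coeff_add,
      MvPolynomial.coeff_monomial, Finset.sum_ite_eq', MvPolynomial.mem_support_iff,
      MvPolynomial.coeff_smul, smul_eq_mul]
    split_ifs <;> simp_all [mul_comm]
    have := congrArg X ‹g * _ = 0›
    simpa [mul_comm] using this.symm

theorem coeff_coeffDer (X : Derivation ℝ A A) (p : PolyFun A n) (s : Fin n →₀ ℕ) :
    ((coeffDer n X).op p).coeff s = X (p.coeff s) := by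
  classical
  change (∑ s ∈ p.support, MvPolynomial.monomial s (X (p.coeff s))).coeff s = _
  simp only [MvPolynomial.coeff_sum, MvPolynomial.coeff_monomial,
      Finset.sum_ite_eq', MvPolynomial.mem_support_iff]
  split_ifs <;> simp_all

theorem coeffDer_mul (X : Derivation ℝ A A) (p q : PolyFun A n) :
    (coeffDer n X).op (p * q) = (coeffDer n X).op p * q + p * (coeffDer n X).op q := by
  classical
  ext s
  simp only [coeff_coeffDer, MvPolynomial.coeff_mul, MvPolynomial.coeff_add, map_sum,
    Derivation.leibniz, ← Finset.sum_add_distrib, smul_eq_mul]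
  exact Finset.sum_congr rfl fun x _ => by ring

theorem coeffDer_algebraMap (X : Derivation ℝ A A) (g : A) :
    (coeffDer n X).op (algebraMap A _ g) = algebraMap A _ (X g) := by
  classical
  ext s
  simp only [coeff_coeffDer, MvPolynomial.algebraMap_eq, MvPolynomial.coeff_C]
  split_ifs <;> simp

theorem coeffDer_var (X : Derivation ℝ A A) (i : Fin n) :
    (coeffDer n X).op (MvPolynomial.X i) = 0 := by
  classical
  ext s
  simp only [coeff_coeffDer, MvPolynomial.coeff_X, MvPolynomial.coeff_zero]
  split_ifs <;> simp

/-- Partial derivatives of polynomials. -/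
def partialDer (i : Fin n) : CovDer (0 : Derivation ℝ A A) (PolyFun A n) where
  op := (MvPolynomial.pderiv (R := A) i).toLinearMap.toAddMonoidHom
  op_smul g p := by simp

/-- The trivial operator. -/
def CovDer.zero (V : Type*) [AddCommGroup V] [Module A V] : CovDer (0 : Derivation ℝ A A) V where
  op := 0
  op_smul g v := by simp

namespace IsTorsionFreeConnection

variable {nabla : VectorFields A →ₗ[A] VectorFields A →ₗ[ℝ] VectorFields A}
  (c : IsTorsionFreeConnection nabla) (X : VectorFields A)

/-- The covariant derivative of vector fields. -/
def onFields : CovDer X (VectorFields A) where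
  op := (nabla X).toAddMonoidHom
  op_smul g Y := c.leibniz X g Y

/-- The covariant derivative of one-forms. -/
def onForms : CovDer X (OneForms A) where
  op := AddMonoidHom.mk' (fun β =>
    { toFun := fun Y => X (β Y) - β (nabla X Y)
      map_add' := fun Y Z => by simp; ring
      map_smul' := fun g Y => by simp [c.leibniz]; ring }) (by intro β γ; ext Y; simp; ring)
  op_smul g β := by ext Y; simp; ring

theorem onForms_apply (β : OneForms A) (Y : VectorFields A) :
    (c.onForms X).op β Y = X (β Y) - β (nabla X Y) := rfl

/-- The covariant derivative of the odd arguments. -/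
def onOdd (n : ℕ) : CovDer X (OddArgs A n) where
  op := AddMonoidHom.mk' (fun w => (nabla X w.1, (c.onForms X).op w.2.1, fun j => X (w.2.2 j))) (by
    intro w w'
    simp [Prod.ext_iff, funext_iff])
  op_smul g w := by
    refine Prod.ext (c.leibniz X g w.1) (Prod.ext ((c.onForms X).op_smul g w.2.1) ?_)
    funext j
    change X (g * w.2.2 j) = g * X (w.2.2 j) + X g * w.2.2 j
    simp; ring

theorem onOdd_apply (w : OddArgs A n) :
    (c.onOdd X n).op w = (nabla X w.1, (c.onForms X).op w.2.1, fun j => X (w.2.2 j)) := rfl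

/-- The covariant derivative of cochains given by a connection. -/
def onCochains (n : ℕ) : EvenDer A n where
  op _ := Cochain.cov (c.onFields X) (c.onOdd X n) (coeffDer n X)
  leibniz h a b := Cochain.cov_mul _ _ _ (coeffDer_mul X) h a b

end IsTorsionFreeConnection

open Cochain

/-- The derivative of cochains along a coordinate of the simplex. -/
def simplexDer (A : Type*) [CommRing A] [Algebra ℝ A] {n : ℕ} (i : Fin n) : EvenDer A n where
  op _ := cov (CovDer.zero _) (CovDer.zero _) (partialDer i)
  leibniz h a b := cov_mul _ _ _ (fun b c => by simp [partialDer, Derivation.leibniz]; ring) h a b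

/-- The derivative of cochains in the even variable. -/
def vertical (n : ℕ) (X : VectorFields A) : EvenDer A n where
  op _ := vder X
  leibniz h a b := vder_mul X h a b

namespace Cochain

theorem cov_const {X : Derivation ℝ A A} (D : CovDer X (VectorFields A))
    (D' : CovDer X (OddArgs A n)) (E : CovDer X (PolyFun A n)) (b : Coeff A n k) :
    cov D D' E (const b) = const ((D'.alt E).op b) := by
  refine ext_coeff fun s v => ?_
  rw [coeff_cov, coeff_const, coeff_const]
  rcases s with _ | s
  · rw [dirDeriv_of_zero _ _ _ ((const b).coeff_mem 0)]; simp
  · have : (const b).coeff (s + 1) = fun _ => 0 := rfl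
    rw [this, dirDeriv_zero]; simp

theorem cov_congr {X : Derivation ℝ A A} (D : CovDer X (VectorFields A))
    (D' : CovDer X (OddArgs A n)) (E : CovDer X (PolyFun A n)) {a b : Cochain A n k} {s : ℕ}
    (h : a.coeff s = b.coeff s) : (cov D D' E a).coeff s = (cov D D' E b).coeff s := by
  funext v
  rw [coeff_cov, coeff_cov, h]

theorem OrderGe.of_congr {r : ℕ} {T : Cochain A n k →ₗ[ℝ] Cochain A n l}
    (hT : ∀ {a b : Cochain A n k} {s : ℕ}, a.coeff s = b.coeff s → (T a).coeff s = (T b).coeff s)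
    {a : Cochain A n k} (ha : a.OrderGe r) : (T a).OrderGe r := fun i hi => by
  rw [hT (b := 0) (ha i hi), map_zero]; rfl

theorem OrderGe.cov {X : Derivation ℝ A A} (D : CovDer X (VectorFields A))
    (D' : CovDer X (OddArgs A n)) (E : CovDer X (PolyFun A n)) {r : ℕ} {a : Cochain A n k}
    (ha : a.OrderGe r) : (cov D D' E a).OrderGe r :=
  OrderGe.of_congr (cov_congr D D' E) ha

theorem OrderGe.vder (X : VectorFields A) {r : ℕ} {a : Cochain A n k} (ha : a.OrderGe (r + 1)) :
    (vder X a).OrderGe r := orderGe_iff.2 fun i hi v => by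
  rw [coeff_vder, show a.coeff (i + 1) = fun _ => 0 from ha _ (by omega), dirDeriv_zero]

theorem OrderGe.contr (w : OddArgs A n) {r : ℕ} {a : Cochain A n (k + 1)} (ha : a.OrderGe r) :
    (contr w a).OrderGe r := orderGe_iff.2 fun i hi v => by
  rw [coeff_contr, ha.coeff_eq hi, map_zero]

theorem orderGe_linear (α : OneForms A) : (linear n α).OrderGe 1 := orderGe_iff.2 fun i hi v => by
  rw [coeff_linear, if_neg (by omega)]

/-- Alternating forms on a quotient of the odd arguments, as cochains. -/
def ofAlt {L : Type*} [AddCommGroup L] [Module A L] (p : OddArgs A n →ₗ[A] L) :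
    (L [⋀^Fin k]→ₗ[A] A) →ₗ[ℝ] Cochain A n k where
  toFun ω := const ((Algebra.linearMap A (PolyFun A n)).compAlternatingMap (ω.compLinearMap p))
  map_add' ω η := ext_coeff fun s v => by
    rw [coeff_add, coeff_const, coeff_const, coeff_const]
    split_ifs
    · ext u; simp
    · simp
  map_smul' c ω := ext_coeff fun s v => by
    rw [coeff_smul, coeff_const, coeff_const]
    split_ifs
    · ext1 u
      simp [Algebra.smul_def]
    · simp

section
variable {L : Type*} [AddCommGroup L] [Module A L] (p : OddArgs A n →ₗ[A] L)

theorem coeff_ofAlt_zero (ω : L [⋀^Fin k]→ₗ[A] A) (v : VectorFields A) (u : Fin k → OddArgs A n) :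
    (ofAlt p ω).coeff 0 v u = algebraMap A _ (ω fun i => p (u i)) := rfl

theorem coeff_ofAlt_succ (ω : L [⋀^Fin k]→ₗ[A] A) (s : ℕ) (v : VectorFields A) :
    (ofAlt p ω).coeff (s + 1) v = 0 := rfl

theorem contr_ofAlt (w : OddArgs A n) (ω : L [⋀^Fin (k + 1)]→ₗ[A] A) :
    contr w (ofAlt p ω) = ofAlt p (ins (p w) ω) := by
  refine ext_coeff fun s v => ?_
  rw [coeff_contr]
  rcases s with _ | s
  · ext1 u
    rw [ins_apply, coeff_ofAlt_zero, coeff_ofAlt_zero, ins_apply]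
    congr 2
    funext i
    refine Fin.cases ?_ (fun i => ?_) i <;> simp
  · rw [coeff_ofAlt_succ, coeff_ofAlt_succ, map_zero]

theorem ofAlt_wedge (h : k + l = m) (ω : L [⋀^Fin k]→ₗ[A] A) (η : L [⋀^Fin l]→ₗ[A] A) :
    ofAlt p (wedge h ω η) = mul h (ofAlt p ω) (ofAlt p η) := by
  refine ext_coeff fun s v => ?_
  change _ = (mul h (const _) _).coeff s v
  rw [coeff_const_mul]
  rcases s with _ | s
  · change (Algebra.linearMap A (PolyFun A n)).compAlternatingMap
      ((wedge h ω η).compLinearMap p) = wedge h _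
      ((Algebra.linearMap A (PolyFun A n)).compAlternatingMap (η.compLinearMap p))
    rw [← wedge_compLinearMap]
    exact (wedge_compAlternatingMap h (ω.compLinearMap p) (η.compLinearMap p)
      (Algebra.ofId A (PolyFun A n))).symm
  · rw [coeff_ofAlt_succ, coeff_ofAlt_succ, wedge_zero]
end

theorem scalar_add (p q : PolyFun A n) : scalar (p + q) = scalar p + scalar q :=
  ext_coeff fun s v => by
    rw [coeff_add]; simp only [scalar, coeff_const]; split_ifs
    · rfl
    · simp

theorem scalar_sum {ι : Type*} (S : Finset ι) (p : ι → PolyFun A n) :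
    scalar (∑ i ∈ S, p i) = ∑ i ∈ S, scalar (p i) := by
  classical
  induction S using Finset.induction_on with
  | empty =>
    simp only [Finset.sum_empty]
    exact ext_coeff fun s v => by simp only [scalar, coeff_const]; split_ifs <;> rfl
  | insert i S hi ih => rw [Finset.sum_insert hi, Finset.sum_insert hi, scalar_add, ih]

theorem scalar_mul (h : 0 + 0 = 0) (p q : PolyFun A n) :
    scalar (p * q) = mul h (scalar p) (scalar q) := ext_coeff fun s v => by
  rw [coeff_scalar_mul]; simp only [scalar, coeff_const]; split_ifs
  · rfl
  · simp

theorem scalar_one_mul (h : 0 + k = k) (a : Cochain A n k) : mul h (scalar 1) a = a :=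
  ext_coeff fun s v => by rw [coeff_scalar_mul, one_smul]

theorem coeff_scalar_zero (p : PolyFun A n) (v : VectorFields A) (u : Fin 0 → OddArgs A n) :
    (scalar p).coeff 0 v u = p := rfl

theorem cov_scalar {X : Derivation ℝ A A} (D : CovDer X (VectorFields A))
    (D' : CovDer X (OddArgs A n)) (E : CovDer X (PolyFun A n)) (p : PolyFun A n) :
    cov D D' E (scalar p) = scalar (E.op p) := by
  rw [scalar, cov_const]
  congr 1
  ext u
  rw [CovDer.alt_zero_apply]; rfl

theorem cov_oneForm {X : Derivation ℝ A A} (D : CovDer X (VectorFields A))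
    (D' : CovDer X (OddArgs A n)) (E : CovDer X (PolyFun A n)) (φ ψ : OddArgs A n →ₗ[A] A)
    (h : ∀ w, E.op (algebraMap A _ (φ w)) - algebraMap A _ (φ (D'.op w)) = algebraMap A _ (ψ w)) :
    cov D D' E (oneForm φ) = oneForm ψ := by
  rw [oneForm, cov_const]
  congr 1
  ext1 u
  rw [CovDer.alt_apply, Fin.sum_univ_one]
  exact h (u 0)

end Cochain

section Generation

variable {L : Type*} [AddCommGroup L] [Module A L] {ι : Type*} [Fintype ι] {e : ι → L}
  {ε : ι → L →ₗ[A] A}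

/-- The Euler identity for forms on a module with a finite dual basis; it lets derivations on such
forms be tested on functions and on the coframe only. -/
theorem sum_wedge_ins (he : ∀ x, x = ∑ i, ε i x • e i) (h : 1 + k = k + 1)
    (ω : L [⋀^Fin (k + 1)]→ₗ[A] A) :
    ∑ i, wedge h (AlternatingMap.ofSubsingleton A L A (0 : Fin 1) (ε i)) (ins (e i) ω)
      = ((k : ℝ) + 1) • ω := by
  have hins : ∀ {l : ℕ} (x : L) (η : L [⋀^Fin (l + 1)]→ₗ[A] A),
      ∑ i, ε i x • ins (e i) η = ins x η := by
    intro l x η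
    conv_rhs => rw [he x]
    change _ = η.curryLeft _
    rw [map_sum]
    refine Finset.sum_congr rfl fun i _ => ?_
    rw [map_smul]; rfl
  induction k with
  | zero =>
    refine ins_ext fun x => ?_
    rw [map_sum]
    simp only [ins_wedge_zero_right (show 0 + 1 + 0 = 0 + 1 from rfl) rfl, wedge_zero_left]
    refine (hins x ω).trans ?_
    simp
  | succ k ih =>
    refine ins_ext fun x => ?_
    rw [map_sum]
    simp only [ins_wedge (show 0 + 1 + (k + 1) = (k + 1) + 1 by omega) (show 0 + (k + 1) = k + 1 by omega)
      (show 0 + 1 + k = k + 1 by omega), ins_ins_swap x, wedge_zero_left]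
    rw [Finset.sum_add_distrib]
    have h1 : ∀ i, (-1 : ℤ) ^ (0 + 1) • wedge (show 0 + 1 + k = k + 1 by omega)
        (AlternatingMap.ofSubsingleton A L A (0 : Fin 1) (ε i)) (-ins (e i) (ins x ω))
        = wedge (show 1 + k = k + 1 by omega)
        (AlternatingMap.ofSubsingleton A L A (0 : Fin 1) (ε i)) (ins (e i) (ins x ω)) := by
      intro i
      rw [← neg_one_zsmul (ins (e i) (ins x ω)), wedge_zsmul_right]
      simp
    simp only [h1, ih]
    have h2 := hins x ω
    have h3 : ∀ i, ins x (AlternatingMap.ofSubsingleton A L A (0 : Fin 1) (ε i)) ![] = ε i x :=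
      fun i => rfl
    simp only [h3, h2]
    ext u
    simp only [AlternatingMap.add_apply, AlternatingMap.smul_apply, ins_apply]
    push_cast
    module

/-- A derivation on alternating forms along a graded map vanishes if it does so on functions and on a
coframe. -/
theorem eq_zero_of_alt_derivation {d : ℕ} (he : ∀ x, x = ∑ i, ε i x • e i)
    (E : ∀ k, (L [⋀^Fin k]→ₗ[A] A) →ₗ[ℝ] Cochain A n (k + d))
    (φ : ∀ k, (L [⋀^Fin k]→ₗ[A] A) → Cochain A n k) (sgn : ℕ → ℝ)
    (hE : ∀ (k l m : ℕ) (h : k + l = m) ω η, E m (wedge h ω η)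
      = Cochain.mul (show k + d + l = m + d by omega) (E k ω) (φ l η)
        + sgn k • Cochain.mul (show k + (l + d) = m + d by omega) (φ k ω) (E l η))
    (h0 : ∀ g : A, E 0 (AlternatingMap.constOfIsEmpty A _ (Fin 0) g) = 0)
    (h1 : ∀ i, E 1 (AlternatingMap.ofSubsingleton A L A (0 : Fin 1) (ε i)) = 0)
    (k : ℕ) (ω : L [⋀^Fin k]→ₗ[A] A) : E k ω = 0 := by
  induction k with
  | zero =>
    have : ω = AlternatingMap.constOfIsEmpty A _ (Fin 0) (ω ![]) := by
      ext v; rw [Subsingleton.elim v ![]]; rfl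
    rw [this, h0]
  | succ k ih =>
    -- The Euler identity writes a multiple of `ω` as a sum of products of a coframe element and a
    -- form of degree `k`, both of which `E` kills.
    have h2 : ((k : ℝ) + 1) • E (k + 1) ω = 0 := by
      rw [← map_smul, ← sum_wedge_ins he (Nat.add_comm 1 k), map_sum]
      refine Finset.sum_eq_zero fun i _ => ?_
      rw [hE, h1, ih, Cochain.zero_mul, Cochain.mul_zero, smul_zero, add_zero]
    exact (smul_eq_zero.1 h2).resolve_left (by positivity)

end Generation

end FormalPoisson

end

/-! ### Lie algebroid differentials and the Koszul bracket of a Poisson structure. -/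

noncomputable section

namespace FormalPoisson

set_option linter.unusedSectionVars false

namespace AnchoredBracket

variable {A L : Type*} [CommRing A] [Algebra ℝ A] [AddCommGroup L] [Module A L]
    [Module ℝ L] [IsScalarTower ℝ A L] (S : AnchoredBracket A L) {k l m : ℕ}

/-- A derivation of the ring as an operator on the ring. -/
def _root_.FormalPoisson.CovDer.self (X : Derivation ℝ A A) : CovDer X A where
  op := (X : A →ₗ[ℝ] A).toAddMonoidHom
  op_smul g v := by simp; ring

/-- The bracket with an element. -/
def ad (x : L) : CovDer (S.anchor x) L where
  op := (S.bracket x).toAddMonoidHom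
  op_smul g v := S.bracket_smul x g v

/-- The Lie derivative of alternating forms. -/
def lie (x : L) (ω : L [⋀^Fin k]→ₗ[A] A) : L [⋀^Fin k]→ₗ[A] A :=
  ((S.ad x).alt (CovDer.self (S.anchor x))).op ω

theorem lie_apply (x : L) (ω : L [⋀^Fin k]→ₗ[A] A) (v : Fin k → L) :
    S.lie x ω v = S.anchor x (ω v) - ∑ j, ω (Function.update v j (S.bracket x (v j))) := rfl

theorem lie_wedge (x : L) (h : k + l = m) (a : L [⋀^Fin k]→ₗ[A] A) (b : L [⋀^Fin l]→ₗ[A] A) :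
    S.lie x (wedge h a b) = wedge h (S.lie x a) b + wedge h a (S.lie x b) :=
  CovDer.alt_wedge _ _ (fun b c => by
    change S.anchor x (b * c) = S.anchor x b * c + b * S.anchor x c
    simp; ring) h a b

theorem d_add (a b : L [⋀^Fin k]→ₗ[A] A) : S.d (a + b) = S.d a + S.d b :=
  map_add (S.differential k) a b

theorem d_zsmul (c : ℤ) (a : L [⋀^Fin k]→ₗ[A] A) : S.d (c • a) = c • S.d a :=
  map_zsmul (S.differential k) c a

theorem ins_d_zero (x : L) (ω : L [⋀^Fin 0]→ₗ[A] A) : ins x (S.d ω) = S.lie x ω := by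
  ext v
  rw [ins_apply, d_apply, lie_apply]
  simp

/-- Cartan's formula. A bracket of `x` with another argument occurs twice in `d`, once with `x` as
the distinguished argument and once with `x` among the others; the two halves give the full term of
the Lie derivative. -/
theorem ins_d (x : L) (ω : L [⋀^Fin (k + 1)]→ₗ[A] A) :
    ins x (S.d ω) = S.lie x ω - S.d (ins x ω) := by
  ext v
  have hrem : ∀ (i : Fin (k + 1)), (i.succ).removeNth (Fin.cons x v : Fin (k + 2) → L)
      = Fin.cons x (i.removeNth v) := by
    intro i
    funext j
    refine Fin.cases ?_ (fun j => ?_) j <;> simp [Fin.removeNth]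
  have hmove : ∀ (j : Fin (k + 1)) (y : L), ω (Function.update v j y)
      = (-1 : ℤ) ^ (j : ℕ) • ω (Fin.cons y (j.removeNth v)) := by
    intro j y
    have := ω.map_insertNth j y (j.removeNth v)
    rw [← Fin.insertNth_removeNth]
    exact this
  have hneg : ∀ (y : L) (u : Fin k → L), ω (Fin.cons (-y) u) = - ω (Fin.cons y u) := fun y u => by
    have := ω.map_update_neg (Fin.cons y u) 0 y
    simpa using this
  rw [ins_apply, d_apply, AlternatingMap.sub_apply, lie_apply, d_apply, Fin.sum_univ_succ]
  simp only [Fin.cons_zero, Fin.cons_succ, hrem, Fin.removeNth_zero, Fin.tail_cons, ins_apply,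
    Fin.val_zero, pow_zero, one_smul]
  have h1 : ∀ i : Fin (k + 1), ∑ j, ω (Function.update (Fin.cons x (i.removeNth v) :
        Fin (k + 1) → L) j (S.bracket (v i) ((Fin.cons x (i.removeNth v) : Fin (k + 1) → L) j)))
      = - ω (Fin.cons (S.bracket x (v i)) (i.removeNth v))
        + ∑ j, ω (Fin.cons x (Function.update (i.removeNth v) j
          (S.bracket (v i) (i.removeNth v j)))) := by
    intro i
    rw [Fin.sum_univ_succ]
    simp only [Fin.cons_zero, Fin.cons_succ, Fin.update_cons_zero, ← Fin.cons_update]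
    rw [S.bracket_swap (v i) x, hneg]
  simp only [h1, hmove, Fin.val_succ]
  -- Separates half of the missing bracket term from the summand that belongs to `d (ins x ω)`.
  have key : ∀ (i : ℕ) (b c e : A), (-1 : ℤ) ^ (i + 1) • (c - (1 / 2 : ℝ) • (-b + e))
      = -((-1 : ℤ) ^ i • (c - (1 / 2 : ℝ) • e)) - (1 / 2 : ℝ) • (-1 : ℤ) ^ i • b := by
    intro i b c e
    rw [pow_succ]
    rcases neg_one_pow_eq_or ℤ i with h | h <;> rw [h] <;> module
  simp only [key, Finset.sum_sub_distrib, Finset.sum_neg_distrib, ← Finset.smul_sum]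
  module

/-- Contraction and Lie derivative are derivations, so Cartan's formula gives the rule by induction
on the degree. The Jacobi identity plays no role. -/
theorem d_wedge (h : k + l = m) (a : L [⋀^Fin k]→ₗ[A] A) (b : L [⋀^Fin l]→ₗ[A] A) :
    S.d (wedge h a b) = wedge (show k + 1 + l = m + 1 by omega) (S.d a) b
      + (-1 : ℤ) ^ k • wedge (show k + (l + 1) = m + 1 by omega) a (S.d b) := by
  have comm0 : ∀ {l : ℕ} (h : 0 + l = l) (h' : l + 0 = l) (a : L [⋀^Fin 0]→ₗ[A] A)
      (b : L [⋀^Fin l]→ₗ[A] A), wedge h' b a = wedge h a b := fun h h' a b => by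
    rw [wedge_zero_left, wedge_zero_right]
  -- Multiplication by a function is settled separately, since `ins_wedge` requires both factors to
  -- have positive degree; the case of a function on the right reduces to it by commutativity.
  have left : ∀ {l : ℕ} (h : 0 + l = l) (a : L [⋀^Fin 0]→ₗ[A] A) (b : L [⋀^Fin l]→ₗ[A] A),
      S.d (wedge h a b) = wedge (show 0 + 1 + l = l + 1 by omega) (S.d a) b
        + wedge (show 0 + (l + 1) = l + 1 by omega) a (S.d b) := by
    intro l
    induction l with
    | zero =>
      intro h a b
      refine ins_ext fun x => ?_
      rw [ins_d_zero, lie_wedge, map_add, ins_wedge_zero_right _ (show 0 + 0 = 0 from rfl),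
        ins_wedge_zero_left _ (show 0 + 0 = 0 from rfl), ins_d_zero, ins_d_zero]
    | succ l ih =>
      intro h a b
      refine ins_ext fun x => ?_
      rw [ins_d, lie_wedge, map_add, ins_wedge_zero_left h (Nat.zero_add l), ih,
        ins_wedge (show 0 + 1 + (l + 1) = l + 1 + 1 by omega) (show 0 + (l + 1) = l + 1 by omega)
          (show 0 + 1 + l = l + 1 by omega), ins_wedge_zero_left _ (Nat.zero_add (l + 1)), ins_d_zero,
        ins_d]
      simp only [sub_eq_add_neg, wedge_add_right, ← neg_one_zsmul (S.d _), wedge_zsmul_right]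
      module
  induction m generalizing k l with
  | zero =>
    obtain rfl : k = 0 := by omega
    obtain rfl : l = 0 := by omega
    rw [left]; simp
  | succ m ih =>
    rcases k with _ | k
    · obtain rfl : l = m + 1 := by omega
      rw [left]; simp
    rcases l with _ | l
    · obtain rfl : k = m := by omega
      rw [comm0 (Nat.zero_add _), left, comm0 (Nat.zero_add _),
        wedge_comm (show 0 + 1 + (k + 1) = k + 1 + 1 by omega) (show k + 1 + (0 + 1) = k + 1 + 1 by omega)]
      simp only [zero_add, one_mul]
      abel
    have h₁ : k + (l + 1) = m := by omega
    have h₂ : k + 1 + l = m := by omega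
    refine ins_ext fun x => ?_
    rw [ins_d, lie_wedge, map_add, map_zsmul, ins_wedge h h₁ h₂, d_add, d_zsmul, ih h₁ _ _ left, ih h₂ _ _ left,
      ins_wedge (show k + 1 + 1 + (l + 1) = m + 1 + 1 by omega) (show k + 1 + (l + 1) = m + 1 by omega)
        (show k + 1 + 1 + l = m + 1 by omega), ins_d,
      ins_wedge (show k + 1 + (l + 1 + 1) = m + 1 + 1 by omega) (show k + (l + 1 + 1) = m + 1 by omega)
        (show k + 1 + (l + 1) = m + 1 by omega), ins_d]
    simp only [sub_eq_add_neg, wedge_add_left, wedge_add_right, ← neg_one_zsmul (S.d _),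
      wedge_zsmul_left, wedge_zsmul_right, pow_succ, smul_add, smul_smul]
    rcases neg_one_pow_eq_or ℤ k with hk | hk <;> rw [hk] <;> norm_num <;> abel

theorem d_one_apply (ω : L [⋀^Fin 1]→ₗ[A] A) (x y : L) :
    S.d ω ![x, y] = S.anchor x (ω ![y]) - S.anchor y (ω ![x]) - ω ![S.bracket x y] := by
  have h1 : ins x (S.d ω) ![y] = _ := congrFun (congrArg DFunLike.coe (S.ins_d x ω)) ![y]
  rw [AlternatingMap.sub_apply, lie_apply] at h1
  have h2 : S.d (ins x ω) ![y] = S.anchor y (ω ![x]) := by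
    have h3 : ins y (S.d (ins x ω)) ![] = _ :=
      congrFun (congrArg DFunLike.coe (S.ins_d_zero y (ins x ω))) ![]
    rw [lie_apply] at h3
    simp only [Finset.univ_eq_empty, Finset.sum_empty, sub_zero] at h3
    exact h3
  rw [h2] at h1
  refine h1.trans ?_
  change S.anchor x (ω ![y]) - (∑ j : Fin 1, ω (Function.update ![y] j (S.bracket x (![y] j))))
    - S.anchor y (ω ![x]) = _
  rw [Fin.sum_univ_one]
  simp only [Matrix.cons_val_zero]
  rw [show (Function.update ![y] 0 (S.bracket x y) : Fin 1 → L) = ![S.bracket x y] by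
    funext i; fin_cases i; rfl]
  ring

theorem d_two_apply (ω : L [⋀^Fin 2]→ₗ[A] A) (x y z : L) :
    S.d ω ![x, y, z] = S.anchor x (ω ![y, z]) - S.anchor y (ω ![x, z]) + S.anchor z (ω ![x, y])
      - ω ![S.bracket x y, z] - ω ![y, S.bracket x z] + ω ![x, S.bracket y z] := by
  have h1 : ins x (S.d ω) ![y, z] = _ := congrFun (congrArg DFunLike.coe (S.ins_d x ω)) ![y, z]
  rw [AlternatingMap.sub_apply, lie_apply, d_one_apply] at h1
  refine h1.trans ?_
  change S.anchor x (ω ![y, z]) - (∑ j : Fin 2, ω (Function.update ![y, z] j (S.bracket x (![y, z] j))))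
    - _ = _
  rw [Fin.sum_univ_two]
  simp only [Matrix.cons_val_zero, Matrix.cons_val_one]
  rw [show (Function.update ![y, z] 0 (S.bracket x y) : Fin 2 → L) = ![S.bracket x y, z] by
    funext i; fin_cases i <;> rfl, show (Function.update ![y, z] 1 (S.bracket x z) : Fin 2 → L)
      = ![y, S.bracket x z] by funext i; fin_cases i <;> rfl]
  have h4 : ∀ u, ins x ω ![u] = ω ![x, u] := fun u => rfl
  rw [h4, h4, h4]
  ring

/-- The square of the differential vanishes on functions. -/
theorem d_d_zero {ι : Type*} [Fintype ι] {e : ι → L} {ε : ι → L →ₗ[A] A}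
    (he : ∀ x, x = ∑ i, ε i x • e i)
    (hA : ∀ i j, S.anchor (S.bracket (e i) (e j)) = ⁅S.anchor (e i), S.anchor (e j)⁆)
    (ω : L [⋀^Fin 0]→ₗ[A] A) : S.d (S.d ω) = 0 := by
  have h1 : ∀ x, S.d ω ![x] = S.anchor x (ω ![]) := by
    intro x
    have h3 : ins x (S.d ω) ![] = _ := congrFun (congrArg DFunLike.coe (S.ins_d_zero x ω)) ![]
    rw [lie_apply] at h3
    simp only [Finset.univ_eq_empty, Finset.sum_empty, sub_zero] at h3
    exact h3
  have ext_span : ∀ {r : ℕ} (η : L [⋀^Fin (r + 1)]→ₗ[A] A), (∀ i, ins (e i) η = 0) → η = 0 := by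
    intro r η h
    refine ins_ext fun x => ?_
    rw [he x, map_zero]
    change η.curryLeft _ = 0
    rw [map_sum]
    exact Finset.sum_eq_zero fun i _ => by rw [map_smul]; exact (congrArg _ (h i)).trans (smul_zero _)
  refine ext_span _ fun i => ext_span _ fun j => ?_
  ext v
  rw [Subsingleton.elim v ![]]
  change S.d (S.d ω) ![e i, e j] = 0
  rw [d_one_apply, h1, h1, h1, hA, Derivation.commutator_apply]
  ring

/-- The square of `d` is alternating and `A`-multilinear, so it is tested on generators; there it
expands into the Jacobi identity and the anchor condition. Only squares in degrees zero and one are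
needed later, because these degrees contain the generators. -/
theorem d_d_one {ι : Type*} [Fintype ι] {e : ι → L} {ε : ι → L →ₗ[A] A}
    (he : ∀ x, x = ∑ i, ε i x • e i)
    (hA : ∀ i j, S.anchor (S.bracket (e i) (e j)) = ⁅S.anchor (e i), S.anchor (e j)⁆)
    (hJ : ∀ i j r, S.bracket (e i) (S.bracket (e j) (e r)) = S.bracket (S.bracket (e i) (e j)) (e r)
      + S.bracket (e j) (S.bracket (e i) (e r)))
    (ω : L [⋀^Fin 1]→ₗ[A] A) : S.d (S.d ω) = 0 := by
  have ext_span : ∀ {r : ℕ} (η : L [⋀^Fin (r + 1)]→ₗ[A] A), (∀ i, ins (e i) η = 0) → η = 0 := by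
    intro r η h
    refine ins_ext fun x => ?_
    rw [he x, map_zero]
    change η.curryLeft _ = 0
    rw [map_sum]
    exact Finset.sum_eq_zero fun i _ => by rw [map_smul]; exact (congrArg _ (h i)).trans (smul_zero _)
  refine ext_span _ fun i => ext_span _ fun j => ext_span _ fun r => ?_
  ext v
  rw [Subsingleton.elim v ![]]
  change S.d (S.d ω) ![e i, e j, e r] = 0
  have hadd : ∀ x y, ω ![x + y] = ω ![x] + ω ![y] := fun x y => by
    have hu : ∀ z : L, (Function.update ![x] 0 z : Fin 1 → L) = ![z] := fun z => by
      funext i; fin_cases i; rfl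
    have := ω.map_update_add ![x] 0 x y
    rwa [hu, hu, hu] at this
  rw [d_two_apply]
  simp only [d_one_apply, hA, Derivation.commutator_apply, map_sub]
  rw [hJ i j r, hadd]
  ring

end AnchoredBracket

variable {A : Type*} [CommRing A] [Algebra ℝ A]

namespace PoissonStructure

variable (P : PoissonStructure A)

/-- The Koszul bracket of exact forms is the differential of the Poisson bracket; this is how the
Jacobi identity for functions enters the calculus of forms. -/
theorem bracket_grad (f g : A) :
    P.cotangentBracket.bracket (grad f) (grad g) = grad (P.sharp (grad f) g) := by
  ext Y
  have h : P.sharp (grad f) g = - P.sharp (grad g) f := P.skew_apply (grad g) (grad f)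
  change (P.sharp (grad f) (Y g) - ⁅P.sharp (grad f), Y⁆ g)
    - (P.sharp (grad g) (Y f) - ⁅P.sharp (grad g), Y⁆ f) - Y (P.sharp (grad f) g) = _
  rw [Derivation.commutator_apply, Derivation.commutator_apply, grad_apply, h]
  simp

theorem anchor_eq (α : OneForms A) : P.cotangentBracket.anchor α = P.sharp α := rfl

theorem anchor_bracket_grad (f g : A) :
    P.sharp (P.cotangentBracket.bracket (grad f) (grad g)) = ⁅P.sharp (grad f), P.sharp (grad g)⁆ := by
  ext h
  rw [bracket_grad, Derivation.commutator_apply]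
  have h1 := P.jacobi f g h
  have h2 : P.sharp (grad (P.sharp (grad f) g)) h = - P.sharp (grad h) (P.sharp (grad f) g) :=
    P.skew_apply (grad h) _
  have h3 : P.sharp (grad f) h = - P.sharp (grad h) f := P.skew_apply (grad h) (grad f)
  rw [h2, h3]
  simp only [map_neg]
  linear_combination -h1

theorem _root_.FormalPoisson.Frame.span_grad (F : Frame A) :
    Submodule.span A (Set.range fun i => grad (F.f i)) = ⊤ := by
  refine eq_top_iff.2 fun α _ => ?_
  rw [F.oneForm_eq α]
  exact Submodule.sum_mem _ fun i _ => Submodule.smul_mem _ _ (Submodule.subset_span ⟨i, rfl⟩)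

/-- On exact forms this is the Jacobi identity. Both sides obey the same Leibniz rules in each
argument, and the exact forms of the frame span all one-forms. -/
theorem sharp_bracket (F : Frame A) (α β : OneForms A) :
    P.sharp (P.cotangentBracket.bracket α β) = ⁅P.sharp α, P.sharp β⁆ := by
  have hs : ∀ (X : VectorFields A) (f : A) (Y : VectorFields A), ⁅X, f • Y⁆ = f • ⁅X, Y⁆ + X f • Y :=
    (tangentBracket A).bracket_smul
  have hα : α ∈ Submodule.span A (Set.range fun i => grad (F.f i)) := by rw [F.span_grad]; trivial
  have hβ : β ∈ Submodule.span A (Set.range fun i => grad (F.f i)) := by rw [F.span_grad]; trivial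
  induction hβ using Submodule.span_induction with
  | mem β hβ =>
    obtain ⟨j, rfl⟩ := hβ
    induction hα using Submodule.span_induction with
    | mem α hα => obtain ⟨i, rfl⟩ := hα; exact P.anchor_bracket_grad _ _
    | zero => simp
    | add x y _ _ hx hy => simp only [map_add, LinearMap.add_apply, hx, hy, add_lie]
    | smul a x _ hx =>
      rw [P.cotangentBracket.bracket_swap, P.cotangentBracket.bracket_smul, map_neg, map_add,
        map_smul, map_smul, map_smul, P.cotangentBracket.bracket_swap, map_neg, hx,
        ← lie_skew (a • P.sharp x), hs, lie_skew, P.anchor_eq]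
  | zero => simp
  | add x y _ _ hx hy => simp only [map_add, hx, hy, lie_add]
  | smul a x _ hx =>
    rw [P.cotangentBracket.bracket_smul, map_add, map_smul, map_smul, map_smul, hx, hs, P.anchor_eq]

theorem differential_differential_zero (F : Frame A) (U : Polyvectors A 0) :
    P.differential 1 (P.differential 0 U) = 0 :=
  P.cotangentBracket.d_d_zero (e := fun i => grad (F.f i))
    (ε := fun i => Module.Dual.eval A _ (F.X i)) F.oneForm_eq
    (fun _ _ => P.sharp_bracket F _ _) U

theorem differential_differential_one (F : Frame A) (U : Polyvectors A 1) :
    P.differential 2 (P.differential 1 U) = 0 := by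
  refine P.cotangentBracket.d_d_one (e := fun i => grad (F.f i))
    (ε := fun i => Module.Dual.eval A _ (F.X i)) F.oneForm_eq
    (fun _ _ => P.sharp_bracket F _ _) (fun i j r => ?_) U
  simp only [bracket_grad]
  rw [← map_add]
  congr 1
  have h := congrFun (congrArg DFunLike.coe (P.anchor_bracket_grad (F.f i) (F.f j))) (F.f r)
  rw [bracket_grad, Derivation.commutator_apply] at h
  rw [h]; ring

end PoissonStructure

theorem deRham_deRham_zero (F : Frame A) (ω : Forms A 0) : deRham A 1 (deRham A 0 ω) = 0 :=
  (tangentBracket A).d_d_zero (e := F.X) (ε := fun i => grad (F.f i)) F.sum_eq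
    (fun _ _ => rfl) ω

end FormalPoisson

end

/-! ### Taylor expansion along the geodesics of a family of connections. -/

noncomputable section

namespace FormalPoisson

set_option linter.unusedSectionVars false

variable {A : Type*} [CommRing A] [Algebra ℝ A] {n m k l : ℕ}

open Cochain

theorem alternatingMap_sum_apply {R V W ι κ : Type*} [CommSemiring R] [AddCommMonoid V] [Module R V]
    [AddCommMonoid W] [Module R W] (S : Finset κ) (g : κ → V [⋀^ι]→ₗ[R] W) (u : ι → V) :
    (∑ i ∈ S, g i) u = ∑ i ∈ S, g i u := by
  classical
  induction S using Finset.induction_on with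
  | empty => simp
  | insert i S hi ih => rw [Finset.sum_insert hi, Finset.sum_insert hi, AlternatingMap.add_apply, ih]

theorem sum_barycentric (n : ℕ) : ∑ i, barycentric (A := A) n i = 1 := by
  rw [Fin.sum_univ_succ]
  simp [barycentric]

theorem coeffDer_one (X : Derivation ℝ A A) : (coeffDer n X).op 1 = 0 := by
  have := coeffDer_algebraMap (n := n) X 1
  simpa using this

theorem coeffDer_barycentric (X : Derivation ℝ A A) (i : Fin (n + 1)) :
    (coeffDer n X).op (barycentric n i) = 0 := by
  refine Fin.cases ?_ (fun i => ?_) i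
  · change (coeffDer n X).op (1 - ∑ i, MvPolynomial.X i) = 0
    rw [map_sub, map_sum, coeffDer_one, Finset.sum_eq_zero fun i _ => coeffDer_var X i, sub_zero]
  · exact coeffDer_var X i

/-- The combination of connections with the barycentric coordinates as coefficients. -/
def familyDer (x : Fin (n + 1) → TorsionFreeConnection A) (X : VectorFields A) : EvenDer A n :=
  EvenDer.comb (fun j => scalar (barycentric n j)) (fun j => (x j).2.onCochains X n)

theorem familyDer_apply (x : Fin (n + 1) → TorsionFreeConnection A) (X : VectorFields A)
    (a : Cochain A n k) : (familyDer x X).op k a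
      = ∑ j, mul (Nat.zero_add k) (scalar (barycentric n j)) (((x j).2.onCochains X n).op k a) := by
  simp only [familyDer, EvenDer.comb, LinearMap.sum_apply, LinearMap.comp_apply]
  rfl

theorem familyDer_congr (x : Fin (n + 1) → TorsionFreeConnection A) (X : VectorFields A)
    {a b : Cochain A n k} {s : ℕ} (h : a.coeff s = b.coeff s) :
    ((familyDer x X).op k a).coeff s = ((familyDer x X).op k b).coeff s := by
  funext v
  rw [familyDer_apply, familyDer_apply, coeff_sum, coeff_sum]
  refine Finset.sum_congr rfl fun j _ => ?_
  rw [coeff_scalar_mul, coeff_scalar_mul]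
  congr 1
  exact congrFun (cov_congr _ _ _ h) v

/-- The barycentric coordinates sum to one, so the combination acts on functions as the derivation
`X`, whatever the connections are. -/
theorem familyDer_scalar (x : Fin (n + 1) → TorsionFreeConnection A) (X : VectorFields A)
    (p : PolyFun A n) : (familyDer x X).op 0 (scalar p) = scalar ((coeffDer n X).op p) := by
  have h : ∀ j, ((x j).2.onCochains X n).op 0 (scalar p) = scalar ((coeffDer n X).op p) :=
    fun j => cov_scalar _ _ _ p
  rw [familyDer_apply]
  simp only [h, ← Cochain.scalar_mul]
  rw [← scalar_sum, ← Finset.sum_mul, sum_barycentric, one_mul]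

/-- The spray of a family of connections. -/
def spray (F : Frame A) (x : Fin (n + 1) → TorsionFreeConnection A) : EvenDer A n :=
  EvenDer.comb (fun i => linear n (grad (F.f i))) (fun i => familyDer x (F.X i))

section Flow

variable (F : Frame A) (x : Fin (n + 1) → TorsionFreeConnection A)

theorem spray_apply (a : Cochain A n k) : (spray F x).op k a
    = ∑ i, mul (Nat.zero_add k) (linear n (grad (F.f i))) ((familyDer x (F.X i)).op k a) := by
  simp only [spray, EvenDer.comb, LinearMap.sum_apply, LinearMap.comp_apply]
  rfl

theorem coeff_spray_zero (a : Cochain A n k) (v : VectorFields A) :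
    ((spray F x).op k a).coeff 0 v = 0 := by
  rw [spray_apply, coeff_sum]
  exact Finset.sum_eq_zero fun i _ => coeff_linear_mul_zero _ _ _ _

theorem coeff_spray_succ (a : Cochain A n k) (s : ℕ) (v : VectorFields A) :
    ((spray F x).op k a).coeff (s + 1) v
      = ∑ i, v (F.f i) • ((familyDer x (F.X i)).op k a).coeff s v := by
  rw [spray_apply, coeff_sum]
  exact Finset.sum_congr rfl fun i _ => coeff_linear_mul_succ _ _ _ _ _

theorem spray_congr {a b : Cochain A n k} {s : ℕ} (h : a.coeff s = b.coeff s) :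
    ((spray F x).op k a).coeff (s + 1) = ((spray F x).op k b).coeff (s + 1) := by
  funext v
  simp only [coeff_spray_succ, familyDer_congr x _ h]

/-- The iterates that give the Taylor coefficients of a solution of the radial equation. -/
def flowStep (s : ℕ) : Cochain A n k →ₗ[ℝ] Cochain A n k :=
  match s with
  | 0 => LinearMap.id
  -- The spray raises the degree in the even variable by exactly one, so the radial equation is the
  -- recursion `(s + 1) c_{s+1} = (spray c)_{s+1}`, in which the right side depends on `c_s` alone.
  | s + 1 => (1 / ((s : ℝ) + 1)) • (spray F x).op k ∘ₗ flowStep s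

/-- The solution of the radial equation `euler c = spray c` with a given component of degree zero. -/
def flow : Cochain A n k →ₗ[ℝ] Cochain A n k where
  toFun a := ofCoeff (fun s => (flowStep F x s a).coeff s) fun s => coeff_mem _ s
  map_add' a b := ext_coeff fun s v => by
    rw [coeff_ofCoeff, map_add]; rfl
  map_smul' c a := ext_coeff fun s v => by
    rw [coeff_ofCoeff, map_smul]; rfl

theorem coeff_flow (a : Cochain A n k) (s : ℕ) : (flow F x a).coeff s = (flowStep F x s a).coeff s :=
  rfl

theorem coeff_flow_zero (a : Cochain A n k) : (flow F x a).coeff 0 = a.coeff 0 := rfl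

theorem euler_flow (a : Cochain A n k) : euler (flow F x a) = (spray F x).op k (flow F x a) := by
  refine ext_coeff fun s v => ?_
  rcases s with _ | s
  · rw [coeff_euler, coeff_spray_zero]; simp
  · rw [spray_congr F x (coeff_flow F x a s), coeff_euler, coeff_flow]
    change ((s + 1 : ℕ) : ℝ) • ((1 / ((s : ℝ) + 1)) • (spray F x).op k (flowStep F x s a)).coeff _ v = _
    rw [coeff_smul, smul_smul]
    push_cast
    rw [mul_one_div_cancel (by positivity), one_smul]

/-- The same recursion propagates the vanishing, since the factor `s + 1` is invertible. -/
theorem eq_zero_of_radial {c : Cochain A n k} (h : euler c = (spray F x).op k c)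
    (h0 : c.coeff 0 = 0) : c = 0 := by
  have key : ∀ s, c.coeff s = 0 := by
    intro s
    induction s with
    | zero => exact h0
    | succ s ih =>
      funext v
      have h1 := congrArg (fun a : Cochain A n k => a.coeff (s + 1) v) h
      simp only [coeff_euler, spray_congr F x (b := 0) ih, map_zero] at h1
      have h2 := (smul_eq_zero.1 h1).resolve_left (by positivity)
      exact h2
  exact ext_coeff fun s v => by rw [key]; rfl

theorem eq_flow {c a : Cochain A n k} (h : euler c = (spray F x).op k c)
    (h0 : c.coeff 0 = a.coeff 0) : c = flow F x a := by
  refine sub_eq_zero.1 (eq_zero_of_radial F x (c := c - flow F x a) ?_ ?_)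
  · rw [map_sub, map_sub, h, euler_flow]
  · funext v; rw [coeff_sub, h0, coeff_flow_zero]; simp

/-- The Euler operator and the spray are both derivations, so a product of solutions is a solution
with the product of the initial values. This makes the Taylor expansion an algebra map. -/
theorem flow_mul (h : k + l = m) (a : Cochain A n k) (b : Cochain A n l) :
    flow F x (mul h a b) = mul h (flow F x a) (flow F x b) := by
  refine (eq_flow F x ?_ ?_).symm
  · rw [euler_mul, (spray F x).leibniz, euler_flow, euler_flow]
  · funext v
    rw [coeff_mul, coeff_mul]
    simp [coeff_flow_zero]

/-- The projection of the odd arguments to one-forms. -/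
def oddProj (A : Type*) [CommRing A] [Algebra ℝ A] (n : ℕ) : OddArgs A n →ₗ[A] OneForms A :=
  LinearMap.fst A _ _ ∘ₗ LinearMap.snd A _ _

/-- The Taylor expansion of polyvector fields along the geodesics of a family of connections. -/
def taylor (k : ℕ) : Polyvectors A k →ₗ[ℝ] Cochain A n k :=
  flow F x ∘ₗ ofAlt (oddProj A n)

theorem taylor_wedge (h : k + l = m) (U : Polyvectors A k) (V : Polyvectors A l) :
    taylor F x m (wedge h U V) = mul h (taylor F x k U) (taylor F x l V) := by
  simp only [taylor, LinearMap.comp_apply, ofAlt_wedge, flow_mul]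

theorem coeff_taylor_zero (U : Polyvectors A k) :
    (taylor F x k U).coeff 0 = (ofAlt (oddProj A n) U).coeff 0 := rfl

/-- A function as a polyvector field. -/
def funPoly (g : A) : Polyvectors A 0 := AlternatingMap.constOfIsEmpty A _ (Fin 0) g

/-- A vector field as a polyvector field. -/
def fieldPoly (X : VectorFields A) : Polyvectors A 1 :=
  AlternatingMap.ofSubsingleton A (OneForms A) A (0 : Fin 1) (Module.Dual.eval A _ X)

/-- One step of the recursion applied to `g` gives `∑ yᵢ Xᵢ(g)`, which the frame identifies with the
generator of `dg`. Up to higher order the even generators are therefore expansions of functions. -/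
theorem taylor_fun_sub (g : A) : (taylor F x 0 (funPoly g)
    - scalar (algebraMap A _ g) - linear n (grad g)).OrderGe 2 := by
  refine orderGe_iff.2 fun i hi v => ?_
  rw [coeff_sub, coeff_sub]
  rcases i with _ | _ | i
  · rw [coeff_taylor_zero, coeff_linear, if_neg (by omega), sub_zero]
    exact sub_self _
  · rw [coeff_linear, if_pos rfl, scalar, coeff_const, if_neg (by omega), sub_zero]
    have h1 : (taylor F x 0 (funPoly g)).coeff 1 v
        = ((spray F x).op 0 (scalar (algebraMap A _ g))).coeff 1 v := by
      change ((1 / (((0 : ℕ) : ℝ) + 1)) • (spray F x).op 0 (scalar (algebraMap A _ g))).coeff 1 v = _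
      rw [coeff_smul]; simp
    rw [h1, coeff_spray_succ]
    simp only [familyDer_scalar, coeffDer_algebraMap]
    refine sub_eq_zero.2 ?_
    ext1 u
    change (∑ i, v (F.f i) • (scalar (algebraMap A (PolyFun A n) (F.X i g))).coeff 0 v) u
      = algebraMap A _ (v g)
    rw [F.sum_apply v g, map_sum, alternatingMap_sum_apply]
    refine Finset.sum_congr rfl fun i _ => ?_
    rw [AlternatingMap.smul_apply, coeff_scalar_zero, Algebra.smul_def, map_mul]
  · omega

theorem taylor_field_sub (X : VectorFields A) :
    (taylor F x 1 (fieldPoly X) - odd n X).OrderGe 1 := by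
  refine orderGe_iff.2 fun i hi v => ?_
  obtain rfl : i = 0 := by omega
  rw [coeff_sub, coeff_taylor_zero]
  exact sub_self _

end Flow

/-! ### Compatibility of the Taylor expansion with maps of simplices. -/

section Pull

variable (φ : Fin (m + 1) → Fin (n + 1))

namespace Cochain

theorem coeff_pull (a : Cochain A n k) (s : ℕ) (v : VectorFields A) :
    (pull φ a).coeff s v = pullCoeff (A := A) φ (a.coeff s v) := rfl

/-- Pull-back of cochains as a linear map. -/
def pullHom (k : ℕ) : Cochain A n k →ₗ[ℝ] Cochain A m k where
  toFun := pull φ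
  map_add' a b := ext_coeff fun s v => by
    rw [coeff_pull, coeff_add, map_add]; rfl
  map_smul' c a := ext_coeff fun s v => by
    rw [coeff_pull, coeff_smul, real_smul_coeff, map_smul, ← real_smul_coeff]; rfl

theorem pullHom_apply (a : Cochain A n k) : pullHom φ k a = pull φ a := rfl

theorem pull_mul {q : ℕ} (h : k + l = q) (a : Cochain A n k) (b : Cochain A n l) :
    pull φ (mul h a b) = mul h (pull φ a) (pull φ b) := by
  refine ext_coeff fun s v => ?_
  rw [coeff_pull, coeff_mul, coeff_mul, map_sum]
  refine Finset.sum_congr rfl fun p _ => ?_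
  rw [coeff_pull, coeff_pull]
  change (pullFun φ).toLinearMap.compAlternatingMap ((wedge h _ _).compLinearMap _) = _
  rw [← wedge_compLinearMap, ← wedge_compAlternatingMap]
  rfl

theorem pull_scalar (p : PolyFun A n) : pull φ (scalar p) = scalar (pullFun φ p) := by
  refine ext_coeff fun s v => ?_
  rw [coeff_pull, scalar, scalar, coeff_const, coeff_const]
  split_ifs
  · rfl
  · simp

theorem pull_ofAlt {L : Type*} [AddCommGroup L] [Module A L] (p : OddArgs A n →ₗ[A] L)
    (p' : OddArgs A m →ₗ[A] L) (hp : ∀ u, p (u.1, u.2.1, pushVec φ u.2.2) = p' u)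
    (ω : L [⋀^Fin k]→ₗ[A] A) : pull φ (ofAlt p ω) = ofAlt p' ω := by
  refine ext_coeff fun s v => ?_
  rw [coeff_pull]
  rcases s with _ | s
  · ext1 u
    rw [coeff_ofAlt_zero]
    change pullFun φ (algebraMap A _ (ω fun i => p ((u i).1, (u i).2.1, pushVec φ (u i).2.2))) = _
    rw [AlgHom.commutes]
    simp only [hp]
  · rw [coeff_ofAlt_succ, coeff_ofAlt_succ, map_zero]

theorem pull_linear (α : OneForms A) : pull φ (linear n α) = linear m α := by
  refine ext_coeff fun s v => ?_
  rw [coeff_pull, coeff_linear, coeff_linear]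
  split_ifs
  · ext u
    change MvPolynomial.coeff _ (pullFun φ (algebraMap A (PolyFun A n) (α v))) = _
    rw [AlgHom.commutes]; rfl
  · simp

theorem pull_dSimplex (j : Fin n) : pull φ (dSimplex (A := A) j)
    = oneForm (LinearMap.proj j ∘ₗ pushVec φ ∘ₗ LinearMap.snd A _ _ ∘ₗ LinearMap.snd A _ _) :=
  pull_ofAlt φ (LinearMap.proj j ∘ₗ LinearMap.snd A _ _ ∘ₗ LinearMap.snd A _ _)
    (LinearMap.proj j ∘ₗ pushVec φ ∘ₗ LinearMap.snd A _ _ ∘ₗ LinearMap.snd A _ _) (fun _ => rfl)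
    (AlternatingMap.ofSubsingleton A A A (0 : Fin 1) LinearMap.id)

theorem pull_euler (a : Cochain A n k) : pull φ (euler a) = euler (pull φ a) :=
  ext_coeff fun s v => by
    rw [coeff_pull, coeff_euler, coeff_euler, coeff_pull, real_smul_coeff, map_smul,
      ← real_smul_coeff]

theorem OrderGe.pull {r : ℕ} {a : Cochain A n k} (ha : a.OrderGe r) : (pull φ a).OrderGe r :=
  orderGe_iff.2 fun i hi v => by rw [coeff_pull, ha.coeff_eq hi, map_zero]

end Cochain

theorem pullFun_var (j : Fin n) : pullFun (A := A) φ (MvPolynomial.X j)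
    = ∑ i, if φ i = j.succ then barycentric m i else 0 := by
  simp [pullFun]

theorem pullFun_barycentric (j : Fin (n + 1)) : pullFun (A := A) φ (barycentric n j)
    = ∑ i, if φ i = j then barycentric m i else 0 := by
  refine Fin.cases ?_ (fun j => pullFun_var φ j) j
  -- The coordinate `t₀` is not a polynomial variable; its case follows from the others because all
  -- barycentric coordinates sum to one.
  change pullFun (A := A) φ (1 - ∑ i, MvPolynomial.X i) = _
  simp only [map_sub, map_one, map_sum, pullFun_var]
  rw [Finset.sum_comm, ← sum_barycentric m, ← Finset.sum_sub_distrib]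
  refine Finset.sum_congr rfl fun i _ => ?_
  refine Fin.cases (motive := fun c => φ i = c → _) (fun h => ?_) (fun c h => ?_) (φ i) rfl
  · simp [h, (Fin.succ_ne_zero _).symm]
  · simp [h]

theorem coeffDer_pullFun (X : Derivation ℝ A A) (p : PolyFun A n) :
    (coeffDer m X).op (pullFun φ p) = pullFun φ ((coeffDer n X).op p) := by
  induction p using MvPolynomial.induction_on with
  | C a =>
    have h := coeffDer_algebraMap (n := n) X a
    have h' := coeffDer_algebraMap (n := m) X a
    rw [← MvPolynomial.algebraMap_eq, AlgHom.commutes, h, h', AlgHom.commutes]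
  | add p q hp hq => simp only [map_add, hp, hq]
  | mul_X p i hp =>
    have h : (coeffDer m X).op (pullFun φ (MvPolynomial.X i)) = 0 := by
      rw [pullFun_var, map_sum]
      refine Finset.sum_eq_zero fun i _ => ?_
      split_ifs
      · exact coeffDer_barycentric X i
      · simp
    rw [map_mul, coeffDer_mul, coeffDer_mul, h, coeffDer_var, hp]
    simp

theorem pushVec_der (X : Derivation ℝ A A) (τ : Fin m → A) (j : Fin n) :
    pushVec φ (fun i => X (τ i)) j = X (pushVec φ τ j) := by
  change (∑ i, if φ i = j.succ then barycentricVec m (fun i => X (τ i)) i else 0)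
    = X (∑ i, if φ i = j.succ then barycentricVec m τ i else 0)
  rw [map_sum]
  refine Finset.sum_congr rfl fun i _ => ?_
  split_ifs
  · refine Fin.cases ?_ (fun i => ?_) i <;> simp [barycentricVec]
  · simp

/-- The affine map of simplices has constant coefficients, which the derivation `X` annihilates, and
it leaves the arguments from `M` alone. -/
theorem pull_onCochains {nabla : VectorFields A →ₗ[A] VectorFields A →ₗ[ℝ] VectorFields A}
    (c : IsTorsionFreeConnection nabla) (X : VectorFields A) (a : Cochain A n k) :
    pull φ ((c.onCochains X n).op k a) = (c.onCochains X m).op k (pull φ a) := by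
  refine ext_coeff fun s v => ?_
  change pullCoeff (A := A) φ (((c.onOdd X n).alt (coeffDer n X)).op (a.coeff s v)
      - dirDeriv A s (a.coeff s) v ((c.onFields X).op v))
    = ((c.onOdd X m).alt (coeffDer m X)).op (pullCoeff (A := A) φ (a.coeff s v))
      - dirDeriv A s (fun v => pullCoeff (A := A) φ (a.coeff s v)) v ((c.onFields X).op v)
  rw [map_sub, dirDeriv_comp (a.coeff_mem s)]
  congr 1
  ext1 u
  let p : OddArgs A m →ₗ[A] OddArgs A n :=
    LinearMap.prodMap LinearMap.id (LinearMap.prodMap LinearMap.id (pushVec φ))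
  have hp : ∀ w, p ((c.onOdd X m).op w) = (c.onOdd X n).op (p w) := fun w => by
    rw [c.onOdd_apply, c.onOdd_apply]
    refine Prod.ext rfl (Prod.ext rfl ?_)
    funext j
    exact pushVec_der φ X w.2.2 j
  change pullFun φ (((c.onOdd X n).alt (coeffDer n X)).op (a.coeff s v) fun i => p (u i))
    = (coeffDer m X).op (pullFun φ (a.coeff s v fun i => p (u i)))
      - ∑ j, pullFun φ (a.coeff s v fun i => p (Function.update u j ((c.onOdd X m).op (u j)) i))
  rw [CovDer.alt_apply, map_sub, coeffDer_pullFun, map_sum]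
  congr 1
  refine Finset.sum_congr rfl fun j _ => ?_
  congr 2
  funext i
  rcases eq_or_ne i j with rfl | h
  · simp [hp]
  · simp [h]

/-- The `j`-th barycentric coordinate pulls back to the sum over the fibre of `φ` at `j`. Regrouping
by vertices of the source replaces the tuple `x` by `x ∘ φ`. -/
theorem pull_familyDer (x : Fin (n + 1) → TorsionFreeConnection A) (X : VectorFields A)
    (a : Cochain A n k) :
    pull φ ((familyDer x X).op k a) = (familyDer (x ∘ φ) X).op k (pull φ a) := by
  rw [familyDer_apply, familyDer_apply, ← pullHom_apply, map_sum]
  simp only [pullHom_apply, pull_mul, pull_scalar, pullFun_barycentric, pull_onCochains, scalar_sum,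
    sum_mul]
  rw [Finset.sum_comm]
  refine Finset.sum_congr rfl fun i _ => ?_
  rw [Finset.sum_eq_single (φ i)]
  · simp
  · intro j _ hj
    rw [if_neg (Ne.symm hj)]
    refine ext_coeff fun s v => ?_
    rw [coeff_scalar_mul, zero_smul]; rfl
  · simp

theorem pull_spray (F : Frame A) (x : Fin (n + 1) → TorsionFreeConnection A) (a : Cochain A n k) :
    pull φ ((spray F x).op k a) = (spray F (x ∘ φ)).op k (pull φ a) := by
  rw [spray_apply, spray_apply, ← pullHom_apply, map_sum]
  simp only [pullHom_apply, pull_mul, pull_linear, pull_familyDer]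

/-- The pulled-back expansion solves the radial equation of `x ∘ φ` with the same initial value, so
uniqueness applies. -/
theorem pull_taylor (F : Frame A) (x : Fin (n + 1) → TorsionFreeConnection A)
    (U : Polyvectors A k) : pull φ (taylor F x k U) = taylor F (x ∘ φ) k U := by
  refine eq_flow F (x ∘ φ) ?_ ?_
  · rw [← pull_euler, ← pull_spray]
    exact congrArg _ (euler_flow F x _)
  · rw [← pull_ofAlt φ (oddProj A n) (oddProj A m) (fun _ => rfl)]
    funext v
    rw [coeff_pull, coeff_pull]
    rfl

end Pull

end FormalPoisson

end

/-! ### Rigidity: derivations of bounded order are determined by generators. -/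

noncomputable section

namespace FormalPoisson

set_option linter.unusedSectionVars false

variable {A : Type*} [CommRing A] [Algebra ℝ A] {n m k l : ℕ}

namespace Cochain

/-- Cochains that are homogeneous in the even variable. -/
def IsHom (s : ℕ) (a : Cochain A n k) : Prop := ∀ i, i ≠ s → a.coeff i = 0

theorem isHom_comp (s : ℕ) (a : Cochain A n k) : (comp s a).IsHom s := fun i hi => by
  funext v
  rw [coeff_comp, if_neg hi]; rfl

theorem IsHom.orderGe {s : ℕ} {a : Cochain A n k} (h : a.IsHom s) : a.OrderGe s :=
  fun i hi => h i (by omega)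

theorem IsHom.euler {s : ℕ} {a : Cochain A n k} (h : a.IsHom s) : euler a = (s : ℝ) • a :=
  ext_coeff fun i v => by
    rw [coeff_euler, coeff_smul]
    by_cases hi : i = s
    · rw [hi]
    · rw [h i hi]; simp

theorem IsHom.vder {s : ℕ} {a : Cochain A n k} (h : a.IsHom (s + 1)) (X : VectorFields A) :
    (vder X a).IsHom s := fun i hi => by
  funext v
  rw [coeff_vder, show a.coeff (i + 1) = fun _ => 0 from h _ (by omega), dirDeriv_zero]; rfl

theorem IsHom.eq_scalar {a : Cochain A n 0} (h : a.IsHom 0) : a = scalar (a.coeff 0 0 ![]) := by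
  refine ext_coeff fun i v => ?_
  rw [scalar, coeff_const]
  split_ifs with hi
  · subst hi
    obtain ⟨f, hf⟩ := a.coeff_mem 0
    ext1 u
    rw [hf, hf, Subsingleton.elim u ![], Subsingleton.elim (fun _ : Fin 0 => v) fun _ => 0]
    rfl
  · rw [h i hi]; rfl

theorem orderGe_sub_sum_comp (a : Cochain A n k) (r : ℕ) :
    (a - ∑ s ∈ Finset.range r, comp s a).OrderGe r := orderGe_iff.2 fun i hi v => by
  rw [coeff_sub, coeff_sum]
  simp only [coeff_comp]
  rw [Finset.sum_ite_eq (Finset.range r) i, if_pos (Finset.mem_range.2 hi), sub_self]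

theorem comp_eq_zero {a : Cochain A n k} {r s : ℕ} (h : a.OrderGe r) (hs : s < r) : comp s a = 0 :=
  ext_coeff fun i v => by
    rw [coeff_comp]
    split_ifs with hi
    · rw [hi, h.coeff_eq hs]; rfl
    · rfl

end Cochain

open Cochain

/-- Derivations of cochains along a filtered map, of bounded order. -/
structure RelDer (A : Type*) [CommRing A] [Algebra ℝ A] (n m d : ℕ) where
  op : ∀ k, Cochain A n k →ₗ[ℝ] Cochain A m (k + d)
  base : ∀ k, Cochain A n k →ₗ[ℝ] Cochain A m k
  sgn : ℕ → ℝ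
  leibniz : ∀ {k l p : ℕ} (h : k + l = p) (a : Cochain A n k) (b : Cochain A n l),
    op p (Cochain.mul h a b) = Cochain.mul (show k + d + l = p + d by omega) (op k a) (base l b)
      + sgn k • Cochain.mul (show k + (l + d) = p + d by omega) (base k a) (op l b)
  drop : ℕ
  base_order : ∀ {k r : ℕ} {a : Cochain A n k}, a.OrderGe r → (base k a).OrderGe r
  op_order : ∀ {k r : ℕ} {a : Cochain A n k}, a.OrderGe (r + drop) → (op k a).OrderGe r

namespace RelDer

variable {d : ℕ} (E : RelDer A n m d) (F : Frame A) (x : Fin (n + 1) → TorsionFreeConnection A)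

/-- A cochain is an infinite product of components, but the bounded loss of order lets only finitely
many of them matter modulo order `r`. -/
theorem order_of_comp {r : ℕ} {a : Cochain A n k} (h : ∀ s, (E.op k (comp s a)).OrderGe r) :
    (E.op k a).OrderGe r := by
  have h1 : a = (a - ∑ s ∈ Finset.range (r + E.drop), comp s a)
      + ∑ s ∈ Finset.range (r + E.drop), comp s a := by abel
  rw [h1, map_add, map_sum]
  exact (E.op_order (orderGe_sub_sum_comp a _)).add (OrderGe.sum _ fun s _ => h s)

theorem op_scalar (hA : ∀ g : A, E.op 0 (scalar (algebraMap A _ g)) = 0)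
    (ht : ∀ i : Fin n, E.op 0 (scalar (MvPolynomial.X i)) = 0) (p : PolyFun A n) :
    E.op 0 (scalar p) = 0 := by
  induction p using MvPolynomial.induction_on with
  | C a => exact hA a
  | add p q hp hq => rw [scalar_add, map_add, hp, hq, add_zero]
  | mul_X p i hp =>
    rw [scalar_mul rfl, E.leibniz, hp, ht, Cochain.mul_zero, Cochain.zero_mul, smul_zero, add_zero]

/-- The Euler identity writes a homogeneous cochain as a combination of products `yᵢ ∂ᵢ a`, and the
Leibniz rule passes the bound from the `yᵢ` to it by induction. In degree at least two every term
retains another even factor, whence the gain of one order that drives the next lemma. -/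
theorem order_of_isHom (hs : ∀ p : PolyFun A n, E.op 0 (scalar p) = 0) {r : ℕ}
    (hy : ∀ i, (E.op 0 (linear n (grad (F.f i)))).OrderGe r) (s : ℕ) :
    ∀ a : Cochain A n 0, a.IsHom s →
      (E.op 0 a).OrderGe r ∧ (2 ≤ s → (E.op 0 a).OrderGe (r + 1)) := by
  induction s with
  | zero =>
    intro a ha
    rw [ha.eq_scalar, hs]
    exact ⟨OrderGe.zero _, fun h => by omega⟩
  | succ s ih =>
    intro a ha
    have h1 : E.op 0 a = (1 / ((s : ℝ) + 1)) • ∑ i, (mul (show 0 + d + 0 = 0 + d by omega)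
          (E.op 0 (linear n (grad (F.f i)))) (E.base 0 (vder (F.X i) a))
        + E.sgn 0 • mul (show 0 + (0 + d) = 0 + d by omega)
          (E.base 0 (linear n (grad (F.f i)))) (E.op 0 (vder (F.X i) a))) := by
      simp only [← E.leibniz (Nat.add_zero 0)]
      rw [← map_sum, sum_linear_mul_vder F, ha.euler, map_smul, smul_smul]
      push_cast
      rw [one_div_mul_cancel (by positivity), one_smul]
    rw [h1]
    have h2 : ∀ i, (E.op 0 (vder (F.X i) a)).OrderGe r := fun i => (ih _ (ha.vder (F.X i))).1
    have h3 : ∀ i, (mul (show 0 + (0 + d) = 0 + d by omega)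
          (E.base 0 (linear n (grad (F.f i)))) (E.op 0 (vder (F.X i) a))).OrderGe (r + 1) := fun i => by
      rw [add_comm r]
      exact OrderGe.mul _ (E.base_order (orderGe_linear _)) (h2 i)
    refine ⟨OrderGe.smul _ (OrderGe.sum _ fun i _ => ?_),
      fun h => OrderGe.smul _ (OrderGe.sum _ fun i _ => ?_)⟩
    · exact ((hy i).mul _ (orderGe_zero _)).add (((h3 i).mono (by omega)).smul _)
    · exact ((hy i).mul _ (E.base_order ((ha.vder (F.X i)).orderGe.mono (by omega)))).add
        ((h3 i).smul _)

/-- Bootstrap: `y_{df}` equals `j f - f` up to a cochain of order two. `E` kills `j f` and `f`, and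
on the rest its values have one order more than was known on the generators. So `E` vanishes to all
orders on the generators. -/
theorem op_zero_eq_zero (hs : ∀ p : PolyFun A n, E.op 0 (scalar p) = 0)
    (hf : ∀ i, E.op 0 (taylor F x 0 (funPoly (F.f i))) = 0) (a : Cochain A n 0) : E.op 0 a = 0 := by
  have hy : ∀ r i, (E.op 0 (linear n (grad (F.f i)))).OrderGe r := by
    intro r
    induction r with
    | zero => exact fun i => orderGe_zero _
    | succ r ih =>
      intro i
      have h1 := taylor_fun_sub F x (F.f i)
      set c := taylor F x 0 (funPoly (F.f i)) - scalar (algebraMap A _ (F.f i))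
        - linear n (grad (F.f i)) with hc
      have h2 : linear n (grad (F.f i)) = taylor F x 0 (funPoly (F.f i))
        - scalar (algebraMap A _ (F.f i)) - c := by rw [hc]; abel
      rw [h2, map_sub, map_sub, hf, hs, sub_zero, zero_sub]
      refine OrderGe.neg (E.order_of_comp fun s => ?_)
      rcases lt_or_ge s 2 with h | h
      · rw [comp_eq_zero h1 h, map_zero]; exact OrderGe.zero _
      · exact (E.order_of_isHom F hs ih s _ (isHom_comp s c)).2 h
  exact eq_zero_of_orderGe fun r => E.order_of_comp fun s =>
    (E.order_of_isHom F hs (hy r) s _ (isHom_comp s a)).1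

/-- A derivation of bounded order vanishes if it vanishes on functions, on the differentials of
coordinates, and on the Taylor expansions of coordinates and of vector fields. -/
theorem eq_zero (hA : ∀ g : A, E.op 0 (scalar (algebraMap A _ g)) = 0)
    (ht : ∀ i : Fin n, E.op 0 (scalar (MvPolynomial.X i)) = 0)
    (hdf : ∀ i, E.op 1 (oneForm (grad (F.f i) ∘ₗ LinearMap.fst A _ _)) = 0)
    (hdt : ∀ j : Fin n, E.op 1 (dSimplex j) = 0)
    (hf : ∀ i, E.op 0 (taylor F x 0 (funPoly (F.f i))) = 0)
    (hX : ∀ i, E.op 1 (taylor F x 1 (fieldPoly (F.X i))) = 0) (k : ℕ) (a : Cochain A n k) :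
    E.op k a = 0 := by
  have h0 := E.op_zero_eq_zero F x (E.op_scalar hA ht) hf
  -- Once `E` vanishes in degree `k`, the odd Euler identity expresses it in degree `k + 1` by its
  -- values on the coframe.
  have expand : ∀ (k : ℕ) (a : Cochain A n (k + 1)), (∀ b : Cochain A n k, E.op k b = 0) →
      ((k : ℝ) + 1) • E.op (k + 1) a = ∑ J, mul (show 1 + d + k = k + 1 + d by omega)
        (E.op 1 (oneForm (F.oddForm n J))) (E.base k (contr (F.oddVec n J) a)) := by
    intro k a hk
    rw [← map_smul, ← sum_oneForm_mul_contr F (Nat.add_comm 1 k) a, map_sum]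
    refine Finset.sum_congr rfl fun J _ => ?_
    rw [E.leibniz, hk, Cochain.mul_zero, smul_zero, add_zero]
  -- The same bootstrap for the odd generators: `z_X` equals `j X` up to a cochain of order one. In
  -- its expansion the coframe on `M` and on the simplex is killed, and each remaining term contains
  -- a coefficient of positive order.
  have hz : ∀ r i, (E.op 1 (odd n (F.X i))).OrderGe r := by
    intro r
    induction r with
    | zero => exact fun i => orderGe_zero _
    | succ r ih =>
      intro i
      have h1 := taylor_field_sub F x (F.X i)
      set c := taylor F x 1 (fieldPoly (F.X i)) - odd n (F.X i) with hc
      have h2 : odd n (F.X i) = taylor F x 1 (fieldPoly (F.X i)) - c := by rw [hc]; abel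
      rw [h2, map_sub, hX, zero_sub]
      have h3 := expand 0 c h0
      rw [show (((0 : ℕ) : ℝ) + 1) = 1 by norm_num, one_smul] at h3
      rw [show E.op 1 c = _ from h3]
      refine OrderGe.neg (OrderGe.sum _ fun J _ => ?_)
      rcases J with i | i | j
      · have : E.op 1 (oneForm (F.oddForm n (Sum.inl i))) = 0 := hdf i
        rw [this, Cochain.zero_mul]; exact OrderGe.zero _
      · exact OrderGe.mul _ (ih i) (E.base_order (h1.contr _))
      · have : E.op 1 (oneForm (F.oddForm n (Sum.inr (Sum.inr j)))) = 0 := hdt j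
        rw [this, Cochain.zero_mul]; exact OrderGe.zero _
  have hJ : ∀ J, E.op 1 (oneForm (F.oddForm n J)) = 0 := by
    rintro (i | i | j)
    · exact hdf i
    · exact eq_zero_of_orderGe fun r => hz r i
    · exact hdt j
  induction k with
  | zero => exact h0 a
  | succ k ih =>
    have h1 := expand k a ih
    simp only [hJ, Cochain.zero_mul, Finset.sum_const_zero] at h1
    exact (smul_eq_zero.1 h1).resolve_left (by positivity)

end RelDer

end FormalPoisson

end

/-! ### Successive approximation and the exterior covariant derivative. -/

noncomputable section

namespace FormalPoisson

set_option linter.unusedSectionVars false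

theorem wedge_one_one {A L B : Type*} [CommRing A] [AddCommGroup L] [Module A L] [CommRing B]
    [Algebra A B] [Algebra ℝ B] (h : 1 + 1 = 2) (a b : L [⋀^Fin 1]→ₗ[A] B) (u w : L) :
    wedge h a b ![u, w] = a ![u] * b ![w] - a ![w] * b ![u] := by
  have h1 := ins_wedge (show 0 + 1 + (0 + 1) = 1 + 1 from rfl) (show 0 + (0 + 1) = 1 from rfl)
    (show 0 + 1 + 0 = 1 from rfl) a b u
  have h2 : ins u (wedge h a b) ![w] = _ := congrFun (congrArg DFunLike.coe h1) ![w]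
  rw [wedge_zero_left, wedge_zero_right] at h2
  refine h2.trans ?_
  change a ![u] * b ![w] + ((-1 : ℤ) ^ (0 + 1)) • (b ![u] * a ![w]) = _
  simp
  ring

variable {A : Type*} [CommRing A] [Algebra ℝ A] {n m k l : ℕ}

open Cochain

namespace Cochain

theorem coeff_mul_lowest (h : k + l = m) {r : ℕ} {a : Cochain A n k} (ha : a.OrderGe r)
    (b : Cochain A n l) (v : VectorFields A) :
    (mul h a b).coeff r v = wedge h (a.coeff r v) (b.coeff 0 v) := by
  rw [coeff_mul, Finset.sum_eq_single (r, 0)]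
  · rintro ⟨i, j⟩ hij hne
    rw [Finset.HasAntidiagonal.mem_antidiagonal] at hij
    have : i < r := by
      rcases Nat.lt_or_ge i r with h | h
      · exact h
      · exact absurd (Prod.ext (by simp at hij ⊢; omega) (by simp at hij ⊢; omega)) hne
    rw [ha.coeff_eq this, zero_wedge]
  · intro h
    exact absurd (Finset.HasAntidiagonal.mem_antidiagonal.2 (by simp)) h

theorem coeff_mul_lowest' (h : k + l = m) {r : ℕ} (a : Cochain A n k) {b : Cochain A n l}
    (hb : b.OrderGe r) (v : VectorFields A) :
    (mul h a b).coeff r v = wedge h (a.coeff 0 v) (b.coeff r v) := by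
  rw [mul_comm h (show l + k = m by omega), coeff_smul, coeff_mul_lowest _ hb,
    wedge_comm h (show l + k = m by omega), neg_one_pow_smul_eq]

/-- The component of degree `s` is constant from stage `s + 1` on, and is taken from there. -/
theorem exists_limit (a : ℕ → Cochain A n k) (h : ∀ r, (a (r + 1) - a r).OrderGe r) :
    ∃ b : Cochain A n k, ∀ r, (b - a r).OrderGe r := by
  refine ⟨ofCoeff (fun s => (a (s + 1)).coeff s) fun s => coeff_mem _ s, fun r => ?_⟩
  refine orderGe_iff.2 fun i hi v => ?_
  rw [coeff_sub, coeff_ofCoeff, sub_eq_zero]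
  induction r with
  | zero => omega
  | succ r ih =>
    rcases Nat.lt_or_ge i r with h1 | h1
    · have h2 := (h r).coeff_eq h1 v
      rw [coeff_sub, sub_eq_zero] at h2
      rw [ih h1, h2]
    · obtain rfl : i = r := by omega
      rfl

/-- Successive approximation. -/
theorem exists_correction {S I : Type*} [Fintype I] {p : ℕ} (D : S → Cochain A n p)
    (B : I → S → Cochain A n 0) (f : I → S)
    (h : ∀ (w : I → Cochain A n p) (r : ℕ),
      (∀ g, (D g + ∑ i, mul (Nat.add_zero p) (w i) (B i g)).OrderGe r) → ∀ g,
      ((D g + ∑ i, mul (Nat.add_zero p) (w i) (B i g)) - ∑ i, mul (Nat.add_zero p)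
        (D (f i) + ∑ j, mul (Nat.add_zero p) (w j) (B j (f i))) (B i g)).OrderGe (r + 1)) :
    ∃ w : I → Cochain A n p, ∀ g, D g + ∑ i, mul (Nat.add_zero p) (w i) (B i g) = 0 := by
  let T : (I → Cochain A n p) → S → Cochain A n p := fun w g =>
    D g + ∑ i, mul (Nat.add_zero p) (w i) (B i g)
  -- Each unknown is corrected by the error at the corresponding test element `f i`. By hypothesis
  -- the lowest-order error everywhere is the combination of these errors with coefficients `B`, so
  -- one correction raises the order for all elements at once.
  let a : ℕ → I → Cochain A n p := fun r => Nat.rec 0 (fun _ w i => w i - T w (f i)) r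
  have ha : ∀ r i, a (r + 1) i = a r i - T (a r) (f i) := fun r i => rfl
  have hT : ∀ w w' g, T w g - T w' g = ∑ i, mul (Nat.add_zero p) (w i - w' i) (B i g) := by
    intro w w' g
    change D g + _ - (D g + _) = _
    rw [add_sub_add_left_eq_sub, ← Finset.sum_sub_distrib]
    exact Finset.sum_congr rfl fun i _ => (sub_mul _ _ _ _).symm
  have hord : ∀ r g, (T (a r) g).OrderGe r := by
    intro r
    induction r with
    | zero => exact fun g => orderGe_zero _
    | succ r ih =>
      intro g
      have h1 : T (a (r + 1)) g = T (a r) g - ∑ i, mul (Nat.add_zero p) (T (a r) (f i)) (B i g) := by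
        rw [← sub_add_cancel (T (a (r + 1)) g) (T (a r) g), hT]
        simp only [ha, sub_sub_cancel_left, neg_mul, Finset.sum_neg_distrib]
        abel
      rw [h1]
      exact h (a r) r ih g
  have hlim : ∀ i, ∃ b : Cochain A n p, ∀ r, (b - a r i).OrderGe r := fun i =>
    exists_limit (fun r => a r i) fun r => by
      rw [ha, sub_sub_cancel_left]
      exact (hord r _).neg
  choose w hw using hlim
  refine ⟨w, fun g => eq_zero_of_orderGe fun r => ?_⟩
  have h1 : T w g = T (a r) g + ∑ i, mul (Nat.add_zero p) (w i - a r i) (B i g) := by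
    rw [← hT]; abel
  change (T w g).OrderGe r
  rw [h1]
  exact (hord r g).add (OrderGe.sum _ fun i _ => (hw i r).mul _ (orderGe_zero _))

end Cochain

/-- Each coefficient of the polynomial value is a derivation of `A`, to which the frame identity
applies. -/
theorem Frame.der_apply (F : Frame A) (δ : A →ₗ[ℝ] PolyFun A n)
    (hδ : ∀ (g h : A), δ (g * h) = g • δ h + h • δ g) (g : A) :
    δ g = ∑ i, F.X i g • δ (F.f i) := by
  ext s
  let D : Derivation ℝ A A := Derivation.mk'
    { toFun := fun g => (δ g).coeff s
      map_add' := fun g h => by simp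
      map_smul' := fun c g => by simp } (fun g h => by
      change (δ (g * h)).coeff s = _
      rw [hδ]; simp)
  have h := F.sum_apply D g
  change (δ g).coeff s = ∑ i, (δ (F.f i)).coeff s * F.X i g at h
  rw [h, MvPolynomial.coeff_sum]
  exact Finset.sum_congr rfl fun i _ => by rw [MvPolynomial.coeff_smul, smul_eq_mul, _root_.mul_comm]

section Existence

variable (F : Frame A) (x : Fin (n + 1) → TorsionFreeConnection A)

/-- The exterior covariant derivative on cochains. -/
def extDer : OddDer A n :=
  OddDer.add (OddDer.comb (fun i => oneForm (grad (F.f i) ∘ₗ LinearMap.fst A _ _))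
    (fun i => familyDer x (F.X i))) (OddDer.comb (fun j => dSimplex j) (fun j => simplexDer A j))

theorem extDer_apply (a : Cochain A n k) : (extDer F x).op k a
    = ∑ i, mul (Nat.add_comm 1 k) (oneForm (grad (F.f i) ∘ₗ LinearMap.fst A _ _))
        ((familyDer x (F.X i)).op k a)
      + ∑ j, mul (Nat.add_comm 1 k) (dSimplex j) ((simplexDer A j).op k a) := by
  simp only [extDer, OddDer.add, OddDer.comb, LinearMap.add_apply, LinearMap.sum_apply,
    LinearMap.comp_apply]
  rfl

theorem OrderGe_extDer {r : ℕ} {a : Cochain A n k} (ha : a.OrderGe r) :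
    ((extDer F x).op k a).OrderGe r := by
  rw [extDer_apply]
  refine (OrderGe.sum _ fun i _ => ?_).add (OrderGe.sum _ fun j _ => ?_)
  · rw [← Nat.zero_add r]
    exact OrderGe.mul _ (orderGe_zero _) (OrderGe.of_congr (familyDer_congr x _) (by simpa using ha))
  · rw [← Nat.zero_add r]
    exact OrderGe.mul _ (orderGe_zero _) (OrderGe.cov _ _ _ (by simpa using ha))

theorem scalar_zero : scalar (0 : PolyFun A n) = 0 :=
  ext_coeff fun s v => by simp only [scalar, coeff_const]; split_ifs <;> rfl

theorem simplexDer_fun (j : Fin n) (g : A) :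
    (simplexDer A j).op 0 (scalar (algebraMap A _ g)) = 0 := by
  refine (cov_scalar _ _ _ _).trans ?_
  rw [← scalar_zero]
  congr 1
  simp [partialDer]

theorem simplexDer_oneForm (j : Fin n) (φ : OddArgs A n →ₗ[A] A) :
    (simplexDer A j).op 1 (oneForm φ) = 0 := by
  refine (cov_oneForm _ _ _ φ 0 fun w => ?_).trans ?_
  · simp [partialDer, CovDer.zero]
  · exact ext_coeff fun s v => by
      rw [oneForm, coeff_const]; split_ifs
      · ext u; simp [oneCoeff]
      · rfl

theorem extDer_coord (j : Fin n) :
    (extDer F x).op 0 (scalar (MvPolynomial.X j)) = dSimplex j := by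
  rw [extDer_apply]
  simp only [familyDer_scalar, coeffDer_var, scalar_zero, Cochain.mul_zero, Finset.sum_const_zero,
    zero_add]
  rw [Finset.sum_eq_single j]
  · have : (simplexDer A j).op 0 (scalar (MvPolynomial.X j)) = scalar 1 := by
      refine (cov_scalar _ _ _ _).trans ?_
      congr 1
      simp [partialDer]
    rw [this]
    refine ext_coeff fun s v => ?_
    rw [coeff_mul_scalar, one_smul]
  · intro i _ hi
    have : (simplexDer A i).op 0 (scalar (MvPolynomial.X j)) = 0 := by
      refine (cov_scalar _ _ _ _).trans ?_
      rw [← scalar_zero]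
      congr 1
      simp [partialDer, MvPolynomial.pderiv_X, hi.symm]
    rw [this, Cochain.mul_zero]
  · simp

theorem oneForm_zero : oneForm (0 : OddArgs A n →ₗ[A] A) = 0 :=
  ext_coeff fun s v => by
    rw [oneForm, coeff_const]; split_ifs
    · ext u; simp [oneCoeff]
    · rfl

theorem dSimplex_eq (j : Fin n) : dSimplex (A := A) j
    = oneForm (LinearMap.proj j ∘ₗ LinearMap.snd A _ _ ∘ₗ LinearMap.snd A _ _) := rfl

theorem extDer_dSimplex (j : Fin n) : (extDer F x).op 1 (dSimplex j) = 0 := by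
  rw [extDer_apply, dSimplex_eq]
  have h1 : ∀ (c : TorsionFreeConnection A) (X : VectorFields A), (c.2.onCochains X n).op 1
      (oneForm (LinearMap.proj j ∘ₗ LinearMap.snd A _ _ ∘ₗ LinearMap.snd A _ _)) = 0 := by
    intro c X
    refine (cov_oneForm _ _ _ _ 0 fun w => ?_).trans oneForm_zero
    rw [coeffDer_algebraMap, c.2.onOdd_apply]
    simp
  simp only [simplexDer_oneForm, familyDer_apply, h1, Cochain.mul_zero, Finset.sum_const_zero,
    add_zero]

/-- The sum is the antisymmetrised Hessian of `g`, which vanishes because the connection has no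
torsion. -/
theorem sum_wedge_nabla_grad (c : TorsionFreeConnection A) (g : A) :
    ∑ i, wedge (show 1 + 1 = 2 from rfl)
      (AlternatingMap.ofSubsingleton A (VectorFields A) A (0 : Fin 1) (grad (F.f i)))
      (AlternatingMap.ofSubsingleton A (VectorFields A) A (0 : Fin 1)
        ((c.2.onForms (F.X i)).op (grad g))) = 0 := by
  ext u
  rw [show u = ![u 0, u 1] by funext i; fin_cases i <;> rfl]
  generalize u 0 = Y
  generalize u 1 = Z
  have key : ∀ Y Z : VectorFields A, ∑ i, Y (F.f i) * ((F.X i) (Z g) - (c.1 (F.X i) Z) g)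
      = Y (Z g) - c.1 Y Z g := by
    intro Y Z
    simp only [_root_.mul_sub, Finset.sum_sub_distrib]
    rw [← F.sum_apply]
    congr 1
    let T : VectorFields A →ₗ[A] A :=
      { toFun := fun Y => c.1 Y Z g
        map_add' := fun Y Y' => by simp
        map_smul' := fun a Y => by simp }
    refine Eq.trans ?_ (congrArg T (F.sum_eq Y)).symm
    rw [map_sum]
    exact Finset.sum_congr rfl fun i _ => by rw [map_smul]; rfl
  rw [alternatingMap_sum_apply]
  simp only [wedge_one_one, Finset.sum_sub_distrib]
  have h3 := congrArg (fun D : VectorFields A => D g) (c.2.torsion_free Y Z)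
  simp only [Derivation.sub_apply, Derivation.commutator_apply] at h3
  refine (congrArg₂ (· - ·) (key Y Z) (key Z Y)).trans ?_
  simp only [AlternatingMap.zero_apply]
  linear_combination -h3

/-- Both composites are derivations along the inclusion of forms, so functions and the differentials
of the frame suffice. On the latter the claim is `sum_wedge_nabla_grad`, the place where
torsion-freeness is needed. -/
theorem extDer_ofForm (ω : Forms A k) :
    (extDer F x).op k (ofForm n ω) = ofForm n (deRham A k ω) := by
  let p : OddArgs A n →ₗ[A] VectorFields A := LinearMap.fst A _ _
  refine sub_eq_zero.1 (eq_zero_of_alt_derivation (d := 1) (e := F.X)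
    (ε := fun i => grad (F.f i)) F.sum_eq
    (fun k => (extDer F x).op k ∘ₗ ofAlt p - ofAlt p ∘ₗ deRham A k) (fun _ => ofAlt p)
    (fun k => (-1) ^ k) ?_ ?_ ?_ k ω)
  · intro k l m h ω η
    simp only [LinearMap.sub_apply, LinearMap.comp_apply, ofAlt_wedge, (extDer F x).leibniz h]
    have h1 : deRham A m (wedge h ω η) = _ := (tangentBracket A).d_wedge h ω η
    rw [h1, map_add, map_zsmul, ofAlt_wedge, ofAlt_wedge, neg_one_pow_smul_eq, Cochain.sub_mul,
      Cochain.mul_sub]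
    change _ - (mul _ (ofAlt p (deRham A k ω)) _ + _ • mul _ _ (ofAlt p (deRham A l η))) = _
    module
  · intro g
    have h1 : (extDer F x).op 0 (scalar (algebraMap A _ g)) = ofAlt p (deRham A 0
        (AlternatingMap.constOfIsEmpty A _ (Fin 0) g)) := by
      rw [extDer_apply]
      simp only [simplexDer_fun, Cochain.mul_zero, Finset.sum_const_zero, add_zero,
        familyDer_scalar, coeffDer_algebraMap]
      refine ext_coeff fun s v => ?_
      rw [coeff_sum]
      simp only [coeff_mul_scalar]
      rcases s with _ | s
      · ext1 u
        rw [alternatingMap_sum_apply, coeff_ofAlt_zero]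
        have h2 : deRham A 0 (AlternatingMap.constOfIsEmpty A _ (Fin 0) g) (fun i => p (u i))
            = (u 0).1 g := by
          have h3 := (tangentBracket A).ins_d_zero (u 0).1
            (AlternatingMap.constOfIsEmpty A _ (Fin 0) g)
          have h4 := congrFun (congrArg DFunLike.coe h3) ![]
          rw [AnchoredBracket.lie_apply] at h4
          simp only [Finset.univ_eq_empty, Finset.sum_empty, sub_zero] at h4
          refine Eq.trans ?_ h4
          refine congrArg _ ?_
          funext i
          fin_cases i
          rfl
        rw [h2, F.sum_apply (u 0).1 g, map_sum]
        refine Finset.sum_congr rfl fun i _ => ?_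
        rw [map_mul, AlternatingMap.smul_apply, smul_eq_mul, _root_.mul_comm]
        rfl
      · rw [coeff_ofAlt_succ]
        exact Finset.sum_eq_zero fun i _ => smul_zero _
    exact sub_eq_zero.2 h1
  · intro i
    have h1 : deRham A 1 (AlternatingMap.ofSubsingleton A (VectorFields A) A (0 : Fin 1)
        (grad (F.f i))) = 0 := by
      ext u
      rw [show u = ![u 0, u 1] by funext i; fin_cases i <;> rfl]
      refine ((tangentBracket A).d_one_apply _ _ _).trans ?_
      change (u 0) ((u 1) (F.f i)) - (u 1) ((u 0) (F.f i)) - ⁅u 0, u 1⁆ (F.f i) = 0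
      rw [Derivation.commutator_apply]; ring
    rw [LinearMap.sub_apply, LinearMap.comp_apply, LinearMap.comp_apply, h1, map_zero, sub_zero]
    change (extDer F x).op 1 (oneForm (grad (F.f i) ∘ₗ p)) = 0
    rw [extDer_apply]
    simp only [simplexDer_oneForm, Cochain.mul_zero, Finset.sum_const_zero, add_zero,
      familyDer_apply]
    have h2 : ∀ (c : TorsionFreeConnection A) (X : VectorFields A),
        (c.2.onCochains X n).op 1 (oneForm (grad (F.f i) ∘ₗ p))
          = oneForm ((c.2.onForms X).op (grad (F.f i)) ∘ₗ p) := by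
      intro c X
      refine cov_oneForm _ _ _ _ _ fun w => ?_
      rw [coeffDer_algebraMap, ← map_sub]
      rfl
    simp only [h2, Cochain.mul_sum]
    rw [Finset.sum_comm]
    refine Finset.sum_eq_zero fun j _ => ?_
    have h3 : ∀ r, mul (Nat.add_comm 1 1) (oneForm (grad (F.f r) ∘ₗ p)) (mul (Nat.zero_add 1)
        (scalar (barycentric n j)) (oneForm (((x j).2.onForms (F.X r)).op (grad (F.f i)) ∘ₗ p)))
        = mul (Nat.zero_add 2) (scalar (barycentric n j)) (ofAlt p (wedge (show 1 + 1 = 2 from rfl)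
      (AlternatingMap.ofSubsingleton A (VectorFields A) A (0 : Fin 1) (grad (F.f r)))
      (AlternatingMap.ofSubsingleton A (VectorFields A) A (0 : Fin 1)
        (((x j).2.onForms (F.X r)).op (grad (F.f i)))))) := by
      intro r
      rw [Cochain.mul_left_comm (Nat.zero_add 1) (Nat.add_comm 1 1) (Nat.add_comm 1 1)
        (Nat.zero_add 2), ofAlt_wedge, Nat.mul_zero, pow_zero, one_smul]
      rfl
    rw [Finset.sum_congr rfl fun r _ => h3 r, ← Cochain.mul_sum, ← map_sum, sum_wedge_nabla_grad,
      map_zero, Cochain.mul_zero]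

end Existence

end FormalPoisson

end

/-! ### Construction of the differential on a simplex. -/

noncomputable section

namespace FormalPoisson

set_option linter.unusedSectionVars false

variable {A : Type*} [CommRing A] [Algebra ℝ A] {n m k l : ℕ}

open Cochain

theorem funPoly_mul (g h : A) :
    funPoly (g * h) = wedge (show 0 + 0 = 0 from rfl) (funPoly g) (funPoly h) := by
  rw [wedge_zero_left]; rfl

/-- Functions as polyvector fields, as a linear map. -/
def funPolyHom (A : Type*) [CommRing A] [Algebra ℝ A] : A →ₗ[ℝ] Polyvectors A 0 where
  toFun := funPoly
  map_add' _ _ := rfl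
  map_smul' _ _ := rfl

theorem Frame.fieldPoly_expand (F : Frame A) (U : Polyvectors A 1) :
    U = ∑ i, wedge (Nat.zero_add 1) (funPoly (U ![grad (F.f i)])) (fieldPoly (F.X i)) := by
  ext u
  have h1 : ∀ α : OneForms A, U ![α] = ins α U ![] := fun α => rfl
  rw [alternatingMap_sum_apply, show u = ![u 0] by funext i; fin_cases i; rfl, h1]
  generalize u 0 = α
  let T : OneForms A →ₗ[A] A :=
    { toFun := fun α => ins α U ![]
      map_add' := fun α β => by rw [ins_add_left]; rfl
      map_smul' := fun c α => by rw [ins_smul_left]; rfl }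
  change T α = _
  conv_lhs => rw [F.oneForm_eq α]
  rw [map_sum]
  refine Finset.sum_congr rfl fun i _ => ?_
  rw [map_smul, wedge_zero_left, smul_eq_mul, _root_.mul_comm]
  rfl

section

variable (F : Frame A) (P : PoissonStructure A) (x : Fin (n + 1) → TorsionFreeConnection A)

/-- The failure of the Taylor expansion to intertwine the Poisson differential and a derivation. -/
def defect (Q : OddDer A n) (k : ℕ) : Polyvectors A k →ₗ[ℝ] Cochain A n (k + 1) :=
  Q.op k ∘ₗ taylor F x k - taylor F x (k + 1) ∘ₗ P.differential k

/-- Since the expansion is multiplicative and both differentials are derivations, the defect is a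
derivation along the expansion; hence `defect_eq_zero` tests it on functions and on frame fields
only. -/
theorem defect_wedge (Q : OddDer A n) (h : k + l = m) (U : Polyvectors A k) (V : Polyvectors A l) :
    defect F P x Q m (wedge h U V)
      = mul (show k + 1 + l = m + 1 by omega) (defect F P x Q k U) (taylor F x l V)
        + (-1 : ℝ) ^ k • mul (show k + (l + 1) = m + 1 by omega) (taylor F x k U)
          (defect F P x Q l V) := by
  simp only [defect, LinearMap.sub_apply, LinearMap.comp_apply, taylor_wedge F x h, Q.leibniz h]
  have h1 : P.differential m (wedge h U V) = _ := P.cotangentBracket.d_wedge h U V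
  rw [h1, map_add, map_zsmul, taylor_wedge, taylor_wedge, neg_one_pow_smul_eq, Cochain.sub_mul,
    Cochain.mul_sub]
  change _ - (mul _ (taylor F x _ (P.differential k U)) _
    + _ • mul _ _ (taylor F x _ (P.differential l V))) = _
  module

theorem defect_eq_zero (Q : OddDer A n) (h0 : ∀ g, defect F P x Q 0 (funPoly g) = 0)
    (h1 : ∀ i, defect F P x Q 1 (fieldPoly (F.X i)) = 0) (k : ℕ) (U : Polyvectors A k) :
    Q.op k (taylor F x k U) = taylor F x (k + 1) (P.differential k U) :=
  sub_eq_zero.1 (eq_zero_of_alt_derivation (d := 1) (e := fun i => grad (F.f i))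
    (ε := fun i => Module.Dual.eval A _ (F.X i)) F.oneForm_eq (defect F P x Q)
    (fun k => taylor F x k) (fun k => (-1) ^ k) (fun _ _ _ h U V => defect_wedge F P x Q h U V) h0 h1 k U)

/-- The exterior covariant derivative with correction terms. -/
def corrected (w : Fin F.N → Cochain A n 1) (ζ : Fin F.N → Cochain A n 2) : OddDer A n :=
  OddDer.add (extDer F x) (OddDer.add (OddDer.comb w (fun i => vertical n (F.X i)))
    (OddDer.contrComb ζ (fun i => (0, grad (F.f i), 0))))

theorem corrected_zero (w : Fin F.N → Cochain A n 1) (ζ : Fin F.N → Cochain A n 2)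
    (a : Cochain A n 0) : (corrected F x w ζ).op 0 a
      = (extDer F x).op 0 a + ∑ i, mul (Nat.add_zero 1) (w i) (vder (F.X i) a) := by
  simp only [corrected, OddDer.add, OddDer.comb, OddDer.contrComb, LinearMap.add_apply,
    LinearMap.sum_apply, LinearMap.comp_apply, add_zero]
  rfl

theorem corrected_succ (w : Fin F.N → Cochain A n 1) (ζ : Fin F.N → Cochain A n 2)
    (a : Cochain A n (k + 1)) : (corrected F x w ζ).op (k + 1) a
      = (extDer F x).op (k + 1) a
        + (∑ i, mul (Nat.add_comm 1 (k + 1)) (w i) (vder (F.X i) a)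
        + ∑ i, mul (show 2 + k = k + 1 + 1 by omega) (ζ i) (contr (0, grad (F.f i), 0) a)) := by
  simp only [corrected, OddDer.add, OddDer.comb, OddDer.contrComb, LinearMap.add_apply,
    LinearMap.sum_apply, LinearMap.comp_apply]
  rfl

theorem corrected_const_zero (w : Fin F.N → Cochain A n 1) (ζ : Fin F.N → Cochain A n 2)
    (b : Coeff A n 0) : (corrected F x w ζ).op 0 (const b) = (extDer F x).op 0 (const b) := by
  rw [corrected_zero]
  simp [vder_const, Cochain.mul_zero]

/-- Constants have no even variable to differentiate, and forms on `M` or on the simplex have no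
cotangent argument to contract. The values on the base are thus independent of the corrections. -/
theorem corrected_const_succ (w : Fin F.N → Cochain A n 1) (ζ : Fin F.N → Cochain A n 2)
    (b : Coeff A n (k + 1)) (hb : ∀ i, contr (0, grad (F.f i), 0) (const b) = 0) :
    (corrected F x w ζ).op (k + 1) (const b) = (extDer F x).op (k + 1) (const b) := by
  rw [corrected_succ]
  simp [vder_const, Cochain.mul_zero, hb]

/-- Only the vertical derivatives lower the order, and only by one; this is the continuity of the
differential. -/
theorem corrected_order (w : Fin F.N → Cochain A n 1) (ζ : Fin F.N → Cochain A n 2) {r : ℕ}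
    {a : Cochain A n k} (ha : a.OrderGe (r + 1)) : ((corrected F x w ζ).op k a).OrderGe r := by
  have hv : ∀ (h : 1 + k = k + 1) i, (mul h (w i) (vder (F.X i) a)).OrderGe r := fun h i => by
    rw [← Nat.zero_add r]
    exact OrderGe.mul h (orderGe_zero _) (OrderGe.vder _ (by simpa using ha))
  rcases k with _ | k
  · rw [corrected_zero]
    exact (OrderGe_extDer F x (ha.mono (by omega))).add (OrderGe.sum _ fun i _ => hv _ i)
  · rw [corrected_succ]
    refine (OrderGe_extDer F x (ha.mono (by omega))).add ((OrderGe.sum _ fun i _ => hv _ i).add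
      (OrderGe.sum _ fun i _ => ?_))
    rw [← Nat.zero_add r]
    exact OrderGe.mul _ (orderGe_zero _) ((ha.mono (by omega)).contr _)

/-- To lowest order the vertical derivative along `Xᵢ` of `j g` is `Xᵢ(g)`, the coefficient with
which a derivation of `A` at `fᵢ` enters its value at `g`. This match makes the correction equations
solvable although the frame need not be a basis. -/
theorem coeff_vder_taylor (X : VectorFields A) (g : A) (v : VectorFields A) :
    (vder X (taylor F x 0 (funPoly g))).coeff 0 v = (scalar (algebraMap A _ (X g))).coeff 0 v := by
  have h1 := ((taylor_fun_sub F x g).vder X).coeff_eq Nat.zero_lt_one v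
  rw [map_sub, map_sub, vder_linear, coeff_sub, coeff_sub, scalar, vder_const] at h1
  simpa [sub_eq_zero] using h1

theorem coeff_contr_taylor (α : OneForms A) (U : Polyvectors A 1) (v : VectorFields A) :
    (contr (0, α, 0) (taylor F x 1 U)).coeff 0 v = (scalar (algebraMap A _ (U ![α]))).coeff 0 v := by
  rw [coeff_contr, coeff_taylor_zero]
  ext1 u
  rw [ins_apply, coeff_ofAlt_zero]
  change algebraMap A (PolyFun A n) _ = algebraMap A (PolyFun A n) _
  congr 1
  refine congrArg U ?_
  funext i
  fin_cases i
  rfl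

/-- As `j g` has leading term `g`, the lowest-order part of the defect is a derivation in `g`. It is
therefore given by its values at the `fᵢ` with coefficients `Xᵢ(g)`, which successive approximation
can remove. Contractions do not act in degree zero, so the result holds for every `ζ`. -/
theorem exists_vertical_correction : ∃ w : Fin F.N → Cochain A n 1,
    ∀ ζ g, defect F P x (corrected F x w ζ) 0 (funPoly g) = 0 := by
  have hD : ∀ w ζ g, defect F P x (corrected F x w ζ) 0 (funPoly g)
      = defect F P x (extDer F x) 0 (funPoly g)
        + ∑ i, mul (Nat.add_zero 1) (w i) (vder (F.X i) (taylor F x 0 (funPoly g))) := by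
    intro w ζ g
    simp only [defect, LinearMap.sub_apply, LinearMap.comp_apply, corrected_zero]
    exact add_sub_right_comm _ _ _
  refine Exists.elim (exists_correction (fun g => defect F P x (extDer F x) 0 (funPoly g))
    (fun i g => vder (F.X i) (taylor F x 0 (funPoly g))) F.f ?_)
    fun w hw => ⟨w, fun ζ g => (hD w ζ g).trans (hw g)⟩
  intro w r hr g
  simp only [← hD w 0] at hr ⊢
  refine orderGe_iff.2 fun s hs v => ?_
  rw [coeff_sub, coeff_sum]
  rcases Nat.lt_or_ge s r with h | h
  · rw [(hr g).coeff_eq h, zero_sub, neg_eq_zero]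
    refine Finset.sum_eq_zero fun i _ => ?_
    exact (OrderGe.mul (Nat.add_zero 1) (hr (F.f i)) (orderGe_zero _)).coeff_eq (by omega) v
  obtain rfl : s = r := by omega
  ext1 u
  let δ : A →ₗ[ℝ] PolyFun A n :=
    { toFun := fun g => (defect F P x (corrected F x w 0) 0 (funPoly g)).coeff s v u
      map_add' := fun g h => by
        have : funPoly (g + h) = funPoly g + funPoly h := map_add (funPolyHom A) g h
        rw [this, map_add, coeff_add]; rfl
      map_smul' := fun c g => by
        have : funPoly (c • g) = c • funPoly g := map_smul (funPolyHom A) c g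
        rw [this, map_smul, coeff_smul]; rfl }
  have hδ : ∀ g h : A, δ (g * h) = g • δ h + h • δ g := by
    intro g h
    change (defect F P x (corrected F x w 0) 0 (funPoly (g * h))).coeff s v u = _
    rw [funPoly_mul, defect_wedge, coeff_add, pow_zero, one_smul, coeff_mul_lowest _ (hr g),
      coeff_mul_lowest' _ _ (hr h), wedge_zero_left, wedge_zero_right, coeff_taylor_zero,
      coeff_taylor_zero]
    simp only [AlternatingMap.add_apply, AlternatingMap.smul_apply, coeff_ofAlt_zero]
    change algebraMap A (PolyFun A n) h • δ g + algebraMap A (PolyFun A n) g • δ h = _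
    rw [algebraMap_smul, algebraMap_smul, add_comm]
  rw [AlternatingMap.sub_apply, alternatingMap_sum_apply]
  refine sub_eq_zero.2 ((F.der_apply δ hδ g).trans (Finset.sum_congr rfl fun i _ => ?_))
  rw [coeff_mul_lowest _ (hr (F.f i)), coeff_vder_taylor, wedge_zero_right]
  change _ = algebraMap A (PolyFun A n) _ • δ (F.f i)
  simp [Algebra.smul_def]

/-- Once the defect vanishes on functions, it is linear over functions in its lowest order on vector
fields, hence given by its values on the frame fields; the `ζᵢ` remove these without disturbing
functions. -/
theorem exists_corrections : ∃ (w : Fin F.N → Cochain A n 1) (ζ : Fin F.N → Cochain A n 2),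
    ∀ k U, (corrected F x w ζ).op k (taylor F x k U) = taylor F x (k + 1) (P.differential k U) := by
  obtain ⟨w, hw⟩ := exists_vertical_correction F P x
  have hD : ∀ ζ U, defect F P x (corrected F x w ζ) 1 U = defect F P x (corrected F x w 0) 1 U
        + ∑ i, mul (Nat.add_zero 2) (ζ i) (contr (0, grad (F.f i), 0) (taylor F x 1 U)) := by
    intro ζ U
    simp only [defect, LinearMap.sub_apply, LinearMap.comp_apply]
    rw [corrected_succ, corrected_succ]
    simp only [Pi.zero_apply, Cochain.zero_mul, Finset.sum_const_zero, add_zero]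
    rw [← add_assoc]
    exact add_sub_right_comm _ _ _
  refine Exists.elim (exists_correction (fun U => defect F P x (corrected F x w 0) 1 U)
    (fun i U => contr (0, grad (F.f i), 0) (taylor F x 1 U)) (fun i => fieldPoly (F.X i)) ?_)
    fun ζ hζ => ⟨w, ζ, defect_eq_zero F P x _ (hw ζ) fun i => (hD ζ _).trans (hζ _)⟩
  intro ζ r hr U
  simp only [← hD ζ] at hr ⊢
  refine orderGe_iff.2 fun s hs v => ?_
  rw [coeff_sub, coeff_sum]
  rcases Nat.lt_or_ge s r with h | h
  · rw [(hr U).coeff_eq h, zero_sub, neg_eq_zero]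
    refine Finset.sum_eq_zero fun i _ => ?_
    exact (OrderGe.mul (Nat.add_zero 2) (hr (fieldPoly (F.X i))) (orderGe_zero _)).coeff_eq
      (by omega) v
  obtain rfl : s = r := by omega
  have h1 : defect F P x (corrected F x w ζ) 1 U = ∑ i, mul (Nat.zero_add 2)
      (taylor F x 0 (funPoly (U ![grad (F.f i)])))
      (defect F P x (corrected F x w ζ) 1 (fieldPoly (F.X i))) := by
    conv_lhs => rw [F.fieldPoly_expand U]
    rw [map_sum]
    refine Finset.sum_congr rfl fun i _ => ?_
    rw [defect_wedge, hw, Cochain.zero_mul, zero_add, pow_zero, one_smul]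
  rw [h1, coeff_sum]
  refine sub_eq_zero.2 (Finset.sum_congr rfl fun i _ => ?_)
  rw [coeff_mul_lowest' _ _ (hr _), coeff_mul_lowest _ (hr _), coeff_contr_taylor, wedge_zero_left,
    wedge_zero_right]
  rfl

/-- The existence of the curved structure attached to a family of connections. -/
theorem exists_structure : ∃ D : CurvedLInfty A n, ∀ (k : ℕ) (U : Polyvectors A k),
    D.Q k (taylor F x k U) = taylor F x (k + 1) (P.differential k U) := by
  obtain ⟨w, ζ, h⟩ := exists_corrections F P x
  have hform : ∀ k (ω : Forms A k), (corrected F x w ζ).op k (ofForm n ω) = ofForm n (deRham A k ω) := by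
    intro k ω
    rw [← extDer_ofForm F x]
    rcases k with _ | k
    · exact corrected_const_zero F x w ζ _
    refine corrected_const_succ F x w ζ _ fun i => ?_
    refine (contr_ofAlt (LinearMap.fst A _ _) (0, grad (F.f i), 0) ω).trans ?_
    have : ins (0 : VectorFields A) ω = 0 := (ω.curryLeft).map_zero
    exact (congrArg (ofAlt (LinearMap.fst A _ _)) this).trans (map_zero _)
  have hcoord : ∀ j : Fin n, (corrected F x w ζ).op 0 (scalar (MvPolynomial.X j)) = dSimplex j := by
    intro j
    rw [← extDer_coord F x]
    exact corrected_const_zero F x w ζ _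
  have hdS : ∀ j : Fin n, (corrected F x w ζ).op 1 (dSimplex j) = 0 := by
    intro j
    rw [← extDer_dSimplex F x]
    refine corrected_const_succ F x w ζ _ fun i => ?_
    refine (contr_oneForm _ _).trans ?_
    simp [scalar_zero]
  have hdf : ∀ i, (corrected F x w ζ).op 1
      (oneForm (grad (F.f i) ∘ₗ LinearMap.fst A _ _)) = 0 := by
    intro i
    refine (hform 1 (AlternatingMap.ofSubsingleton A _ A (0 : Fin 1) (grad (F.f i)))).trans ?_
    have h1 : deRham A 1 (AlternatingMap.ofSubsingleton A (VectorFields A) A (0 : Fin 1)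
        (grad (F.f i))) = 0 := by
      ext u
      rw [show u = ![u 0, u 1] by funext i; fin_cases i <;> rfl]
      refine ((tangentBracket A).d_one_apply _ _ _).trans ?_
      change (u 0) ((u 1) (F.f i)) - (u 1) ((u 0) (F.f i)) - ⁅u 0, u 1⁆ (F.f i) = 0
      rw [Derivation.commutator_apply]; ring
    rw [h1]
    exact map_zero (ofAlt (LinearMap.fst A _ _))
  -- The square of an odd derivation is an even derivation, since the cross terms carry opposite
  -- signs; it loses at most two orders. It kills the generators because the de Rham and the Poisson
  -- differentials square to zero there, so rigidity makes it zero.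
  let E : RelDer A n n 2 :=
    { op := fun k => (corrected F x w ζ).op (k + 1) ∘ₗ (corrected F x w ζ).op k
      base := fun k => LinearMap.id
      sgn := fun _ => 1
      leibniz := by
        intro k l p h a b
        simp only [LinearMap.comp_apply, LinearMap.id_apply, one_smul]
        rw [(corrected F x w ζ).leibniz h, map_add, map_smul, (corrected F x w ζ).leibniz,
          (corrected F x w ζ).leibniz, smul_add, smul_smul, ← mul_pow]
        rw [pow_succ]
        norm_num
      drop := 2
      base_order := fun h => h
      op_order := fun h => corrected_order F x w ζ (corrected_order F x w ζ h) }
  have hE : ∀ k a, E.op k a = 0 := by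
    refine E.eq_zero F x (fun g => ?_) (fun j => ?_) (fun i => ?_) (fun j => ?_) (fun i => ?_)
      fun i => ?_
    · change (corrected F x w ζ).op 1 ((corrected F x w ζ).op 0
        (ofForm n (AlternatingMap.constOfIsEmpty A _ (Fin 0) g))) = 0
      rw [hform, hform, deRham_deRham_zero F]
      exact map_zero (ofAlt (LinearMap.fst A _ _))
    · change (corrected F x w ζ).op 1 ((corrected F x w ζ).op 0 _) = 0
      rw [hcoord, hdS]
    · change (corrected F x w ζ).op 2 ((corrected F x w ζ).op 1 _) = 0
      rw [hdf, map_zero]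
    · change (corrected F x w ζ).op 2 ((corrected F x w ζ).op 1 _) = 0
      rw [hdS, map_zero]
    · change (corrected F x w ζ).op 1 ((corrected F x w ζ).op 0 _) = 0
      rw [h, h, P.differential_differential_zero F, map_zero]
    · change (corrected F x w ζ).op 2 ((corrected F x w ζ).op 1 _) = 0
      rw [h, h, P.differential_differential_one F, map_zero]
  exact ⟨{  Q := (corrected F x w ζ).op
            Q_Q := hE
            leibniz := fun k l m h a b => (corrected F x w ζ).leibniz h a b
            Q_form := hform
            Q_coord := hcoord
            continuous := fun k s a ha => corrected_order F x w ζ fun i hi => ha i (by omega) }, h⟩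

end

end FormalPoisson

end

/-! ### Naturality in the simplex. -/

noncomputable section

namespace FormalPoisson

set_option linter.unusedSectionVars false

section
variable {A : Type*} [CommRing A] [Algebra ℝ A] {n m k l : ℕ}

open Cochain

theorem coeff_oneForm_zero (φ : OddArgs A n →ₗ[A] A) (v : VectorFields A)
    (u : Fin 1 → OddArgs A n) : (oneForm φ).coeff 0 v u = algebraMap A _ (φ (u 0)) := rfl

theorem coeff_oneForm_succ (φ : OddArgs A n →ₗ[A] A) (s : ℕ) (v : VectorFields A) :
    (oneForm φ).coeff (s + 1) v = 0 := rfl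

theorem CurvedLInfty.Q_one (D : CurvedLInfty A n) : D.Q 0 (scalar 1) = 0 := by
  have h := D.leibniz 0 0 0 rfl (scalar 1) (scalar 1)
  have h1 : mul rfl (scalar 1) (scalar 1) = (scalar 1 : Cochain A n 0) := by
    rw [scalar_one_mul]
  have h2 : ∀ a : Cochain A n 1, mul (show 1 + 0 = 1 from rfl) a (scalar 1) = a := fun a =>
    ext_coeff fun s v => by rw [coeff_mul_scalar, one_smul]
  rw [h1, pow_zero, one_smul, scalar_one_mul, h2] at h
  simpa using h

theorem CurvedLInfty.Q_grad (D : CurvedLInfty A n) (g : A) :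
    D.Q 1 (oneForm (grad g ∘ₗ LinearMap.fst A _ _)) = 0 := by
  refine (D.Q_form 1 (AlternatingMap.ofSubsingleton A _ A (0 : Fin 1) (grad g))).trans ?_
  have h1 : deRham A 1 (AlternatingMap.ofSubsingleton A (VectorFields A) A (0 : Fin 1)
      (grad g)) = 0 := by
    ext u
    rw [show u = ![u 0, u 1] by funext i; fin_cases i <;> rfl]
    refine ((tangentBracket A).d_one_apply _ _ _).trans ?_
    change (u 0) ((u 1) g) - (u 1) ((u 0) g) - ⁅u 0, u 1⁆ g = 0
    rw [Derivation.commutator_apply]; ring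
  rw [h1]
  exact map_zero (ofAlt (LinearMap.fst A _ _))

theorem CurvedLInfty.Q_fun (D : CurvedLInfty A n) (g : A) :
    D.Q 0 (scalar (algebraMap A _ g)) = oneForm (grad g ∘ₗ LinearMap.fst A _ _) := by
  refine (D.Q_form 0 (AlternatingMap.constOfIsEmpty A _ (Fin 0) g)).trans ?_
  have h : deRham A 0 (AlternatingMap.constOfIsEmpty A _ (Fin 0) g)
      = AlternatingMap.ofSubsingleton A _ A (0 : Fin 1) (grad g) := by
    refine ins_ext fun x => ?_
    refine ((tangentBracket A).ins_d_zero x _).trans ?_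
    ext u
    rw [AnchoredBracket.lie_apply]
    simp only [Finset.univ_eq_empty, Finset.sum_empty, sub_zero]
    rfl
  rw [h]
  rfl

theorem CurvedLInfty.Q_barycentric (D : CurvedLInfty A n) (i : Fin (n + 1)) (s : ℕ)
    (v : VectorFields A) (u : Fin 1 → OddArgs A n) :
    (D.Q 0 (scalar (barycentric n i))).coeff s v u
      = if s = 0 then algebraMap A _ (barycentricVec n (u 0).2.2 i) else 0 := by
  have h1 : ∀ j : Fin n, (D.Q 0 (scalar (MvPolynomial.X j))).coeff s v u
      = if s = 0 then algebraMap A _ ((u 0).2.2 j) else 0 := fun j => by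
    rw [D.Q_coord]
    rcases s with _ | s
    · rfl
    · rw [if_neg (by omega)]; rfl
  refine Fin.cases ?_ (fun i => h1 i) i
  have h2 : scalar (barycentric n 0) = scalar 1
      - ∑ i, (scalar (MvPolynomial.X i) : Cochain A n 0) := by
    rw [eq_sub_iff_add_eq, ← scalar_sum, ← scalar_add]
    congr 1
    simp [barycentric]
  rw [h2, map_sub, map_sum, D.Q_one, zero_sub, coeff_neg, coeff_sum, AlternatingMap.neg_apply,
    alternatingMap_sum_apply]
  simp only [h1]
  split_ifs
  · simp [barycentricVec]
  · simp

/-- Naturality of the curved structures with respect to maps of simplices. -/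
theorem CurvedLInfty.pull_comm (F : Frame A) (P : PoissonStructure A) (φ : Fin (m + 1) → Fin (n + 1))
    (x : Fin (n + 1) → TorsionFreeConnection A) (D : CurvedLInfty A n) (D' : CurvedLInfty A m)
    (hD : ∀ (k : ℕ) (U : Polyvectors A k),
      D.Q k (taylor F x k U) = taylor F x (k + 1) (P.differential k U))
    (hD' : ∀ (k : ℕ) (U : Polyvectors A k),
      D'.Q k (taylor F (x ∘ φ) k U) = taylor F (x ∘ φ) (k + 1) (P.differential k U))
    (k : ℕ) (a : Cochain A n k) : D'.Q k (pull φ a) = pull φ (D.Q k a) := by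
  -- The failure of naturality is a derivation along the pull-back. On expansions it vanishes by
  -- `pull_taylor` and the two intertwining properties, on the base by the prescribed values;
  -- rigidity does the rest.
  let E : RelDer A n m 1 :=
    { op := fun k => D'.Q k ∘ₗ pullHom φ k - pullHom φ (k + 1) ∘ₗ D.Q k
      base := fun k => pullHom φ k
      sgn := fun k => (-1) ^ k
      leibniz := by
        intro k l p h a b
        simp only [LinearMap.sub_apply, LinearMap.comp_apply, D.leibniz k l p h, map_add, map_smul]
        simp only [pullHom_apply, pull_mul, D'.leibniz k l p h, Cochain.sub_mul, Cochain.mul_sub]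
        module
      drop := 1
      base_order := fun h => h.pull φ
      op_order := fun {k r a} h => by
        have h1 := D'.continuous k r (pull φ a) (fun i hi => h.pull φ i (by omega))
        have h2 := D.continuous k r a (fun i hi => h i (by omega))
        exact OrderGe.sub (fun i hi => h1 i hi) (OrderGe.pull φ fun i hi => h2 i hi) }
  have hfun : ∀ g : A, pull φ (scalar (algebraMap A (PolyFun A n) g))
      = scalar (algebraMap A (PolyFun A m) g) := fun g => by
    rw [pull_scalar, AlgHom.commutes]
  have hform : ∀ g : A, pull φ (oneForm (grad g ∘ₗ LinearMap.fst A _ _))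
      = oneForm (grad g ∘ₗ LinearMap.fst A _ _) := fun g =>
    pull_ofAlt φ (LinearMap.fst A _ _) (LinearMap.fst A _ _) (fun _ => rfl)
      (AlternatingMap.ofSubsingleton A _ A (0 : Fin 1) (grad g))
  have hvar : ∀ j : Fin n, E.op 0 (scalar (MvPolynomial.X j)) = 0 := fun j => by
    change D'.Q 0 (pull φ (scalar (MvPolynomial.X j))) - pull φ (D.Q 0 (scalar (MvPolynomial.X j))) = 0
    rw [D.Q_coord, pull_dSimplex, pull_scalar, pullFun_var, scalar_sum, map_sum, sub_eq_zero]
    refine ext_coeff fun s v => ?_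
    ext1 u
    rw [coeff_sum, alternatingMap_sum_apply]
    have h1 : ∀ i, (D'.Q 0 (scalar (if φ i = j.succ then barycentric m i else 0))).coeff s v u
        = if φ i = j.succ then (if s = 0 then algebraMap A (PolyFun A m)
          (barycentricVec m (u 0).2.2 i) else 0) else 0 := fun i => by
      split_ifs with h h'
      · rw [D'.Q_barycentric, if_pos h']
      · rw [D'.Q_barycentric, if_neg h']
      · rw [scalar_zero, map_zero]; rfl
    simp only [h1]
    rcases s with _ | s
    · rw [coeff_oneForm_zero]
      change _ = algebraMap A (PolyFun A m)
        (∑ i, if φ i = j.succ then barycentricVec m (u 0).2.2 i else 0)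
      rw [map_sum]
      refine Finset.sum_congr rfl fun i _ => ?_
      by_cases h : φ i = j.succ <;> simp [h]
    · rw [coeff_oneForm_succ]
      simp
  refine sub_eq_zero.1 (E.eq_zero F x (fun g => ?_) hvar (fun i => ?_) (fun j => ?_) (fun i => ?_)
    (fun i => ?_) k a)
  · change D'.Q 0 (pull φ (scalar (algebraMap A _ g))) - pull φ (D.Q 0 _) = 0
    rw [hfun, D.Q_fun, D'.Q_fun, hform, sub_self]
  · change D'.Q 1 (pull φ _) - pull φ (D.Q 1 _) = 0
    rw [hform, D'.Q_grad, D.Q_grad, ← pullHom_apply, map_zero, sub_self]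
  · have h1 := sub_eq_zero.1 (hvar j)
    change D'.Q 0 (pull φ (scalar (MvPolynomial.X j))) = pull φ (D.Q 0 (scalar (MvPolynomial.X j))) at h1
    change D'.Q 1 (pull φ (dSimplex j)) - pull φ (D.Q 1 (dSimplex j)) = 0
    rw [← D.Q_coord, ← h1, D'.Q_Q, D.Q_Q, ← pullHom_apply, map_zero, sub_self]
  · change D'.Q 0 (pull φ (taylor F x 0 _)) - pull φ (D.Q 0 _) = 0
    rw [pull_taylor, hD', hD, pull_taylor, sub_self]
  · change D'.Q 1 (pull φ (taylor F x 1 _)) - pull φ (D.Q 1 _) = 0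
    rw [pull_taylor, hD', hD, pull_taylor, sub_self]

end

/-! ### The contractible simplicial set of tuples of connections. -/

section Family

/-- The simplicial set whose simplices are sequences of points of a given set. -/
def codiscrete (C : Type u) : SSet.{u} where
  obj Δ := Fin (Δ.unop.len + 1) → C
  map f := ↾(fun x => x ∘ f.unop.toOrderHom)

/-- A simplex is an arbitrary labelling of vertices. The labels on a sphere therefore define the
filling, and agreement is checked at each vertex by naturality. -/
theorem fillsSpheres_codiscrete (C : Type u) [Nonempty C] : FillsSpheres (codiscrete C) := by
  classical
  intro n b
  let vertex (j : Fin (n + 1)) : (Δ[n] : SSet.{u}).obj (op ⦋0⦌) :=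
    SSet.stdSimplex.objEquiv.symm (SimplexCategory.const ⦋0⦌ ⦋n⦌ j)
  -- The arbitrary label matters only for `n = 0`, where the boundary is empty; otherwise every
  -- vertex lies in the boundary.
  let c : Fin (n + 1) → C := fun j => if hj : vertex j ∈ (SSet.boundary.{u} n).obj (op ⦋0⦌) then
    b.app (op ⦋0⦌) ⟨vertex j, hj⟩ 0 else Classical.arbitrary C
  refine ⟨SSet.yonedaEquiv.symm (show (codiscrete C).obj (op ⦋n⦌) from c), ?_⟩
  ext Δ σ
  funext i
  have h1 : ((SSet.boundary.{u} n).toSSet.map (SimplexCategory.const ⦋0⦌ Δ.unop i).op σ).1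
      = vertex (SSet.stdSimplex.objEquiv σ.1 i) := rfl
  have h2 : vertex (SSet.stdSimplex.objEquiv σ.1 i) ∈ (SSet.boundary.{u} n).obj (op ⦋0⦌) := by
    rw [← h1]
    exact ((SSet.boundary.{u} n).toSSet.map (SimplexCategory.const ⦋0⦌ Δ.unop i).op σ).2
  have h3 := congrFun (ConcreteCategory.congr_hom (b.naturality (SimplexCategory.const ⦋0⦌ Δ.unop i).op) σ)
  change c (SSet.stdSimplex.objEquiv σ.1 i) = b.app Δ σ i
  exact (dif_pos h2).trans (h3 0)

/-- The structures are chosen independently for all tuples. Faces and degeneracies still match,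
since naturality uses nothing but the intertwining property of each choice. -/
theorem Frame.exists_family {A : Type u} [CommRing A] [Algebra ℝ A] (F : Frame A)
    (P : PoissonStructure A) [Nonempty (TorsionFreeConnection A)] :
    ∃ (G : ContractibleFamily.{u, u} A) (connection : G.K.obj (op ⦋0⦌) ≃ TorsionFreeConnection A),
      ∀ x, ∀ (k : ℕ) (U : Polyvectors A k), (G.member 0 x).Q k (taylor F (fun _ => connection x) k U)
        = taylor F (fun _ => connection x) (k + 1) (P.differential k U) := by
  choose D hD using fun (n : ℕ) (x : Fin (n + 1) → TorsionFreeConnection A) =>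
    exists_structure F P x
  refine ⟨{  K := codiscrete (TorsionFreeConnection A)
             contractible := fillsSpheres_codiscrete _
             member := D
             natural := fun m n φ x k a => CurvedLInfty.pull_comm F P φ.toOrderHom x (D n x)
              (D m (x ∘ φ.toOrderHom)) (hD n x) (hD m _) k a },
    Equiv.funUnique (Fin 1) (TorsionFreeConnection A), fun x k U => ?_⟩
  have h : ∀ y : Fin 1 → TorsionFreeConnection A, (D 0 y).Q k (taylor F (fun _ => y 0) k U)
      = taylor F (fun _ => y 0) (k + 1) (P.differential k U) := fun y => by
    have hy : (fun _ => y 0) = y := funext fun i => by rw [Subsingleton.elim i 0]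
    rw [hy]
    exact hD 0 y k U
  exact h x

/-- The torsion-free connection for which the fields of a frame are combined with second
derivatives of the coordinates. -/
theorem Frame.nonempty_connection {A : Type*} [CommRing A] [Algebra ℝ A] (F : Frame A) :
    Nonempty (TorsionFreeConnection A) := by
  refine ⟨⟨LinearMap.mk₂' A ℝ (fun X Y => ∑ i, X (Y (F.f i)) • F.X i) ?_ ?_ ?_ ?_, ?_, ?_⟩⟩
  · intro X X' Y
    simp [add_smul, Finset.sum_add_distrib]
  · intro c X Y
    simp [mul_smul, Finset.smul_sum]
  · intro X Y Y'
    simp [add_smul, Finset.sum_add_distrib]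
  · intro c X Y
    simp [Finset.smul_sum]
  · intro X f Y
    simp only [LinearMap.mk₂'_apply, Derivation.smul_apply, smul_eq_mul, Derivation.leibniz, add_smul,
      mul_smul, Finset.sum_add_distrib, Finset.smul_sum]
    congr 1
    conv_rhs => rw [F.sum_eq Y, Finset.smul_sum]
    exact Finset.sum_congr rfl fun i _ => by rw [smul_comm]
  · intro X Y
    simp only [LinearMap.mk₂'_apply, ← Finset.sum_sub_distrib, ← sub_smul]
    conv_rhs => rw [F.sum_eq ⁅X, Y⁆]
    rfl

end Family

end FormalPoisson

end

/-! ### Low brackets: the even generators. -/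

noncomputable section

namespace FormalPoisson

set_option linter.unusedSectionVars false

variable {A : Type*} [CommRing A] [Algebra ℝ A] {n m k l : ℕ}

open Cochain

section Vanishing

variable (F : Frame A) (x : Fin (n + 1) → TorsionFreeConnection A)

theorem contr_familyDer_tangent (X : VectorFields A) {a : Cochain A n (k + 1)}
    (ha : ∀ Y : VectorFields A, contr (Y, 0, 0) a = 0) (Y : VectorFields A) :
    contr (Y, 0, 0) ((familyDer x X).op (k + 1) a) = 0 := by
  rw [familyDer_apply, map_sum]
  refine Finset.sum_eq_zero fun j _ => ?_
  rw [contr_mul_zero_left _ _ (Nat.zero_add k)]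
  have h1 : contr (Y, 0, 0) (((x j).2.onCochains X n).op (k + 1) a) = 0 := by
    refine (contr_cov _ _ _ _ a).trans ?_
    rw [ha, map_zero, zero_sub, neg_eq_zero]
    have h2 : ((x j).2.onOdd X n).op (Y, 0, 0) = ((x j).1 X Y, 0, 0) := by
      rw [IsTorsionFreeConnection.onOdd_apply]
      refine Prod.ext rfl (Prod.ext (map_zero _) ?_)
      funext i
      exact map_zero X
    rw [h2, ha]
  rw [h1, Cochain.mul_zero]

/-- Polyvector fields involve only cotangent arguments, and covariant derivatives preserve the
splitting of the odd arguments; no stage of the recursion creates a form on `M`. -/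
theorem contr_taylor_tangent (U : Polyvectors A (k + 1)) (Y : VectorFields A) :
    contr (Y, 0, 0) (taylor F x (k + 1) U) = 0 := by
  have h1 : ∀ s (Y : VectorFields A), contr (Y, 0, 0) (flowStep F x s
      (ofAlt (oddProj A n) U)) = 0 := by
    intro s
    induction s with
    | zero =>
      intro Y
      refine (contr_ofAlt _ _ _).trans ?_
      have : ins (0 : OneForms A) U = 0 := (U.curryLeft).map_zero
      exact (congrArg (ofAlt (oddProj A n)) this).trans (map_zero _)
    | succ s ih =>
      intro Y
      change contr _ ((1 / ((s : ℝ) + 1)) • (spray F x).op (k + 1) _) = 0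
      rw [map_smul, spray_apply, map_sum]
      refine smul_eq_zero_of_right _ (Finset.sum_eq_zero fun i _ => ?_)
      rw [contr_mul_zero_left _ _ (Nat.zero_add k), contr_familyDer_tangent x _ ih, Cochain.mul_zero]
  refine ext_coeff fun s v => ?_
  have h2 := congrArg (fun a : Cochain A n k => a.coeff s v) (h1 s Y)
  exact h2

end Vanishing

theorem cov_linear {nabla : VectorFields A →ₗ[A] VectorFields A →ₗ[ℝ] VectorFields A}
    (c : IsTorsionFreeConnection nabla) (X : VectorFields A) (α : OneForms A) :
    (c.onCochains X n).op 0 (linear n α) = linear n ((c.onForms X).op α) := by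
  refine ext_coeff fun s v => ?_
  refine (coeff_cov _ _ _ _ _ _).trans ?_
  by_cases hs : s = 1
  · subst hs
    have h := congrArg (fun a : Cochain A n 0 => a.coeff 0 v) (vder_linear (n := n) (nabla X v) α)
    simp only [coeff_vder] at h
    ext1 u
    rw [AlternatingMap.sub_apply, CovDer.alt_zero_apply]
    refine (congrArg₂ (· - ·) (coeffDer_algebraMap X (α v))
      (congrFun (congrArg DFunLike.coe h) u)).trans ?_
    rw [coeff_scalar_zero, ← map_sub]
    rfl
  · have h : (linear n α).coeff s = fun _ => 0 := by
      funext v; rw [coeff_linear, if_neg hs]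
    rw [h, dirDeriv_zero, map_zero, coeff_linear, if_neg hs, sub_zero]

theorem cov_odd {nabla : VectorFields A →ₗ[A] VectorFields A →ₗ[ℝ] VectorFields A}
    (c : IsTorsionFreeConnection nabla) (X Z : VectorFields A) :
    (c.onCochains X n).op 1 (odd n Z) = odd n (nabla X Z) := by
  refine cov_oneForm _ _ _ _ _ fun w => ?_
  rw [coeffDer_algebraMap, ← map_sub]
  congr 1
  change X (w.2.1 Z) - (X (w.2.1 Z) - w.2.1 (nabla X Z)) = w.2.1 (nabla X Z)
  ring

theorem familyDer_single (c : TorsionFreeConnection A) (X : VectorFields A) (a : Cochain A 0 k) :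
    (familyDer (fun _ => c) X).op k a = (c.2.onCochains X 0).op k a := by
  rw [familyDer_apply, Fin.sum_univ_one]
  have : barycentric (A := A) 0 0 = 1 := by simp [barycentric]
  rw [this, scalar_one_mul]

theorem differential_fun (P : PoissonStructure A) (g : A) (β : OneForms A) :
    P.differential 0 (funPoly g) ![β] = P.sharp β g := by
  have h3 := congrFun (congrArg DFunLike.coe (P.cotangentBracket.ins_d_zero β (funPoly g))) ![]
  rw [AnchoredBracket.lie_apply] at h3
  simp only [Finset.univ_eq_empty, Finset.sum_empty, sub_zero] at h3
  exact h3

section LowBrackets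

variable (F : Frame A) (P : PoissonStructure A) (c : TorsionFreeConnection A)
  (D : CurvedLInfty A 0)

/-- The Taylor expansion intertwines the Poisson differential and the differential of `D`. -/
def Intertwines : Prop := ∀ (k : ℕ) (U : Polyvectors A k),
  D.Q k (taylor F (fun _ => c) k U) = taylor F (fun _ => c) (k + 1) (P.differential k U)

variable {F P c D}

theorem CurvedLInfty.order {D : CurvedLInfty A n} {r : ℕ} {a : Cochain A n k} (ha : a.OrderGe (r + 1)) :
    (D.Q k a).OrderGe r := fun i hi => D.continuous k r a (fun i hi => ha i (by omega)) i hi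

/-- In `y_{dg} = j g - g - e` the term `e` has order two and `Q e` has order at least one, so the
lowest component is that of `j [Π, g] - dg`. -/
theorem coeff_Q_linear_grad_zero (hD : Intertwines F P c D) (g : A) (v Y : VectorFields A)
    (β : OneForms A) : (D.Q 0 (linear 0 (grad g))).coeff 0 v ![(Y, β, 0)]
      = algebraMap A (PolyFun A 0) (- Y g + P.sharp β g) := by
  have h1 := taylor_fun_sub F (fun _ : Fin 1 => c) g
  set e := taylor F (fun _ : Fin 1 => c) 0 (funPoly g) - scalar (algebraMap A _ g)
    - linear 0 (grad g) with he
  have h2 : linear 0 (grad g) = taylor F (fun _ : Fin 1 => c) 0 (funPoly g)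
    - scalar (algebraMap A _ g) - e := by rw [he]; abel
  rw [h2, map_sub, map_sub, hD 0, D.Q_fun, coeff_sub, coeff_sub,
    (CurvedLInfty.order h1).coeff_eq (by omega), sub_zero, AlternatingMap.sub_apply,
    coeff_oneForm_zero, coeff_taylor_zero, coeff_ofAlt_zero]
  have h3 : (P.differential 0 (funPoly g) fun i => oddProj A 0 ((![(Y, β, 0)] : Fin 1 → OddArgs A 0) i))
      = P.sharp β g := by
    rw [← differential_fun]
    congr 1
    funext i
    fin_cases i
    rfl
  rw [h3, ← map_sub]
  congr 1
  change P.sharp β g - Y g = _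
  ring

theorem linear_add (α β : OneForms A) : linear n (α + β) = linear n α + linear n β :=
  ext_coeff fun s v => by
    rw [coeff_add]; simp only [coeff_linear]; split_ifs
    · ext u; simp
    · simp

theorem linear_zero : linear n (0 : OneForms A) = 0 :=
  ext_coeff fun s v => by
    simp only [coeff_linear]; split_ifs
    · ext u; simp
    · rfl

theorem linear_smul (a : A) (α : OneForms A) :
    linear n (a • α) = mul rfl (scalar (algebraMap A _ a)) (linear n α) :=
  ext_coeff fun s v => by
    rw [coeff_scalar_mul]; simp only [coeff_linear]; split_ifs
    · ext1 u; simp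
    · simp

/-- Exact forms span. For `a • α` the additional term of the Leibniz rule, `da` times `y_α`, has
degree one and does not enter here. -/
theorem coeff_Q_linear_zero (hD : Intertwines F P c D) (α : OneForms A) (v Y : VectorFields A) (β : OneForms A) :
    (D.Q 0 (linear 0 α)).coeff 0 v ![(Y, β, 0)]
      = algebraMap A (PolyFun A 0) (- α Y + α (P.sharp β)) := by
  have hα : α ∈ Submodule.span A (Set.range fun i => grad (F.f i)) := by rw [F.span_grad]; trivial
  induction hα using Submodule.span_induction with
  | mem α hα =>
    obtain ⟨i, rfl⟩ := hα
    exact coeff_Q_linear_grad_zero hD _ _ _ _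
  | zero => rw [linear_zero, map_zero]; simp
  | add α α' _ _ h h' =>
    rw [linear_add, map_add, coeff_add, AlternatingMap.add_apply, h, h', ← map_add]
    congr 1
    simp only [LinearMap.add_apply]
    ring
  | smul a α _ h =>
    rw [linear_smul, D.leibniz, coeff_add, pow_zero, one_smul, coeff_scalar_mul, D.Q_fun, oneForm,
      coeff_const_mul, coeff_linear, if_neg (by omega), wedge_zero]
    rw [AlternatingMap.add_apply, AlternatingMap.zero_apply, AlternatingMap.smul_apply, h,
      smul_eq_mul, ← map_mul, zero_add]
    congr 1
    simp only [LinearMap.smul_apply, smul_eq_mul]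
    ring

/-- In tangent directions the lowest-order part of `Q` is minus the Koszul differential: this holds
on linear generators by `l₀`, and the Euler identity propagates it through the degrees. It serves
both for `l₁` and for the weight estimate. -/
theorem coeff_Q_tangent (hD : Intertwines F P c D) (r : ℕ) : ∀ (a : Cochain A 0 0),
    a.OrderGe (r + 1) → ∀ v Y : VectorFields A,
    (D.Q 0 a).coeff r v ![(Y, 0, 0)] = - (vder Y a).coeff r v ![] := by
  -- Only the homogeneous component of degree `r + 1` contributes. Written as a combination of
  -- products `yᵢ ∂ᵢ a`, it leaves a term in `Q yᵢ`, which is known, and a term in `Q (∂ᵢ a)` of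
  -- lower degree.
  have reduce : ∀ r, (∀ (a : Cochain A 0 0), a.IsHom (r + 1) → ∀ (v Y : VectorFields A) i,
      (mul (Nat.zero_add 1) (linear 0 (grad (F.f i))) (D.Q 0 (vder (F.X i) a))).coeff r v ![(Y, 0, 0)]
        = - (mul rfl (linear 0 (grad (F.f i))) (vder Y (vder (F.X i) a))).coeff r v ![]) →
      ∀ (a : Cochain A 0 0), a.OrderGe (r + 1) → ∀ v Y : VectorFields A,
        (D.Q 0 a).coeff r v ![(Y, 0, 0)] = - (vder Y a).coeff r v ![] := by
    intro r hr a ha v Y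
    have h1 : (a - comp (r + 1) a).OrderGe (r + 2) := orderGe_iff.2 fun i hi v => by
      rw [coeff_sub, coeff_comp]
      split_ifs with h
      · exact sub_self _
      · rw [ha.coeff_eq (by omega), sub_zero]
    have h3 := isHom_comp (r + 1) a
    have h6 : (D.Q 0 a).coeff r v = (D.Q 0 (comp (r + 1) a)).coeff r v := by
      refine sub_eq_zero.1 ?_
      rw [← coeff_sub, ← map_sub]
      exact (CurvedLInfty.order h1).coeff_eq (by omega) v
    have h7 : (vder Y a).coeff r v = (vder Y (comp (r + 1) a)).coeff r v := by
      refine sub_eq_zero.1 ?_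
      rw [← coeff_sub, ← map_sub]
      exact (h1.vder Y).coeff_eq (by omega) v
    rw [h6, h7]
    generalize comp (r + 1) a = b at h3 ⊢
    have h4 : ((r : ℝ) + 1) • b = ∑ i, mul rfl (linear 0 (grad (F.f i))) (vder (F.X i) b) := by
      rw [sum_linear_mul_vder F, h3.euler]; push_cast; rfl
    have h5 : ((r : ℝ) + 1) • ((D.Q 0 b).coeff r v ![(Y, 0, 0)])
        = ((r : ℝ) + 1) • (- (vder Y b).coeff r v ![]) := by
      rw [← AlternatingMap.smul_apply, ← coeff_smul, ← map_smul, smul_neg,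
        ← AlternatingMap.smul_apply, ← coeff_smul, ← map_smul, h4, map_sum, map_sum, coeff_sum,
        coeff_sum, alternatingMap_sum_apply, alternatingMap_sum_apply, ← Finset.sum_neg_distrib]
      refine Finset.sum_congr rfl fun i _ => ?_
      rw [D.leibniz, vder_mul, coeff_add, coeff_add, pow_zero, one_smul, vder_linear,
        coeff_scalar_mul, AlternatingMap.add_apply, AlternatingMap.add_apply, neg_add]
      refine congrArg₂ (· + ·) ?_ (hr b h3 v Y i)
      rw [coeff_mul_lowest' _ _ ((h3.vder (F.X i)).orderGe), wedge_zero_right,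
        AlternatingMap.smul_apply, AlternatingMap.smul_apply, coeff_Q_linear_zero hD]
      simp [_root_.mul_comm]
    exact smul_right_injective _ (show ((r : ℝ) + 1) ≠ 0 by positivity) h5
  induction r with
  | zero =>
    refine reduce 0 fun a ha v Y i => ?_
    rw [coeff_linear_mul_zero, coeff_linear_mul_zero]
    simp
  | succ r ih =>
    refine reduce (r + 1) fun a ha v Y i => ?_
    rw [coeff_linear_mul_succ, coeff_linear_mul_succ, AlternatingMap.smul_apply,
      AlternatingMap.smul_apply, ih _ ((ha.vder (F.X i)).orderGe), smul_neg]

theorem coeff_taylor_fun_two (g : A) :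
    (euler (taylor F (fun _ : Fin 1 => c) 0 (funPoly g))).coeff 2
      = (∑ i, mul rfl (linear 0 (grad (F.f i))) (linear 0 ((c.2.onForms (F.X i)).op (grad g)))
        : Cochain A 0 0).coeff 2 := by
  have h1 : (taylor F (fun _ : Fin 1 => c) 0 (funPoly g)).coeff 1 = (linear 0 (grad g)).coeff 1 := by
    have h := taylor_fun_sub F (fun _ : Fin 1 => c) g
    funext v
    have h2 := h.coeff_eq (show 1 < 2 by omega) v
    rw [coeff_sub, coeff_sub, scalar, coeff_const, if_neg (by omega), sub_zero] at h2
    exact sub_eq_zero.1 h2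
  have h2 : euler (taylor F (fun _ : Fin 1 => c) 0 (funPoly g)) = _ := euler_flow F _ _
  rw [h2]
  refine (spray_congr F (fun _ : Fin 1 => c) h1).trans ?_
  rw [spray_apply]
  simp only [familyDer_single, cov_linear]

theorem vder_congr (X : VectorFields A) {a b : Cochain A n k} {s : ℕ}
    (h : a.coeff (s + 1) = b.coeff (s + 1)) : (vder X a).coeff s = (vder X b).coeff s := by
  funext v
  rw [coeff_vder, coeff_vder, h]

/-- By the recursion, twice the quadratic part of `j g` is `∑ yᵢ y_{∇ᵢ dg}`. Its derivative at `v`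
along `Y` is the sum of the Hessian at `(Y, v)` and at `(v, Y)`, and these agree because there is no
torsion. -/
theorem coeff_vder_taylor_one (g : A) (v Y : VectorFields A) :
    (vder Y (taylor F (fun _ : Fin 1 => c) 0 (funPoly g))).coeff 1 v ![]
      = algebraMap A (PolyFun A 0) (Y (v g) - c.1 Y v g) := by
  set a := taylor F (fun _ : Fin 1 => c) 0 (funPoly g) with ha
  have h1 : (euler a).coeff 2 = ((2 : ℝ) • a).coeff 2 := by
    funext v; rw [coeff_euler, coeff_smul]; norm_num
  have h2 : (2 : ℝ) • ((vder Y a).coeff 1 v ![])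
      = (2 : ℝ) • algebraMap A (PolyFun A 0) (Y (v g) - c.1 Y v g) := by
    rw [← AlternatingMap.smul_apply, ← coeff_smul, ← map_smul,
      ← vder_congr Y h1, vder_congr Y (coeff_taylor_fun_two g), map_sum, coeff_sum,
      alternatingMap_sum_apply]
    have h3 : ∀ i, (vder Y (mul rfl (linear 0 (grad (F.f i)))
        (linear 0 ((c.2.onForms (F.X i)).op (grad g))))).coeff 1 v ![]
        = algebraMap A (PolyFun A 0) (Y (F.f i) * (F.X i (v g) - c.1 (F.X i) v g)
          + v (F.f i) * (F.X i (Y g) - c.1 (F.X i) Y g)) := by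
      intro i
      rw [vder_mul, vder_linear, vder_linear, coeff_add, coeff_scalar_mul, coeff_mul_scalar,
        AlternatingMap.add_apply, AlternatingMap.smul_apply, AlternatingMap.smul_apply, coeff_linear,
        coeff_linear, if_pos rfl, if_pos rfl]
      simp [IsTorsionFreeConnection.onForms_apply, _root_.mul_comm]
    simp only [h3]
    rw [← map_sum]
    have key : ∀ Y Z : VectorFields A, ∑ i, Y (F.f i) * ((F.X i) (Z g) - (c.1 (F.X i) Z) g)
        = Y (Z g) - c.1 Y Z g := by
      intro Y Z
      let T : VectorFields A →ₗ[A] A :=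
        { toFun := fun Y => Y (Z g) - c.1 Y Z g
          map_add' := fun Y Y' => by simp; ring
          map_smul' := fun a Y => by simp; ring }
      refine Eq.trans ?_ (congrArg T (F.sum_eq Y)).symm
      rw [map_sum]
      exact Finset.sum_congr rfl fun i _ => by rw [map_smul]; rfl
    rw [Finset.sum_add_distrib, key, key]
    have h3 := congrArg (fun D : VectorFields A => D g) (c.2.torsion_free Y v)
    simp only [Derivation.sub_apply, Derivation.commutator_apply] at h3
    have h4 : v (Y g) - c.1 v Y g = Y (v g) - c.1 Y v g := by linear_combination h3
    rw [h4, map_add]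
    module
  exact smul_right_injective _ (show (2 : ℝ) ≠ 0 by norm_num) h2

/-- With `y_{dg} = j g - g - e`, the expansion `j [Π, g]` has no tangent component and `dg` has
degree zero; what is left is `-Q e`, which in this degree is the vertical derivative of `e`. -/
theorem coeff_Q_linear_grad_one (hD : Intertwines F P c D) (g : A) (v Y : VectorFields A) :
    (D.Q 0 (linear 0 (grad g))).coeff 1 v ![(Y, 0, 0)]
      = algebraMap A (PolyFun A 0) (Y (v g) - c.1 Y v g) := by
  have h1 := taylor_fun_sub F (fun _ : Fin 1 => c) g
  set e := taylor F (fun _ : Fin 1 => c) 0 (funPoly g) - scalar (algebraMap A _ g)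
    - linear 0 (grad g) with he
  have h2 : linear 0 (grad g) = taylor F (fun _ : Fin 1 => c) 0 (funPoly g)
    - scalar (algebraMap A _ g) - e := by rw [he]; abel
  have h3 : (taylor F (fun _ : Fin 1 => c) 1 (P.differential 0 (funPoly g))).coeff 1 v ![(Y, 0, 0)]
      = 0 := by
    have := congrArg (fun a : Cochain A 0 0 => a.coeff 1 v ![])
      (contr_taylor_tangent F (fun _ : Fin 1 => c) (P.differential 0 (funPoly g)) Y)
    exact this
  have h4 : (vder Y e).coeff 1 v ![] = algebraMap A (PolyFun A 0) (Y (v g) - c.1 Y v g) := by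
    rw [he, map_sub, map_sub, vder_linear, scalar, vder_const, coeff_sub, coeff_sub, scalar,
      coeff_const, if_neg (by omega), sub_zero, AlternatingMap.sub_apply, coeff_vder_taylor_one]
    exact sub_zero _
  rw [h2, map_sub, map_sub, hD 0, D.Q_fun, coeff_sub, coeff_sub, AlternatingMap.sub_apply,
    AlternatingMap.sub_apply, coeff_Q_tangent hD 1 e h1, h4, coeff_oneForm_succ, h3]
  simp

theorem coeff_Q_linear_one (hD : Intertwines F P c D) (α : OneForms A) (v Y : VectorFields A) :
    (D.Q 0 (linear 0 α)).coeff 1 v ![(Y, 0, 0)]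
      = algebraMap A (PolyFun A 0) (Y (α v) - α (c.1 Y v)) := by
  have hα : α ∈ Submodule.span A (Set.range fun i => grad (F.f i)) := by rw [F.span_grad]; trivial
  induction hα using Submodule.span_induction with
  | mem α hα =>
    obtain ⟨i, rfl⟩ := hα
    exact coeff_Q_linear_grad_one hD _ _ _
  | zero => rw [linear_zero, map_zero]; simp
  | add α α' _ _ h h' =>
    rw [linear_add, map_add, coeff_add, AlternatingMap.add_apply, h, h', ← map_add]
    congr 1
    simp only [LinearMap.add_apply, map_add]
    ring
  | smul a α _ h =>
    rw [linear_smul, D.leibniz, coeff_add, pow_zero, one_smul, coeff_scalar_mul, D.Q_fun, oneForm,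
      coeff_const_mul, coeff_linear, if_pos rfl, wedge_zero_right]
    rw [AlternatingMap.add_apply, AlternatingMap.smul_apply, AlternatingMap.smul_apply, h]
    change algebraMap A (PolyFun A 0) (α v) * algebraMap A (PolyFun A 0) (Y a)
      + algebraMap A _ a * _ = _
    rw [← map_mul, ← map_mul, ← map_add]
    congr 1
    simp only [LinearMap.smul_apply, smul_eq_mul, Derivation.leibniz]
    ring

end LowBrackets

end FormalPoisson

end

/-! ### Low brackets: the odd generators; the map of dg algebras. -/

noncomputable section

namespace FormalPoisson

set_option linter.unusedSectionVars false

variable {A : Type*} [CommRing A] [Algebra ℝ A] {n m k l : ℕ}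

open Cochain

theorem contr_odd (w : OddArgs A n) (X : VectorFields A) :
    contr w (odd n X) = scalar (algebraMap A _ (w.2.1 X)) := contr_oneForm _ _

theorem contr_odd_tangent (Y X : VectorFields A) : contr ((Y, 0, 0) : OddArgs A n) (odd n X) = 0 := by
  rw [contr_odd]
  refine ext_coeff fun s v => ?_
  rw [scalar, coeff_const]
  split_ifs
  · ext u; simp
  · rfl

/-- A one-cochain on `M` that vanishes on tangent arguments is a combination of the `odd (F.X i)`. -/
theorem eq_sum_odd_mul (F : Frame A) {e : Cochain A 0 1}
    (he : ∀ Y : VectorFields A, contr (Y, 0, 0) e = 0) :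
    e = ∑ i, mul (show 1 + 0 = 1 from rfl) (odd 0 (F.X i)) (contr (0, grad (F.f i), 0) e) := by
  have h := sum_oneForm_mul_contr F (show 1 + 0 = 0 + 1 from rfl) e
  rw [Fintype.sum_sum_type, Fintype.sum_sum_type] at h
  simp only [Nat.cast_zero, Finset.univ_eq_empty (α := Fin 0), Finset.sum_empty, add_zero] at h
  rw [Finset.sum_eq_zero fun i _ => ?_] at h
  · exact ((zero_add _).symm.trans (h.trans (by norm_num))).symm
  · change mul _ _ (contr (F.X i, 0, 0) e) = 0
    rw [he, Cochain.mul_zero]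

section LowBrackets

variable {F : Frame A} {P : PoissonStructure A} {c : TorsionFreeConnection A}
  {D : CurvedLInfty A 0}

theorem contr_taylor_sub_odd (X Y : VectorFields A) :
    contr (Y, 0, 0) (taylor F (fun _ : Fin (n + 1) => c) 1 (fieldPoly X) - odd n X) = 0 := by
  rw [map_sub, contr_taylor_tangent, contr_odd_tangent, sub_zero]

/-- The difference `j X - z_X` has no tangent component, so it expands in the odd generators. With
`Q_odd` the Leibniz rule becomes a recursion for `Q z_X`. -/
theorem Q_taylor_sub_odd (X : VectorFields A) :
    D.Q 1 (taylor F (fun _ : Fin 1 => c) 1 (fieldPoly X) - odd 0 X)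
      = ∑ i, (mul (show 2 + 0 = 2 from rfl) (D.Q 1 (odd 0 (F.X i))) (contr (0, grad (F.f i), 0)
          (taylor F (fun _ : Fin 1 => c) 1 (fieldPoly X) - odd 0 X))
        - mul (show 1 + 1 = 2 from rfl) (odd 0 (F.X i)) (D.Q 0 (contr (0, grad (F.f i), 0)
          (taylor F (fun _ : Fin 1 => c) 1 (fieldPoly X) - odd 0 X)))) := by
  conv_lhs => rw [eq_sum_odd_mul F (contr_taylor_sub_odd X), map_sum]
  refine Finset.sum_congr rfl fun i _ => ?_
  rw [D.leibniz]
  simp [sub_eq_add_neg]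

theorem Q_odd (hD : Intertwines F P c D) (X : VectorFields A) :
    D.Q 1 (odd 0 X) = taylor F (fun _ : Fin 1 => c) 2 (P.differential 1 (fieldPoly X))
      - D.Q 1 (taylor F (fun _ : Fin 1 => c) 1 (fieldPoly X) - odd 0 X) := by
  rw [map_sub, hD 1]; abel

/-- In the recursion two tangent contractions kill all terms except multiples of the same quantity
for the `Xᵢ`, with coefficients of positive order. So the quantity has every order and is zero. -/
theorem contr_contr_Q_odd (hD : Intertwines F P c D) (X Y Z : VectorFields A) :
    contr (Z, 0, 0) (contr (Y, 0, 0) (D.Q 1 (odd 0 X))) = 0 := by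
  refine eq_zero_of_orderGe fun r => ?_
  induction r generalizing X with
  | zero => exact orderGe_zero _
  | succ r ih =>
    rw [Q_odd hD, map_sub, contr_taylor_tangent, zero_sub, Q_taylor_sub_odd, map_neg, map_sum, map_sum]
    refine (OrderGe.sum _ fun i _ => ?_).neg
    rw [map_sub, map_sub, contr_mul_zero_right _ (show 1 + 1 + 0 = 1 + 1 from rfl) rfl,
      contr_mul_zero_right _ (show 0 + 1 + 0 = 0 + 1 from rfl) rfl]
    rw [contr_mul _ (show 0 + 1 + (0 + 1) = 1 + 1 from rfl) rfl rfl, contr_odd_tangent,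
      Cochain.zero_mul, map_add, map_zero, map_smul,
      contr_mul_zero_right _ (show 0 + 1 + 0 = 0 + 1 from rfl) rfl,
      contr_odd_tangent, Cochain.zero_mul, smul_zero]
    exact (OrderGe.mul _ (ih _) ((taylor_field_sub F _ X).contr _)).sub
      ((OrderGe.zero _).add (OrderGe.zero _))

theorem coeff_Q_odd_tangent (hD : Intertwines F P c D) (X v Y Z : VectorFields A) (s : ℕ) :
    (D.Q 1 (odd 0 X)).coeff s v ![(Y, 0, 0), (Z, 0, 0)] = 0 :=
  congrArg (fun a : Cochain A 0 0 => a.coeff s v ![]) (contr_contr_Q_odd hD X Y Z)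

/-- The linear part of `j X` is `∑ yᵢ z_{∇ᵢ X}`. -/
theorem coeff_vder_taylor_field (X Y v : VectorFields A) (β : OneForms A) :
    (vder Y (taylor F (fun _ : Fin 1 => c) 1 (fieldPoly X))).coeff 0 v ![(0, β, 0)]
      = algebraMap A (PolyFun A 0) (β (c.1 Y X)) := by
  set a := taylor F (fun _ : Fin 1 => c) 1 (fieldPoly X) with ha
  have h1 : a.coeff 0 = (odd 0 X).coeff 0 := by
    funext v
    refine sub_eq_zero.1 ?_
    rw [← coeff_sub]
    exact (taylor_field_sub F _ X).coeff_eq (by omega) v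
  have h2 : a.coeff 1 = (∑ i, mul (Nat.zero_add 1) (linear 0 (grad (F.f i)))
      (odd 0 (c.1 (F.X i) X)) : Cochain A 0 1).coeff 1 := by
    have h3 : euler a = _ := euler_flow F _ _
    have h4 : a.coeff 1 = (euler a).coeff 1 := by
      funext v; rw [coeff_euler]; simp
    rw [h4, h3]
    refine (spray_congr F _ h1).trans ?_
    rw [spray_apply]
    simp only [familyDer_single, cov_odd]
  rw [vder_congr Y h2, map_sum, coeff_sum, alternatingMap_sum_apply]
  have h5 : ∀ i, (vder Y (mul (Nat.zero_add 1) (linear 0 (grad (F.f i)))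
      (odd 0 (c.1 (F.X i) X)))).coeff 0 v ![(0, β, 0)]
      = algebraMap A (PolyFun A 0) (Y (F.f i) * β (c.1 (F.X i) X)) := by
    intro i
    rw [vder_mul, vder_linear, coeff_add, AlternatingMap.add_apply, coeff_linear_mul_zero,
      coeff_scalar_mul, AlternatingMap.smul_apply, map_mul]
    exact add_zero _
  simp only [h5]
  rw [← map_sum]
  congr 1
  conv_rhs => rw [F.sum_eq Y]
  simp

/-- At order zero the recursion leaves `∑ zᵢ` times `Q` of a coefficient of order one, whose tangent
part is minus a vertical derivative; the frame reassembles the linear part of `j X`. -/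
theorem coeff_Q_odd_mixed (hD : Intertwines F P c D) (X v Y : VectorFields A) (β : OneForms A) :
    (D.Q 1 (odd 0 X)).coeff 0 v ![(Y, 0, 0), (0, β, 0)] = algebraMap A (PolyFun A 0) (β (c.1 Y X)) := by
  rw [Q_odd hD, Q_taylor_sub_odd]
  set e := taylor F (fun _ : Fin 1 => c) 1 (fieldPoly X) - odd 0 X with he
  have he1 : e.OrderGe 1 := taylor_field_sub F _ X
  have h1 : (taylor F (fun _ : Fin 1 => c) 2 (P.differential 1 (fieldPoly X))).coeff 0 v
      ![(Y, 0, 0), (0, β, 0)] = 0 :=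
    congrArg (fun a : Cochain A 0 1 => a.coeff 0 v ![(0, β, 0)])
      (contr_taylor_tangent F (fun _ : Fin 1 => c) (P.differential 1 (fieldPoly X)) Y)
  rw [coeff_sub, AlternatingMap.sub_apply, h1, coeff_sum, alternatingMap_sum_apply, zero_sub,
    ← Finset.sum_neg_distrib]
  have h2 : ∀ i, -(mul (show 2 + 0 = 2 from rfl) (D.Q 1 (odd 0 (F.X i))) (contr (0, grad (F.f i), 0) e)
        - mul (show 1 + 1 = 2 from rfl) (odd 0 (F.X i)) (D.Q 0 (contr (0, grad (F.f i), 0) e))).coeff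
          0 v ![(Y, 0, 0), (0, β, 0)]
      = β (F.X i) • (vder Y e).coeff 0 v ![(0, grad (F.f i), 0)] := by
    intro i
    have h3 : (contr ((0, grad (F.f i), 0) : OddArgs A 0) e).OrderGe (0 + 1) := he1.contr _
    rw [coeff_sub, AlternatingMap.sub_apply, coeff_mul_lowest' _ _ (orderGe_zero _),
      h3.coeff_eq (by omega), wedge_zero_right, coeff_mul_lowest' _ _ (orderGe_zero _), wedge_one_one,
      coeff_Q_tangent hD 0 _ h3]
    have h4 : ((odd 0 (F.X i)).coeff 0 v) ![((Y, 0, 0) : OddArgs A 0)] = 0 := by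
      change algebraMap A (PolyFun A 0) 0 = 0
      simp
    have h5 : ((odd 0 (F.X i)).coeff 0 v) ![((0, β, 0) : OddArgs A 0)]
        = algebraMap A (PolyFun A 0) (β (F.X i)) := rfl
    have h6 : (vder Y (contr ((0, grad (F.f i), 0) : OddArgs A 0) e)).coeff 0 v ![]
        = (vder Y e).coeff 0 v ![(0, grad (F.f i), 0)] := by
      rw [← contr_vder]; rfl
    rw [h4, h5, h6]
    simp [Algebra.smul_def]
  refine (Finset.sum_congr rfl fun i _ => h2 i).trans ?_
  have h7 : ∀ β : OneForms A, (vder Y e).coeff 0 v ![(0, β, 0)]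
      = algebraMap A (PolyFun A 0) (β (c.1 Y X)) := by
    intro β
    rw [he, map_sub, coeff_sub, AlternatingMap.sub_apply, coeff_vder_taylor_field, odd, vder_const]
    exact sub_zero _
  simp only [h7]
  conv_rhs => rw [F.oneForm_eq β]
  simp [Algebra.smul_def]

theorem hasLowBrackets (hD : Intertwines F P c D) : HasLowBrackets P c.1 D where
  l0_tangent := coeff_Q_linear_zero hD
  l1_tangent := coeff_Q_linear_one hD
  l0_cotangent X v Y Z := coeff_Q_odd_tangent hD X v Y Z 0
  l1_cotangent := coeff_Q_odd_mixed hD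
  l1_mixed X v Y Z := coeff_Q_odd_tangent hD X v Y Z 1

theorem taylor_one (x : Fin (n + 1) → TorsionFreeConnection A) :
    taylor F x 0 (AlternatingMap.constOfIsEmpty A _ (Fin 0) 1) = scalar 1 := by
  refine (eq_flow F x ?_ ?_).symm
  · have h : ∀ X, (familyDer x X).op 0 (scalar 1) = 0 := by
      intro X
      rw [familyDer_scalar, ← map_one (algebraMap A (PolyFun A n)), coeffDer_algebraMap,
        Derivation.map_one_eq_zero, map_zero, scalar_zero]
    rw [spray_apply]
    simp only [h, Cochain.mul_zero, Finset.sum_const_zero]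
    refine ext_coeff fun s v => ?_
    rw [coeff_euler, scalar, coeff_const]
    split_ifs with hs
    · subst hs; simp
    · simp
  · funext v
    ext u
    simp [scalar, coeff_const, coeff_ofAlt_zero]

/-- The Taylor expansion as a map of dg algebras. -/
def taylorMap (hD : Intertwines F P c D) : TaylorMap P D where
  j := taylor F (fun _ => c)
  map_one := taylor_one _
  map_wedge _ _ _ h U V := taylor_wedge F _ h U V
  comm := hD
  zeroth_jet k U v Y β := by
    rw [coeff_taylor_zero, coeff_ofAlt_zero]; rfl

end LowBrackets

end FormalPoisson

end

/-! ### Further operators on cochains. -/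

noncomputable section

namespace FormalPoisson

set_option linter.unusedSectionVars false

variable {A : Type*} [CommRing A] [Algebra ℝ A] {n m k l : ℕ}

namespace Cochain

/-- Multiplication of the components of a cochain by real numbers that depend on the degree. -/
def scale (g : ℕ → ℝ) : Cochain A n k →ₗ[ℝ] Cochain A n k where
  toFun a := ofCoeff (fun s v => g s • a.coeff s v) fun s => by
    have : (fun v => g s • a.coeff s v) = algebraMap ℝ A (g s) • a.coeff s := by
      funext v; exact real_smul_coeff _ _
    rw [this]
    exact Submodule.smul_mem _ _ (a.coeff_mem s)
  map_add' a b := ext_coeff fun s v => smul_add _ _ _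
  map_smul' c a := ext_coeff fun s v => smul_comm (g s) c (a.coeff s v)

theorem coeff_scale (g : ℕ → ℝ) (a : Cochain A n k) (s : ℕ) (v : VectorFields A) :
    (scale g a).coeff s v = g s • a.coeff s v := rfl

theorem contr_scale (g : ℕ → ℝ) (w : OddArgs A n) (a : Cochain A n (k + 1)) :
    contr w (scale g a) = scale g (contr w a) := rfl

theorem contr_euler (w : OddArgs A n) (a : Cochain A n (k + 1)) :
    contr w (euler a) = euler (contr w a) := rfl

theorem contr_comp (w : OddArgs A n) (s : ℕ) (a : Cochain A n (k + 1)) :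
    contr w (comp s a) = comp s (contr w a) := ext_coeff fun i v => by
  rw [coeff_contr, coeff_comp, coeff_comp]
  split_ifs
  · rfl
  · exact map_zero _

theorem vder_scale (g : ℕ → ℝ) (X : VectorFields A) (a : Cochain A n k) :
    vder X (scale g a) = scale (fun s => g (s + 1)) (vder X a) := ext_coeff fun s v => by
  rw [coeff_scale, coeff_vder, coeff_vder]
  have h : (scale g a).coeff (s + 1) = fun v => (algebraMap ℝ A (g (s + 1)) •
      LinearMap.id (R := A) (M := Coeff A n k)) (a.coeff (s + 1) v) := by
    funext v; rw [coeff_scale, real_smul_coeff]; rfl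
  rw [h, dirDeriv_comp (a.coeff_mem _), real_smul_coeff]
  rfl

theorem mul_scale_scalar (g : ℕ → ℝ) (h : k + l = m) (b : Coeff A n k) (a : Cochain A n l) :
    mul h (const b) (scale g a) = scale g (mul h (const b) a) := ext_coeff fun s v => by
  rw [coeff_const_mul, coeff_scale, coeff_scale, coeff_const_mul, real_smul_coeff, real_smul_coeff,
    wedge_smul_right']

theorem vder_add_left (X Y : VectorFields A) (a : Cochain A n k) :
    vder (X + Y) a = vder X a + vder Y a := ext_coeff fun s v => by
  rw [coeff_add, coeff_vder, coeff_vder, coeff_vder, dirDeriv_add_right (a.coeff_mem _)]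

theorem vder_smul_left (g : A) (X : VectorFields A) (a : Cochain A n k) :
    vder (g • X) a = mul (Nat.zero_add k) (scalar (algebraMap A _ g)) (vder X a) :=
  ext_coeff fun s v => by
    rw [coeff_scalar_mul, coeff_vder, coeff_vder, dirDeriv_smul_right (a.coeff_mem _)]
    ext u
    simp [Algebra.smul_def]

theorem vder_zero_left (a : Cochain A n k) : vder (0 : VectorFields A) a = 0 := by
  rw [← zero_smul A (0 : VectorFields A), vder_smul_left, map_zero, scalar_zero, Cochain.zero_mul]

theorem sum_scalar_mul_vder (F : Frame A) (Y : VectorFields A) (a : Cochain A n k) :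
    ∑ i, mul (Nat.zero_add k) (scalar (algebraMap A _ (Y (F.f i)))) (vder (F.X i) a) = vder Y a := by
  classical
  conv_rhs => rw [F.sum_eq Y]
  have h : ∀ S : Finset (Fin F.N), ∑ i ∈ S, mul (Nat.zero_add k) (scalar (algebraMap A _ (Y (F.f i))))
      (vder (F.X i) a) = vder (∑ i ∈ S, Y (F.f i) • F.X i) a := by
    intro S
    induction S using Finset.induction_on with
    | empty => simp [vder_zero_left]
    | insert i S hi ih => rw [Finset.sum_insert hi, Finset.sum_insert hi, ih, vder_add_left,
        vder_smul_left]
  exact h _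

theorem contr_add_left (w w' : OddArgs A n) (a : Cochain A n (k + 1)) :
    contr (w + w') a = contr w a + contr w' a := ext_coeff fun _ _ => ins_add_left _ _ _

theorem contr_smul_left (g : A) (w : OddArgs A n) (a : Cochain A n (k + 1)) :
    contr (g • w) a = mul (Nat.zero_add k) (scalar (algebraMap A _ g)) (contr w a) :=
  ext_coeff fun s v => by
    rw [coeff_scalar_mul, coeff_contr, coeff_contr, ins_smul_left]
    ext u
    simp [Algebra.smul_def]

theorem contr_zero_left (a : Cochain A n (k + 1)) : contr (0 : OddArgs A n) a = 0 := by
  rw [← zero_smul A (0 : OddArgs A n), contr_smul_left, map_zero, scalar_zero, Cochain.zero_mul]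

theorem sum_scalar_mul_contr_tangent (F : Frame A) (Y : VectorFields A) (a : Cochain A n (k + 1)) :
    ∑ i, mul (Nat.zero_add k) (scalar (algebraMap A _ (Y (F.f i)))) (contr (F.X i, 0, 0) a)
      = contr (Y, 0, 0) a := by
  classical
  conv_rhs => rw [F.sum_eq Y]
  have h : ∀ S : Finset (Fin F.N), ∑ i ∈ S, mul (Nat.zero_add k) (scalar (algebraMap A _ (Y (F.f i))))
      (contr (F.X i, 0, 0) a) = contr (∑ i ∈ S, Y (F.f i) • F.X i, 0, 0) a := by
    intro S
    induction S using Finset.induction_on with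
    | empty =>
      rw [Finset.sum_empty, Finset.sum_empty]
      exact (contr_zero_left a).symm
    | insert i S hi ih =>
      rw [Finset.sum_insert hi, Finset.sum_insert hi, ih, ← contr_smul_left, ← contr_add_left]
      simp
  exact h _

theorem contr_oneForm_mul (w : OddArgs A n) (φ : OddArgs A n →ₗ[A] A) (a : Cochain A n (k + 1)) :
    contr w (mul (Nat.add_comm 1 (k + 1)) (oneForm φ) a)
      = mul (Nat.zero_add (k + 1)) (scalar (algebraMap A _ (φ w))) a
        - mul (Nat.add_comm 1 k) (oneForm φ) (contr w a) := by
  rw [contr_mul w (k := 0) (l := k) (m := k + 1) (by omega) (by omega) (by omega), contr_oneForm]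
  simp [sub_eq_add_neg]

theorem contr_oneForm_mul_zero (w : OddArgs A n) (φ : OddArgs A n →ₗ[A] A) (a : Cochain A n 0) :
    contr w (mul (Nat.add_comm 1 0) (oneForm φ) a)
      = mul (Nat.zero_add 0) (scalar (algebraMap A _ (φ w))) a := by
  rw [contr_mul_zero_right w (show 0 + 1 + 0 = 0 + 1 from rfl) rfl, contr_oneForm]

end Cochain

open Cochain

/-! ### The Koszul differential and its contracting homotopy. -/

section Koszul

variable (F : Frame A)

/-- The exterior derivative of a function, as a linear function of the odd arguments. -/
abbrev gradArg (n : ℕ) (g : A) : OddArgs A n →ₗ[A] A := grad g ∘ₗ LinearMap.fst A _ _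

/-- The Koszul differential `∑ᵢ dfᵢ ∂/∂Xᵢ`. -/
def koszul : Cochain A n k →ₗ[ℝ] Cochain A n (k + 1) :=
  ∑ i, mulHom (Nat.add_comm 1 k) (oneForm (gradArg n (F.f i))) ∘ₗ vder (F.X i)

/-- The contracting homotopy `∑ᵢ yᵢ ι(Xᵢ)` of the Koszul differential. -/
def radialContr : Cochain A n (k + 1) →ₗ[ℝ] Cochain A n k :=
  ∑ i, mulHom (Nat.zero_add k) (linear n (grad (F.f i))) ∘ₗ contr (F.X i, 0, 0)

/-- The operator that multiplies cochains of degree `p` in the tangent arguments by `p`. -/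
def tangentDegree (k : ℕ) : Cochain A n k →ₗ[ℝ] Cochain A n k :=
  match k with
  | 0 => 0
  | k + 1 => ∑ i, mulHom (Nat.add_comm 1 k) (oneForm (gradArg n (F.f i))) ∘ₗ contr (F.X i, 0, 0)

theorem koszul_apply (a : Cochain A n k) : koszul F a
    = ∑ i, mul (Nat.add_comm 1 k) (oneForm (gradArg n (F.f i))) (vder (F.X i) a) := by
  rw [koszul, LinearMap.sum_apply]; rfl

theorem radialContr_apply (a : Cochain A n (k + 1)) : radialContr F a
    = ∑ i, mul (Nat.zero_add k) (linear n (grad (F.f i))) (contr (F.X i, 0, 0) a) := by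
  rw [radialContr, LinearMap.sum_apply]; rfl

theorem tangentDegree_succ (a : Cochain A n (k + 1)) : tangentDegree F (k + 1) a
    = ∑ i, mul (Nat.add_comm 1 k) (oneForm (gradArg n (F.f i))) (contr (F.X i, 0, 0) a) := by
  rw [tangentDegree, LinearMap.sum_apply]; rfl

theorem scalar_zero_mul (a : Cochain A n k) :
    mul (Nat.zero_add k) (scalar (algebraMap A _ 0)) a = 0 := by
  rw [map_zero, scalar_zero, Cochain.zero_mul]

theorem contr_koszul_tangent (Y : VectorFields A) (a : Cochain A n (k + 1)) :
    contr (Y, 0, 0) (koszul F a) = vder Y a - koszul F (contr (Y, 0, 0) a) := by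
  rw [koszul_apply, koszul_apply, map_sum, ← sum_scalar_mul_vder F Y a, ← Finset.sum_sub_distrib]
  refine Finset.sum_congr rfl fun i _ => ?_
  rw [contr_oneForm_mul, contr_vder]
  rfl

theorem contr_koszul_tangent_zero (Y : VectorFields A) (a : Cochain A n 0) :
    contr (Y, 0, 0) (koszul F a) = vder Y a := by
  rw [koszul_apply, map_sum, ← sum_scalar_mul_vder F Y a]
  refine Finset.sum_congr rfl fun i _ => ?_
  rw [contr_oneForm_mul_zero]
  rfl

theorem contr_tangentDegree_tangent (Y : VectorFields A) (a : Cochain A n (k + 1)) :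
    contr (Y, 0, 0) (tangentDegree F (k + 1) a)
      = contr (Y, 0, 0) a + tangentDegree F k (contr (Y, 0, 0) a) := by
  rw [← sum_scalar_mul_contr_tangent F Y a, tangentDegree_succ, map_sum]
  rcases k with _ | k
  · simp only [contr_oneForm_mul_zero]
    exact (add_zero _).symm
  · rw [sum_scalar_mul_contr_tangent F Y a, tangentDegree_succ,
      ← sum_scalar_mul_contr_tangent F Y a, ← Finset.sum_add_distrib]
    refine Finset.sum_congr rfl fun i _ => ?_
    rw [contr_oneForm_mul, sum_scalar_mul_contr_tangent F Y a, contr_contr (F.X i, 0, 0) (Y, 0, 0),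
      Cochain.mul_neg]
    exact sub_eq_add_neg _ _

theorem contr_tangentDegree_cotangent (β : OneForms A) (a : Cochain A n (k + 1)) :
    contr (0, β, 0) (tangentDegree F (k + 1) a) = tangentDegree F k (contr (0, β, 0) a) := by
  rw [tangentDegree_succ, map_sum]
  have h : ∀ i, gradArg n (F.f i) ((0, β, 0) : OddArgs A n) = 0 := fun i =>
    (grad (F.f i)).map_zero
  rcases k with _ | k
  · simp only [contr_oneForm_mul_zero, h, scalar_zero_mul, Finset.sum_const_zero]
    rfl
  · rw [tangentDegree_succ]
    refine Finset.sum_congr rfl fun i _ => ?_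
    rw [contr_oneForm_mul, h, scalar_zero_mul, zero_sub, contr_contr (F.X i, 0, 0) (0, β, 0),
      Cochain.mul_neg]

theorem sum_gradArg (g : A) : ∑ i, mul (Nat.add_comm 1 0) (oneForm (gradArg n (F.f i)))
    (scalar (algebraMap A _ (F.X i g))) = oneForm (gradArg n g) := by
  refine ext_contr fun w => ?_
  rw [map_sum]
  simp only [contr_oneForm_mul_zero, contr_oneForm, ← scalar_mul, ← map_mul]
  rw [← scalar_sum, ← map_sum]
  congr 2
  exact (F.sum_apply w.1 g).symm

theorem koszul_linear_mul (g : A) (a : Cochain A n k) :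
    koszul F (mul (Nat.zero_add k) (linear n (grad g)) a)
      = mul (Nat.add_comm 1 k) (oneForm (gradArg n g)) a
        + mul (Nat.zero_add (k + 1)) (linear n (grad g)) (koszul F a) := by
  rw [koszul_apply, koszul_apply, Cochain.mul_sum, ← sum_gradArg F g, Cochain.sum_mul,
    ← Finset.sum_add_distrib]
  refine Finset.sum_congr rfl fun i _ => ?_
  rw [vder_mul, vder_linear, Cochain.mul_add]
  refine congrArg₂ (· + ·) ?_ ?_
  · exact (Cochain.mul_assoc (A := A) (n := n) (Nat.add_comm 1 0) (Nat.add_comm 1 k) (Nat.zero_add k) (Nat.add_comm 1 k)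
      _ _ _).symm
  · rw [Cochain.mul_left_comm (q := k + 1) _ _ (Nat.add_comm 1 k) (by omega)]
    simp

/-- The anticommutator of `∑ dfᵢ ∂/∂Xᵢ` and `∑ yᵢ ι(Xᵢ)` counts the even variables and the tangent
arguments together. -/
theorem koszul_radialContr (a : Cochain A n (k + 1)) :
    koszul F (radialContr F a) + radialContr F (koszul F a)
      = euler a + tangentDegree F (k + 1) a := by
  rw [radialContr_apply, radialContr_apply, map_sum, tangentDegree_succ, ← Finset.sum_add_distrib,
    ← sum_linear_mul_vder F (Nat.zero_add (k + 1)), ← Finset.sum_add_distrib]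
  refine Finset.sum_congr rfl fun i _ => ?_
  rw [koszul_linear_mul, contr_koszul_tangent, Cochain.mul_sub]
  abel

/-- The Koszul differential lowers the polynomial degree by one, which shifts the index of the
scaling factors. -/
theorem koszul_scale (g : ℕ → ℝ) (a : Cochain A n k) :
    koszul F (scale g a) = scale (fun s => g (s + 1)) (koszul F a) := by
  rw [koszul_apply, koszul_apply, map_sum]
  refine Finset.sum_congr rfl fun i _ => ?_
  rw [vder_scale, oneForm, mul_scale_scalar]

theorem radialContr_taylor (x : Fin (n + 1) → TorsionFreeConnection A) (U : Polyvectors A (k + 1)) :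
    radialContr F (taylor F x (k + 1) U) = 0 := by
  rw [radialContr_apply]
  refine Finset.sum_eq_zero fun i _ => ?_
  rw [contr_taylor_tangent, Cochain.mul_zero]

theorem koszul_leibniz (h : k + l = m) (a : Cochain A n k) (b : Cochain A n l) :
    koszul F (mul h a b) = mul (by omega) (koszul F a) b
      + (-1 : ℝ) ^ k • mul (by omega) a (koszul F b) := by
  rw [koszul_apply, koszul_apply, koszul_apply, Cochain.mul_sum, Cochain.sum_mul, Finset.smul_sum,
    ← Finset.sum_add_distrib]
  refine Finset.sum_congr rfl fun i _ => ?_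
  rw [vder_mul, Cochain.mul_add]
  refine congrArg₂ (· + ·) ?_ ?_
  · exact (Cochain.mul_assoc _ _ _ _ _ _ _).symm
  · rw [Cochain.mul_left_comm (q := l + 1) _ _ (Nat.add_comm 1 l) (by omega)]
    simp

end Koszul

/-! ### The weight filtration. -/

section Weight

/-- The filtration of the cochains in which the even variables and the tangent arguments have weight
one, and the cotangent arguments have weight two. -/
def WeightGe (k r : ℕ) (a : Cochain A 0 k) : Prop :=
  match k, a with
  | 0, a => a.OrderGe r
  -- Truncated subtraction is harmless: weight at least zero is no condition, see
  -- `weightGe_zero_right`.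
  | k + 1, a => (∀ Y : VectorFields A, WeightGe k (r - 1) (contr (Y, 0, 0) a)) ∧
      ∀ β : OneForms A, WeightGe k (r - 2) (contr (0, β, 0) a)

theorem WeightGe.mono {r r' : ℕ} {a : Cochain A 0 k} (h : WeightGe k r a) (hr : r' ≤ r) :
    WeightGe k r' a := by
  induction k generalizing r r' with
  | zero => exact OrderGe.mono h hr
  | succ k ih => exact ⟨fun Y => ih (h.1 Y) (by omega), fun β => ih (h.2 β) (by omega)⟩

theorem weightGe_zero_right (a : Cochain A 0 k) : WeightGe k 0 a := by
  induction k with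
  | zero => exact orderGe_zero a
  | succ k ih => exact ⟨fun Y => ih _, fun β => ih _⟩

theorem WeightGe.zero (k r : ℕ) : WeightGe k r (0 : Cochain A 0 k) := by
  induction k generalizing r with
  | zero => exact OrderGe.zero r
  | succ k ih => exact ⟨fun Y => by rw [map_zero]; exact ih _, fun β => by rw [map_zero]; exact ih _⟩

theorem WeightGe.add {r : ℕ} {a b : Cochain A 0 k} (ha : WeightGe k r a) (hb : WeightGe k r b) :
    WeightGe k r (a + b) := by
  induction k generalizing r with
  | zero => exact OrderGe.add ha hb
  | succ k ih => exact ⟨fun Y => by rw [map_add]; exact ih (ha.1 Y) (hb.1 Y),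
      fun β => by rw [map_add]; exact ih (ha.2 β) (hb.2 β)⟩

theorem WeightGe.scale (g : ℕ → ℝ) {r : ℕ} {a : Cochain A 0 k} (ha : WeightGe k r a) :
    WeightGe k r (Cochain.scale g a) := by
  induction k generalizing r with
  | zero =>
    refine orderGe_iff.2 fun i hi v => ?_
    rw [coeff_scale, OrderGe.coeff_eq ha hi, smul_zero]
  | succ k ih => exact ⟨fun Y => by rw [contr_scale]; exact ih (ha.1 Y),
      fun β => by rw [contr_scale]; exact ih (ha.2 β)⟩

theorem WeightGe.smul (c : ℝ) {r : ℕ} {a : Cochain A 0 k} (ha : WeightGe k r a) :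
    WeightGe k r (c • a) := by
  have h : Cochain.scale (fun _ => c) a = c • a := ext_coeff fun s v => by rw [coeff_scale, coeff_smul]
  rw [← h]
  exact ha.scale _

theorem WeightGe.neg {r : ℕ} {a : Cochain A 0 k} (ha : WeightGe k r a) : WeightGe k r (-a) := by
  rw [← neg_one_smul ℝ]; exact ha.smul _

theorem WeightGe.sub {r : ℕ} {a b : Cochain A 0 k} (ha : WeightGe k r a) (hb : WeightGe k r b) :
    WeightGe k r (a - b) := by
  rw [sub_eq_add_neg]; exact ha.add hb.neg

theorem WeightGe.sum {ι : Type*} (S : Finset ι) {r : ℕ} {a : ι → Cochain A 0 k}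
    (ha : ∀ i ∈ S, WeightGe k r (a i)) : WeightGe k r (∑ i ∈ S, a i) := by
  classical
  induction S using Finset.induction_on with
  | empty => exact WeightGe.zero _ _
  | insert i S hi ih =>
    rw [Finset.sum_insert hi]
    exact (ha i (Finset.mem_insert_self _ _)).add (ih fun j hj => ha j (Finset.mem_insert_of_mem hj))

theorem WeightGe.mul (h : k + l = m) {r r' : ℕ} {a : Cochain A 0 k} {b : Cochain A 0 l}
    (ha : WeightGe k r a) (hb : WeightGe l r' b) : WeightGe m (r + r') (Cochain.mul h a b) := by
  induction m generalizing k l r r' with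
  | zero =>
    obtain rfl : k = 0 := by omega
    obtain rfl : l = 0 := by omega
    exact OrderGe.mul h ha hb
  | succ m ih =>
    rcases k with _ | k
    · obtain rfl : l = m + 1 := by omega
      refine ⟨fun Y => ?_, fun β => ?_⟩ <;> rw [contr_mul_zero_left _ _ (Nat.zero_add m)]
      · exact (ih _ ha (hb.1 Y)).mono (by omega)
      · exact (ih _ ha (hb.2 β)).mono (by omega)
    · rcases l with _ | l
      · obtain rfl : k = m := by omega
        refine ⟨fun Y => ?_, fun β => ?_⟩ <;> rw [contr_mul_zero_right _ _ (Nat.add_zero k)]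
        · exact (ih _ (ha.1 Y) hb).mono (by omega)
        · exact (ih _ (ha.2 β) hb).mono (by omega)
      · refine ⟨fun Y => ?_, fun β => ?_⟩ <;>
          rw [contr_mul _ _ (show k + (l + 1) = m by omega) (show k + 1 + l = m by omega)]
        · exact ((ih _ (ha.1 Y) hb).mono (by omega)).add
            (((ih _ ha (hb.1 Y)).mono (by omega)).smul _)
        · exact ((ih _ (ha.2 β) hb).mono (by omega)).add
            (((ih _ ha (hb.2 β)).mono (by omega)).smul _)

/-- Each odd argument accounts for at most two units of weight, the rest must come from even
variables. So convergence in weight is convergence in order. -/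
theorem WeightGe.orderGe {r : ℕ} {a : Cochain A 0 k} (ha : WeightGe k r a) : a.OrderGe (r - 2 * k) := by
  induction k generalizing r with
  | zero => exact OrderGe.mono ha (by omega)
  | succ k ih =>
    refine orderGe_iff.2 fun i hi v => ins_ext fun w => ?_
    have hw : w = (w.1, 0, 0) + (0, w.2.1, 0) := by
      refine Prod.ext (by simp) (Prod.ext (by simp) (Subsingleton.elim _ _))
    rw [← coeff_contr, hw, contr_add_left, coeff_add, (ih (ha.1 w.1)).coeff_eq (by omega),
      (ih (ha.2 w.2.1)).coeff_eq (by omega), add_zero, map_zero]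

/-- A tangent argument of weight one is traded for an even variable of weight one. -/
theorem WeightGe.radialContr (F : Frame A) {r : ℕ} {a : Cochain A 0 (k + 1)}
    (ha : WeightGe (k + 1) r a) : WeightGe k r (radialContr F a) := by
  rw [radialContr_apply]
  have h : ∀ i, WeightGe 0 1 (linear 0 (grad (F.f i))) := fun i => orderGe_linear _
  exact WeightGe.sum _ fun i _ => ((h i).mul _ (ha.1 _)).mono (by omega)

/-- All odd arguments that remain are cotangent and count twice. The transport in the hypothesis
lets one statement include degree zero, where it is vacuous. -/
theorem weightGe_of_contr_tangent {r : ℕ} {a : Cochain A 0 k} (ha : a.OrderGe r)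
    (h : ∀ (j : ℕ) (hj : k = j + 1) (Y : VectorFields A), contr (Y, 0, 0) (hj ▸ a) = 0) :
    WeightGe k (r + 2 * k) a := by
  induction k generalizing r with
  | zero => exact ha
  | succ k ih =>
    refine ⟨fun Y => ?_, fun β => ?_⟩
    · rw [show contr (Y, 0, 0) a = 0 from h k rfl Y]; exact WeightGe.zero _ _
    · refine (ih (ha.contr _) fun j hj Y => ?_).mono (by omega)
      subst hj
      have h1 : contr (Y, 0, 0) a = 0 := h _ rfl Y
      change contr (Y, 0, 0) (contr (0, β, 0) a) = 0
      rw [contr_contr, h1, map_zero, neg_zero]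

/-- In exact weight `r = s + p + 2 q`, with polynomial degree `s`, `p` tangent and `q` cotangent
arguments and `p + q = k`, one has `p = s + 2 k - r`. Modulo higher weight the tangent degree is
thus a function of `s`, which can be inverted by a mere scaling of components. -/
theorem weightGe_numberOperator (F : Frame A) {r : ℕ} {a : Cochain A 0 k} (ha : WeightGe k r a) :
    WeightGe k (r + 1) (euler a + (2 * (k : ℝ) - r) • a - tangentDegree F k a) := by
  induction k generalizing r with
  | zero =>
    refine orderGe_iff.2 fun i hi v => ?_
    change (i : ℝ) • a.coeff i v + (2 * ((0 : ℕ) : ℝ) - r) • a.coeff i v - 0 = 0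
    rcases (Nat.lt_succ_iff_lt_or_eq).1 hi with h | rfl
    · rw [OrderGe.coeff_eq ha h]; simp
    · rw [← add_smul]; simp
  | succ k ih =>
    refine ⟨fun Y => ?_, fun β => ?_⟩
    · rcases r with _ | r
      · exact weightGe_zero_right _
      have h := ih (ha.1 Y)
      refine WeightGe.mono (r := r + 1) ?_ (by omega)
      refine (congrArg (WeightGe k (r + 1)) ?_).mpr h
      rw [map_sub, map_add, map_smul, contr_euler, contr_tangentDegree_tangent]
      simp only [Nat.add_sub_cancel]
      push_cast
      module
    · rcases r with _ | _ | r
      · exact weightGe_zero_right _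
      · exact weightGe_zero_right _
      have h := ih (ha.2 β)
      refine WeightGe.mono (r := r + 1) ?_ (by omega)
      refine (congrArg (WeightGe k (r + 1)) ?_).mpr h
      rw [map_sub, map_add, map_smul, contr_euler, contr_tangentDegree_cotangent]
      simp only [show r + 1 + 1 - 2 = r from rfl]
      push_cast
      module

end Weight

end FormalPoisson

end

/-! ### Comparison with Poisson cohomology. -/

noncomputable section

namespace FormalPoisson

set_option linter.unusedSectionVars false

variable {A : Type*} [CommRing A] [Algebra ℝ A] {n m k l : ℕ}

open Cochain

theorem weightGe_gradArg (g : A) : WeightGe 1 1 (oneForm (gradArg 0 g)) := by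
  refine ⟨fun Y => orderGe_zero _, fun β => ?_⟩
  have h : gradArg 0 g ((0, β, 0) : OddArgs A 0) = 0 := (grad g).map_zero
  rw [contr_oneForm, h, map_zero, scalar_zero]
  exact WeightGe.zero _ _

theorem weightGe_odd (X : VectorFields A) : WeightGe 1 2 (odd 0 X) := by
  refine ⟨fun Y => ?_, fun β => orderGe_zero _⟩
  rw [contr_odd_tangent]
  exact WeightGe.zero _ _

section Cohomology

variable (F : Frame A) {P : PoissonStructure A} {c : TorsionFreeConnection A} (D : CurvedLInfty A 0)

/-- The part of the differential complementary to the (negative of the) Koszul differential. -/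
def remainder : Cochain A 0 k →ₗ[ℝ] Cochain A 0 (k + 1) := D.Q k + koszul F

theorem remainder_apply (a : Cochain A 0 k) : remainder F D a = D.Q k a + koszul F a := rfl

theorem remainder_leibniz (h : k + l = m) (a : Cochain A 0 k) (b : Cochain A 0 l) :
    remainder F D (mul h a b) = mul (by omega) (remainder F D a) b
      + (-1 : ℝ) ^ k • mul (by omega) a (remainder F D b) := by
  rw [remainder_apply, remainder_apply, remainder_apply, D.leibniz k l m h, koszul_leibniz,
    Cochain.add_mul, Cochain.mul_add, smul_add]
  abel

theorem koszul_oneForm (φ : OddArgs A 0 →ₗ[A] A) : koszul F (oneForm φ) = 0 := by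
  rw [koszul_apply]
  refine Finset.sum_eq_zero fun i _ => ?_
  have h : vder (F.X i) (oneForm φ) = 0 := vder_const _ _
  rw [h, Cochain.mul_zero]

variable {F D}

/-- In degree two, weight below three is possible only with two tangent arguments, and that
component vanishes by `contr_contr_Q_odd`. -/
theorem weightGe_remainder_odd (hD : Intertwines F P c D) (X : VectorFields A) :
    WeightGe 2 3 (remainder F D (odd 0 X)) := by
  have h : koszul F (odd 0 X) = 0 := koszul_oneForm F _
  rw [remainder_apply, h, add_zero]
  refine ⟨fun Y => ⟨fun Z => ?_, fun β => orderGe_zero _⟩, fun β =>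
    ⟨fun Z => orderGe_zero _, fun β => orderGe_zero _⟩⟩
  rw [contr_contr_Q_odd hD]
  exact WeightGe.zero _ _

/-- `Q` lowers the order by at most one, which is enough in cotangent directions; in tangent
directions the lowest part is cancelled by the Koszul term (`coeff_Q_tangent`). -/
theorem weightGe_remainder_zero (hD : Intertwines F P c D) {r : ℕ} {a : Cochain A 0 0}
    (ha : WeightGe 0 r a) : WeightGe 1 (r + 1) (remainder F D a) := by
  have ha' : a.OrderGe r := ha
  rcases r with _ | r
  · exact ⟨fun Y => orderGe_zero _, fun β => orderGe_zero _⟩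
  have hR : (remainder F D a).OrderGe r := by
    rw [remainder_apply]
    refine (CurvedLInfty.order ha').add ?_
    rw [koszul_apply]
    exact OrderGe.sum _ fun i _ => ((orderGe_zero _).mul _ (ha'.vder (F.X i))).mono (by omega)
  refine ⟨fun Y => orderGe_iff.2 fun i hi v => ?_, fun β => hR.contr _⟩
  rcases Nat.lt_or_ge i r with h | h
  · exact (hR.contr _).coeff_eq h v
  obtain rfl : i = r := by omega
  rw [remainder_apply, map_add, contr_koszul_tangent_zero, coeff_add]
  ext u
  obtain rfl : u = ![] := Subsingleton.elim _ _
  rw [AlternatingMap.add_apply]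
  have h1 := coeff_Q_tangent hD i a ha' v Y
  have h2 : (contr ((Y, 0, 0) : OddArgs A 0) (D.Q 0 a)).coeff i v ![]
      = (D.Q 0 a).coeff i v ![(Y, 0, 0)] := rfl
  rw [h2, h1]
  simp

/-- The remainder is a derivation, so by the odd Euler identity it is enough to know it on cochains
of degree zero and on the coframe. Weight two for the odd generators is what makes this work: `Q y`
contains the term in `z` given by `Π`, which with weight one would compete with the Koszul part. -/
theorem WeightGe.remainder (hD : Intertwines F P c D) {r : ℕ} {a : Cochain A 0 k}
    (ha : WeightGe k r a) : WeightGe (k + 1) (r + 1) (remainder F D a) := by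
  induction k generalizing r with
  | zero => exact weightGe_remainder_zero hD ha
  | succ k ih =>
    have h := sum_oneForm_mul_contr F (Nat.add_comm 1 k) a
    have ha' : a = (1 / ((k : ℝ) + 1)) • ((k : ℝ) + 1) • a := by
      rw [smul_smul, one_div_mul_cancel (by positivity), one_smul]
    rw [ha', ← h, map_smul, map_sum]
    have key : ∀ (w : ℕ) (φ : OddArgs A 0 →ₗ[A] A) (b : Cochain A 0 k),
        WeightGe 1 w (oneForm φ) → WeightGe 2 (w + 1) (FormalPoisson.remainder F D (oneForm φ)) →
        WeightGe k (r - w) b →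
        WeightGe (k + 1 + 1) (r + 1) (FormalPoisson.remainder F D
          (Cochain.mul (Nat.add_comm 1 k) (oneForm φ) b)) := by
      intro w φ b h1 h2 h3
      rw [remainder_leibniz]
      exact ((h2.mul _ h3).mono (by omega)).add (((h1.mul _ (ih h3)).mono (by omega)).smul _)
    refine (WeightGe.sum _ fun J _ => ?_).smul _
    rcases J with i | i | j
    · refine key 1 _ _ (weightGe_gradArg _) ?_ (ha.1 _)
      have h0 : FormalPoisson.remainder F D (oneForm (gradArg 0 (F.f i))) = 0 := by
        rw [remainder_apply, koszul_oneForm, add_zero]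
        exact D.Q_grad _
      exact h0 ▸ WeightGe.zero 2 2
    · exact key 2 _ _ (weightGe_odd (F.X i)) (weightGe_remainder_odd hD (F.X i)) (ha.2 _)
    · exact j.elim0

/-- A cochain that vanishes on tangent arguments is determined by its values on the others. -/
theorem eq_of_contr_tangent {b b' : Coeff A 0 k} (h : ∀ (j : ℕ) (hj : k = j + 1) (Y : VectorFields A),
    ins ((Y, 0, 0) : OddArgs A 0) (hj ▸ b) = ins ((Y, 0, 0) : OddArgs A 0) (hj ▸ b'))
    (h' : ∀ β : Fin k → OneForms A, b (fun i => (0, β i, 0)) = b' fun i => (0, β i, 0)) : b = b' := by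
  induction k with
  | zero =>
    refine AlternatingMap.ext fun u => ?_
    rw [show u = fun i => (0, (fun i => (u i).2.1) i, 0) from Subsingleton.elim _ _]
    exact h' _
  | succ k ih =>
    refine ins_ext fun w => ?_
    have hw : w = (w.1, 0, 0) + (0, w.2.1, 0) :=
      Prod.ext (by simp) (Prod.ext (by simp) (Subsingleton.elim _ _))
    rw [hw, ins_add_left, ins_add_left, h k rfl]
    congr 1
    refine ih (fun j hj Y => ?_) fun β => ?_
    · subst hj
      have h1 : ins ((Y, 0, 0) : OddArgs A 0) b = ins ((Y, 0, 0) : OddArgs A 0) b' := h _ rfl Y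
      change ins ((Y, 0, 0) : OddArgs A 0) (ins _ b) = ins ((Y, 0, 0) : OddArgs A 0) (ins _ b')
      rw [ins_ins_swap, h1, ins_ins_swap, neg_neg]
    · have := h' (Fin.cons w.2.1 β)
      rw [show (fun i => ((0 : VectorFields A), (Fin.cons w.2.1 β : Fin (k + 1) → OneForms A) i,
          (0 : Fin 0 → A))) = Fin.cons (0, w.2.1, 0) fun i => (0, β i, 0) by
        funext i; refine Fin.cases ?_ (fun i => ?_) i <;> rfl] at this
      exact this

/-- The polyvector field given by the component of degree zero of a cochain. -/
def symbol (a : Cochain A 0 k) : Polyvectors A k :=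
  (MvPolynomial.isEmptyAlgEquiv A (Fin 0)).toLinearMap.compAlternatingMap
    ((a.coeff 0 0).compLinearMap (LinearMap.inr A _ _ ∘ₗ LinearMap.inl A _ _))

theorem algebraMap_symbol (a : Cochain A 0 k) (β : Fin k → OneForms A) (v : VectorFields A) :
    algebraMap A (PolyFun A 0) (symbol a β) = a.coeff 0 v (fun i => (0, β i, 0)) := by
  have h1 : a.coeff 0 v = a.coeff 0 0 := by
    obtain ⟨f, hf⟩ := a.coeff_mem 0
    rw [hf, hf]
    congr 1
    exact Subsingleton.elim _ _
  rw [h1]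
  exact (MvPolynomial.isEmptyAlgEquiv A (Fin 0)).symm_apply_apply _

-- A Taylor expansion of positive degree has no tangent component, and its part of degree zero is
-- the polyvector field itself; this identifies the obstruction met in the step below.
variable (F c) in
theorem comp_zero_eq {a : Cochain A 0 (k + 1)}
    (h : ∀ Y : VectorFields A, (contr (Y, 0, 0) a).OrderGe 1) :
    comp 0 a = comp 0 (taylor F (fun _ => c) (k + 1) (symbol a)) := by
  refine ext_coeff fun s v => ?_
  rw [coeff_comp, coeff_comp]
  split_ifs with hs
  · subst hs
    refine eq_of_contr_tangent (fun j hj Y => ?_) fun β => ?_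
    · obtain rfl : k = j := by omega
      refine ((h Y).coeff_eq (by omega) v).trans ?_
      exact (congrArg (fun a : Cochain A 0 k => a.coeff 0 v)
        (contr_taylor_tangent F (fun _ : Fin 1 => c) (symbol a) Y)).symm
    · rw [← algebraMap_symbol a β v, coeff_taylor_zero, coeff_ofAlt_zero]
      rfl
  · rfl

/-- In leading weight `r` the Koszul anticommutator acts on polynomial degree `s` as `h s = 2 s + 2
(k + 1) - r`, and the homotopy kills expansions, so dividing by `h` gives a primitive modulo higher
weight. In leading weight, `h s = 0` forces the number of tangent arguments to be `-s`, hence `s =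
0` and `r = 2 (k + 1)`: there the leading part is a polyvector field, and its expansion is
subtracted. -/
theorem exists_weight_step (hD : Intertwines F P c D) {r : ℕ} {a : Cochain A 0 (k + 1)}
    (ha : WeightGe (k + 1) r a) {V : Polyvectors A (k + 2)}
    (hV : D.Q (k + 1) a = taylor F (fun _ => c) (k + 2) V) :
    ∃ (b : Cochain A 0 k) (U : Polyvectors A (k + 1)), WeightGe k r b ∧
      (r ≠ 2 * (k + 1) → U = 0) ∧
      WeightGe (k + 1) (r + 1) (a - D.Q k b - taylor F (fun _ => c) (k + 1) U) := by
  set g : ℕ → ℝ := fun s => (2 * (s : ℝ) + 2 * k - r)⁻¹ with hg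
  set h : ℕ → ℝ := fun s => 2 * (s : ℝ) + 2 * (k + 1) - r with hh
  -- The shift accounts for the Koszul differential, which lowers the degree by one. Where `h s`
  -- vanishes the inverse is zero by convention, so these components are left untouched.
  have hgh : ∀ s, g (s + 1) = (h s)⁻¹ := fun s => by
    simp only [hg, hh]; push_cast; congr 1; ring
  set b := - scale g (radialContr F a) with hb
  have hbW : WeightGe k r b := ((ha.radialContr F).scale g).neg
  set T := euler a + (2 * ((k + 1 : ℕ) : ℝ) - r) • a - tangentDegree F (k + 1) a with hT
  have hTW : WeightGe (k + 1) (r + 1) T := weightGe_numberOperator F ha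
  have hRW := ha.remainder hD
  have hRa : radialContr F (koszul F a) = radialContr F (remainder F D a) := by
    rw [remainder_apply, map_add, hV, radialContr_taylor, zero_add]
  have h1 : koszul F (radialContr F a) = scale h a - T - radialContr F (remainder F D a) := by
    rw [← hRa, ← add_sub_cancel_right (koszul F (radialContr F a)) (radialContr F (koszul F a)),
      koszul_radialContr]
    refine congrArg (fun x => x - _) ?_
    have : scale h a = (2 : ℝ) • euler a + (2 * ((k + 1 : ℕ) : ℝ) - r) • a := ext_coeff fun s v => by
      simp only [coeff_scale, coeff_add, coeff_smul, coeff_euler, hh]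
      push_cast
      module
    rw [this, hT]
    module
  have h2 : a - D.Q k b = scale (fun s => if h s = 0 then 1 else 0) a
      + scale (fun s => g (s + 1)) (T + radialContr F (remainder F D a)) - remainder F D b := by
    have hkb : koszul F b = - scale (fun s => g (s + 1)) (scale h a - T
        - radialContr F (remainder F D a)) := by
      rw [hb, map_neg, koszul_scale, h1]
    rw [remainder_apply F D b, hkb]
    have : a - scale (fun s => g (s + 1)) (scale h a) = scale (fun s => if h s = 0 then 1 else 0) a :=
      ext_coeff fun s v => by
        rw [coeff_sub, coeff_scale, coeff_scale, coeff_scale, hgh, smul_smul]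
        split_ifs with h0
        · rw [h0]; simp
        · rw [inv_mul_cancel₀ h0]; simp
    rw [← this]
    simp only [map_sub, map_add]
    abel
  have h3 : WeightGe (k + 1) (r + 1)
      (scale (fun s => g (s + 1)) (T + radialContr F (remainder F D a)) - remainder F D b) :=
    ((hTW.add (hRW.radialContr F)).scale _).sub (hbW.remainder hD)
  by_cases hr : r = 2 * (k + 1)
  · refine ⟨b, symbol a, hbW, fun h => absurd hr h, ?_⟩
    rw [h2, add_sub_assoc, add_sub_right_comm]
    refine WeightGe.add ?_ h3
    have h4 : scale (fun s => if h s = 0 then 1 else 0) a = comp 0 a := ext_coeff fun s v => by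
      have : h s = 0 ↔ s = 0 := by
        simp only [hh, hr]
        push_cast
        constructor
        · intro h0
          exact_mod_cast (show (s : ℝ) = 0 by linarith)
        · rintro rfl; simp
      rw [coeff_scale, coeff_comp]
      simp only [this]
      split_ifs <;> simp
    have h5 : ∀ Y : VectorFields A, (contr (Y, 0, 0) a).OrderGe 1 := fun Y =>
      (ha.1 Y).orderGe.mono (by omega)
    rw [h4, comp_zero_eq F c h5, ← neg_sub]
    refine (WeightGe.mono (weightGe_of_contr_tangent (r := 1) ?_ fun j hj Y => ?_) (by omega)).neg
    · refine orderGe_iff.2 fun i hi v => ?_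
      rw [coeff_sub, coeff_comp, if_pos (by omega), sub_self]
    · obtain rfl : k = j := by omega
      change contr (Y, 0, 0) (_ - _) = 0
      rw [map_sub, contr_comp, contr_taylor_tangent, map_zero, sub_zero]
  · refine ⟨b, 0, hbW, fun _ => rfl, ?_⟩
    rw [map_zero, sub_zero, h2, add_sub_assoc]
    refine WeightGe.add ?_ h3
    have h4 : scale (fun s => if h s = 0 then 1 else 0) a = 0 := ext_coeff fun s v => by
      rw [coeff_scale]
      split_ifs with h0
      -- Outside weight `2 (k + 1)` such an `s` is positive, so `s < 2 s = r - 2 (k + 1)` and the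
      -- component vanishes by `WeightGe.orderGe`.
      · have h5 : 2 * s + 2 * (k + 1) = r := by
          have : (2 * (s : ℝ) + 2 * (k + 1)) = r := by simp only [hh] at h0; linarith
          exact_mod_cast this
        rw [ha.orderGe.coeff_eq (by omega)]
        simp
      · simp
    rw [h4]
    exact WeightGe.zero _ _

theorem taylor_injective (x : Fin 1 → TorsionFreeConnection A) :
    Function.Injective (taylor F x k) := by
  intro U V h
  ext β
  have h1 := congrArg (fun a : Cochain A 0 k => a.coeff 0 0 fun i => (0, β i, 0)) h
  simp only [coeff_taylor_zero, coeff_ofAlt_zero] at h1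
  exact (MvPolynomial.isEmptyAlgEquiv A (Fin 0)).symm.injective h1

theorem Q_sub_Q_sub_taylor (hD : Intertwines F P c D) {a : Cochain A 0 (k + 1)}
    {V : Polyvectors A (k + 2)} (hV : D.Q (k + 1) a = taylor F (fun _ => c) (k + 2) V)
    (b : Cochain A 0 k) (U : Polyvectors A (k + 1)) :
    D.Q (k + 1) (a - D.Q k b - taylor F (fun _ => c) (k + 1) U)
      = taylor F (fun _ => c) (k + 2) (V - P.differential (k + 1) U) := by
  rw [map_sub, map_sub, map_sub, D.Q_Q, sub_zero, hV, hD]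

/-- A cochain of positive degree whose differential is a Taylor expansion is, up to a coboundary, a Taylor expansion. -/
theorem exists_eq_taylor_add (hD : Intertwines F P c D) (a : Cochain A 0 (k + 1))
    (V : Polyvectors A (k + 2)) (hV : D.Q (k + 1) a = taylor F (fun _ => c) (k + 2) V) :
    ∃ (b : Cochain A 0 k) (U : Polyvectors A (k + 1)),
      a = taylor F (fun _ => c) (k + 1) U + D.Q k b := by
  have h1 : ∀ r, ∃ (b : Cochain A 0 k) (U : Polyvectors A (k + 1)),
      WeightGe (k + 1) r (a - D.Q k b - taylor F (fun _ => c) (k + 1) U) := by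
    intro r
    induction r with
    | zero => exact ⟨0, 0, weightGe_zero_right _⟩
    | succ r ih =>
      obtain ⟨b, U, h⟩ := ih
      obtain ⟨b', U', -, -, h'⟩ := exists_weight_step hD h (Q_sub_Q_sub_taylor hD hV b U)
      refine ⟨b + b', U + U', ?_⟩
      convert h' using 1
      rw [map_add, map_add]
      abel
  -- Polyvector fields enter only at weight `2 (k + 1)`. Past it only coboundaries are subtracted,
  -- and the limit concerns the primitives alone.
  obtain ⟨b₀, U₀, h₀⟩ := h1 (2 * (k + 1) + 1)
  set a' := a - D.Q k b₀ - taylor F (fun _ => c) (k + 1) U₀ with ha'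
  have hV' := Q_sub_Q_sub_taylor hD hV b₀ U₀
  rw [← ha'] at hV'
  have step : ∀ (r : ℕ) (b : Cochain A 0 k), WeightGe (k + 1) (2 * (k + 1) + 1 + r) (a' - D.Q k b) →
      ∃ b' : Cochain A 0 k, (b' - b).OrderGe r ∧
        WeightGe (k + 1) (2 * (k + 1) + 1 + (r + 1)) (a' - D.Q k b') := by
    intro r b hb
    have hQ : D.Q (k + 1) (a' - D.Q k b) = taylor F (fun _ => c) (k + 2)
        (V - P.differential (k + 1) U₀) := by rw [map_sub, D.Q_Q, sub_zero]; exact hV'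
    obtain ⟨b', U', h1, h2, h3⟩ := exists_weight_step hD hb hQ
    rw [h2 (by omega), map_zero, sub_zero, sub_sub, ← map_add] at h3
    refine ⟨b + b', ?_, h3⟩
    rw [add_sub_cancel_left]
    -- The primitive has degree `k` and weight `2 (k + 1) + 1 + r`, hence order at least `r`.
    exact h1.orderGe.mono (by omega)
  have hseq : ∃ B : ℕ → Cochain A 0 k, (∀ r, (B (r + 1) - B r).OrderGe r) ∧
      ∀ r, WeightGe (k + 1) (2 * (k + 1) + 1 + r) (a' - D.Q k (B r)) := by
    choose! G hG1 hG2 using step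
    let B : ℕ → Cochain A 0 k := fun r => Nat.rec 0 G r
    have hB : ∀ r, WeightGe (k + 1) (2 * (k + 1) + 1 + r) (a' - D.Q k (B r)) := by
      intro r
      induction r with
      | zero =>
        change WeightGe (k + 1) _ (a' - D.Q k 0)
        rw [map_zero, sub_zero]; exact h₀
      | succ r ih => exact hG2 r _ ih
    exact ⟨B, fun r => hG1 r _ (hB r), hB⟩
  obtain ⟨B, hB1, hB2⟩ := hseq
  obtain ⟨b, hb⟩ := exists_limit B hB1
  -- By continuity `Q` of the tail has order at least `r` when the tail has order `r + 1`; the stage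
  -- is chosen accordingly.
  have hfin : a' - D.Q k b = 0 := by
    refine eq_zero_of_orderGe fun r => ?_
    have e : a' - D.Q k b = (a' - D.Q k (B (r + 1))) - D.Q k (b - B (r + 1)) := by
      rw [map_sub]; abel
    rw [e]
    exact ((hB2 (r + 1)).orderGe.mono (by omega)).sub (CurvedLInfty.order (hb (r + 1)))
  refine ⟨b₀ + b, U₀, ?_⟩
  rw [map_add]
  have h5 := sub_eq_zero.1 hfin
  rw [ha'] at h5
  rw [← h5]
  abel

/-- No primitive is available in degree zero. After the expansion of the symbol is subtracted, the
differential still has no tangent component, so the lowest part has vanishing derivatives in all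
directions and is zero by the Euler identity. -/
theorem exists_eq_taylor_zero (hD : Intertwines F P c D) (a : Cochain A 0 0) (V : Polyvectors A 1)
    (hV : D.Q 0 a = taylor F (fun _ => c) 1 V) : ∃ U : Polyvectors A 0, a = taylor F (fun _ => c) 0 U := by
  refine ⟨symbol a, sub_eq_zero.1 ?_⟩
  set a' := a - taylor F (fun _ : Fin 1 => c) 0 (symbol a) with ha'
  have hQ : D.Q 0 a' = taylor F (fun _ => c) 1 (V - P.differential 0 (symbol a)) := by
    rw [ha', map_sub, map_sub, hD, hV]
  refine eq_zero_of_orderGe fun r => ?_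
  rcases r with _ | r
  · exact orderGe_zero _
  induction r with
  | zero =>
    refine orderGe_iff.2 fun i hi v => ?_
    obtain rfl : i = 0 := by omega
    rw [ha', coeff_sub, sub_eq_zero]
    ext u
    rw [show u = fun i => (0, (fun i => (u i).2.1) i, 0) from Subsingleton.elim _ _,
      ← algebraMap_symbol a, coeff_taylor_zero, coeff_ofAlt_zero]
    rfl
  | succ r ih =>
    refine orderGe_iff.2 fun i hi v => ?_
    rcases Nat.lt_or_ge i (r + 1) with h | h
    · exact ih.coeff_eq h v
    obtain rfl : i = r + 1 := by omega
    have h1 : ∀ Y : VectorFields A, (vder Y a').coeff r v = 0 := by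
      intro Y
      refine AlternatingMap.ext fun u => ?_
      obtain rfl : u = ![] := Subsingleton.elim _ _
      have h2 := coeff_Q_tangent hD r a' ih v Y
      have h3 : (D.Q 0 a').coeff r v ![(Y, 0, 0)] = 0 := by
        rw [hQ]
        exact congrArg (fun a : Cochain A 0 0 => a.coeff r v ![])
          (contr_taylor_tangent F (fun _ : Fin 1 => c) _ Y)
      rw [h3] at h2
      exact neg_eq_zero.1 h2.symm
    have h2 : ((r + 1 : ℕ) : ℝ) • a'.coeff (r + 1) v = 0 := by
      rw [← coeff_euler, ← sum_linear_mul_vder F rfl, coeff_sum]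
      refine Finset.sum_eq_zero fun i _ => ?_
      rw [coeff_linear_mul_succ, h1, smul_zero]
    exact (smul_eq_zero.1 h2).resolve_left (by positivity)

/-- Surjectivity is the case of cocycles. For injectivity, `j U = Q a` with `a` not closed: the
preceding results give `a = j W` up to a coboundary, and `U` is the differential of `W` because `j`
is injective. This is why they assume only that `Q a` is an expansion. -/
theorem computesPoissonCohomology (hD : Intertwines F P c D) : ComputesPoissonCohomology P D := by
  refine ⟨taylorMap hD, fun k => ⟨?_, ?_⟩⟩
  · refine (injective_iff_map_eq_zero _).2 fun x => ?_
    obtain ⟨⟨U, hU⟩, rfl⟩ := Submodule.mkQ_surjective _ x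
    intro h
    have h1 := (Submodule.Quotient.mk_eq_zero _).1 h
    change taylor F (fun _ : Fin 1 => c) k U ∈ boundaries D.Q k at h1
    refine (Submodule.Quotient.mk_eq_zero _).2 ?_
    change U ∈ boundaries P.differential k
    rcases k with _ | k
    · have h2 : taylor F (fun _ : Fin 1 => c) 0 U = 0 := h1
      exact taylor_injective (fun _ => c) (h2.trans (map_zero _).symm)
    · obtain ⟨a, ha⟩ := h1
      rcases k with _ | k
      · obtain ⟨W, rfl⟩ := exists_eq_taylor_zero hD a U ha
        exact ⟨W, taylor_injective (fun _ => c) ((hD 0 W).symm.trans ha)⟩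
      · obtain ⟨b, W, rfl⟩ := exists_eq_taylor_add hD a U ha
        refine ⟨W, taylor_injective (fun _ => c) ((hD _ W).symm.trans ?_)⟩
        rw [← ha, map_add, D.Q_Q, add_zero]
  · intro y
    obtain ⟨⟨a, ha⟩, rfl⟩ := Submodule.mkQ_surjective _ y
    have ha0 : D.Q k a = 0 := ha
    have key : ∃ U : Polyvectors A k, P.differential k U = 0 ∧
        a - taylor F (fun _ => c) k U ∈ boundaries D.Q k := by
      rcases k with _ | k
      · obtain ⟨U, rfl⟩ := exists_eq_taylor_zero hD a 0 (by rw [ha0, map_zero])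
        refine ⟨U, taylor_injective (F := F) (fun _ => c) ?_, by rw [sub_self]; exact zero_mem _⟩
        rw [← hD 0 U, ha0, map_zero]
      · obtain ⟨b, U, rfl⟩ := exists_eq_taylor_add hD a 0 (by rw [ha0, map_zero])
        refine ⟨U, taylor_injective (F := F) (fun _ => c) ?_, by rw [add_sub_cancel_left]; exact ⟨b, rfl⟩⟩
        rw [map_add, D.Q_Q, add_zero] at ha0
        rw [← hD _ U, ha0, map_zero]
    obtain ⟨U, hU, hb⟩ := key
    refine ⟨Submodule.Quotient.mk ⟨U, hU⟩, ?_⟩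
    refine (Submodule.Quotient.eq _).2 ?_
    change taylor F (fun _ : Fin 1 => c) k U - a ∈ boundaries D.Q k
    rw [← neg_sub]
    exact neg_mem hb

end Cohomology

end FormalPoisson

end

/-! ### The symplectic case and the assembly over an algebra with a frame. -/

noncomputable section

namespace FormalPoisson

set_option linter.unusedSectionVars false

variable {A : Type*} [CommRing A] [Algebra ℝ A] {n m k l : ℕ}

section Complexes

variable {X Y : ℕ → Type*} [∀ k, AddCommGroup (X k)] [∀ k, Module ℝ (X k)]
  [∀ k, AddCommGroup (Y k)] [∀ k, Module ℝ (Y k)]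

theorem Cohomology.map_bijective {d : ∀ k, X k →ₗ[ℝ] X (k + 1)} {d' : ∀ k, Y k →ₗ[ℝ] Y (k + 1)}
    (f : ∀ k, X k →ₗ[ℝ] Y k) (hf : ∀ k x, d' k (f k x) = f (k + 1) (d k x))
    (hb : ∀ k, Function.Bijective (f k)) (k : ℕ) :
    Function.Bijective (Cohomology.map (d := d) (d' := d') f hf k) := by
  refine ⟨(injective_iff_map_eq_zero _).2 fun x => ?_, fun y => ?_⟩
  · obtain ⟨⟨x, hx⟩, rfl⟩ := Submodule.mkQ_surjective _ x
    intro h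
    have h1 := (Submodule.Quotient.mk_eq_zero _).1 h
    change f k x ∈ boundaries d' k at h1
    refine (Submodule.Quotient.mk_eq_zero _).2 ?_
    change x ∈ boundaries d k
    rcases k with _ | k
    · exact (hb 0).1 ((show f 0 x = 0 from h1).trans (map_zero _).symm)
    · obtain ⟨y, hy⟩ := h1
      obtain ⟨z, rfl⟩ := (hb k).2 y
      exact ⟨z, (hb (k + 1)).1 ((hf k z).symm.trans hy)⟩
  · obtain ⟨⟨y, hy⟩, rfl⟩ := Submodule.mkQ_surjective _ y
    obtain ⟨x, rfl⟩ := (hb k).2 y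
    have hy' : d' k (f k x) = 0 := hy
    have hx : d k x = 0 := (hb (k + 1)).1 (by rw [← hf, hy', map_zero])
    exact ⟨Submodule.Quotient.mk ⟨x, hx⟩, rfl⟩

end Complexes

section Products

variable (D : CurvedLInfty A n)

theorem mul_mem_boundaries_left (h : k + l = m) {x : Cochain A n k} (hx : x ∈ boundaries D.Q k)
    {b : Cochain A n l} (hb : D.Q l b = 0) : Cochain.mul h x b ∈ boundaries D.Q m := by
  rcases k with _ | k
  · obtain rfl : x = 0 := hx
    rw [Cochain.zero_mul]
    exact zero_mem _
  · obtain ⟨y, rfl⟩ := hx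
    obtain ⟨m, rfl⟩ : ∃ j, m = j + 1 := ⟨k + l, by omega⟩
    refine ⟨Cochain.mul (by omega) y b, ?_⟩
    rw [D.leibniz k l m (by omega), hb, Cochain.mul_zero, smul_zero, add_zero]

theorem mul_mem_boundaries_right (h : k + l = m) {a : Cochain A n k} (ha : D.Q k a = 0)
    {x : Cochain A n l} (hx : x ∈ boundaries D.Q l) : Cochain.mul h a x ∈ boundaries D.Q m := by
  rw [Cochain.mul_comm h (show l + k = m by omega)]
  exact Submodule.smul_mem _ _ (mul_mem_boundaries_left D _ hx ha)

theorem CurvedLInfty.Q_mul_eq_zero (h : k + l = m) {a : Cochain A n k} (ha : D.Q k a = 0)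
    {b : Cochain A n l} (hb : D.Q l b = 0) : D.Q m (Cochain.mul h a b) = 0 := by
  rw [D.leibniz, ha, hb, Cochain.mul_zero, Cochain.zero_mul, smul_zero, add_zero]

end Products

section Symplectic

variable (P : PoissonStructure A)

/-- Pull-back of differential forms along the map `sharp`. -/
def sharpForms (k : ℕ) : Forms A k →ₗ[ℝ] Polyvectors A k where
  toFun ω := ω.compLinearMap P.sharp
  map_add' _ _ := rfl
  map_smul' _ _ := rfl

theorem sharpForms_apply (ω : Forms A k) (β : Fin k → OneForms A) :
    sharpForms P k ω β = ω fun i => P.sharp (β i) := rfl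

/-- The anchor is a morphism of Lie algebroids from the cotangent to the tangent one, so the two
Koszul formulas agree term by term. -/
theorem differential_sharpForms (F : Frame A) (k : ℕ) (ω : Forms A k) :
    P.differential k (sharpForms P k ω) = sharpForms P (k + 1) (deRham A k ω) := by
  ext β
  rw [sharpForms_apply]
  refine (P.cotangentBracket.d_apply _ _).trans (((tangentBracket A).d_apply _ _).trans ?_).symm
  refine Finset.sum_congr rfl fun i _ => ?_
  congr 2
  congr 1
  refine Finset.sum_congr rfl fun j _ => ?_
  rw [sharpForms_apply]
  congr 1
  funext a
  rcases eq_or_ne a j with rfl | h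
  · rw [Function.update_self, Function.update_self, P.sharp_bracket F]
    rfl
  · rw [Function.update_of_ne h, Function.update_of_ne h]
    rfl

theorem sharpForms_bijective (hP : Function.Bijective P.sharp) (k : ℕ) :
    Function.Bijective (sharpForms P k) := by
  refine ⟨fun ω η h => ?_, fun U => ?_⟩
  · ext v
    choose β hβ using fun i => hP.2 (v i)
    obtain rfl : v = fun i => P.sharp (β i) := funext fun i => (hβ i).symm
    exact congrArg (fun U : Polyvectors A k => U β) h
  · let s := LinearEquiv.ofBijective P.sharp hP
    refine ⟨U.compLinearMap s.symm.toLinearMap, ?_⟩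
    ext β
    rw [sharpForms_apply, AlternatingMap.compLinearMap_apply]
    congr 1
    funext i
    exact s.symm_apply_apply (β i)

variable {P} {D : CurvedLInfty A 0}

/-- The inverse isomorphism is pull-back of forms along the anchor followed by the quasi-isomorphism
`T.j`; both respect products already on cochains. -/
theorem hasDeRhamCohomologyAlgebra (F : Frame A) (T : TaylorMap P D)
    (hT : ∀ k, Function.Bijective (T.onCohomology k)) (hP : Function.Bijective P.sharp) :
    HasDeRhamCohomologyAlgebra D := by
  let Ψ : ∀ k, DeRhamCohomology A k →ₗ[ℝ] CECohomology D k := fun k =>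
    T.onCohomology k ∘ₗ Cohomology.map (X := fun k => Forms A k) (Y := fun k => Polyvectors A k)
      (sharpForms P) (fun k => differential_sharpForms P F k) k
  have hΨ : ∀ k, Function.Bijective (Ψ k) := fun k =>
    (hT k).comp (Cohomology.map_bijective _ _ (sharpForms_bijective P hP) k)
  refine ⟨fun k => (LinearEquiv.ofBijective (Ψ k) (hΨ k)).symm, ?_⟩
  intro k l m h a b ω η ha hb hω hη hωa hηb
  -- Equality of classes is restated as exactness of a difference, so that the product can be
  -- treated by telescoping.
  have key : ∀ (k : ℕ) (a : Cochain A 0 k) (ω : Forms A k) (ha : D.Q k a = 0) (hω : deRham A k ω = 0),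
      (LinearEquiv.ofBijective (Ψ k) (hΨ k)).symm (D.classOf a ha) = deRhamClass ω hω ↔
        a - T.j k (sharpForms P k ω) ∈ boundaries D.Q k := by
    intro k a ω ha hω
    rw [LinearEquiv.symm_apply_eq]
    exact Submodule.Quotient.eq _
  rw [key] at hωa hηb
  have hωη : deRham A m (wedge h ω η) = 0 := by
    refine ((tangentBracket A).d_wedge h ω η).trans ?_
    rw [show (tangentBracket A).d ω = 0 from hω, show (tangentBracket A).d η = 0 from hη]
    rw [wedge_zero, zero_wedge, smul_zero, add_zero]
  refine ⟨D.Q_mul_eq_zero h ha hb, hωη, ?_⟩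
  rw [key]
  have hJ : D.Q k (T.j k (sharpForms P k ω)) = 0 := by
    rw [T.comm, differential_sharpForms P F, hω, map_zero, map_zero]
  have e : Cochain.mul h a b - T.j m (sharpForms P m (wedge h ω η))
      = Cochain.mul h (a - T.j k (sharpForms P k ω)) b
        + Cochain.mul h (T.j k (sharpForms P k ω)) (b - T.j l (sharpForms P l η)) := by
    have h1 : sharpForms P m (wedge h ω η) = wedge h (sharpForms P k ω) (sharpForms P l η) :=
      (wedge_compLinearMap h ω η P.sharp).symm
    rw [h1, T.map_wedge k l m h, Cochain.sub_mul, Cochain.mul_sub]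
    abel
  rw [e]
  exact add_mem (mul_mem_boundaries_left D h hωa hb) (mul_mem_boundaries_right D h hJ hηb)

end Symplectic

/-- The family of curved `L∞` structures over an algebra whose derivations have a finite frame. -/
theorem Frame.exists_contractibleFamily {A : Type u} [CommRing A] [Algebra ℝ A] (F : Frame A)
    (P : PoissonStructure A) :
    ∃ (G : ContractibleFamily.{u, u} A) (connection : G.K.obj (op ⦋0⦌) ≃ TorsionFreeConnection A),
      ∀ x : G.K.obj (op ⦋0⦌),
        HasLowBrackets P (connection x).1 (G.member 0 x) ∧
        ComputesPoissonCohomology P (G.member 0 x) ∧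
        (Function.Bijective P.sharp → HasDeRhamCohomologyAlgebra (G.member 0 x)) := by
  have : Nonempty (TorsionFreeConnection A) := F.nonempty_connection
  obtain ⟨G, connection, hG⟩ := F.exists_family P
  refine ⟨G, connection, fun x => ?_⟩
  have hD : Intertwines F P (connection x) (G.member 0 x) := hG x
  obtain ⟨T, hT⟩ := computesPoissonCohomology hD
  exact ⟨hasLowBrackets hD, ⟨T, hT⟩, hasDeRhamCohomologyAlgebra F T hT⟩

end FormalPoisson

end

/-! ### Hadamard's lemma. -/

noncomputable section

namespace FormalPoisson

set_option linter.unusedSectionVars false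

open scoped Manifold ContDiff Topology
open Set

section Hadamard

/-- Differentiation under the integral replaces `G` by its derivative and `k` by `k + 1`; hence both
`k` and the target space vary in the induction. -/
theorem contDiff_integral_smul {E : Type u} [NormedAddCommGroup E] [NormedSpace ℝ E]
    [FiniteDimensional ℝ E] (n : ℕ) :
    ∀ {F : Type u} [NormedAddCommGroup F] [NormedSpace ℝ F] (k : ℕ) {G : E → F},
      ContDiff ℝ n G → ContDiff ℝ n fun x => ∫ t in (0 : ℝ)..1, t ^ k • G (t • x) := by
  induction n with
  | zero =>
    intro F _ _ k G hG
    have hG' : Continuous G := hG.continuous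
    refine contDiff_zero.2 ?_
    refine intervalIntegral.continuous_parametric_intervalIntegral_of_continuous' (f := fun x t =>
      t ^ k • G (t • x)) ?_ 0 1
    exact (continuous_snd.pow k).smul (hG'.comp (continuous_snd.smul continuous_fst))
  | succ n ih =>
    intro F _ _ k G hG
    have hG1 : Differentiable ℝ G := hG.differentiable (by simp)
    have hG2 : ContDiff ℝ n (fderiv ℝ G) := hG.fderiv_right le_rfl
    have hc : Continuous G := hG.continuous
    have hc2 : Continuous (fderiv ℝ G) := hG2.continuous
    refine contDiff_succ_iff_hasFDerivAt.2 ⟨fun x => ∫ t in (0 : ℝ)..1, t ^ (k + 1) • fderiv ℝ G (t • x),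
      ih (k + 1) hG2, fun x => ?_⟩
    obtain ⟨C, hC⟩ := ((isCompact_Icc (a := (0 : ℝ)) (b := 1)).prod
      (isCompact_closedBall x 1)).exists_bound_of_continuousOn
      (f := fun p : ℝ × E => p.1 ^ (k + 1) • fderiv ℝ G (p.1 • p.2))
      ((continuous_fst.pow _).smul (hc2.comp (continuous_fst.smul continuous_snd))).continuousOn
    refine intervalIntegral.hasFDerivAt_integral_of_dominated_of_fderiv_le
      (F := fun x t => t ^ k • G (t • x)) (F' := fun x t => t ^ (k + 1) • fderiv ℝ G (t • x))
      (bound := fun _ => C) (Metric.closedBall_mem_nhds x zero_lt_one) ?_ ?_ ?_ ?_ ?_ ?_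
    · refine Filter.Eventually.of_forall fun y => Continuous.aestronglyMeasurable ?_
      exact (continuous_id.pow k).smul (hc.comp (continuous_id.smul continuous_const))
    · refine Continuous.intervalIntegrable ?_ _ _
      exact (continuous_id.pow k).smul (hc.comp (continuous_id.smul continuous_const))
    · have : SecondCountableTopologyEither ℝ (E →L[ℝ] F) := secondCountableTopologyEither_of_left ℝ _
      refine Continuous.aestronglyMeasurable ?_
      exact (continuous_id.pow _).smul (hc2.comp (continuous_id.smul continuous_const))
    · refine Filter.Eventually.of_forall fun t ht y hy => hC (t, y) ⟨?_, hy⟩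
      rw [uIoc_of_le zero_le_one] at ht
      exact ⟨ht.1.le, ht.2⟩
    · exact intervalIntegrable_const
    · refine Filter.Eventually.of_forall fun t _ y _ => ?_
      have h1 : HasFDerivAt (fun y : E => t • y) (t • ContinuousLinearMap.id ℝ E) y :=
        (hasFDerivAt_id y).const_smul t
      have h2 := ((hG1 (t • y)).hasFDerivAt.comp y h1).const_smul (t ^ k)
      convert h2 using 1
      · ext z
        simp
      · ext z
        simp [pow_succ, smul_smul]

/-- Hadamard's lemma. -/
theorem exists_smooth_factorization {E : Type u} [NormedAddCommGroup E] [NormedSpace ℝ E]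
    [FiniteDimensional ℝ E] {h : E → ℝ} (hh : ContDiff ℝ ∞ h) (x₀ : E) (h0 : h x₀ = 0) :
    ∃ Φ : E → E →L[ℝ] ℝ, ContDiff ℝ ∞ Φ ∧ Φ x₀ = fderiv ℝ h x₀ ∧ ∀ x, h x = Φ x (x - x₀) := by
  set G : E → E →L[ℝ] ℝ := fun x => fderiv ℝ h (x + x₀) with hG
  have hGs : ContDiff ℝ ∞ G :=
    (hh.fderiv_right (m := ∞) (by simp)).comp (contDiff_id.add contDiff_const)
  have key : ContDiff ℝ ∞ fun x => ∫ t in (0 : ℝ)..1, t ^ 0 • G (t • x) := by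
    refine contDiff_infty.2 fun n => ?_
    exact contDiff_integral_smul n 0 (hGs.of_le (by exact_mod_cast le_top))
  refine ⟨fun x => ∫ t in (0 : ℝ)..1, t ^ 0 • G (t • (x - x₀)),
    key.comp (contDiff_id.sub contDiff_const), ?_, fun x => ?_⟩
  · simp [hG]
  · have hd : ∀ t : ℝ, HasDerivAt (fun t : ℝ => h (t • (x - x₀) + x₀)) (G (t • (x - x₀)) (x - x₀)) t := by
      intro t
      have h1 : HasDerivAt (fun t : ℝ => t • (x - x₀) + x₀) (x - x₀) t := by
        simpa using ((hasDerivAt_id t).smul_const (x - x₀)).add_const x₀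
      exact ((hh.differentiable (by simp)).differentiableAt.hasFDerivAt).comp_hasDerivAt t h1
    have hcont : Continuous fun t : ℝ => G (t • (x - x₀)) :=
      hGs.continuous.comp (continuous_id.smul continuous_const)
    have h2 := intervalIntegral.integral_eq_sub_of_hasDerivAt (fun t _ => hd t)
      ((hcont.clm_apply continuous_const).intervalIntegrable 0 1)
    have h3 := ContinuousLinearMap.intervalIntegral_apply (μ := MeasureTheory.volume) (hcont.intervalIntegrable 0 1) (x - x₀)
    simp only [pow_zero, one_smul]
    rw [h3, h2]
    simp [h0]

end Hadamard

/-! ### Differentials in charts, and derivations at a point. -/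

section Charts

variable {E : Type*} [NormedAddCommGroup E] [NormedSpace ℝ E] {M : Type*} [TopologicalSpace M]
  [ChartedSpace E M] [IsManifold 𝓘(ℝ, E) ∞ M]

theorem contDiffOn_comp_symm {e : OpenPartialHomeomorph M E} (he : e ∈ atlas E M)
    (f : SmoothFunctions E M) : ContDiffOn ℝ ∞ (f ∘ e.symm) e.target := by
  refine contMDiffOn_iff_contDiffOn.1 ?_
  exact f.contMDiff.comp_contMDiffOn
    (contMDiffOn_symm_of_mem_maximalAtlas (IsManifold.subset_maximalAtlas he))

theorem contMDiffAt_of_comp_symm {e : OpenPartialHomeomorph M E} (he : e ∈ atlas E M) {p : M}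
    (hp : p ∈ e.source) {f : M → ℝ} (hf : ContDiffAt ℝ ∞ (f ∘ e.symm) (e p)) :
    ContMDiffAt 𝓘(ℝ, E) 𝓘(ℝ, ℝ) ∞ f p := by
  have h1 := (contMDiffAt_iff_contDiffAt.2 hf).comp p
    (contMDiffAt_of_mem_maximalAtlas (IsManifold.subset_maximalAtlas he) hp)
  refine h1.congr_of_eventuallyEq ?_
  filter_upwards [e.open_source.mem_nhds hp] with q hq
  simp [e.left_inv hq]

theorem contDiffAt_transition {e e' : OpenPartialHomeomorph M E} (he : e ∈ atlas E M)
    (he' : e' ∈ atlas E M) {p : M} (hp : p ∈ e.source) (hp' : p ∈ e'.source) :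
    ContDiffAt ℝ ∞ (e ∘ e'.symm) (e' p) := by
  refine contMDiffAt_iff_contDiffAt.1 ?_
  have h1 : ContMDiffAt 𝓘(ℝ, E) 𝓘(ℝ, E) ∞ e'.symm (e' p) :=
    contMDiffAt_symm_of_mem_maximalAtlas (IsManifold.subset_maximalAtlas he') (e'.map_source hp')
  refine ContMDiffAt.comp (e' p) ?_ h1
  refine contMDiffAt_of_mem_maximalAtlas (IsManifold.subset_maximalAtlas he) ?_
  rwa [e'.left_inv hp']

/-- The differential of a function at a point, in a chart. -/
def diffAt (e : OpenPartialHomeomorph M E) (f : M → ℝ) (p : M) : E →L[ℝ] ℝ :=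
  fderiv ℝ (f ∘ e.symm) (e p)

theorem diffAt_congr {e : OpenPartialHomeomorph M E} {p : M} (hp : p ∈ e.source) {f g : M → ℝ}
    (h : f =ᶠ[𝓝 p] g) : diffAt e f p = diffAt e g p := by
  refine Filter.EventuallyEq.fderiv_eq ?_
  have h1 : Filter.Tendsto e.symm (𝓝 (e p)) (𝓝 p) := e.tendsto_symm hp
  exact h1.eventually h

theorem differentiableAt_comp_symm {e : OpenPartialHomeomorph M E} (he : e ∈ atlas E M) {p : M}
    (hp : p ∈ e.source) (f : SmoothFunctions E M) : DifferentiableAt ℝ (f ∘ e.symm) (e p) :=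
  ((contDiffOn_comp_symm he f).contDiffAt (e.open_target.mem_nhds (e.map_source hp))).differentiableAt
    (by simp)

theorem diffAt_add {e : OpenPartialHomeomorph M E} (he : e ∈ atlas E M) {p : M}
    (hp : p ∈ e.source) (f g : SmoothFunctions E M) :
    diffAt e (f + g : SmoothFunctions E M) p = diffAt e f p + diffAt e g p :=
  fderiv_add (differentiableAt_comp_symm he hp f) (differentiableAt_comp_symm he hp g)

theorem diffAt_smul {e : OpenPartialHomeomorph M E} (he : e ∈ atlas E M) {p : M}
    (hp : p ∈ e.source) (r : ℝ) (f : SmoothFunctions E M) :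
    diffAt e (r • f : SmoothFunctions E M) p = r • diffAt e f p :=
  fderiv_const_smul (differentiableAt_comp_symm he hp f) r

theorem diffAt_mul {e : OpenPartialHomeomorph M E} (he : e ∈ atlas E M) {p : M}
    (hp : p ∈ e.source) (f g : SmoothFunctions E M) :
    diffAt e (f * g : SmoothFunctions E M) p = f p • diffAt e g p + g p • diffAt e f p := by
  refine (fderiv_mul (differentiableAt_comp_symm he hp f) (differentiableAt_comp_symm he hp g)).trans ?_
  simp only [Function.comp_apply, e.left_inv hp]
  rfl

/-- The differential at a point as a linear map. -/
def diffAtHom {e : OpenPartialHomeomorph M E} (he : e ∈ atlas E M) {p : M} (hp : p ∈ e.source) :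
    SmoothFunctions E M →ₗ[ℝ] E →L[ℝ] ℝ where
  toFun f := diffAt e f p
  map_add' := diffAt_add he hp
  map_smul' := diffAt_smul he hp

/-- The chain rule for the transition map; the two transition maps are mutually inverse near the
point, so `T` is invertible, and it is the same for all functions. -/
theorem exists_diffAt_eq {e e' : OpenPartialHomeomorph M E} (he : e ∈ atlas E M)
    (he' : e' ∈ atlas E M) {p : M} (hp : p ∈ e.source) (hp' : p ∈ e'.source) :
    ∃ T : E ≃L[ℝ] E, ∀ f : SmoothFunctions E M,
      diffAt e' f p = (diffAt e f p).comp (T : E →L[ℝ] E) := by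
  have h1 : DifferentiableAt ℝ (e ∘ e'.symm) (e' p) :=
    (contDiffAt_transition he he' hp hp').differentiableAt (by simp)
  have h2 : DifferentiableAt ℝ (e' ∘ e.symm) (e p) :=
    (contDiffAt_transition he' he hp' hp).differentiableAt (by simp)
  have aux : ∀ {e e' : OpenPartialHomeomorph M E} (hp : p ∈ e.source) (hp' : p ∈ e'.source),
      DifferentiableAt ℝ (e ∘ e'.symm) (e' p) → DifferentiableAt ℝ (e' ∘ e.symm) (e p) →
      (fderiv ℝ (e' ∘ e.symm) (e p)).comp (fderiv ℝ (e ∘ e'.symm) (e' p)) = ContinuousLinearMap.id ℝ E := by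
    intro e e' hp hp' h1 h2
    have h3 : (e ∘ e'.symm) (e' p) = e p := by simp [e'.left_inv hp']
    have h4 := fderiv_comp (e' p) (show DifferentiableAt ℝ (e' ∘ e.symm) ((e ∘ e'.symm) (e' p)) by
      rw [h3]; exact h2) h1
    rw [h3] at h4
    rw [← h4, ← fderiv_id (x := e' p)]
    refine Filter.EventuallyEq.fderiv_eq ?_
    have h5 : Filter.Tendsto e'.symm (𝓝 (e' p)) (𝓝 p) := e'.tendsto_symm hp'
    filter_upwards [h5.eventually (e.open_source.mem_nhds hp),
      e'.open_target.mem_nhds (e'.map_source hp')] with y hy hy'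
    simp [e.left_inv hy, e'.right_inv hy']
  refine ⟨ContinuousLinearEquiv.equivOfInverse (fderiv ℝ (e ∘ e'.symm) (e' p))
    (fderiv ℝ (e' ∘ e.symm) (e p))
    (fun x => congrArg (fun L : E →L[ℝ] E => L x) (aux hp hp' h1 h2))
    (fun x => congrArg (fun L : E →L[ℝ] E => L x) (aux hp' hp h2 h1)), fun f => ?_⟩
  have h3 : (e ∘ e'.symm) (e' p) = e p := by simp [e'.left_inv hp']
  have h4 := fderiv_comp (e' p) (show DifferentiableAt ℝ (f ∘ e.symm) ((e ∘ e'.symm) (e' p)) by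
    rw [h3]; exact differentiableAt_comp_symm he hp f) h1
  rw [h3] at h4
  refine Eq.trans (Filter.EventuallyEq.fderiv_eq ?_) h4
  have h5 : Filter.Tendsto e'.symm (𝓝 (e' p)) (𝓝 p) := e'.tendsto_symm hp'
  filter_upwards [h5.eventually (e.open_source.mem_nhds hp)] with y hy
  simp [e.left_inv hy]

end Charts

section PointDerivations

variable {E : Type*} [NormedAddCommGroup E] [NormedSpace ℝ E] [FiniteDimensional ℝ E]
  {M : Type*} [TopologicalSpace M] [ChartedSpace E M] [IsManifold 𝓘(ℝ, E) ∞ M] [T2Space M]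

/-- A derivation of the algebra of smooth functions annihilates functions with vanishing differential
at a point. -/
theorem derivation_apply_eq_zero (Y : VectorFields (SmoothFunctions E M)) (p : M)
    (h : SmoothFunctions E M) (hh : diffAt (chartAt E p) h p = 0) : (Y h) p = 0 := by
  set e := chartAt E p with he
  have hep : p ∈ e.source := mem_chart_source E p
  have heA : e ∈ atlas E M := chart_mem_atlas E p
  obtain ⟨ρ⟩ : Nonempty (SmoothBumpFunction 𝓘(ℝ, E) p) := inferInstance
  set χ : ContDiffBump (e p) := ρ.toContDiffBump with hχ
  have hball : Metric.closedBall (e p) χ.rOut ⊆ e.target := by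
    have := ρ.closedBall_subset
    simpa using this
  have hρ : ∀ q ∈ e.source, ρ q = χ (e q) := fun q hq => ρ.eqOn_source hq
  let h' : SmoothFunctions E M := h - algebraMap ℝ _ (h p)
  have hh' : ∀ q, h' q = h q - h p := fun q => rfl
  -- Cutting off in the chart extends the local expression by zero to all of `E`, where Hadamard's
  -- lemma applies.
  set h1 : E → ℝ := fun y => χ y * h' (e.symm y) with hh1
  have h1s : ContDiff ℝ ∞ h1 := by
    refine contDiff_iff_contDiffAt.2 fun y => ?_
    by_cases hy : y ∈ tsupport χ
    · have hy' : y ∈ e.target := hball (by rwa [χ.tsupport_eq] at hy)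
      exact χ.contDiffAt.mul ((contDiffOn_comp_symm heA h').contDiffAt (e.open_target.mem_nhds hy'))
    · refine contDiffAt_const (c := (0 : ℝ)) |>.congr_of_eventuallyEq ?_
      filter_upwards [(isClosed_tsupport χ).isOpen_compl.mem_nhds hy] with z hz
      simp only [hh1]
      rw [image_eq_zero_of_notMem_tsupport hz, zero_mul]
  have h10 : h1 (e p) = 0 := by
    simp [hh1, e.left_inv hep, hh']
  obtain ⟨Φ, hΦs, hΦ0, hΦ⟩ := exists_smooth_factorization h1s (e p) h10
  have hΦ0' : Φ (e p) = 0 := by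
    rw [hΦ0]
    have h2 : h1 =ᶠ[𝓝 (e p)] fun y => (h ∘ e.symm) y - h p := by
      filter_upwards [χ.eventuallyEq_one] with y hy
      simp only [hh1, hy, hh']
      simp
    rw [h2.fderiv_eq, fderiv_sub_const]
    exact hh
  let b := Module.finBasis ℝ E
  have hsm : ∀ g : E → ℝ, ContDiff ℝ ∞ g → ContMDiff 𝓘(ℝ, E) 𝓘(ℝ, ℝ) ∞ fun q => ρ q • g (e q) := by
    intro g hg
    refine ρ.contMDiff_smul ?_
    exact (contMDiff_iff_contDiff.2 hg).comp_contMDiffOn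
      (contMDiffOn_of_mem_maximalAtlas (IsManifold.subset_maximalAtlas heA))
  have hbs : ∀ i, ContDiff ℝ ∞ fun y => b.coord i (y - e p) := fun i =>
    (LinearMap.toContinuousLinearMap (b.coord i)).contDiff.comp (contDiff_id.sub contDiff_const)
  let α : Fin (Module.finrank ℝ E) → SmoothFunctions E M := fun i =>
    ⟨_, hsm _ (hbs i)⟩
  let β : Fin (Module.finrank ℝ E) → SmoothFunctions E M := fun i =>
    ⟨_, hsm (fun y => Φ y (b i)) (hΦs.clm_apply contDiff_const)⟩
  let r : SmoothFunctions E M := ⟨ρ, ρ.contMDiff⟩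
  have hev : ∀ (q : M) (S : Fin (Module.finrank ℝ E) → SmoothFunctions E M),
      (∑ i, S i : SmoothFunctions E M) q = ∑ i, S i q := fun q S =>
    map_sum (ContMDiffMap.evalRingHom (n := ∞) (I := 𝓘(ℝ, E)) (I' := 𝓘(ℝ, ℝ)) (R := ℝ) q) S _
  -- One factor `r` comes from the cut-off in `h1`, the other two make each `α i` and `β i` global.
  -- As all `α i` and `β i` vanish at `p`, the Leibniz rule kills the right side there, while the
  -- left side gives `Y h` because `r p = 1` and `h' p = 0`.
  have hfac : r * r * r * h' = ∑ i, α i * β i := by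
    ext q
    rw [hev]
    change ρ q * ρ q * ρ q * h' q = ∑ i, (ρ q • b.coord i (e q - e p)) * (ρ q • Φ (e q) (b i))
    by_cases hq : q ∈ e.source
    · have h3 := hΦ (e q)
      simp only [hh1, e.left_inv hq] at h3
      rw [← hρ q hq] at h3
      have h4 : ∑ i, (ρ q • b.coord i (e q - e p)) * (ρ q • Φ (e q) (b i))
          = ρ q * ρ q * Φ (e q) (e q - e p) := by
        conv_rhs => rw [← b.sum_repr (e q - e p), map_sum, Finset.mul_sum]
        refine Finset.sum_congr rfl fun i _ => ?_
        simp only [map_smul, smul_eq_mul, Module.Basis.coord_apply]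
        ring
      rw [h4, ← h3]
      ring
    · have h3 : ρ q = 0 := by
        by_contra h4
        exact hq (ρ.support_subset_source h4)
      simp [h3]
  have hY := congrArg (fun g : SmoothFunctions E M => (Y g) p) hfac
  have hr1 : r p = 1 := ρ.eq_one
  have hh'p : h' p = 0 := by rw [hh', sub_self]
  have hYh : Y h' = Y h := by
    change Y (h - _) = _
    rw [map_sub, Derivation.map_algebraMap, sub_zero]
  have hα : ∀ i, α i p = 0 := fun i => by
    change ρ p • b.coord i (e p - e p) = 0
    simp
  have hβ : ∀ i, β i p = 0 := fun i => by
    change ρ p • Φ (e p) (b i) = 0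
    rw [hΦ0']; simp
  have hmul : ∀ g k : SmoothFunctions E M, (Y (g * k)) p = g p * (Y k) p + k p * (Y g) p := fun g k => by
    rw [Derivation.leibniz]; rfl
  rw [map_sum, hev, hmul, hh'p, hYh] at hY
  have hr3 : (r * r * r) p = 1 := by
    change r p * r p * r p = 1
    rw [hr1]; norm_num
  rw [hr3] at hY
  simp only [hmul, hα, hβ] at hY
  simpa using hY

end PointDerivations

end FormalPoisson

end

/-! ### The gradient frame of a family with spanning differentials. -/

noncomputable section

namespace FormalPoisson

set_option linter.unusedSectionVars false

open scoped Manifold ContDiff Topology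
open Set

section Gram

variable {E : Type*} [NormedAddCommGroup E] [NormedSpace ℝ E] {ι : Type*} [Fintype ι]

/-- The bilinear form `∑ᵢ aᵢ ⊗ aᵢ`, as a map to the dual. -/
def gram (a : ι → E →L[ℝ] ℝ) : E →L[ℝ] E →L[ℝ] ℝ := ∑ i, (a i).smulRight (a i)

theorem gram_apply (a : ι → E →L[ℝ] ℝ) (u : E) : gram a u = ∑ i, a i u • a i := by
  simp [gram]

/-- Pairing `gram a w` with `w` gives a sum of squares, so the map is injective, and the dimensions
agree. -/
theorem exists_gram_equiv [FiniteDimensional ℝ E] {a : ι → E →L[ℝ] ℝ}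
    (ha : ∀ w, (∀ i, a i w = 0) → w = 0) :
    ∃ T : E ≃L[ℝ] (E →L[ℝ] ℝ), (T : E →L[ℝ] E →L[ℝ] ℝ) = gram a := by
  have hinj : Function.Injective (gram a : E →ₗ[ℝ] E →L[ℝ] ℝ) := by
    refine (injective_iff_map_eq_zero _).2 fun w hw => ha w ?_
    have h1 : ∑ i, a i w * a i w = 0 := by
      have := congrArg (fun L : E →L[ℝ] ℝ => L w) hw
      simpa [gram_apply, sum_apply] using this
    have h2 := (Finset.sum_eq_zero_iff_of_nonneg fun i _ => mul_self_nonneg (a i w)).1 h1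
    exact fun i => mul_self_eq_zero.1 (h2 i (Finset.mem_univ i))
  have hdim : Module.finrank ℝ E = Module.finrank ℝ (E →L[ℝ] ℝ) := by
    rw [← (LinearMap.toContinuousLinearMap (𝕜 := ℝ) (E := E) (F' := ℝ)).finrank_eq]
    exact (Subspace.dual_finrank_eq (K := ℝ) (V := E)).symm
  refine ⟨(LinearEquiv.ofInjectiveOfFinrankEq _ hinj hdim).toContinuousLinearEquiv, ?_⟩
  ext u v
  rfl

end Gram

variable {E : Type*} [NormedAddCommGroup E] [NormedSpace ℝ E] {M : Type*} [TopologicalSpace M]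
  [ChartedSpace E M] [IsManifold 𝓘(ℝ, E) ∞ M] {ι : Type*}

/-- The differentials of a family of functions at a point have no common kernel. -/
def ImmersiveAt (f : ι → SmoothFunctions E M) (p : M) : Prop :=
  ∀ w : E, (∀ i, diffAt (chartAt E p) (f i) p w = 0) → w = 0

theorem immersiveAt_iff {e : OpenPartialHomeomorph M E} (he : e ∈ atlas E M) {p : M}
    (hp : p ∈ e.source) (f : ι → SmoothFunctions E M) :
    ImmersiveAt f p ↔ ∀ w : E, (∀ i, diffAt e (f i) p w = 0) → w = 0 := by
  have aux : ∀ {e e' : OpenPartialHomeomorph M E}, e ∈ atlas E M → e' ∈ atlas E M → p ∈ e.source →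
      p ∈ e'.source → (∀ w : E, (∀ i, diffAt e (f i) p w = 0) → w = 0) →
      ∀ w : E, (∀ i, diffAt e' (f i) p w = 0) → w = 0 := by
    intro e e' he he' hp hp' h w hw
    obtain ⟨T, hT⟩ := exists_diffAt_eq he he' hp hp'
    have h1 := h (T w) fun i => by
      have := hw i
      rwa [hT] at this
    exact T.map_eq_zero_iff.1 h1
  exact ⟨aux (chart_mem_atlas E p) he (mem_chart_source E p) hp,
    aux he (chart_mem_atlas E p) hp (mem_chart_source E p)⟩

section Frame

variable [Fintype ι] [FiniteDimensional ℝ E] (f : ι → SmoothFunctions E M)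

/-- The vector dual to the differential of `g`, in a chart. -/
def gradientAt (e : OpenPartialHomeomorph M E) (g : M → ℝ) (p : M) : E :=
  (gram fun i => diffAt e (f i) p).inverse (diffAt e g p)

variable {f}

theorem gram_gradientAt {e : OpenPartialHomeomorph M E} (he : e ∈ atlas E M) {p : M}
    (hp : p ∈ e.source) (hf : ImmersiveAt f p) (g : M → ℝ) :
    gram (fun i => diffAt e (f i) p) (gradientAt f e g p) = diffAt e g p := by
  obtain ⟨T, hT⟩ := exists_gram_equiv ((immersiveAt_iff he hp f).1 hf)
  rw [gradientAt, ← hT, ContinuousLinearMap.inverse_equiv]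
  exact T.apply_symm_apply _

theorem eq_gradientAt {e : OpenPartialHomeomorph M E} (he : e ∈ atlas E M) {p : M}
    (hp : p ∈ e.source) (hf : ImmersiveAt f p) {g : M → ℝ} {u : E}
    (hu : gram (fun i => diffAt e (f i) p) u = diffAt e g p) : u = gradientAt f e g p := by
  obtain ⟨T, hT⟩ := exists_gram_equiv ((immersiveAt_iff he hp f).1 hf)
  refine T.injective ?_
  have h1 : ∀ u, T u = gram (fun i => diffAt e (f i) p) u := fun u => by rw [← hT]; rfl
  rw [h1, h1, hu, gram_gradientAt he hp hf]

variable (f) in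
/-- The derivative of `f i` in the direction of the gradient of `g`. -/
def gradientCoeff (i : ι) (g : M → ℝ) (p : M) : ℝ :=
  diffAt (chartAt E p) (f i) p (gradientAt f (chartAt E p) g p)

/-- A change of chart transports Gram form and gradient alike. The definition uses the preferred
chart at each point, whereas smoothness needs one chart for a neighbourhood. -/
theorem gradientCoeff_eq {e : OpenPartialHomeomorph M E} (he : e ∈ atlas E M) {p : M}
    (hp : p ∈ e.source) (hf : ImmersiveAt f p) (i : ι) (g : SmoothFunctions E M) :
    gradientCoeff f i g p = diffAt e (f i) p (gradientAt f e g p) := by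
  have he' := chart_mem_atlas E p
  have hp' := mem_chart_source E p
  obtain ⟨T, hT⟩ := exists_diffAt_eq he he' hp hp'
  have h1 := gram_gradientAt he' hp' hf g
  have h2 : T (gradientAt f (chartAt E p) g p) = gradientAt f e g p := by
    refine eq_gradientAt he hp hf ?_
    ext v
    have h3 := congrArg (fun L : E →L[ℝ] ℝ => L (T.symm v)) h1
    simp only [gram_apply, hT, sum_apply, smul_apply,
      ContinuousLinearMap.comp_apply, ContinuousLinearEquiv.coe_coe, T.apply_symm_apply] at h3 ⊢
    exact h3
  rw [gradientCoeff, hT, ← h2]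
  rfl

theorem contDiffAt_fderiv_comp_symm {e : OpenPartialHomeomorph M E} (he : e ∈ atlas E M) {p : M}
    (hp : p ∈ e.source) (g : SmoothFunctions E M) :
    ContDiffAt ℝ ∞ (fderiv ℝ (g ∘ e.symm)) (e p) :=
  ((contDiffOn_comp_symm he g).contDiffAt (e.open_target.mem_nhds (e.map_source hp))).fderiv_right
    (by simp)

/-- In a fixed chart the coefficient is built from derivatives of smooth functions and inversion of
operators, which is smooth at invertible ones. -/
theorem contMDiff_gradientCoeff (hf : ∀ p, ImmersiveAt f p) (i : ι) (g : SmoothFunctions E M) :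
    ContMDiff 𝓘(ℝ, E) 𝓘(ℝ, ℝ) ∞ (gradientCoeff f i g) := by
  intro p
  set e := chartAt E p
  have he : e ∈ atlas E M := chart_mem_atlas E p
  have hp : p ∈ e.source := mem_chart_source E p
  refine contMDiffAt_of_comp_symm he hp ?_
  have h1 : ContDiffAt ℝ ∞ (fun y => gram fun i => fderiv ℝ (f i ∘ e.symm) y) (e p) := by
    refine ContDiffAt.sum fun i _ => ?_
    have h := contDiffAt_fderiv_comp_symm he hp (f i)
    exact h.smulRight h
  have h2 : ContDiffAt ℝ ∞ (fun y => (gram fun i => fderiv ℝ (f i ∘ e.symm) y).inverse) (e p) := by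
    obtain ⟨T, hT⟩ := exists_gram_equiv ((immersiveAt_iff he hp f).1 (hf p))
    refine ContDiffAt.comp (e p) (g := ContinuousLinearMap.inverse) ?_ h1
    change ContDiffAt ℝ ∞ _ (gram fun i => diffAt e (f i) p)
    rw [← hT]
    exact contDiffAt_map_inverse T
  have h3 := (contDiffAt_fderiv_comp_symm he hp (f i)).clm_apply
    (h2.clm_apply (contDiffAt_fderiv_comp_symm he hp g))
  refine h3.congr_of_eventuallyEq ?_
  filter_upwards [e.open_target.mem_nhds (e.map_source hp)] with y hy
  rw [Function.comp_apply, gradientCoeff_eq he (e.map_target hy) (hf _)]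
  simp only [gradientAt, diffAt, e.right_inv hy]

variable (hf : ∀ p, ImmersiveAt f p)

/-- The evaluation of smooth functions at a point. -/
abbrev evalAt (p : M) : SmoothFunctions E M →+* ℝ :=
  ContMDiffMap.evalRingHom (n := ∞) (I := 𝓘(ℝ, E)) (I' := 𝓘(ℝ, ℝ)) (R := ℝ) p

theorem gradientCoeff_add (i : ι) (g h : SmoothFunctions E M) (p : M) :
    gradientCoeff f i (g + h : SmoothFunctions E M) p
      = gradientCoeff f i g p + gradientCoeff f i h p := by
  simp only [gradientCoeff, gradientAt, diffAt_add (chart_mem_atlas E p) (mem_chart_source E p), map_add]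

theorem gradientCoeff_smul (i : ι) (r : ℝ) (g : SmoothFunctions E M) (p : M) :
    gradientCoeff f i (r • g : SmoothFunctions E M) p = r * gradientCoeff f i g p := by
  simp only [gradientCoeff, gradientAt, diffAt_smul (chart_mem_atlas E p) (mem_chart_source E p),
    map_smul, smul_eq_mul]

theorem gradientCoeff_mul (i : ι) (g h : SmoothFunctions E M) (p : M) :
    gradientCoeff f i (g * h : SmoothFunctions E M) p
      = g p * gradientCoeff f i h p + h p * gradientCoeff f i g p := by
  simp only [gradientCoeff, gradientAt, diffAt_mul (chart_mem_atlas E p) (mem_chart_source E p),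
    map_add, map_smul, smul_eq_mul]

/-- The gradient of `f i` as a derivation. -/
def gradientDer (i : ι) : VectorFields (SmoothFunctions E M) :=
  Derivation.mk'
    { toFun := fun g => ⟨gradientCoeff f i g, contMDiff_gradientCoeff hf i g⟩
      map_add' := fun g h => by ext p; exact gradientCoeff_add i g h p
      map_smul' := fun r g => by ext p; exact gradientCoeff_smul i r g p }
    fun g h => by ext p; exact gradientCoeff_mul i g h p

variable [T2Space M]

/-- At `p` the Gram identity expresses `dg` by the `df i` with the gradient coefficients. Freezing
these as constants, `g - ∑ cᵢ f i` has zero differential at `p`, so every derivation kills it there.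
-/
theorem eq_sum_gradientDer (Y : VectorFields (SmoothFunctions E M)) :
    Y = ∑ i, Y (f i) • gradientDer hf i := by
  ext g p
  have he := chart_mem_atlas E p
  have hp := mem_chart_source E p
  set h : SmoothFunctions E M := g - ∑ i, gradientCoeff f i g p • f i with hh
  have h1 : diffAt (chartAt E p) h p = 0 := by
    change diffAtHom he hp h = 0
    rw [hh, map_sub, map_sum, sub_eq_zero]
    refine (gram_gradientAt he hp (hf p) g).symm.trans ?_
    rw [gram_apply]
    refine Finset.sum_congr rfl fun i _ => ?_
    rw [map_smul]
    rfl
  have h2 := derivation_apply_eq_zero Y p h h1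
  have h3 : evalAt p (Y h) = 0 := h2
  rw [hh, map_sub, map_sum, map_sub, map_sum, sub_eq_zero] at h3
  have h4 : (∑ i, Y (f i) • gradientDer hf i) g = ∑ i, Y (f i) * gradientDer hf i g := by
    rw [← Derivation.coeFnAddMonoidHom_apply, map_sum, Finset.sum_apply]
    rfl
  rw [h4]
  change evalAt p (Y g) = evalAt p _
  rw [h3, map_sum]
  refine Finset.sum_congr rfl fun i _ => ?_
  rw [map_mul, Derivation.map_smul]
  change gradientCoeff f i g p * _ = _ * gradientCoeff f i g p
  rw [mul_comm]
  rfl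

/-- A finite family of functions with spanning differentials gives a frame. -/
theorem nonempty_frame_of_immersive {f : ι → SmoothFunctions E M} (hf : ∀ p, ImmersiveAt f p) :
    Nonempty (Frame (SmoothFunctions E M)) := by
  let σ := Fintype.equivFin ι
  refine ⟨⟨Fintype.card ι, fun j => f (σ.symm j), fun j => gradientDer hf (σ.symm j), fun Y => ?_⟩⟩
  rw [Equiv.sum_comp σ.symm fun i => Y (f i) • gradientDer hf i]
  exact eq_sum_gradientDer hf Y

end Frame

end FormalPoisson

end

/-! ### Finitely many functions with spanning differentials on a `σ`-compact manifold. -/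

noncomputable section

namespace FormalPoisson

set_option linter.unusedSectionVars false

open scoped Manifold ContDiff Topology
open Set

variable {E : Type*} [NormedAddCommGroup E] [NormedSpace ℝ E] [FiniteDimensional ℝ E]
  {M : Type*} [TopologicalSpace M] [ChartedSpace E M] [IsManifold 𝓘(ℝ, E) ∞ M]

section Projection

/-- The tangent vectors of the image of a chart under a family of functions. -/
def tangentImage {n : ℕ} (f : Fin n → SmoothFunctions E M) (e : OpenPartialHomeomorph M E) :
    Set (Fin n → ℝ) :=
  (fun x : E × E => fun i => fderiv ℝ (f i ∘ e.symm) x.1 x.2) '' (e.target ×ˢ univ)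

/-- The set is the image of an open part of `E × E` under a locally Lipschitz map. -/
theorem dimH_tangentImage_le {n : ℕ} (f : Fin n → SmoothFunctions E M)
    {e : OpenPartialHomeomorph M E} (he : e ∈ atlas E M) :
    dimH (tangentImage f e) ≤ (2 * Module.finrank ℝ E : ℕ) := by
  have : SecondCountableTopology E := secondCountable_of_proper
  refine (dimH_image_le_of_locally_lipschitzOn fun x hx => ?_).trans ?_
  · have h1 : ContDiffAt ℝ 1 (fun x : E × E => fun i => fderiv ℝ (f i ∘ e.symm) x.1 x.2) x := by
      refine contDiffAt_pi.2 fun i => ?_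
      have h2 : ContDiffAt ℝ 1 (fderiv ℝ (f i ∘ e.symm)) x.1 :=
        (((contDiffOn_comp_symm he (f i)).contDiffAt (e.open_target.mem_nhds hx.1)).fderiv_right
          (m := ∞) (by simp)).of_le (by simp)
      exact (h2.comp x contDiffAt_fst).clm_apply contDiffAt_snd
    obtain ⟨K, t, ht, hK⟩ := h1.exists_lipschitzOnWith
    exact ⟨K, t, mem_nhdsWithin_of_mem_nhds ht, hK⟩
  · refine (dimH_mono (subset_univ _)).trans ?_
    rw [Real.dimH_univ_eq_finrank (E × E), Module.finrank_prod, two_mul]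

variable [SigmaCompactSpace M]

/-- A family of more than twice the dimension functions can be projected along a line such that it
remains immersive where it was. -/
theorem exists_projection {n : ℕ} (hn : 2 * Module.finrank ℝ E ≤ n)
    (f : Fin (n + 1) → SmoothFunctions E M) :
    ∃ g : Fin n → SmoothFunctions E M, (∀ p, ImmersiveAt f p → ImmersiveAt g p) ∧
      ∀ x, (∀ i, f i x = 0) → ∀ i, g i x = 0 := by
  obtain ⟨s, hs, hcov⟩ := countable_cover_nhds_of_sigmaCompact
    (f := fun x : M => (chartAt E x).source) fun x => (chartAt E x).open_source.mem_nhds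
      (mem_chart_source E x)
  set B : Set (Fin (n + 1) → ℝ) := ⋃ x ∈ s, tangentImage f (chartAt E x) with hB
  -- Countably many charts suffice, and their tangent images have dimension at most `2 dim E ≤ n < n
  -- + 1`; so some nonzero direction is tangent to none of them.
  have hdim : dimH B < Module.finrank ℝ (Fin (n + 1) → ℝ) := by
    rw [hB, dimH_bUnion hs, Module.finrank_fin_fun]
    refine lt_of_le_of_lt (iSup₂_le fun x _ => dimH_tangentImage_le f (chart_mem_atlas E x)) ?_
    exact_mod_cast Nat.lt_succ_of_le hn
  have hdense := dense_compl_of_dimH_lt_finrank hdim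
  obtain ⟨v, hv0, hvB⟩ := hdense.inter_open_nonempty {0}ᶜ isOpen_compl_singleton
    ⟨fun _ => 1, fun h => one_ne_zero (congrFun h 0)⟩
  obtain ⟨a, ha⟩ : ∃ a, v a ≠ 0 := by
    by_contra h
    push Not at h
    exact hv0 (funext h)
  refine ⟨fun i => f (a.succAbove i) - (v (a.succAbove i) / v a) • f a, fun p hp w hw => ?_,
    fun x hx i => ?_⟩
  · have hc : p ∈ ⋃ x ∈ s, (chartAt E x).source := hcov ▸ mem_univ p
    obtain ⟨x, hxs, hpx⟩ := mem_iUnion₂.1 hc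
    have hw' : ∀ w : E, (∀ i, diffAt (chartAt E x) (f (a.succAbove i)
        - (v (a.succAbove i) / v a) • f a : SmoothFunctions E M) p w = 0) → w = 0 := by
      intro w hw
      set L := diffAtHom (chart_mem_atlas E x) hpx with hL
      -- A vector lost under the projection along `v` has its image proportional to `v`; if the
      -- factor is nonzero, rescaling shows that `v` is a tangent vector, contrary to its choice.
      have h1 : ∀ i, L (f i) w = (L (f a) w / v a) * v i := by
        intro i
        rcases Fin.eq_self_or_eq_succAbove a i with rfl | ⟨j, rfl⟩
        · field_simp
        · have h2 : L (f (a.succAbove j) - (v (a.succAbove j) / v a) • f a) w = 0 := hw j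
          rw [map_sub, map_smul] at h2
          have h3 : L (f (a.succAbove j)) w - (v (a.succAbove j) / v a) * L (f a) w = 0 := h2
          rw [sub_eq_zero.1 h3]
          ring
      set t := L (f a) w / v a with ht
      by_cases ht0 : t = 0
      · refine (immersiveAt_iff (chart_mem_atlas E x) hpx f).1 hp w fun i => ?_
        have := h1 i
        rw [ht0, zero_mul] at this
        exact this
      · refine absurd (mem_iUnion₂.2 ⟨x, hxs, ?_⟩) hvB
        refine ⟨(chartAt E x p, t⁻¹ • w), ⟨(chartAt E x).map_source hpx, mem_univ _⟩, ?_⟩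
        funext i
        have h2 : L (f i) (t⁻¹ • w) = v i := by
          rw [map_smul, h1, smul_eq_mul, ← mul_assoc, inv_mul_cancel₀ ht0, one_mul]
        exact h2
    exact (immersiveAt_iff (chart_mem_atlas E x) hpx _).2 hw' w hw
  · change f (a.succAbove i) x - (v (a.succAbove i) / v a) * f a x = 0
    rw [hx, hx, mul_zero, sub_zero]

theorem exists_projection_iterate (m : ℕ) (f : Fin (2 * Module.finrank ℝ E + m) → SmoothFunctions E M) :
    ∃ g : Fin (2 * Module.finrank ℝ E) → SmoothFunctions E M,
      (∀ p, ImmersiveAt f p → ImmersiveAt g p) ∧ ∀ x, (∀ i, f i x = 0) → ∀ i, g i x = 0 := by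
  induction m with
  | zero => exact ⟨f, fun _ h => h, fun _ h => h⟩
  | succ m ih =>
    obtain ⟨g, hg, hg'⟩ := exists_projection (Nat.le_add_right _ m) f
    obtain ⟨h, hh, hh'⟩ := ih g
    exact ⟨h, fun p hp => hh p (hg p hp), fun x hx => hh' x (hg' x hx)⟩

theorem exists_projection_of_fintype {ι : Type*} [Fintype ι] (f : ι → SmoothFunctions E M) :
    ∃ g : Fin (2 * Module.finrank ℝ E) → SmoothFunctions E M,
      (∀ p, ImmersiveAt f p → ImmersiveAt g p) ∧ ∀ x, (∀ i, f i x = 0) → ∀ i, g i x = 0 := by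
  let σ := Fintype.equivFin ι
  -- Padding with `2 dim E` zero functions brings any cardinality to the form required by the
  -- iteration.
  obtain ⟨g, hg, hg'⟩ := exists_projection_iterate (Fintype.card ι)
    (Fin.append (fun _ => 0) fun j => f (σ.symm j))
  refine ⟨g, fun p hp => hg p fun w hw => hp w fun i => ?_, fun x hx => hg' x fun i => ?_⟩
  · have := hw (Fin.natAdd _ (σ i))
    rwa [Fin.append_right, σ.symm_apply_apply] at this
  · refine Fin.addCases (fun i => ?_) (fun i => ?_) i
    · rw [Fin.append_left]; rfl
    · rw [Fin.append_right]; exact hx _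

end Projection

section Local

variable [T2Space M]

/-- Chart coordinates multiplied by a bump function that equals one near `p`. -/
theorem exists_immersive_near (p : M) {V : Set M} (hV : V ∈ 𝓝 p) :
    ∃ f : Fin (Module.finrank ℝ E) → SmoothFunctions E M,
      (∀ᶠ q in 𝓝 p, ImmersiveAt f q) ∧ ∀ x ∉ V, ∀ i, f i x = 0 := by
  obtain ⟨ρ, hρ⟩ : ∃ ρ : SmoothBumpFunction 𝓘(ℝ, E) p, tsupport ρ ⊆ V := by
    obtain ⟨ρ, hρ, -⟩ := (SmoothBumpFunction.nhds_basis_support (I := 𝓘(ℝ, E)) hV).mem_iff.1 hV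
    exact ⟨ρ, hρ⟩
  set e := chartAt E p
  have he : e ∈ atlas E M := chart_mem_atlas E p
  let b := Module.finBasis ℝ E
  let c : Fin (Module.finrank ℝ E) → E →L[ℝ] ℝ := fun i => LinearMap.toContinuousLinearMap (b.coord i)
  have hsm : ∀ i, ContMDiff 𝓘(ℝ, E) 𝓘(ℝ, ℝ) ∞ fun q => ρ q • c i (e q) := fun i => by
    refine ρ.contMDiff_smul ?_
    exact (contMDiff_iff_contDiff.2 (c i).contDiff).comp_contMDiffOn
      (contMDiffOn_of_mem_maximalAtlas (IsManifold.subset_maximalAtlas he))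
  refine ⟨fun i => ⟨_, hsm i⟩, ?_, fun x hx i => ?_⟩
  · filter_upwards [ρ.eventuallyEq_one.eventually_nhds, e.open_source.mem_nhds (mem_chart_source E p)]
      with q hq hqe
    refine (immersiveAt_iff he hqe _).2 fun w hw => ?_
    have h1 : ∀ i, c i w = 0 := by
      intro i
      rw [← hw i]
      have h2 : (fun q => ρ q • c i (e q)) =ᶠ[𝓝 q] fun q => c i (e q) := by
        filter_upwards [hq] with z hz
        rw [hz]; simp
      change _ = diffAt e (fun q => ρ q • c i (e q)) q w
      rw [diffAt_congr hqe h2]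
      have h3 : (fun q => c i (e q)) ∘ e.symm =ᶠ[𝓝 (e q)] c i := by
        filter_upwards [e.open_target.mem_nhds (e.map_source hqe)] with y hy
        simp [e.right_inv hy]
      rw [diffAt, h3.fderiv_eq, (c i).fderiv]
    exact b.ext_elem fun i => by simpa [c] using h1 i
  · change ρ x • _ = (0 : ℝ)
    rw [image_eq_zero_of_notMem_tsupport fun h => hx (hρ h), zero_smul]

variable [SigmaCompactSpace M]

/-- A finite subcover gives finitely many local coordinates, and projection reduces them to a number
that does not depend on `K`. This uniform number allows infinitely many compact sets to be combined.
-/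
theorem exists_immersive_compact {K V : Set M} (hK : IsCompact K) (hV : IsOpen V) (hKV : K ⊆ V) :
    ∃ f : Fin (2 * Module.finrank ℝ E) → SmoothFunctions E M,
      (∀ p ∈ K, ImmersiveAt f p) ∧ ∀ x ∉ V, ∀ i, f i x = 0 := by
  choose! f hf hf' using fun (p : M) (hp : p ∈ K) =>
    exists_immersive_near (E := E) p (hV.mem_nhds (hKV hp))
  obtain ⟨t, htK, ht⟩ := hK.elim_nhds_subcover (fun p => {q | ImmersiveAt (f p) q}) fun p hp => hf p hp
  obtain ⟨g, hg, hg'⟩ := exists_projection_of_fintype (ι := t × Fin (Module.finrank ℝ E))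
    fun i => f i.1 i.2
  refine ⟨g, fun p hp => hg p fun w hw => ?_, fun x hx => hg' x fun i => hf' _ (htK _ i.1.2) x hx _⟩
  obtain ⟨c, hc, hpc⟩ := mem_iUnion₂.1 (ht hp)
  exact hpc w fun i => hw (⟨c, hc⟩, i)

end Local

section Global

variable [T2Space M] [SigmaCompactSpace M]

variable (E M) in
/-- On a `σ`-compact manifold there are finitely many functions with spanning differentials. -/
theorem exists_immersive : ∃ f : Fin 3 × Fin (2 * Module.finrank ℝ E) → SmoothFunctions E M,
    ∀ p, ImmersiveAt f p := by
  have : LocallyCompactSpace M := ChartedSpace.locallyCompactSpace E M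
  -- The shifted exhaustion starts with the empty set, so the truncated index `j - 1` for `j = 0`
  -- removes nothing from the shell.
  let K := (CompactExhaustion.choice M).shiftr
  have hK0 : K 0 = ∅ := rfl
  have hA : ∀ j, IsCompact (K (j + 1) \ interior (K j)) := fun j => (K.isCompact _).diff isOpen_interior
  let V : ℕ → Set M := fun j => interior (K (j + 2)) \ K (j - 1)
  have hV : ∀ j, IsOpen (V j) := fun j => isOpen_interior.sdiff (K.isCompact _).isClosed
  have hAV : ∀ j, K (j + 1) \ interior (K j) ⊆ V j := by
    rintro j x ⟨h1, h2⟩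
    refine ⟨K.subset_interior (by omega) h1, fun h3 => ?_⟩
    rcases j with _ | j
    · exact (hK0 ▸ h3 : x ∈ (∅ : Set M))
    · exact h2 (K.subset_interior (by omega) h3)
  choose g hg hg' using fun j => exists_immersive_compact (E := E) (hA j) (hV j) (hAV j)
  have hloc : LocallyFinite V := by
    intro x
    obtain ⟨n, hn⟩ := K.exists_mem_nhds x
    refine ⟨K n, hn, (finite_Iic n).subset ?_⟩
    rintro j ⟨y, hy1, hy2⟩
    rw [mem_Iic]
    by_contra h
    exact hy1.2 (K.subset (by omega) hy2)
  -- Shells whose indices are congruent modulo three are disjoint: the earlier one lies in a member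
  -- of the exhaustion that the later one avoids. So three families are enough.
  have hdisj : ∀ (r : Fin 3) (m m' : ℕ) (x : M), x ∈ V (3 * m + r) → x ∈ V (3 * m' + r) → m = m' := by
    have aux : ∀ (r : Fin 3) (m m' : ℕ) (x : M), x ∈ V (3 * m + r) → x ∈ V (3 * m' + r) → ¬ m < m' := by
      intro r m m' x h h' hlt
      exact h'.2 (K.subset (by omega) (interior_subset h.1))
    intro r m m' x h h'
    rcases lt_trichotomy m m' with hlt | rfl | hlt
    · exact absurd hlt (aux r m m' x h h')
    · rfl
    · exact absurd hlt (aux r m' m x h' h)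
  have hsupp : ∀ (r : Fin 3) i, LocallyFinite fun m => Function.support (g (3 * m + r) i) := by
    intro r i
    refine (hloc.comp_injective (g := fun m => 3 * m + (r : ℕ)) fun m m' h => by
      simp only at h; omega).subset fun m x hx => ?_
    by_contra h
    exact hx (hg' _ x h i)
  let F : Fin 3 × Fin (2 * Module.finrank ℝ E) → SmoothFunctions E M := fun ri =>
    ⟨fun x => ∑ᶠ m : ℕ, g (3 * m + ri.1) ri.2 x, contMDiff_finsum (fun m => (g _ _).contMDiff)
      (hsupp ri.1 ri.2)⟩
  -- On a shell the locally finite sum of its colour has a single possibly nonzero term, so it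
  -- inherits the differentials there.
  have hF : ∀ (r : Fin 3) (m : ℕ) i, ∀ x ∈ V (3 * m + r), F (r, i) x = g (3 * m + r) i x := by
    intro r m i x hx
    refine finsum_eq_single _ m fun m' hm' => ?_
    exact hg' _ x (fun h => hm' (hdisj r m' m x h hx)) i
  refine ⟨F, fun p w hw => ?_⟩
  obtain ⟨h1, h2⟩ := (CompactExhaustion.choice M).mem_sdiff_shiftr_find p
  set j := (CompactExhaustion.choice M).find p
  have hp : p ∈ K (j + 1) \ interior (K j) := ⟨h1, fun h => h2 (interior_subset h)⟩
  obtain ⟨m, r, hmr⟩ : ∃ (m : ℕ) (r : Fin 3), j = 3 * m + r :=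
    ⟨j / 3, ⟨j % 3, Nat.mod_lt _ (by norm_num)⟩, (Nat.div_add_mod j 3).symm⟩
  refine hg j p hp w fun i => ?_
  rw [← hw (r, i)]
  refine congrArg (fun L : E →L[ℝ] ℝ => L w) (diffAt_congr (mem_chart_source E p) ?_)
  filter_upwards [(hV j).mem_nhds (hAV j hp)] with x hx
  clear_value j
  subst hmr
  exact (hF r m i x hx).symm

variable (E M) in
theorem nonempty_frame : Nonempty (Frame (SmoothFunctions E M)) := by
  obtain ⟨f, hf⟩ := exists_immersive E M
  exact nonempty_frame_of_immersive hf

end Global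

end FormalPoisson

end

open FormalPoisson

theorem mainTheorem5 {E : Type*} [NormedAddCommGroup E] [NormedSpace ℝ E] [FiniteDimensional ℝ E]
    {M : Type u} [TopologicalSpace M] [ChartedSpace E M]
    [IsManifold (modelWithCornersSelf ℝ E) ((⊤ : ℕ∞) : WithTop ℕ∞) M] [T2Space M] [SigmaCompactSpace M]
    (P : PoissonStructure (SmoothFunctions E M)) :
    ∃ (F : ContractibleFamily.{u, u} (SmoothFunctions E M))
      (connection : F.K.obj (op ⦋0⦌) ≃ TorsionFreeConnection (SmoothFunctions E M)),
      ∀ x : F.K.obj (op ⦋0⦌),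
        HasLowBrackets P (connection x).1 (F.member 0 x) ∧
        ComputesPoissonCohomology P (F.member 0 x) ∧
        (Function.Bijective P.sharp → HasDeRhamCohomologyAlgebra (F.member 0 x)) := by
  obtain ⟨F⟩ := nonempty_frame E M
  exact F.exists_contractibleFamily P
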